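/- **Model.** Pairs of players $j\in\{1,2\}$ (partner: $-j$) have observables $W_j=(X_j^\top,Z_j^\top)^\top$, treatments $D_j\in\{0,1\}$, errors $\varepsilon_j$ and $U_j^{(d_j,d_{-j})}$. Almost surely $D_j=\mathbf 1\{W_j^\top\gamma_0^*+D_{-j}\,\eta(W_j^\top\gamma_1^*)\ge\varepsilon_j\}$ with $\eta>0$ known; $\varepsilon_j$ has a known continuous CDF $F_j$, and $\Pr(\varepsilon_1\le a_1,\varepsilon_2\le a_2)=H_{\rho^*}(F_1(a_1),F_2(a_2))$, where $H_\rho$, $\rho\in[\underline c_\rho,\bar c_\rho]$, are copulas with densities $h_\rho$. Outcomes are $Y_j=Y_j^{(D_j,D_{-j})}$, $Y_j^{(d_j,d_{-j})}=X_j^\top\beta_j^{(d_j,d_{-j})}+U_j^{(d_j,d_{-j})}$. For all $(d_1,d_2)$, $(\varepsilon_1,\varepsilon_2,U_1^{(d_1,d_2)},U_2^{(d_2,d_1)})$ is independent of $W=(W_1,W_2)$; $E|U_1^{(1,0)}|<\infty$ and $E\|X_1\|^2<\infty$. The data $(Y_{ji},D_{ji},W_{ji})_{j=1,2}$, $i=1,\dots,n$,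 are i.i.d. **Notation.** For $\theta=(\gamma_0,\gamma_1,\rho,\lambda)$ let $P_j^0(\gamma)=F_j(W_j^\top\gamma_0)$, $P_j^1(\gamma)=F_j(W_j^\top\gamma_0+\eta(W_j^\top\gamma_1))$, $\mathcal L_{\rm mul}(\theta)=H_\rho(P_1^1,P_2^1)-H_\rho(P_1^1,P_2^0)-H_\rho(P_1^0,P_2^1)+H_\rho(P_1^0,P_2^0)$, $\mathcal L^{(1,0)}(\theta)=P_1^0-H_\rho(P_1^0,P_2^1)$, $\mathcal L^{(0,1)}(\theta)=P_2^0-H_\rho(P_1^1,P_2^0)$, $\mathcal L^{(1,1)}(\theta)=H_\rho(P_1^1,P_2^1)-\lambda\mathcal L_{\rm mul}(\theta)$ and $\mathcal L^{(0,0)}=1-\mathcal L^{(1,0)}-\mathcal L^{(0,1)}-\mathcal L^{(1,1)}$. A superscript-free symbol is evaluated at the true $\theta^*$, a hat means evaluation at the maximum likelihood estimator $\hat\theta_n$, a measurable function of the sample $(D_i,W_i)_{i\le n}$ that (with probability approaching one) maximizes $\sum_i\log\mathcal L_i^{D_i}(\theta)$ over a parameter space $\Theta\ni\theta^*$ with $\rho\in[\underline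 c_\rho,\bar c_\rho]$, $\lambda\in[0,1]$. Write $h=h_{\rho^*}$, $\hat h=h_{\hat\rho_n}$, $V_j=F_j(\varepsilon_j)$, $I=\mathbf 1\{D=(1,0)\}$, $\mathcal S^{(1,0)}=\mathrm{supp}[P_1^0,P_2^1\mid D=(1,0)]$, $$m^{(1,0)}(x,p_1,p_2)=E[Y_1^{(1,0)}\mid X=x,V=(p_1,p_2)],\qquad g(p_1,p_2)=\int_0^{p_1}\!\!\int_{p_2}^1E[U_1^{(1,0)}\mid V=(v_1,v_2)]\,h(v_1,v_2)\,dv_2\,dv_1 ,$$ and $e=IY_1-IX_1^\top\beta_1^{(1,0)}-\frac{I}{\mathcal L^{(1,0)}}g(P_1^0,P_2^1)$. Fix $x=(x_1,x_2)\in\mathrm{supp}[X]$, where $X=(X_1,X_2)$; $m^{(1,0)}$ is the version of the conditional mean that is continuous, relative to $\mathrm{supp}[X]\times[0,1]^2$, at every point $(x,p)$ with $p\in\mathcal S^{(1,0)}$. Let $\tau_\varpi:[0,1]\to[0,1]$ ($\varpi>0$) be nondecreasing and $C^1$ with bounded derivative, with $\tau_\varpi(a)=0$ iff $a\le\varpi$.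 Let $b_K=(b_{1K},\dots,b_{KK})^\top$ be bivariate basis functions, $K=K_n\ge1$, $\ddot b_K=\partial^2b_K/\partial p_1\partial p_2$, $\zeta_d(K)=\max_{|\mathbf a|\le d}\sup_{[0,1]^2}\|\partial^{\mathbf a}b_K\|$, and $$R_{K,i}=\big(\tau_\varpi(\mathcal L_i^{(1,0)})I_iX_{1i}^\top,\ \tfrac{\tau_\varpi(\mathcal L_i^{(1,0)})I_i}{\mathcal L_i^{(1,0)}}b_K(P_{1i}^0,P_{2i}^1)^\top\big)^\top .$$ The infeasible coefficients are $(\tilde\beta^\top,\tilde\alpha^\top)^\top=\big[\sum_iR_{K,i}R_{K,i}^\top\big]^{-}\sum_iR_{K,i}\,\tau_\varpi(\mathcal L_i^{(1,0)})I_iY_{1i}$ (any symmetric generalized inverse), and $\tilde m^{(1,0)}(x,p)=x_1^\top\tilde\beta-\ddot b_K(p)^\top\tilde\alpha/h(p)$. The feasible $\hat\beta,\hat\alpha,\hat m^{(1,0)}(x,p)=x_1^\top\hat\beta-\ddot b_K(p)^\top\hat\alpha/\hat h(p)$ are obtained in the same way with $\hat\theta_n$ in place of $\theta^*$. Let $\Psi_K=E[R_KR_K^\top]$,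 $\Psi_{nK}=n^{-1}\sum_iR_{K,i}R_{K,i}^\top$ and, for functions $f$ on $\mathrm{supp}[W]$, $\mathcal P_{nK}f=b_K^\top(\mathbf 0,\mathbf I_K)\Psi_{nK}^{-1}n^{-1}\sum_iR_{K,i}f(W_i)$, with $\|\mathcal P_{nK}\|_\infty=\sup\{\sup_{\mathcal S^{(1,0)}}|\mathcal P_{nK}f|: f\text{ continuous},\ \sup_{\mathrm{supp}[W]}|f|=1\}$. **Theorem.** Suppose that (as $n\to\infty$) 1. $\|\hat\theta_n-\theta^*\|=O_P(n^{-1/2})$ and $\max_{i\le n}|\hat P_{ji}^d-P_{ji}^d|=O_P(n^{-1/2})$ for $j=1,2$, $d=0,1$; for $\rho$ near $\rho^*$, $H_\rho$ and $h_\rho$ are Lipschitz in $\rho$ uniformly on $[0,1]^2$, and $h_\rho$ is continuous on $[0,1]^2$ and bounded away from zero on $\mathcal S^{(1,0)}$; 2. the eigenvalues of $\Psi_K$ are bounded away from $0$ and $\infty$ uniformly in $K$; $E[e^4\mid W,D]$ is bounded; 3. for some integer $s\ge2$, $g$ and $b_K$ are $s$ times continuously differentiable on $[0,1]^2$ and there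 are $\alpha_K\in\mathbb R^K$ with $\sup_{[0,1]^2}|\partial^{\mathbf a}g-(\partial^{\mathbf a}b_K)^\top\alpha_K|=O(K^{(|\mathbf a|-s)/2})$ for $|\mathbf a|\le2$; 4. $\zeta_0(K)\sqrt{\log K/n}\to0$, $\zeta_1(K)/\sqrt n\to0$, $\zeta_0(K)\zeta_1(K)/\sqrt n=O(1)$, $\zeta_0(K)^2\sqrt{\log n/n}\to0$, and $\|b_K(p)-b_K(p')\|\le c_bK^\omega\|p-p'\|$ on $[0,1]^2$ for some $c_b>0$, $\omega\ge0$; 5. $\|\mathcal P_{nK}\|_\infty=O_P(1)$, and $\sup_{\mathcal S^{(1,0)}}|(\partial^{\mathbf a}b_K)^\top\alpha|\le O(K^{|\mathbf a|/2})\sup_{\mathcal S^{(1,0)}}|b_K^\top\alpha|$ uniformly in $\alpha\in\mathbb R^K$, for $|\mathbf a|\le2$. Then $$\sup_{p\in\mathcal S^{(1,0)}}|\tilde m^{(1,0)}(x,p)-m^{(1,0)}(x,p)|=O_P\big(\zeta_0(K)K\sqrt{\log n/n}\big)+O_P\big(K^{(2-s)/2}\big),$$ and the same holds with $\hat m^{(1,0)}$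 in place of $\tilde m^{(1,0)}$. If moreover $\zeta_0(K)\asymp\sqrt K$ and $K\asymp(\log n/n)^{-1/(1+s)}$, then both suprema are $O_P\big((\log n/n)^{(s-2)/(2s+2)}\big)$, the rate $(\log n/n)^{(s-q)/(2s+d)}$ of Stone for a derivative of order $q=2$ of an $s$-smooth function of $d=2$ variables. -/

import Mathlib

open MeasureTheory ProbabilityTheory Filter Topology Set Asymptotics
open scoped ENNReal

noncomputable section

namespace GameMTE

/-! ### Stochastic order, partial derivatives on the closed unit square -/

/-- `X n = O_P(r n)` for nonnegative extended-real random variables: for every `δ > 0` there is `C`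
such that `P(X n > C * r n) ≤ δ` for all large `n` (outer probability, so that suprema need not be
measurable).  For nonnegative rates, `O_P(a n) + O_P(b n)` is the same as `O_P(a n + b n)`. -/
def IsOP {Ω : Type*} [MeasurableSpace Ω] (μ : Measure Ω) (X : ℕ → Ω → ℝ≥0∞) (r : ℕ → ℝ) : Prop :=
  ∀ δ : ℝ≥0∞, 0 < δ → ∃ C : ℝ, 0 < C ∧ ∀ᶠ n in atTop, μ {ω | ENNReal.ofReal (C * r n) < X n ω} ≤ δ

/-- The closed unit square `[0,1]²`. -/
def unitSquare : Set (ℝ × ℝ) := Icc 0 1 ×ˢ Icc 0 1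

/-- Partial derivative in the first variable (one-sided at the edges of the square). -/
def pd1 (f : ℝ × ℝ → ℝ) : ℝ × ℝ → ℝ :=
  fun p => derivWithin (fun t => f (t, p.2)) (Icc 0 1) p.1

/-- Partial derivative in the second variable (one-sided at the edges of the square). -/
def pd2 (f : ℝ × ℝ → ℝ) : ℝ × ℝ → ℝ :=
  fun p => derivWithin (fun t => f (p.1, t)) (Icc 0 1) p.2

/-- `∂^a f` for a multi-index `a = (a₁, a₂)`. -/
def pd (a : ℕ × ℕ) (f : ℝ × ℝ → ℝ) : ℝ × ℝ → ℝ := pd1^[a.1] (pd2^[a.2] f)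

/-- `H` is a bivariate copula on `[0,1]²` with density `h`. -/
structure IsCopulaWithDensity (H h : ℝ × ℝ → ℝ) : Prop where
  nonneg : ∀ p ∈ unitSquare, 0 ≤ h p
  integrable : IntegrableOn h unitSquare
  eq_integral : ∀ p ∈ unitSquare, H p = ∫ v in Icc 0 p.1 ×ˢ Icc 0 p.2, h v
  margin_one : ∀ p ∈ Icc (0 : ℝ) 1, H (p, 1) = p
  margin_two : ∀ p ∈ Icc (0 : ℝ) 1, H (1, p) = p

/-- Smoothed trimming function with cut-off `ϖ`: a nondecreasing `C¹` map `[0,1] → [0,1]` with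
bounded derivative, which vanishes exactly on `[0, ϖ]`. -/
structure IsTrimming (ϖ : ℝ) (τ : ℝ → ℝ) : Prop where
  pos : 0 < ϖ
  maps : MapsTo τ (Icc 0 1) (Icc 0 1)
  mono : MonotoneOn τ (Icc 0 1)
  zero_iff : ∀ a ∈ Icc (0 : ℝ) 1, τ a = 0 ↔ a ≤ ϖ
  contDiff : ContDiffOn ℝ 1 τ (Icc 0 1)
  bdd_deriv : ∃ C, ∀ a ∈ Icc (0 : ℝ) 1, |derivWithin τ (Icc 0 1) a| ≤ C

/-! ### Population model

Player 1 is `0 : Fin 2` and player 2 is `1 : Fin 2`. -/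

/-- `W_j = (X_j, Z_j)`, with the covariates `X_j` on the left summand. -/
abbrev WVec (dX dZ : ℕ) : Type := Fin dX ⊕ Fin dZ → ℝ

/-- Treatments and `W` of the two players of a pair. -/
abbrev Design (dX dZ : ℕ) : Type := (Fin 2 → Bool) × (Fin 2 → WVec dX dZ)

/-- An observation `(Y, D, W)` of a pair. -/
abbrev Obs (dX dZ : ℕ) : Type := (Fin 2 → ℝ) × Design dX dZ

/-- First-stage parameters `θ = ((γ₀, γ₁), ρ, λ)`. -/
abbrev Param (dX dZ : ℕ) : Type := (WVec dX dZ × WVec dX dZ) × ℝ × ℝ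

/-- The other player. -/
def opp (j : Fin 2) : Fin 2 := 1 - j

/-- The covariates of player `j`. -/
def covX {dX dZ : ℕ} (w : Fin 2 → WVec dX dZ) (j : Fin 2) : Fin dX → ℝ := fun k => w j (Sum.inl k)

/-- The random and deterministic ingredients of the game with potential outcomes.
`U j d d'` is the error of player `j` when the own treatment is `d` and the partner's is `d'`;
`β j d d'` is the corresponding coefficient vector. -/
structure Model (Ω₀ : Type*) (dX dZ : ℕ) where
  W : Ω₀ → Fin 2 → WVec dX dZ
  ε : Ω₀ → Fin 2 → ℝ
  U : Fin 2 → Bool → Bool → Ω₀ → ℝ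
  D : Ω₀ → Fin 2 → Bool
  β : Fin 2 → Bool → Bool → Fin dX → ℝ
  /-- interaction function -/
  η : ℝ → ℝ
  /-- copula family `H_ρ` and densities `h_ρ`, for `ρ ∈ [ρmin, ρmax]` -/
  H : ℝ → ℝ × ℝ → ℝ
  h : ℝ → ℝ × ℝ → ℝ
  ρmin : ℝ
  ρmax : ℝ
  /-- true value of the first-stage parameter -/
  θ : Param dX dZ

namespace Model

variable {Ω₀ : Type*} [MeasurableSpace Ω₀] {dX dZ : ℕ}

/-- Potential outcome `Y_j^{(d, d')} = X_jᵀ β_j^{(d, d')} + U_j^{(d, d')}`. -/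
def potY (M : Model Ω₀ dX dZ) (j : Fin 2) (d d' : Bool) (ω : Ω₀) : ℝ :=
  covX (M.W ω) j ⬝ᵥ M.β j d d' + M.U j d d' ω

/-- Observed outcome. -/
def Y (M : Model Ω₀ dX dZ) (ω : Ω₀) (j : Fin 2) : ℝ := M.potY j (M.D ω j) (M.D ω (opp j)) ω

/-- `(D, W)` of a pair. -/
def design (M : Model Ω₀ dX dZ) (ω : Ω₀) : Design dX dZ := (M.D ω, M.W ω)

/-- The observables `(Y, D, W)` of a pair. -/
def obs (M : Model Ω₀ dX dZ) (ω : Ω₀) : Obs dX dZ := (M.Y ω, M.design ω)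

/-- Marginal distribution function of `ε_j`. -/
def F (M : Model Ω₀ dX dZ) (μ₀ : Measure Ω₀) (j : Fin 2) : ℝ → ℝ :=
  fun a => cdf (μ₀.map fun ω => M.ε ω j) a

/-- `V = (F₁(ε₁), F₂(ε₂))`. -/
def V (M : Model Ω₀ dX dZ) (μ₀ : Measure Ω₀) (ω : Ω₀) : ℝ × ℝ :=
  (M.F μ₀ 0 (M.ε ω 0), M.F μ₀ 1 (M.ε ω 1))

/-- `X = (X₁, X₂)`. -/
def X (M : Model Ω₀ dX dZ) (ω : Ω₀) : Fin 2 → Fin dX → ℝ := covX (M.W ω)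

/-- `P_j^d(γ)` as a function of `w`: `F_j(w_jᵀγ₀)` for `d = 0`, `F_j(w_jᵀγ₀ + η(w_jᵀγ₁))` for
`d = 1`. -/
def P (M : Model Ω₀ dX dZ) (μ₀ : Measure Ω₀) (θ : Param dX dZ) (w : Fin 2 → WVec dX dZ)
    (j : Fin 2) (d : Bool) : ℝ :=
  M.F μ₀ j (w j ⬝ᵥ θ.1.1 + if d then M.η (w j ⬝ᵥ θ.1.2) else 0)

/-- `(P₁⁰, P₂¹)`. -/
def P10 (M : Model Ω₀ dX dZ) (μ₀ : Measure Ω₀) (θ : Param dX dZ) (w : Fin 2 → WVec dX dZ) :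
    ℝ × ℝ :=
  (M.P μ₀ θ w 0 false, M.P μ₀ θ w 1 true)

/-- Conditional probability of the region of multiple equilibria. -/
def Lmul (M : Model Ω₀ dX dZ) (μ₀ : Measure Ω₀) (θ : Param dX dZ) (w : Fin 2 → WVec dX dZ) : ℝ :=
  M.H θ.2.1 (M.P μ₀ θ w 0 true, M.P μ₀ θ w 1 true)
    - M.H θ.2.1 (M.P μ₀ θ w 0 true, M.P μ₀ θ w 1 false)
    - M.H θ.2.1 (M.P μ₀ θ w 0 false, M.P μ₀ θ w 1 true)
    + M.H θ.2.1 (M.P μ₀ θ w 0 false, M.P μ₀ θ w 1 false)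

/-- Choice probability of `(1,0)`: `P₁⁰ - H_ρ(P₁⁰, P₂¹)`. -/
def L10 (M : Model Ω₀ dX dZ) (μ₀ : Measure Ω₀) (θ : Param dX dZ) (w : Fin 2 → WVec dX dZ) : ℝ :=
  M.P μ₀ θ w 0 false - M.H θ.2.1 (M.P10 μ₀ θ w)

/-- Choice probability of `(0,1)`. -/
def L01 (M : Model Ω₀ dX dZ) (μ₀ : Measure Ω₀) (θ : Param dX dZ) (w : Fin 2 → WVec dX dZ) : ℝ :=
  M.P μ₀ θ w 1 false - M.H θ.2.1 (M.P μ₀ θ w 0 true, M.P μ₀ θ w 1 false)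

/-- Choice probability of `(1,1)`. -/
def L11 (M : Model Ω₀ dX dZ) (μ₀ : Measure Ω₀) (θ : Param dX dZ) (w : Fin 2 → WVec dX dZ) : ℝ :=
  M.H θ.2.1 (M.P μ₀ θ w 0 true, M.P μ₀ θ w 1 true) - θ.2.2 * M.Lmul μ₀ θ w

/-- Choice probability of the observed action `d = (d₁, d₂)`. -/
def Lik (M : Model Ω₀ dX dZ) (μ₀ : Measure Ω₀) (θ : Param dX dZ) (z : Design dX dZ) : ℝ :=
  match z.1 0, z.1 1 with
  | true, false => M.L10 μ₀ θ z.2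
  | false, true => M.L01 μ₀ θ z.2
  | true, true => M.L11 μ₀ θ z.2
  | false, false => 1 - M.L10 μ₀ θ z.2 - M.L01 μ₀ θ z.2 - M.L11 μ₀ θ z.2

/-- Log-likelihood of a sample (with `log 0 = -∞`). -/
def logLik (M : Model Ω₀ dX dZ) (μ₀ : Measure Ω₀) {n : ℕ} (z : Fin n → Design dX dZ)
    (θ : Param dX dZ) : EReal :=
  ∑ i, ENNReal.log (ENNReal.ofReal (M.Lik μ₀ θ (z i)))

/-- `S^{(1,0)}`, the support of the law of `(P₁⁰, P₂¹)` conditional on `D = (1,0)`. -/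
def S10 (M : Model Ω₀ dX dZ) (μ₀ : Measure Ω₀) : Set (ℝ × ℝ) :=
  ((μ₀[|{ω | M.D ω 0 = true ∧ M.D ω 1 = false}]).map fun ω => M.P10 μ₀ M.θ (M.W ω)).support

/-- `v ↦ E[U₁^{(1,0)} | V = v]`. -/
def meanU (M : Model Ω₀ dX dZ) (μ₀ : Measure Ω₀) [IsFiniteMeasure μ₀] (v : ℝ × ℝ) : ℝ :=
  ∫ u, u ∂(condDistrib (M.U 0 true false) (M.V μ₀) μ₀ v)

/-- `g₁^{(1,0)}(p₁, p₂) = ∫₀^{p₁} ∫_{p₂}^1 E[U₁^{(1,0)} | V = (v₁, v₂)] h(v₁, v₂) dv₁ dv₂`. -/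
def g10 (M : Model Ω₀ dX dZ) (μ₀ : Measure Ω₀) [IsFiniteMeasure μ₀] (p : ℝ × ℝ) : ℝ :=
  ∫ v in Icc 0 p.1 ×ˢ Icc p.2 1, M.meanU μ₀ v * M.h M.θ.2.1 v

/-- `m` is a version of the marginal treatment response function
`m(x, p) = E[Y₁^{(1,0)} | X = x, V = p]`. -/
def IsMTR10 (M : Model Ω₀ dX dZ) (μ₀ : Measure Ω₀) [IsFiniteMeasure μ₀]
    (m : (Fin 2 → Fin dX → ℝ) × (ℝ × ℝ) → ℝ) : Prop :=
  ∀ᵐ z ∂(μ₀.map fun ω => (M.X ω, M.V μ₀ ω)),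
    m z = ∫ y, y ∂(condDistrib (M.potY 0 true false) (fun ω => (M.X ω, M.V μ₀ ω)) μ₀ z)

/-- Indicator `I^{(1,0)}`. -/
def I10 (z : Design dX dZ) : ℝ := if z.1 0 = true ∧ z.1 1 = false then 1 else 0

/-- Regression error `e₁^{(1,0)} = I Y₁ - I X₁ᵀβ₁ - (I / L) g₁(P₁⁰, P₂¹)` of the `(1,0)` equation,
where `I = I^{(1,0)}` and `L = L^{(1,0)}`. -/
def err (M : Model Ω₀ dX dZ) (μ₀ : Measure Ω₀) [IsFiniteMeasure μ₀] (ω : Ω₀) : ℝ :=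
  I10 (M.design ω) * M.Y ω 0
    - I10 (M.design ω) * (covX (M.W ω) 0 ⬝ᵥ M.β 0 true false)
    - I10 (M.design ω) / M.L10 μ₀ M.θ (M.W ω) * M.g10 μ₀ (M.P10 μ₀ M.θ (M.W ω))

/-! ### Assumptions on the population -/

/-- Parametric game: best-response treatment decisions with positive interaction effect, errors with
continuous marginals and joint law given by a member of a parametric copula family with densities.
(Independence of `ε` and `W` is part of `LinearOutcome.indep`.) -/
structure ParametricGame (M : Model Ω₀ dX dZ) (μ₀ : Measure Ω₀) : Prop where
  meas_W : Measurable M.W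
  meas_ε : Measurable M.ε
  meas_D : Measurable M.D
  meas_η : Measurable M.η
  η_pos : ∀ t, 0 < M.η t
  decision : ∀ᵐ ω ∂μ₀, ∀ j, M.D ω j = true ↔
    M.ε ω j ≤ M.W ω j ⬝ᵥ M.θ.1.1 + if M.D ω (opp j) then M.η (M.W ω j ⬝ᵥ M.θ.1.2) else 0
  cdf_cont : ∀ j, Continuous (M.F μ₀ j)
  ρ_mem : M.θ.2.1 ∈ Icc M.ρmin M.ρmax
  copula : ∀ ρ ∈ Icc M.ρmin M.ρmax, IsCopulaWithDensity (M.H ρ) (M.h ρ)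
  joint_cdf : ∀ a₁ a₂ : ℝ, μ₀.real {ω | M.ε ω 0 ≤ a₁ ∧ M.ε ω 1 ≤ a₂}
    = M.H M.θ.2.1 (M.F μ₀ 0 a₁, M.F μ₀ 1 a₂)

/-- Linear potential outcomes (the linear form is built into `Model.potY`) with errors that are,
together with `ε`, independent of `W`; here `U^{(d,d')} = (U₁^{(d,d')}, U₂^{(d',d)})`.  The last two
fields are the moments needed for the conditional mean and for the design matrix. -/
structure LinearOutcome (M : Model Ω₀ dX dZ) (μ₀ : Measure Ω₀) : Prop where
  meas_U : ∀ j d d', Measurable (M.U j d d')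
  indep : ∀ d d', IndepFun (fun ω => (M.ε ω, M.U 0 d d' ω, M.U 1 d' d ω)) M.W μ₀
  integrable_U : Integrable (M.U 0 true false) μ₀
  memLp_X : ∀ k, MemLp (fun ω => M.X ω 0 k) 2 μ₀

/-- Smoothness of the copula family near the true `ρ`: Lipschitz in `ρ` (uniformly on the square),
with continuous densities that are bounded away from zero on `S^{(1,0)}`. -/
def SmoothCopula (M : Model Ω₀ dX dZ) (μ₀ : Measure Ω₀) : Prop :=
  ∃ N ∈ 𝓝[Icc M.ρmin M.ρmax] M.θ.2.1, ∃ L : ℝ,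
    (∀ ρ ∈ N, ∀ ρ' ∈ N, ∀ p ∈ unitSquare, |M.H ρ p - M.H ρ' p| ≤ L * |ρ - ρ'|) ∧
    (∀ ρ ∈ N, ∀ ρ' ∈ N, ∀ p ∈ unitSquare, |M.h ρ p - M.h ρ' p| ≤ L * |ρ - ρ'|) ∧
    (∀ ρ ∈ N, ContinuousOn (M.h ρ) unitSquare) ∧
    (∀ ρ ∈ N, ∃ c : ℝ, 0 < c ∧ ∀ p ∈ M.S10 μ₀, c ≤ M.h ρ p)

/-- `E[(e₁^{(1,0)})⁴ | W, D]` is (finite and) bounded. -/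
def BoundedFourthMoment (M : Model Ω₀ dX dZ) (μ₀ : Measure Ω₀) [IsFiniteMeasure μ₀] : Prop :=
  Integrable (fun ω => M.err μ₀ ω ^ 4) μ₀ ∧
    ∃ C : ℝ, ∀ᵐ ω ∂μ₀,
      (μ₀[fun ω => M.err μ₀ ω ^ 4 | MeasurableSpace.comap M.design inferInstance]) ω ≤ C

end Model

/-! ### First-stage estimator -/

/-- The designs `(D_i, W_i)`, `i < n`, of a sample. -/
def sampleDesign {Ω : Type*} {dX dZ : ℕ} (Z : ℕ → Ω → Obs dX dZ) (n : ℕ) (ω : Ω) :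
    Fin n → Design dX dZ :=
  fun i => (Z i ω).2

/-- `est` is a maximum likelihood estimator over the parameter space `Θ`, computed from the sample
of treatments and `W`; the maximum has to be attained only with probability approaching one. -/
structure IsMLE {Ω₀ Ω : Type*} [MeasurableSpace Ω₀] [MeasurableSpace Ω] {dX dZ : ℕ}
    (M : Model Ω₀ dX dZ) (μ₀ : Measure Ω₀) (μ : Measure Ω) (Z : ℕ → Ω → Obs dX dZ)
    (Θ : Set (Param dX dZ)) (est : ∀ n : ℕ, (Fin n → Design dX dZ) → Param dX dZ) : Prop where
  space : ∀ θ ∈ Θ, θ.2.1 ∈ Icc M.ρmin M.ρmax ∧ θ.2.2 ∈ Icc (0 : ℝ) 1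
  true_mem : M.θ ∈ Θ
  meas : ∀ n, Measurable (est n)
  mem : ∀ n z, est n z ∈ Θ
  max : Tendsto (fun n => μ {ω | ¬ IsMaxOn (M.logLik μ₀ (sampleDesign Z n ω)) Θ
    (est n (sampleDesign Z n ω))}) atTop (𝓝 0)

/-- Root-`n` consistency of the first stage: `‖θ̂ - θ*‖ = O_P(n^{-1/2})` and
`max_i |P̂_{ji}^d - P_{ji}^d| = O_P(n^{-1/2})`. -/
def RootNConsistent {Ω₀ Ω : Type*} [MeasurableSpace Ω₀] [MeasurableSpace Ω] {dX dZ : ℕ}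
    (M : Model Ω₀ dX dZ) (μ₀ : Measure Ω₀) (μ : Measure Ω) (Z : ℕ → Ω → Obs dX dZ)
    (est : ∀ n : ℕ, (Fin n → Design dX dZ) → Param dX dZ) : Prop :=
  IsOP μ (fun n ω => ‖est n (sampleDesign Z n ω) - M.θ‖ₑ) (fun n => 1 / √(n : ℝ)) ∧
  ∀ (j : Fin 2) (d : Bool),
    IsOP μ (fun n ω => ⨆ i : Fin n,
      ‖M.P μ₀ (est n (sampleDesign Z n ω)) (Z i ω).2.2 j d - M.P μ₀ M.θ (Z i ω).2.2 j d‖ₑ)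
      (fun n => 1 / √(n : ℝ))

/-! ### Series estimators -/

/-- A choice of symmetric generalized inverses of symmetric matrices. -/
def IsSymmGenInverse {dX : ℕ}
    (ginv : ∀ K : ℕ, Matrix (Fin dX ⊕ Fin K) (Fin dX ⊕ Fin K) ℝ →
      Matrix (Fin dX ⊕ Fin K) (Fin dX ⊕ Fin K) ℝ) : Prop :=
  ∀ K A, A.IsSymm → (ginv K A).IsSymm ∧ A * ginv K A * A = A

section Series

variable {Ω₀ : Type*} [MeasurableSpace Ω₀] {dX dZ : ℕ}

/-- Trimmed indicator `τ(L^{(1,0)}) I^{(1,0)}` at the first-stage parameter `θ`. -/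
def trimI (M : Model Ω₀ dX dZ) (μ₀ : Measure Ω₀) (τ : ℝ → ℝ) (θ : Param dX dZ)
    (z : Design dX dZ) : ℝ :=
  τ (M.L10 μ₀ θ z.2) * Model.I10 z

/-- Trimmed weight `τ(L^{(1,0)}) I^{(1,0)} / L^{(1,0)}` at the first-stage parameter `θ`. -/
def trimT (M : Model Ω₀ dX dZ) (μ₀ : Measure Ω₀) (τ : ℝ → ℝ) (θ : Param dX dZ)
    (z : Design dX dZ) : ℝ :=
  trimI M μ₀ τ θ z / M.L10 μ₀ θ z.2

/-- The regressor `R_K = (Ĩ X₁ᵀ, T̃ b_K(P₁⁰, P₂¹)ᵀ)ᵀ` at the first-stage parameter `θ`. -/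
def regressor (M : Model Ω₀ dX dZ) (μ₀ : Measure Ω₀) (τ : ℝ → ℝ) {K : ℕ}
    (b : Fin K → ℝ × ℝ → ℝ) (θ : Param dX dZ) (z : Design dX dZ) : Fin dX ⊕ Fin K → ℝ :=
  Sum.elim (fun k => trimI M μ₀ τ θ z * covX z.2 0 k)
    (fun k => trimT M μ₀ τ θ z * b k (M.P10 μ₀ θ z.2))

/-- The `n × (dim X + K)` matrix of regressors. -/
def regMatrix (M : Model Ω₀ dX dZ) (μ₀ : Measure Ω₀) (τ : ℝ → ℝ) {K : ℕ}
    (b : Fin K → ℝ × ℝ → ℝ) (θ : Param dX dZ) {n : ℕ} (o : Fin n → Obs dX dZ) :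
    Matrix (Fin n) (Fin dX ⊕ Fin K) ℝ :=
  Matrix.of fun i => regressor M μ₀ τ b θ (o i).2

/-- Least squares coefficients `[RᵀR]⁻ Rᵀ 𝐘` at the first-stage parameter `θ`. -/
def lsCoef (M : Model Ω₀ dX dZ) (μ₀ : Measure Ω₀) (τ : ℝ → ℝ) {K : ℕ}
    (ginv : Matrix (Fin dX ⊕ Fin K) (Fin dX ⊕ Fin K) ℝ →
      Matrix (Fin dX ⊕ Fin K) (Fin dX ⊕ Fin K) ℝ)
    (b : Fin K → ℝ × ℝ → ℝ) (θ : Param dX dZ) {n : ℕ} (o : Fin n → Obs dX dZ) :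
    Fin dX ⊕ Fin K → ℝ :=
  Matrix.mulVec
    (ginv ((regMatrix M μ₀ τ b θ o).transpose * regMatrix M μ₀ τ b θ o))
    (Matrix.mulVec (regMatrix M μ₀ τ b θ o).transpose
      (fun i => trimI M μ₀ τ θ (o i).2 * (o i).1 0))

/-- The estimator `x₁ᵀβ̂ - b̈_K(p)ᵀα̂ / h_ρ(p)` of `m^{(1,0)}(x, p)` based on the first-stage
parameter `θ`; it is infeasible at the true `θ` and feasible at the estimated one. -/
def mtrEst (M : Model Ω₀ dX dZ) (μ₀ : Measure Ω₀) (τ : ℝ → ℝ) {K : ℕ}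
    (ginv : Matrix (Fin dX ⊕ Fin K) (Fin dX ⊕ Fin K) ℝ →
      Matrix (Fin dX ⊕ Fin K) (Fin dX ⊕ Fin K) ℝ)
    (b : Fin K → ℝ × ℝ → ℝ) (θ : Param dX dZ) {n : ℕ} (o : Fin n → Obs dX dZ)
    (x : Fin 2 → Fin dX → ℝ) (p : ℝ × ℝ) : ℝ :=
  ∑ k, x 0 k * lsCoef M μ₀ τ ginv b θ o (Sum.inl k)
    - (∑ k, pd (1, 1) (b k) p * lsCoef M μ₀ τ ginv b θ o (Sum.inr k)) / M.h θ.2.1 p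

/-- `Ψ_K = E[R_K R_Kᵀ]`. -/
def PsiPop (M : Model Ω₀ dX dZ) (μ₀ : Measure Ω₀) (τ : ℝ → ℝ) {K : ℕ}
    (b : Fin K → ℝ × ℝ → ℝ) : Matrix (Fin dX ⊕ Fin K) (Fin dX ⊕ Fin K) ℝ :=
  Matrix.of fun k l => ∫ ω, regressor M μ₀ τ b M.θ (M.design ω) k *
    regressor M μ₀ τ b M.θ (M.design ω) l ∂μ₀

/-- `Ψ_{nK} = RᵀR / n` (at the true first-stage parameter). -/
def PsiSample (M : Model Ω₀ dX dZ) (μ₀ : Measure Ω₀) (τ : ℝ → ℝ) {K : ℕ}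
    (b : Fin K → ℝ × ℝ → ℝ) {n : ℕ} (o : Fin n → Obs dX dZ) :
    Matrix (Fin dX ⊕ Fin K) (Fin dX ⊕ Fin K) ℝ :=
  (n : ℝ)⁻¹ • ((regMatrix M μ₀ τ b M.θ o).transpose * regMatrix M μ₀ τ b M.θ o)

/-- `(P_{nK} f)(p) = b_K(p)ᵀ S_K Ψ_{nK}⁻¹ (1/n) ∑ R_{K,i} f(Q_i)`, with `Q_i = W_i`. -/
def projOp (M : Model Ω₀ dX dZ) (μ₀ : Measure Ω₀) (τ : ℝ → ℝ) {K : ℕ}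
    (b : Fin K → ℝ × ℝ → ℝ) {n : ℕ} (o : Fin n → Obs dX dZ)
    (f : (Fin 2 → WVec dX dZ) → ℝ) (p : ℝ × ℝ) : ℝ :=
  ∑ k, b k p * Matrix.mulVec (PsiSample M μ₀ τ b o)⁻¹
    ((n : ℝ)⁻¹ • ∑ i, f (o i).2.2 • regressor M μ₀ τ b M.θ (o i).2) (Sum.inr k)

/-- The operator norm of `P_{nK}` restricted on `S^{(1,0)}`: supremum of `|(P_{nK} f)(p)|` over
`p ∈ S^{(1,0)}` and continuous `f` on `supp[W]` with `sup |f| = 1`. -/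
def projNorm (M : Model Ω₀ dX dZ) (μ₀ : Measure Ω₀) (τ : ℝ → ℝ) {K : ℕ}
    (b : Fin K → ℝ × ℝ → ℝ) {n : ℕ} (o : Fin n → Obs dX dZ) : ℝ≥0∞ :=
  ⨆ f ∈ {f : (Fin 2 → WVec dX dZ) → ℝ | ContinuousOn f (μ₀.map M.W).support ∧
    (⨆ q ∈ (μ₀.map M.W).support, ‖f q‖ₑ) = 1},
  ⨆ p ∈ M.S10 μ₀, ‖projOp M μ₀ τ b o f p‖ₑ

/-- `ζ_d(K) = max_{|a| ≤ d} sup_{p ∈ [0,1]²} ‖∂^a b_K(p)‖` (Euclidean norm). -/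
def zeta {K : ℕ} (b : Fin K → ℝ × ℝ → ℝ) (d : ℕ) : ℝ :=
  sSup {r : ℝ | ∃ a : ℕ × ℕ, a.1 + a.2 ≤ d ∧ ∃ p ∈ unitSquare, r = √(∑ k, pd a (b k) p ^ 2)}

/-! ### Assumptions on the sieve.  `K n` is the number of basis functions at sample size `n`. -/

/-- Eigenvalues of `Ψ_K` bounded away from zero and infinity, uniformly in `K`. -/
def EigenBounds (M : Model Ω₀ dX dZ) (μ₀ : Measure Ω₀) (τ : ℝ → ℝ)
    (b : ∀ K : ℕ, Fin K → ℝ × ℝ → ℝ) (K : ℕ → ℕ) : Prop :=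
  ∃ c C : ℝ, 0 < c ∧ ∀ n, spectrum ℝ (PsiPop M μ₀ τ (b (K n))) ⊆ Icc c C

/-- `g₁^{(1,0)}` and `b_K` are `s` times continuously differentiable on `[0,1]²`, and
`sup |∂^a g₁ - (∂^a b_K)ᵀα_K| = O(K^{(|a|-s)/2})` for derivatives up to order two. -/
def SieveApprox (M : Model Ω₀ dX dZ) (μ₀ : Measure Ω₀) [IsFiniteMeasure μ₀]
    (b : ∀ K : ℕ, Fin K → ℝ × ℝ → ℝ) (K : ℕ → ℕ) (s : ℕ) : Prop :=
  ContDiffOn ℝ (s : ℕ∞) (M.g10 μ₀) unitSquare ∧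
  (∀ n k, ContDiffOn ℝ (s : ℕ∞) (b (K n) k) unitSquare) ∧
  ∃ α : ∀ K : ℕ, Fin K → ℝ, ∀ a : ℕ × ℕ, a.1 + a.2 ≤ 2 → ∃ C : ℝ, ∀ᶠ n in atTop,
    ∀ p ∈ unitSquare, |pd a (M.g10 μ₀) p - ∑ k, pd a (b (K n) k) p * α (K n) k|
      ≤ C * (K n : ℝ) ^ ((((a.1 + a.2 : ℕ) : ℝ) - s) / 2)

/-- The growth conditions on the basis:
`ζ₀ √(log K / n) → 0`, `ζ₁ / √n → 0`, `ζ₀ ζ₁ / √n = O(1)` and `ζ₀² √(log n / n) → 0`. -/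
structure BasisGrowth (b : ∀ K : ℕ, Fin K → ℝ × ℝ → ℝ) (K : ℕ → ℕ) : Prop where
  zeta_zero : Tendsto (fun n => zeta (b (K n)) 0 * √(Real.log (K n) / n)) atTop (𝓝 0)
  zeta_one : Tendsto (fun n => zeta (b (K n)) 1 / √(n : ℝ)) atTop (𝓝 0)
  zeta_mul : (fun n => zeta (b (K n)) 0 * zeta (b (K n)) 1 / √(n : ℝ)) =O[atTop] fun _ => (1 : ℝ)
  zeta_sq : Tendsto (fun n => zeta (b (K n)) 0 ^ 2 * √(Real.log n / n)) atTop (𝓝 0)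

/-- Inverse inequality on the sieve space: for derivatives up to order two,
`sup_S |(∂^a b_K)ᵀα| ≤ O(K^{|a|/2}) sup_S |b_Kᵀα|` for all `α ∈ ℝ^K`, where `S = S^{(1,0)}`. -/
def InverseInequality (M : Model Ω₀ dX dZ) (μ₀ : Measure Ω₀)
    (b : ∀ K : ℕ, Fin K → ℝ × ℝ → ℝ) (K : ℕ → ℕ) : Prop :=
  ∀ a : ℕ × ℕ, a.1 + a.2 ≤ 2 → ∃ C : ℝ, ∀ᶠ n in atTop, ∀ α : Fin (K n) → ℝ,
    (⨆ p ∈ M.S10 μ₀, ‖∑ k, pd a (b (K n) k) p * α k‖ₑ)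
      ≤ ENNReal.ofReal (C * (K n : ℝ) ^ (((a.1 + a.2 : ℕ) : ℝ) / 2)) *
        ⨆ p ∈ M.S10 μ₀, ‖∑ k, b (K n) k p * α k‖ₑ

/-- Polynomial Lipschitz constant of the basis:
`‖b_K(p) - b_K(p')‖ ≤ c_b K^ω ‖p - p'‖` on `[0,1]²`, for some finite `c_b > 0`, `ω ≥ 0`. -/
def BasisLipschitz (b : ∀ K : ℕ, Fin K → ℝ × ℝ → ℝ) (K : ℕ → ℕ) : Prop :=
  ∃ c ω : ℝ, 0 < c ∧ 0 ≤ ω ∧ ∀ n, ∀ p ∈ unitSquare, ∀ p' ∈ unitSquare,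
    √(∑ k, (b (K n) k p - b (K n) k p') ^ 2)
      ≤ c * (K n : ℝ) ^ ω * √((p.1 - p'.1) ^ 2 + (p.2 - p'.2) ^ 2)

end Series

/-- The first `n` observations. -/
def sample {Ω : Type*} {dX dZ : ℕ} (Z : ℕ → Ω → Obs dX dZ) (n : ℕ) (ω : Ω) : Fin n → Obs dX dZ :=
  fun i => Z i ω

/-- Stone's uniform rate `(log n / n)^{(s - q) / (2 s + d)}` for a `q`-th order derivative of an
`s`-smooth regression function of `d` variables. -/
def stoneRate (s q d : ℕ) (n : ℕ) : ℝ :=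
  (Real.log n / n) ^ (((s : ℝ) - q) / (2 * s + d))

end GameMTE

end

/-! Identification. Because the interaction effect is positive, action (1,0) occurs almost surely
exactly when the first error lies below its low threshold and the second above its high threshold,
whatever rule selects among equilibria. Independence of W then gives the mean of U on this event as
g(P₁⁰, P₂¹) and its probability as L^{(1,0)}, so the regression error e is centred given the designs
(`ParametricGame.setIntegral_err`). Since g integrates E[U | V]h over a rectangle bounded below in
its second coordinate, its mixed derivative is -E[U | V]h. Hence m(x, p) = x₁ᵀβ - ∂₁∂₂g(p)/h(p),
first almost everywhere and then, by continuity, at every point needed (`ParametricGame.mtr_eq`). It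
remains to estimate β and the mixed derivative of g uniformly.

Estimation. The trimmed response equals the regressors times (β, α_K) plus three errors, at any
first-stage parameter (`response_eq`). The error from the estimated choice probabilities is
O(n^{-1/2}). The sieve error is O(K^{-s/2}); its projection is bounded through ‖P_{nK}‖, and moving
from the estimated to the true design costs only a bounded factor because ζ₀ζ₁/√n is bounded. The
third error is noise. With probability approaching one both Gram matrices divided by n are bounded
below (`tight_gram`, `tight_design`), so generalized inverses are inverses and least squares is
stable under changes of the design.

The first stage is a function of the treatments and W only. Given the designs, all weights of the
noise are therefore constants, even at the estimated parameter, while the noise is independent and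
centred with bounded fourth moments. The supremum over p of b_K(p)ᵀ times the noise part of the
coefficients is bounded by truncation, an exponential inequality and a union bound over a grid whose
size is polynomial in n; it is O(ζ₀√(log n/n)) (`tight_noise_sup`).

This controls b_K(p)ᵀ(α̂ - α_K) uniformly on S^{(1,0)}. The inverse inequality passes to the mixed
derivative at the cost of a factor K, which produces both terms of the rate (`tight_rate`). The
infeasible estimator is the special case of a constant first stage. -/

set_option linter.unusedSectionVars false

noncomputable section

namespace GameMTE

/-! ### Euclidean norm of vectors and least squares projections -/

section LinearAlgebra

variable {ι κ : Type*} [Fintype ι] [Fintype κ]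

/-- Euclidean norm of a vector. -/
def l2 (v : ι → ℝ) : ℝ := ‖(WithLp.toLp 2 v : EuclideanSpace ℝ ι)‖

lemma l2_nonneg (v : ι → ℝ) : 0 ≤ l2 v := norm_nonneg _

lemma l2_eq_sqrt (v : ι → ℝ) : l2 v = √(∑ i, v i ^ 2) := by
  simp [l2, EuclideanSpace.norm_eq]

lemma l2_sq (v : ι → ℝ) : l2 v ^ 2 = ∑ i, v i ^ 2 := by
  rw [l2_eq_sqrt, Real.sq_sqrt (Finset.sum_nonneg fun i _ => sq_nonneg _)]

lemma l2_sq_eq_dot (v : ι → ℝ) : l2 v ^ 2 = v ⬝ᵥ v := by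
  rw [l2_sq]; simp [dotProduct, sq]

lemma l2_add_le (v w : ι → ℝ) : l2 (v + w) ≤ l2 v + l2 w := by
  simpa [l2] using norm_add_le (WithLp.toLp 2 v : EuclideanSpace ℝ ι) (WithLp.toLp 2 w)

lemma l2_sub_le (v w : ι → ℝ) : l2 (v - w) ≤ l2 v + l2 w := by
  simpa [l2] using norm_sub_le (WithLp.toLp 2 v : EuclideanSpace ℝ ι) (WithLp.toLp 2 w)

lemma l2_smul (a : ℝ) (v : ι → ℝ) : l2 (a • v) = |a| * l2 v := by
  simp [l2, norm_smul]

@[simp] lemma l2_zero : l2 (0 : ι → ℝ) = 0 := by simp [l2]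

lemma abs_dot_le (v w : ι → ℝ) : |v ⬝ᵥ w| ≤ l2 v * l2 w := by
  have h := abs_real_inner_le_norm (WithLp.toLp 2 v : EuclideanSpace ℝ ι) (WithLp.toLp 2 w)
  simpa [l2, PiLp.inner_apply, dotProduct, mul_comm] using h

lemma abs_le_l2 (v : ι → ℝ) (i : ι) : |v i| ≤ l2 v := by
  rw [l2_eq_sqrt]
  exact Real.abs_le_sqrt (Finset.single_le_sum (f := fun i => v i ^ 2)
    (fun i _ => sq_nonneg _) (Finset.mem_univ i))

lemma eq_zero_of_l2_eq_zero {v : ι → ℝ} (h : l2 v = 0) : v = 0 := by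
  funext i
  have := abs_le_l2 v i
  rw [h] at this
  exact abs_nonpos_iff.mp this

lemma l2_le_of_abs_le {n : ℕ} (v : Fin n → ℝ) {B : ℝ} (hB : 0 ≤ B) (h : ∀ i, |v i| ≤ B) :
    l2 v ≤ √(n : ℝ) * B := by
  rw [l2_eq_sqrt, ← Real.sqrt_sq hB, ← Real.sqrt_mul (by positivity)]
  apply Real.sqrt_le_sqrt
  calc ∑ i, v i ^ 2 ≤ ∑ _i : Fin n, B ^ 2 :=
        Finset.sum_le_sum fun i _ => sq_le_sq' (by linarith [abs_le.mp (h i)]) (abs_le.mp (h i)).2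
    _ = n * B ^ 2 := by simp

lemma l2_sumElim (v : ι → ℝ) (w : κ → ℝ) : l2 (Sum.elim v w) ^ 2 = l2 v ^ 2 + l2 w ^ 2 := by
  simp [l2_sq]

lemma l2_inl_le (v : ι ⊕ κ → ℝ) : l2 (fun i => v (Sum.inl i)) ≤ l2 v := by
  rw [l2_eq_sqrt, l2_eq_sqrt, Fintype.sum_sum_type]
  exact Real.sqrt_le_sqrt (le_add_of_nonneg_right (Finset.sum_nonneg fun i _ => sq_nonneg _))

lemma l2_inr_le (v : ι ⊕ κ → ℝ) : l2 (fun i => v (Sum.inr i)) ≤ l2 v := by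
  rw [l2_eq_sqrt, l2_eq_sqrt, Fintype.sum_sum_type]
  exact Real.sqrt_le_sqrt (le_add_of_nonneg_left (Finset.sum_nonneg fun i _ => sq_nonneg _))

open Matrix

/-- The Frobenius norm bounds the operator norm. -/
lemma l2_mulVec_le (A : Matrix ι κ ℝ) {d : ℝ} (hd : 0 ≤ d) (hA : ∑ i, ∑ k, A i k ^ 2 ≤ d ^ 2)
    (v : κ → ℝ) : l2 (A *ᵥ v) ≤ d * l2 v := by
  have h : l2 (A *ᵥ v) ^ 2 ≤ (d * l2 v) ^ 2 := by
    rw [l2_sq, mul_pow]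
    calc ∑ i, (A *ᵥ v) i ^ 2 ≤ ∑ i, (∑ k, A i k ^ 2) * l2 v ^ 2 := by
          refine Finset.sum_le_sum fun i _ => ?_
          have := abs_dot_le (A i) v
          rw [← l2_sq, ← mul_pow, ← sq_abs]
          exact pow_le_pow_left₀ (abs_nonneg _) this 2
      _ = (∑ i, ∑ k, A i k ^ 2) * l2 v ^ 2 := by rw [Finset.sum_mul]
      _ ≤ d ^ 2 * l2 v ^ 2 := by gcongr
  exact le_of_sq_le_sq h (mul_nonneg hd (l2_nonneg v))

lemma l2_vecMul_le (A : Matrix ι κ ℝ) {d : ℝ} (hd : 0 ≤ d) (hA : ∑ i, ∑ k, A i k ^ 2 ≤ d ^ 2)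
    (v : ι → ℝ) : l2 (Aᵀ *ᵥ v) ≤ d * l2 v := by
  apply l2_mulVec_le _ hd
  rw [Finset.sum_comm]
  simpa using hA

lemma l2_mulVec_sq (A : Matrix ι κ ℝ) (v : κ → ℝ) :
    l2 (A *ᵥ v) ^ 2 = v ⬝ᵥ ((Aᵀ * A) *ᵥ v) := by
  rw [l2_sq_eq_dot, ← mulVec_mulVec, dotProduct_mulVec v Aᵀ, vecMul_transpose]

/-- Lower bounds on the Gram matrix are stable under small perturbations of the design. -/
lemma gram_lower_of_perturb {A B : Matrix ι κ ℝ} {c : ℝ} (hc : 0 < c) (hA : ∀ v, c * l2 v ^ 2 ≤ l2 (A *ᵥ v) ^ 2)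
    (hBA : ∑ i, ∑ k, (B - A) i k ^ 2 ≤ (√c / 2) ^ 2) (v : κ → ℝ) :
    c / 4 * l2 v ^ 2 ≤ l2 (B *ᵥ v) ^ 2 := by
  -- The singular values of `A` are at least √c and the perturbation moves them by at most √c / 2.
  -- What remains is √c / 2, whose square is the constant c / 4.
  have h1 : √c * l2 v ≤ l2 (A *ᵥ v) := by
    refine le_of_sq_le_sq ?_ (l2_nonneg _)
    rw [mul_pow, Real.sq_sqrt hc.le]
    exact hA v
  have h2 : l2 (A *ᵥ v) ≤ l2 (B *ᵥ v) + √c / 2 * l2 v := by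
    have : A *ᵥ v = B *ᵥ v - (B - A) *ᵥ v := by rw [sub_mulVec]; abel
    rw [this]
    exact (l2_sub_le _ _).trans
      (add_le_add le_rfl (l2_mulVec_le _ (by positivity) hBA v))
  have h3 : √c / 2 * l2 v ≤ l2 (B *ᵥ v) := by linarith
  calc c / 4 * l2 v ^ 2 = (√c / 2 * l2 v) ^ 2 := by
        rw [mul_pow, div_pow, Real.sq_sqrt hc.le]; ring
    _ ≤ _ := pow_le_pow_left₀ (mul_nonneg (by positivity) (l2_nonneg v)) h3 2

variable [DecidableEq κ]

/-- Least squares coefficients of `y` on the columns of `A`. -/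
def lsq (A : Matrix ι κ ℝ) (y : ι → ℝ) : κ → ℝ := (Aᵀ * A)⁻¹ *ᵥ (Aᵀ *ᵥ y)

lemma lsq_add (A : Matrix ι κ ℝ) (y z : ι → ℝ) : lsq A (y + z) = lsq A y + lsq A z := by
  simp [lsq, mulVec_add]

lemma lsq_sub (A : Matrix ι κ ℝ) (y z : ι → ℝ) : lsq A (y - z) = lsq A y - lsq A z := by
  simp only [lsq, mulVec_sub]

variable {A B : Matrix ι κ ℝ} {c : ℝ}

lemma isUnit_gram_det (hc : 0 < c) (hA : ∀ v, c * l2 v ^ 2 ≤ l2 (A *ᵥ v) ^ 2) :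
    IsUnit (Aᵀ * A).det := by
  rw [← Matrix.isUnit_iff_isUnit_det, ← Matrix.mulVec_injective_iff_isUnit]
  intro v w hvw
  have h0 : (Aᵀ * A) *ᵥ (v - w) = 0 := by
    rw [mulVec_sub]; exact sub_eq_zero.mpr hvw
  have h1 := hA (v - w)
  rw [l2_mulVec_sq, h0, dotProduct_zero] at h1
  have h2 : l2 (v - w) ^ 2 ≤ 0 := by
    by_contra hcon
    push Not at hcon
    have := mul_pos hc hcon
    linarith
  have h3 : l2 (v - w) = 0 := by
    have := sq_nonneg (l2 (v - w))
    exact pow_eq_zero_iff (two_ne_zero) |>.mp (le_antisymm h2 this)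
  exact sub_eq_zero.mp (eq_zero_of_l2_eq_zero h3)

lemma gram_mulVec_inv (hc : 0 < c) (hA : ∀ v, c * l2 v ^ 2 ≤ l2 (A *ᵥ v) ^ 2) (w : κ → ℝ) :
    (Aᵀ * A) *ᵥ ((Aᵀ * A)⁻¹ *ᵥ w) = w := by
  rw [mulVec_mulVec, Matrix.mul_nonsing_inv _ (isUnit_gram_det hc hA), one_mulVec]

lemma lsq_mulVec (hc : 0 < c) (hA : ∀ v, c * l2 v ^ 2 ≤ l2 (A *ᵥ v) ^ 2) (w : κ → ℝ) :
    lsq A (A *ᵥ w) = w := by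
  rw [lsq, mulVec_mulVec _ Aᵀ, mulVec_mulVec, Matrix.nonsing_inv_mul _ (isUnit_gram_det hc hA),
    one_mulVec]

lemma l2_mulVec_gram_inv (hc : 0 < c) (hA : ∀ v, c * l2 v ^ 2 ≤ l2 (A *ᵥ v) ^ 2) (w : κ → ℝ) :
    l2 (A *ᵥ ((Aᵀ * A)⁻¹ *ᵥ w)) ^ 2 = ((Aᵀ * A)⁻¹ *ᵥ w) ⬝ᵥ w := by
  rw [l2_mulVec_sq, gram_mulVec_inv hc hA]

lemma l2_gram_inv_le (hc : 0 < c) (hA : ∀ v, c * l2 v ^ 2 ≤ l2 (A *ᵥ v) ^ 2) (w : κ → ℝ) :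
    l2 ((Aᵀ * A)⁻¹ *ᵥ w) ≤ c⁻¹ * l2 w := by
  set u := (Aᵀ * A)⁻¹ *ᵥ w with hu
  have h1 : c * l2 u ^ 2 ≤ l2 u * l2 w :=
    (hA u).trans <| (l2_mulVec_gram_inv hc hA w).le.trans <|
      (le_abs_self _).trans (abs_dot_le _ _)
  rcases (l2_nonneg u).eq_or_lt with h | h
  · rw [← h]; exact mul_nonneg (inv_nonneg.mpr hc.le) (l2_nonneg w)
  · rw [le_inv_mul_iff₀ hc]
    refine le_of_mul_le_mul_left ?_ h
    linarith [h1, sq (l2 u), mul_comm (l2 u) (c * l2 u), mul_assoc c (l2 u) (l2 u)]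

/-- The vector A(AᵀA)⁻¹w holds the weights of the observations in the linear functional w of the
least squares coefficients, so its squared length measures the variance of that functional. -/
lemma l2_mulVec_gram_inv_le (hc : 0 < c) (hA : ∀ v, c * l2 v ^ 2 ≤ l2 (A *ᵥ v) ^ 2)
    (w : κ → ℝ) : l2 (A *ᵥ ((Aᵀ * A)⁻¹ *ᵥ w)) ^ 2 ≤ c⁻¹ * l2 w ^ 2 := by
  rw [l2_mulVec_gram_inv hc hA]
  calc _ ≤ l2 ((Aᵀ * A)⁻¹ *ᵥ w) * l2 w := (le_abs_self _).trans (abs_dot_le _ _)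
    _ ≤ c⁻¹ * l2 w * l2 w := by
        gcongr
        · exact l2_nonneg w
        · exact l2_gram_inv_le hc hA w
    _ = _ := by ring

/-- Fitted values are an orthogonal projection of `y`: their squared length is their inner product
with `y`, and Cauchy–Schwarz finishes. -/
lemma l2_mulVec_lsq_le (hc : 0 < c) (hA : ∀ v, c * l2 v ^ 2 ≤ l2 (A *ᵥ v) ^ 2) (y : ι → ℝ) :
    l2 (A *ᵥ lsq A y) ≤ l2 y := by
  have h : l2 (A *ᵥ lsq A y) ^ 2 ≤ l2 (A *ᵥ lsq A y) * l2 y := by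
    have h1 : l2 (A *ᵥ lsq A y) ^ 2 = (A *ᵥ lsq A y) ⬝ᵥ y := by
      rw [lsq, l2_mulVec_gram_inv hc hA, dotProduct_mulVec _ Aᵀ, vecMul_transpose]
    rw [h1]
    exact (le_abs_self _).trans (abs_dot_le _ _)
  rcases (l2_nonneg (A *ᵥ lsq A y)).eq_or_lt with h' | h'
  · rw [← h']; exact l2_nonneg y
  · rw [sq] at h
    exact le_of_mul_le_mul_left h h'

lemma l2_lsq_sq_le (hc : 0 < c) (hA : ∀ v, c * l2 v ^ 2 ≤ l2 (A *ᵥ v) ^ 2) (y : ι → ℝ) :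
    c * l2 (lsq A y) ^ 2 ≤ l2 y ^ 2 :=
  (hA _).trans (pow_le_pow_left₀ (l2_nonneg _) (l2_mulVec_lsq_le hc hA y) 2)

lemma l2_lsq_le (hc : 0 < c) (hA : ∀ v, c * l2 v ^ 2 ≤ l2 (A *ᵥ v) ^ 2) (y : ι → ℝ) :
    l2 (lsq A y) ≤ (√c)⁻¹ * l2 y := by
  rw [le_inv_mul_iff₀ (Real.sqrt_pos.mpr hc)]
  refine le_of_sq_le_sq ?_ (l2_nonneg y)
  rw [mul_pow, Real.sq_sqrt hc.le]
  exact l2_lsq_sq_le hc hA y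

/-- Perturbation of the design matrix in least squares. -/
lemma l2_lsq_sub_lsq_le (hc : 0 < c) (hA : ∀ v, c * l2 v ^ 2 ≤ l2 (A *ᵥ v) ^ 2)
    (hB : ∀ v, c * l2 v ^ 2 ≤ l2 (B *ᵥ v) ^ 2) {d : ℝ} (hd : 0 ≤ d)
    (hBA : ∑ i, ∑ k, (B - A) i k ^ 2 ≤ d ^ 2) (y : ι → ℝ) :
    l2 (lsq B y - lsq A y) ≤ 3 * d / c * l2 y := by
  set u := lsq A y with hu
  -- By the normal equations Bᵀ applied to the residual equals (B - A)ᵀ applied to it, so both terms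
  -- of `key` are linear in B - A. The constant 3 is 2 from the residual, bounded by the triangle
  -- inequality, plus 1 from the fitted part.
  have hnormal : Aᵀ *ᵥ (y - A *ᵥ u) = 0 := by
    rw [mulVec_sub, mulVec_mulVec, hu, lsq, gram_mulVec_inv hc hA, sub_self]
  have key : lsq B y - u = (Bᵀ * B)⁻¹ *ᵥ ((B - A)ᵀ *ᵥ (y - A *ᵥ u)) - lsq B ((B - A) *ᵥ u) := by
    have h1 : (B - A)ᵀ *ᵥ (y - A *ᵥ u) = Bᵀ *ᵥ (y - A *ᵥ u) := by
      rw [transpose_sub, sub_mulVec, hnormal, sub_zero]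
    have h2 : (Bᵀ * B)⁻¹ *ᵥ (Bᵀ *ᵥ (y - A *ᵥ u)) = lsq B (y - A *ᵥ u) := rfl
    have h3 : lsq B y - lsq B (A *ᵥ u) = lsq B (y - A *ᵥ u) := by
      rw [lsq_sub]
    have h4 : lsq B ((B - A) *ᵥ u) = u - lsq B (A *ᵥ u) := by
      rw [sub_mulVec, lsq_sub, lsq_mulVec hc hB]
    rw [h1, h2, ← h3, h4]
    abel
  rw [key]
  have e1 : l2 ((Bᵀ * B)⁻¹ *ᵥ ((B - A)ᵀ *ᵥ (y - A *ᵥ u))) ≤ c⁻¹ * (d * (2 * l2 y)) := by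
    refine (l2_gram_inv_le hc hB _).trans ?_
    gcongr
    refine (l2_vecMul_le _ hd hBA _).trans ?_
    gcongr
    linarith [l2_sub_le y (A *ᵥ u), l2_mulVec_lsq_le hc hA y]
  have e2 : l2 (lsq B ((B - A) *ᵥ u)) ≤ c⁻¹ * (d * l2 y) := by
    calc _ ≤ (√c)⁻¹ * l2 ((B - A) *ᵥ u) := l2_lsq_le hc hB _
      _ ≤ (√c)⁻¹ * (d * ((√c)⁻¹ * l2 y)) := by
          gcongr
          refine (l2_mulVec_le _ hd hBA _).trans ?_
          gcongr
          exact l2_lsq_le hc hA y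
      _ = ((√c) * √c)⁻¹ * (d * l2 y) := by rw [mul_inv]; ring
      _ = _ := by rw [Real.mul_self_sqrt hc.le]
  calc _ ≤ _ := l2_sub_le _ _
    _ ≤ c⁻¹ * (d * (2 * l2 y)) + c⁻¹ * (d * l2 y) := add_le_add e1 e2
    _ = _ := by ring

/-- A generalized inverse of an invertible matrix is the inverse. -/
lemma eq_inv_of_gen_inverse {S G : Matrix κ κ ℝ} (hS : IsUnit S.det) (h : S * G * S = S) :
    G = S⁻¹ := by
  have h1 : S⁻¹ * (S * G * S) * S⁻¹ = S⁻¹ * S * S⁻¹ := by rw [h]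
  rw [Matrix.nonsing_inv_mul _ hS, Matrix.one_mul] at h1
  rw [← h1, Matrix.mul_assoc S G S, ← Matrix.mul_assoc S⁻¹, Matrix.nonsing_inv_mul _ hS,
    Matrix.one_mul, Matrix.mul_assoc, Matrix.mul_nonsing_inv _ hS, Matrix.mul_one]

end LinearAlgebra

end GameMTE

namespace GameMTE

/-! ### Samples with conditionally independent noise -/

section CondNoise

/-- Disintegration of i.i.d. pairs `(z_i, e_i)`: the `e_i` are independent given all the `z_i`. -/
lemma lintegral_pi_compProd {ι 𝒵 : Type*} [Fintype ι] [MeasurableSpace 𝒵] (ν : Measure 𝒵)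
    [IsProbabilityMeasure ν] (κ : Kernel 𝒵 ℝ) [IsMarkovKernel κ]
    {Φ : (ι → 𝒵) × (ι → ℝ) → ℝ≥0∞} (hΦ : Measurable Φ) :
    ∫⁻ x, Φ (fun i => (x i).1, fun i => (x i).2) ∂(Measure.pi fun _ : ι => ν ⊗ₘ κ)
      = ∫⁻ z, ∫⁻ e, Φ (z, e) ∂(Measure.pi fun i => κ (z i)) ∂(Measure.pi fun _ : ι => ν) := by
  -- Each noise term is realized as e = f(z, u) with u uniform and independent of z. The
  -- disintegration then reduces to Tonelli's theorem for a product of ν's and uniform laws.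
  obtain ⟨f, hf, hfκ⟩ := Kernel.exists_measurable_map_eq_unitInterval κ
  have hf1 : ∀ z, Measurable (f z) := fun z => hf.comp (measurable_const.prodMk measurable_id)
  have hg : Measurable (fun q : 𝒵 × unitInterval => (q.1, f q.1 q.2)) :=
    measurable_fst.prodMk hf
  have hjoint : ν ⊗ₘ κ = (ν.prod volume).map (fun q : 𝒵 × unitInterval => (q.1, f q.1 q.2)) := by
    ext s hs
    rw [Measure.compProd_apply hs, Measure.map_apply hg hs, Measure.prod_apply (hg hs)]
    refine lintegral_congr fun z => ?_
    rw [← hfκ z, Measure.map_apply (hf1 z) (measurable_prodMk_left hs)]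
    rfl
  have : ∀ z : 𝒵, IsProbabilityMeasure (κ z) := inferInstance
  have hprob : IsProbabilityMeasure
      ((ν.prod volume).map (fun q : 𝒵 × unitInterval => (q.1, f q.1 q.2))) :=
    Measure.isProbabilityMeasure_map hg.aemeasurable
  rw [hjoint, ← Measure.pi_map_pi (fun _ => hg.aemeasurable)]
  have hΨ : Measurable (fun x : ι → 𝒵 × ℝ => Φ (fun i => (x i).1, fun i => (x i).2)) := by
    fun_prop
  have hg' : Measurable (fun (x : ι → 𝒵 × unitInterval) i => ((x i).1, f (x i).1 (x i).2)) :=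
    measurable_pi_lambda _ fun i => hg.comp (measurable_pi_apply i)
  rw [lintegral_map hΨ hg']
  have hmp := measurePreserving_arrowProdEquivProdArrow 𝒵 unitInterval ι (fun _ => ν)
    (fun _ => (volume : Measure unitInterval))
  have hΘ : Measurable (fun q : (ι → 𝒵) × (ι → unitInterval) =>
      Φ (q.1, fun i => f (q.1 i) (q.2 i))) := by
    apply hΦ.comp
    refine measurable_fst.prodMk (measurable_pi_lambda _ fun i => ?_)
    have hpair : Measurable fun q : (ι → 𝒵) × (ι → unitInterval) => (q.1 i, q.2 i) :=
      ((measurable_pi_apply i).comp measurable_fst).prodMk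
        ((measurable_pi_apply i).comp measurable_snd)
    exact hf.comp hpair
  calc _ = ∫⁻ q, Φ (q.1, fun i => f (q.1 i) (q.2 i))
        ∂((Measure.pi fun _ : ι => ν).prod
          (Measure.pi fun _ : ι => (volume : Measure unitInterval))) := by
        rw [← hmp.map_eq, lintegral_map hΘ hmp.measurable]
        rfl
    _ = _ := by
        rw [lintegral_prod _ hΘ.aemeasurable]
        refine lintegral_congr fun z => ?_
        have : (Measure.pi fun i => κ (z i)) = (Measure.pi fun _ : ι =>
            (volume : Measure unitInterval)).map (fun u i => f (z i) (u i)) := by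
          rw [Measure.pi_map_pi (fun i => (hf1 (z i)).aemeasurable)]
          simp_rw [hfκ]
        have hzm : Measurable fun e => Φ (z, e) := hΦ.comp measurable_prodMk_left
        have hfm : Measurable fun (u : ι → unitInterval) i => f (z i) (u i) :=
          measurable_pi_lambda _ fun i => (hf1 _).comp (measurable_pi_apply i)
        rw [this, lintegral_map hzm hfm]

/-- Centred law with fourth moment at most `C`. -/
structure CenteredFourth (P : Measure ℝ) (C : ℝ) : Prop where
  integrable : Integrable (fun e => e ^ 4) P
  mean : ∫ e, e ∂P = 0
  moment : ∫ e, e ^ 4 ∂P ≤ C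

/-- Truncation at level `M`. -/
def trunc (M e : ℝ) : ℝ := if |e| ≤ M then e else 0

lemma measurable_trunc (M : ℝ) : Measurable (trunc M) :=
  Measurable.ite (measurableSet_le (by fun_prop) measurable_const) measurable_id measurable_const

lemma abs_trunc_le {M : ℝ} (hM : 0 ≤ M) (e : ℝ) : |trunc M e| ≤ M := by
  unfold trunc; split_ifs with h <;> simp [h, hM]

lemma trunc_sq_le (M e : ℝ) : trunc M e ^ 2 ≤ 1 + e ^ 4 := by
  have : e ^ 2 ≤ 1 + e ^ 4 := by nlinarith [sq_nonneg (e ^ 2 - 1 / 2), sq_nonneg e]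
  unfold trunc; split_ifs with h
  · exact this
  · nlinarith [sq_nonneg (e ^ 2)]

/-- Beyond the truncation level |e| / M exceeds 1, so its cube can be inserted as a factor. A fourth
moment thus buys a tail of order M⁻³. -/
lemma abs_sub_trunc_le {M : ℝ} (hM : 0 < M) (e : ℝ) : |e - trunc M e| ≤ e ^ 4 / M ^ 3 := by
  unfold trunc; split_ifs with h
  · simp; positivity
  · rw [sub_zero, le_div_iff₀ (by positivity)]
    push Not at h
    calc |e| * M ^ 3 ≤ |e| * |e| ^ 3 := by gcongr
      _ = |e| ^ 4 := by ring
      _ = e ^ 4 := by rw [← abs_pow]; exact abs_of_nonneg (by positivity)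

namespace CenteredFourth

variable {P : Measure ℝ} [IsProbabilityMeasure P] {C : ℝ}

lemma integrable_sq (h : CenteredFourth P C) : Integrable (fun e => e ^ 2) P := by
  refine ((integrable_const 1).add h.integrable).mono' (by fun_prop) (ae_of_all _ fun e => ?_)
  simp only [Pi.add_apply, Real.norm_eq_abs, abs_pow, sq_abs]
  nlinarith [sq_nonneg (e ^ 2 - 1 / 2), sq_nonneg e]

lemma integrable_id (h : CenteredFourth P C) : Integrable (fun e => e) P := by
  refine ((integrable_const 1).add h.integrable_sq).mono' (by fun_prop) (ae_of_all _ fun e => ?_)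
  simp only [Pi.add_apply, Real.norm_eq_abs]
  nlinarith [sq_nonneg (|e| - 1), sq_abs e]

lemma integral_sq_le (h : CenteredFourth P C) : ∫ e, e ^ 2 ∂P ≤ 1 + C := by
  calc ∫ e, e ^ 2 ∂P ≤ ∫ e, (1 + e ^ 4) ∂P := by
        refine integral_mono h.integrable_sq ((integrable_const 1).add h.integrable) fun e => ?_
        simp only
        nlinarith [sq_nonneg (e ^ 2 - 1 / 2), sq_nonneg e]
    _ ≤ _ := by
        rw [integral_add (integrable_const 1) h.integrable]
        simpa using h.moment

lemma nonneg (h : CenteredFourth P C) : 0 ≤ C :=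
  (integral_nonneg fun e => by positivity).trans h.moment

lemma integrable_trunc (M : ℝ) (h : CenteredFourth P C) : Integrable (trunc M) P := by
  refine h.integrable_id.mono (measurable_trunc M).aestronglyMeasurable (ae_of_all _ fun e => ?_)
  unfold trunc; split_ifs <;> simp

/-- Truncation destroys centring. As the full variable has mean zero, the bias is minus the mean of
the discarded tail. -/
lemma abs_integral_trunc_le (h : CenteredFourth P C) {M : ℝ} (hM : 0 < M) :
    |∫ e, trunc M e ∂P| ≤ C / M ^ 3 := by
  have h1 : ∫ e, trunc M e ∂P = - ∫ e, (e - trunc M e) ∂P := by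
    rw [integral_sub h.integrable_id (h.integrable_trunc M), h.mean]; ring
  rw [h1, abs_neg]
  calc _ ≤ ∫ e, |e - trunc M e| ∂P := abs_integral_le_integral_abs
    _ ≤ ∫ e, e ^ 4 / M ^ 3 ∂P := by
        refine integral_mono (h.integrable_id.sub (h.integrable_trunc M)).abs
          (h.integrable.div_const _) fun e => abs_sub_trunc_le hM e
    _ ≤ C / M ^ 3 := by
        rw [integral_div]
        gcongr
        exact h.moment

/-- Bound on the moment generating function of a truncated variable. -/
lemma integral_exp_trunc_le (h : CenteredFourth P C) {M a : ℝ} (hM : 0 < M) (ha : |a| * M ≤ 1) :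
    ∫ e, Real.exp (a * trunc M e) ∂P ≤ Real.exp (a ^ 2 * (1 + C) + |a| * (C / M ^ 3)) := by
  -- This is exp y ≤ 1 + y + y² for |y| ≤ 1, a range secured by `ha`. After integration the linear
  -- term leaves only the truncation bias.
  have hb : ∀ e, Real.exp (a * trunc M e) ≤ 1 + a * trunc M e + a ^ 2 * (1 + e ^ 4) := by
    intro e
    have h1 : |a * trunc M e| ≤ 1 := by
      rw [abs_mul]
      exact (mul_le_mul_of_nonneg_left (abs_trunc_le hM.le e) (abs_nonneg a)).trans ha
    have h2 := (abs_le.mp (Real.abs_exp_sub_one_sub_id_le h1)).2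
    have h3 : (a * trunc M e) ^ 2 ≤ a ^ 2 * (1 + e ^ 4) := by
      rw [mul_pow]; exact mul_le_mul_of_nonneg_left (trunc_sq_le M e) (sq_nonneg a)
    linarith
  have hi1 : Integrable (fun e => 1 + a * trunc M e) P :=
    (integrable_const 1).add ((h.integrable_trunc M).const_mul a)
  have hi2 : Integrable (fun e => a ^ 2 * (1 + e ^ 4)) P :=
    ((integrable_const 1).add h.integrable).const_mul _
  calc _ ≤ ∫ e, (1 + a * trunc M e + a ^ 2 * (1 + e ^ 4)) ∂P := by
        refine integral_mono_of_nonneg (ae_of_all _ fun e => (Real.exp_pos _).le)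
          (hi1.add hi2) (ae_of_all _ hb)
    _ = 1 + a * (∫ e, trunc M e ∂P) + a ^ 2 * (1 + ∫ e, e ^ 4 ∂P) := by
        rw [integral_add hi1 hi2, integral_add (integrable_const 1)
          ((h.integrable_trunc M).const_mul a), integral_const_mul, integral_const_mul,
          integral_add (integrable_const 1) h.integrable]
        simp
    _ ≤ 1 + |a| * (C / M ^ 3) + a ^ 2 * (1 + C) := by
        have : a * (∫ e, trunc M e ∂P) ≤ |a| * (C / M ^ 3) :=
          (le_abs_self _).trans (by
            rw [abs_mul]
            exact mul_le_mul_of_nonneg_left (h.abs_integral_trunc_le hM) (abs_nonneg a))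
        have h2 := h.moment
        gcongr
    _ ≤ _ := by
        have := Real.add_one_le_exp (a ^ 2 * (1 + C) + |a| * (C / M ^ 3))
        linarith

end CenteredFourth

/-- Independent (over `i`) pairs with the law `ν ⊗ κ`, where the conditional laws `κ z` are centred
and have fourth moments at most `C`. -/
structure NoisySample {Ω 𝒵 : Type*} [MeasurableSpace Ω] [MeasurableSpace 𝒵] (μ : Measure Ω)
    (z : ℕ → Ω → 𝒵) (e : ℕ → Ω → ℝ) (ν : Measure 𝒵) (κ : Kernel 𝒵 ℝ) (C : ℝ) : Prop where
  aemeas : ∀ i, AEMeasurable (fun ω => (z i ω, e i ω)) μ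
  law : ∀ n : ℕ, μ.map (fun ω (i : Fin n) => (z i ω, e i ω)) = Measure.pi fun _ => ν ⊗ₘ κ
  noise : ∀ᵐ x ∂ν, CenteredFourth (κ x) C

namespace NoisySample

variable {Ω 𝒵 : Type*} [MeasurableSpace Ω] [MeasurableSpace 𝒵] {μ : Measure Ω}
  {z : ℕ → Ω → 𝒵} {e : ℕ → Ω → ℝ} {ν : Measure 𝒵} [IsProbabilityMeasure ν] {κ : Kernel 𝒵 ℝ}
  [IsMarkovKernel κ] {C : ℝ} {n : ℕ}

lemma aemeas_pi (hS : NoisySample μ z e ν κ C) (n : ℕ) :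
    AEMeasurable (fun ω (i : Fin n) => (z i ω, e i ω)) μ :=
  aemeasurable_pi_lambda _ fun i => hS.aemeas i

lemma lintegral_eq (hS : NoisySample μ z e ν κ C)
    {Φ : (Fin n → 𝒵) × (Fin n → ℝ) → ℝ≥0∞} (hΦ : Measurable Φ) :
    ∫⁻ ω, Φ (fun i => z i ω, fun i => e i ω) ∂μ
      = ∫⁻ x, ∫⁻ y, Φ (x, y) ∂(Measure.pi fun i => κ (x i)) ∂(Measure.pi fun _ => ν) := by
  rw [← lintegral_pi_compProd ν κ hΦ, ← hS.law n, lintegral_map' _ (hS.aemeas_pi n)]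
  have : Measurable (fun x : Fin n → 𝒵 × ℝ => Φ (fun i => (x i).1, fun i => (x i).2)) := by
    fun_prop
  exact this.aemeasurable

lemma ae_noise (hS : NoisySample μ z e ν κ C) :
    ∀ᵐ x ∂(Measure.pi fun _ : Fin n => ν), ∀ i, CenteredFourth (κ (x i)) C := by
  rw [ae_all_iff]
  intro i
  exact (Measure.quasiMeasurePreserving_eval (fun _ : Fin n => ν) i).ae hS.noise

lemma nonneg (hS : NoisySample μ z e ν κ C) : 0 ≤ C := by
  obtain ⟨x, hx⟩ := hS.noise.exists
  exact hx.nonneg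

/-- Exponential inequality for sums of truncated noise with coefficients depending on the design. -/
lemma measure_sum_trunc_le (hS : NoisySample μ z e ν κ C) {a : (Fin n → 𝒵) → Fin n → ℝ}
    (ha : ∀ i, Measurable fun x => a x i) {A B M l t : ℝ} (hA : 0 ≤ A) (hM : 0 < M) (hl : 0 < l)
    (hlA : l * A * M ≤ 1) :
    μ {ω | (∀ i, |a (fun i => z i ω) i| ≤ A) ∧ ∑ i, a (fun i => z i ω) i ^ 2 ≤ B ∧
        t < ∑ i, a (fun i => z i ω) i * trunc M (e i ω)}
      ≤ ENNReal.ofReal (Real.exp (-(l * t) + (l ^ 2 * B * (1 + C) + l * (n * A) * (C / M ^ 3)))) := by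
  set G : Set (Fin n → 𝒵) := {x | (∀ i, |a x i| ≤ A) ∧ ∑ i, a x i ^ 2 ≤ B} with hG
  have hGm : MeasurableSet G := by
    rw [hG, ofPred_and, ofPred_forall]
    refine (MeasurableSet.iInter fun i => measurableSet_le (ha i).abs measurable_const).inter
      (measurableSet_le (Finset.measurable_sum _ fun i _ => (ha i).pow_const 2) measurable_const)
  -- Integrand of the exponential Markov inequality. The restriction to `G` involves the designs
  -- alone, so it is constant conditionally on them, and conditional independence turns the
  -- expectation into a product of one-variable moment generating functions.
  set Φ : (Fin n → 𝒵) × (Fin n → ℝ) → ℝ≥0∞ := fun q => G.indicator (fun x =>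
    ENNReal.ofReal (Real.exp (-(l * t)) * ∏ i, Real.exp (l * a x i * trunc M (q.2 i)))) q.1 with hΦ
  have hprodm : Measurable fun q : (Fin n → 𝒵) × (Fin n → ℝ) =>
      ENNReal.ofReal (Real.exp (-(l * t)) * ∏ i, Real.exp (l * a q.1 i * trunc M (q.2 i))) := by
    refine ENNReal.measurable_ofReal.comp (measurable_const.mul
      (Finset.measurable_prod _ fun i _ => Real.measurable_exp.comp ?_))
    exact (((ha i).comp measurable_fst).const_mul l).mul
      ((measurable_trunc M).comp ((measurable_pi_apply i).comp measurable_snd))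
  have hΦm : Measurable Φ := by
    have : Φ = (Prod.fst ⁻¹' G).indicator (fun q : (Fin n → 𝒵) × (Fin n → ℝ) =>
        ENNReal.ofReal (Real.exp (-(l * t)) * ∏ i, Real.exp (l * a q.1 i * trunc M (q.2 i)))) := by
      funext q
      simp only [hΦ, indicator, mem_preimage]
    rw [this]
    exact hprodm.indicator (measurable_fst hGm)
  set s : Set Ω := {ω | (∀ i, |a (fun i => z i ω) i| ≤ A) ∧ ∑ i, a (fun i => z i ω) i ^ 2 ≤ B ∧
        t < ∑ i, a (fun i => z i ω) i * trunc M (e i ω)} with hs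
  have hone : ∀ ω ∈ s, 1 ≤ Φ (fun i => z i ω, fun i => e i ω) := by
    intro ω hω
    obtain ⟨h1, h2, h3⟩ := hω
    have : (fun i : Fin n => z i ω) ∈ G := ⟨h1, h2⟩
    simp only [hΦ, indicator_of_mem this]
    rw [ENNReal.one_le_ofReal, ← Real.exp_sum, ← Real.exp_add, Real.one_le_exp_iff]
    have : ∑ i, l * a (fun i => z i ω) i * trunc M (e i ω)
        = l * ∑ i, a (fun i => z i ω) i * trunc M (e i ω) := by
      rw [Finset.mul_sum]; simp only [mul_assoc]
    rw [this]
    have := mul_lt_mul_of_pos_left h3 hl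
    linarith
  have hC : ∀ x : Fin n → 𝒵, (∀ i, CenteredFourth (κ (x i)) C) → x ∈ G →
      ∫⁻ y, ENNReal.ofReal (Real.exp (-(l * t)) * ∏ i, Real.exp (l * a x i * trunc M (y i)))
        ∂(Measure.pi fun i => κ (x i)) ≤ ENNReal.ofReal
          (Real.exp (-(l * t) + (l ^ 2 * B * (1 + C) + l * (n * A) * (C / M ^ 3)))) := by
    intro x hx hxG
    have hint : ∀ i, Integrable (fun y => Real.exp (l * a x i * trunc M y)) (κ (x i)) := by
      intro i
      refine Integrable.of_bound (C := Real.exp 1) (Real.measurable_exp.comp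
        ((measurable_trunc M).const_mul _)).aestronglyMeasurable (ae_of_all _ fun y => ?_)
      rw [Real.norm_eq_abs, abs_of_pos (Real.exp_pos _)]
      refine Real.exp_le_exp.mpr ((le_abs_self _).trans ?_)
      rw [abs_mul, abs_mul, abs_of_pos hl]
      refine le_trans ?_ hlA
      gcongr
      · exact hxG.1 i
      · exact abs_trunc_le hM.le y
    rw [← ofReal_integral_eq_lintegral_ofReal
      ((Integrable.fintype_prod_dep hint).const_mul _)
      (ae_of_all _ fun y => by positivity), integral_const_mul,
      integral_fintype_prod_eq_prod (fun i y => Real.exp (l * a x i * trunc M y)), Real.exp_add]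
    refine ENNReal.ofReal_le_ofReal (mul_le_mul_of_nonneg_left ?_ (Real.exp_pos _).le)
    calc _ ≤ ∏ i : Fin n, Real.exp ((l * a x i) ^ 2 * (1 + C) + |l * a x i| * (C / M ^ 3)) := by
          refine Finset.prod_le_prod (fun i _ => integral_nonneg fun y => (Real.exp_pos _).le)
            fun i _ => (hx i).integral_exp_trunc_le hM ?_
          refine le_trans ?_ hlA
          rw [abs_mul, abs_of_pos hl]
          gcongr
          exact hxG.1 i
      _ = Real.exp (∑ i : Fin n, ((l * a x i) ^ 2 * (1 + C) + |l * a x i| * (C / M ^ 3))) :=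
          (Real.exp_sum _ _).symm
      _ ≤ _ := by
          apply Real.exp_le_exp.mpr
          rw [Finset.sum_add_distrib, ← Finset.sum_mul, ← Finset.sum_mul]
          have hC0 := hS.nonneg
          have h1 : ∑ i : Fin n, (l * a x i) ^ 2 ≤ l ^ 2 * B := by
            simp_rw [mul_pow]
            rw [← Finset.mul_sum]
            exact mul_le_mul_of_nonneg_left hxG.2 (sq_nonneg l)
          have h2 : ∑ i : Fin n, |l * a x i| ≤ l * (n * A) := by
            calc _ ≤ ∑ _i : Fin n, l * A := Finset.sum_le_sum fun i _ => by
                  rw [abs_mul, abs_of_pos hl]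
                  exact mul_le_mul_of_nonneg_left (hxG.1 i) hl.le
              _ = _ := by simp; ring
          exact add_le_add (mul_le_mul_of_nonneg_right h1 (by linarith))
            (mul_le_mul_of_nonneg_right h2 (by positivity))
  calc μ s ≤ ∫⁻ ω, Φ (fun i => z i ω, fun i => e i ω) ∂μ := by
        have hae : AEMeasurable (fun ω => Φ (fun i => z i ω, fun i => e i ω)) μ := by
          have : Measurable (fun x : Fin n → 𝒵 × ℝ => Φ (fun i => (x i).1, fun i => (x i).2)) := by
            fun_prop
          exact this.comp_aemeasurable (hS.aemeas_pi n)
        calc μ s ≤ μ {ω | 1 ≤ Φ (fun i => z i ω, fun i => e i ω)} := measure_mono hone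
          _ ≤ _ := by simpa using mul_meas_ge_le_lintegral₀ hae 1
    _ = _ := hS.lintegral_eq hΦm
    _ ≤ ∫⁻ x : Fin n → 𝒵, ENNReal.ofReal
          (Real.exp (-(l * t) + (l ^ 2 * B * (1 + C) + l * (n * A) * (C / M ^ 3))))
          ∂(Measure.pi fun _ => ν) := by
        refine lintegral_mono_ae ?_
        filter_upwards [hS.ae_noise (n := n)] with x hx
        by_cases hxG : x ∈ G
        · simp only [hΦ, indicator_of_mem hxG]
          exact hC x hx hxG
        · simp [hΦ, indicator_of_notMem hxG]
    _ = _ := by simp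

/-- Second moment of a noise sum with coefficients depending on the design. -/
lemma lintegral_sum_sq_le (hS : NoisySample μ z e ν κ C) {a : (Fin n → 𝒵) → Fin n → ℝ}
    (ha : ∀ i, Measurable fun x => a x i) :
    ∫⁻ ω, ENNReal.ofReal ((∑ i, a (fun i => z i ω) i * e i ω) ^ 2) ∂μ
      ≤ ENNReal.ofReal (1 + C) *
        ∫⁻ ω, ENNReal.ofReal (∑ i, a (fun i => z i ω) i ^ 2) ∂μ := by
  have hm1 : Measurable fun q : (Fin n → 𝒵) × (Fin n → ℝ) =>
      ENNReal.ofReal ((∑ i, a q.1 i * q.2 i) ^ 2) := by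
    refine ENNReal.measurable_ofReal.comp (Measurable.pow_const
      (Finset.measurable_sum _ fun i _ => ?_) 2)
    exact ((ha i).comp measurable_fst).mul ((measurable_pi_apply i).comp measurable_snd)
  have hm2 : Measurable fun q : (Fin n → 𝒵) × (Fin n → ℝ) =>
      ENNReal.ofReal (∑ i, a q.1 i ^ 2) := by
    refine ENNReal.measurable_ofReal.comp (Finset.measurable_sum _ fun i _ => ?_)
    exact ((ha i).comp measurable_fst).pow_const 2
  rw [hS.lintegral_eq hm1, hS.lintegral_eq hm2, ← lintegral_const_mul _ (by
    have : Measurable fun x => ENNReal.ofReal (∑ i, a x i ^ 2) :=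
      ENNReal.measurable_ofReal.comp (Finset.measurable_sum _ fun i _ => (ha i).pow_const 2)
    simpa using this)]
  refine lintegral_mono_ae ?_
  filter_upwards [hS.ae_noise (n := n)] with x hx
  simp only [lintegral_const, measure_univ, mul_one]
  set P := Measure.pi fun i => κ (x i)
  set Y : Fin n → (Fin n → ℝ) → ℝ := fun i y => a x i * y i with hY
  have hev : ∀ i : Fin n, MeasurePreserving (Function.eval i) P (κ (x i)) :=
    fun i => measurePreserving_eval _ i
  have hid : ∀ i, MemLp (fun e : ℝ => e) 2 (κ (x i)) := fun i =>
    (memLp_two_iff_integrable_sq (by fun_prop)).mpr (hx i).integrable_sq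
  have hLp : ∀ i, MemLp (Y i) 2 P := fun i =>
    ((hid i).comp_measurePreserving (hev i)).const_mul (a x i)
  have hmean : ∀ i, ∫ y, Y i y ∂P = 0 := by
    intro i
    have : ∫ y, y i ∂P = ∫ e, e ∂(κ (x i)) := by
      rw [← (hev i).map_eq, integral_map (hev i).measurable.aemeasurable (by fun_prop)]
    simp only [hY, integral_const_mul, this, (hx i).mean, mul_zero]
  -- With the designs fixed the weighted noise terms are independent and centred, so all cross terms
  -- of the square vanish.
  have hind : iIndepFun Y P := by
    have := iIndepFun_pi (μ := fun i => κ (x i)) (X := fun i (y : ℝ) => a x i * y)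
      (fun i => by fun_prop)
    exact this
  have hvar : Var[∑ i, Y i; P] = ∑ i, Var[Y i; P] :=
    IndepFun.variance_sum (fun i _ => hLp i) fun i _ j _ hij => hind.indepFun hij
  have hint : Integrable (fun y => (∑ i, Y i y) ^ 2) P := by
    have h := (memLp_finsetSum' Finset.univ fun i _ => hLp i).integrable_sq
    simpa using h
  have hsum0 : ∫ y, (∑ i, Y i) y ∂P = 0 := by
    simp only [Finset.sum_apply]
    rw [integral_finsetSum _ fun i _ => (hLp i).integrable one_le_two]
    simp [hmean]
  have hsq : ∫ y, (∑ i, Y i y) ^ 2 ∂P = ∑ i, a x i ^ 2 * ∫ e, e ^ 2 ∂(κ (x i)) := by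
    have h1 : Var[∑ i, Y i; P] = ∫ y, (∑ i, Y i y) ^ 2 ∂P := by
      rw [variance_eq_integral (memLp_finsetSum' Finset.univ fun i _ => hLp i).aemeasurable, hsum0]
      simp
    rw [← h1, hvar]
    refine Finset.sum_congr rfl fun i _ => ?_
    rw [variance_eq_integral (hLp i).aemeasurable, hmean i]
    simp only [hY, sub_zero, mul_pow, integral_const_mul]
    congr 1
    rw [← (hev i).map_eq, integral_map (hev i).measurable.aemeasurable (by fun_prop)]
  rw [← ofReal_integral_eq_lintegral_ofReal hint (ae_of_all _ fun y => sq_nonneg _), hsq,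
    ← ENNReal.ofReal_mul' (Finset.sum_nonneg fun i _ => sq_nonneg _)]
  apply ENNReal.ofReal_le_ofReal
  rw [mul_comm, Finset.sum_mul]
  exact Finset.sum_le_sum fun i _ =>
    mul_le_mul_of_nonneg_left (hx i).integral_sq_le (sq_nonneg _)

end NoisySample

end CondNoise

end GameMTE

namespace GameMTE

/-! ### Calculus on the closed unit square -/

section Square

lemma uniqueDiffOn_unitSquare : UniqueDiffOn ℝ unitSquare :=
  uniqueDiffOn_Icc_zero_one.prod uniqueDiffOn_Icc_zero_one

lemma isCompact_unitSquare : IsCompact unitSquare := isCompact_Icc.prod isCompact_Icc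

lemma measurableSet_unitSquare : MeasurableSet unitSquare := isCompact_unitSquare.measurableSet

variable {f : ℝ × ℝ → ℝ}

lemma hasDerivWithinAt_slice1 {k : ℕ} (hk : 1 ≤ k) (hf : ContDiffOn ℝ k f unitSquare) {p : ℝ × ℝ}
    (hp : p ∈ unitSquare) : HasDerivWithinAt (fun t => f (t, p.2))
      (fderivWithin ℝ f unitSquare p (1, 0)) (Icc 0 1) p.1 := by
  have h1 : HasFDerivWithinAt f (fderivWithin ℝ f unitSquare p) unitSquare p :=
    ((hf.differentiableOn (by exact_mod_cast (Nat.one_le_iff_ne_zero.mp hk))) p hp).hasFDerivWithinAt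
  have h2 : HasDerivWithinAt (fun t : ℝ => (t, p.2)) ((1, 0) : ℝ × ℝ) (Icc 0 1) p.1 :=
    (hasDerivWithinAt_id _ _).prodMk (hasDerivWithinAt_const _ _ _)
  exact HasFDerivWithinAt.comp_hasDerivWithinAt (t := unitSquare) p.1 h1 h2 fun t ht => ⟨ht, hp.2⟩

lemma hasDerivWithinAt_slice2 {k : ℕ} (hk : 1 ≤ k) (hf : ContDiffOn ℝ k f unitSquare) {p : ℝ × ℝ}
    (hp : p ∈ unitSquare) : HasDerivWithinAt (fun t => f (p.1, t))
      (fderivWithin ℝ f unitSquare p (0, 1)) (Icc 0 1) p.2 := by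
  have h1 : HasFDerivWithinAt f (fderivWithin ℝ f unitSquare p) unitSquare p :=
    ((hf.differentiableOn (by exact_mod_cast (Nat.one_le_iff_ne_zero.mp hk))) p hp).hasFDerivWithinAt
  have h2 : HasDerivWithinAt (fun t : ℝ => (p.1, t)) ((0, 1) : ℝ × ℝ) (Icc 0 1) p.2 :=
    (hasDerivWithinAt_const _ _ _).prodMk (hasDerivWithinAt_id _ _)
  exact HasFDerivWithinAt.comp_hasDerivWithinAt (t := unitSquare) p.2 h1 h2 fun t ht => ⟨hp.1, ht⟩

/-- Identifying the coordinatewise one-sided derivative with a directional Fréchet derivative within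
the square lets `pd1` inherit smoothness of one order less. -/
lemma pd1_eq {k : ℕ} (hk : 1 ≤ k) (hf : ContDiffOn ℝ k f unitSquare) {p : ℝ × ℝ}
    (hp : p ∈ unitSquare) : pd1 f p = fderivWithin ℝ f unitSquare p (1, 0) :=
  (hasDerivWithinAt_slice1 hk hf hp).derivWithin (uniqueDiffOn_Icc_zero_one _ hp.1)

lemma pd2_eq {k : ℕ} (hk : 1 ≤ k) (hf : ContDiffOn ℝ k f unitSquare) {p : ℝ × ℝ}
    (hp : p ∈ unitSquare) : pd2 f p = fderivWithin ℝ f unitSquare p (0, 1) :=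
  (hasDerivWithinAt_slice2 hk hf hp).derivWithin (uniqueDiffOn_Icc_zero_one _ hp.2)

lemma hasDerivWithinAt_pd1 {k : ℕ} (hk : 1 ≤ k) (hf : ContDiffOn ℝ k f unitSquare) {p : ℝ × ℝ}
    (hp : p ∈ unitSquare) : HasDerivWithinAt (fun t => f (t, p.2)) (pd1 f p) (Icc 0 1) p.1 := by
  rw [pd1_eq hk hf hp]; exact hasDerivWithinAt_slice1 hk hf hp

lemma hasDerivWithinAt_pd2 {k : ℕ} (hk : 1 ≤ k) (hf : ContDiffOn ℝ k f unitSquare) {p : ℝ × ℝ}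
    (hp : p ∈ unitSquare) : HasDerivWithinAt (fun t => f (p.1, t)) (pd2 f p) (Icc 0 1) p.2 := by
  rw [pd2_eq hk hf hp]; exact hasDerivWithinAt_slice2 hk hf hp

lemma contDiffOn_fderivWithin_apply {k : ℕ} (hf : ContDiffOn ℝ (k + 1 : ℕ) f unitSquare)
    (v : ℝ × ℝ) : ContDiffOn ℝ k (fun p => fderivWithin ℝ f unitSquare p v) unitSquare :=
  (hf.fderivWithin (m := (k : ℕ)) uniqueDiffOn_unitSquare (by norm_cast)).clm_apply contDiffOn_const

lemma contDiffOn_pd1 {k : ℕ} (hf : ContDiffOn ℝ (k + 1 : ℕ) f unitSquare) :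
    ContDiffOn ℝ k (pd1 f) unitSquare :=
  (contDiffOn_fderivWithin_apply hf (1, 0)).congr fun _ hp => pd1_eq (by omega) hf hp

lemma contDiffOn_pd2 {k : ℕ} (hf : ContDiffOn ℝ (k + 1 : ℕ) f unitSquare) :
    ContDiffOn ℝ k (pd2 f) unitSquare :=
  (contDiffOn_fderivWithin_apply hf (0, 1)).congr fun _ hp => pd2_eq (by omega) hf hp

/-- Fundamental theorem of calculus with one-sided derivatives at the ends of `[0,1]`. -/
lemma integral_of_hasDerivWithinAt {u u' : ℝ → ℝ}
    (h : ∀ x ∈ Icc (0 : ℝ) 1, HasDerivWithinAt u (u' x) (Icc 0 1) x)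
    (hc : ContinuousOn u' (Icc 0 1)) {p : ℝ} (hp : p ∈ Icc (0 : ℝ) 1) :
    ∫ x in Icc 0 p, u' x = u p - u 0 := by
  have hsub : Icc 0 p ⊆ Icc (0 : ℝ) 1 := Icc_subset_Icc_right hp.2
  rw [integral_Icc_eq_integral_Ioc, ← intervalIntegral.integral_of_le hp.1]
  refine intervalIntegral.integral_eq_sub_of_hasDerivAt_of_le hp.1
    (fun x hx => ((h x (hsub hx)).continuousWithinAt).mono hsub) (fun x hx => ?_) ?_
  · have hx1 : x < 1 := hx.2.trans_le hp.2
    exact (h x ⟨hx.1.le, hx1.le⟩).hasDerivAt (Icc_mem_nhds hx.1 hx1)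
  · exact (hc.mono (by rw [uIcc_of_le hp.1]; exact hsub)).intervalIntegrable

/-- Integral of the mixed second derivative over a rectangle with a vertex at the origin. -/
lemma integral_pd11 (hf : ContDiffOn ℝ 2 f unitSquare) {p : ℝ × ℝ} (hp : p ∈ unitSquare) :
    ∫ v in Icc 0 p.1 ×ˢ Icc 0 p.2, pd (1, 1) f v
      = f p - f (p.1, 0) - (f (0, p.2) - f (0, 0)) := by
  have hf2 : ContDiffOn ℝ ((1 + 1 : ℕ)) f unitSquare := by exact_mod_cast hf
  have h2 := contDiffOn_pd2 hf2
  have h12 : ContDiffOn ℝ (0 : ℕ) (pd1 (pd2 f)) unitSquare := contDiffOn_pd1 (by exact_mod_cast h2)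
  have hc : ContinuousOn (pd1 (pd2 f)) unitSquare := h12.continuousOn
  have hsub : Icc 0 p.1 ×ˢ Icc 0 p.2 ⊆ unitSquare :=
    prod_mono (Icc_subset_Icc_right hp.1.2) (Icc_subset_Icc_right hp.2.2)
  have hint : IntegrableOn (pd1 (pd2 f)) (Icc 0 p.1 ×ˢ Icc 0 p.2)
      ((volume : Measure ℝ).prod volume) := by
    have := (hc.integrableOn_compact (μ := volume) isCompact_unitSquare).mono_set hsub
    rwa [Measure.volume_eq_prod] at this
  change ∫ v in Icc 0 p.1 ×ˢ Icc 0 p.2, pd1 (pd2 f) v ∂volume = _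
  -- In `pd (1, 1)` the derivative in the first variable is taken last, hence it is undone first:
  -- after the swap the first variable is the inner one.
  rw [Measure.volume_eq_prod, ← setIntegral_prod_swap, setIntegral_prod]
  swap
  · rw [IntegrableOn, ← Measure.prod_restrict] at hint ⊢
    exact hint.swap
  have hslice2 : ∀ a ∈ Icc (0 : ℝ) 1, ContinuousOn (fun y => pd2 f (a, y)) (Icc 0 1) :=
    fun a ha => h2.continuousOn.comp (by fun_prop) fun y hy => ⟨ha, hy⟩
  calc _ = ∫ y in Icc 0 p.2, (pd2 f (p.1, y) - pd2 f (0, y)) := by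
        refine setIntegral_congr_fun measurableSet_Icc fun y hy => ?_
        have hy' : y ∈ Icc (0 : ℝ) 1 := Icc_subset_Icc_right hp.2.2 hy
        exact integral_of_hasDerivWithinAt (u := fun x => pd2 f (x, y))
          (u' := fun x => pd1 (pd2 f) (x, y))
          (fun x hx => hasDerivWithinAt_pd1 le_rfl (by exact_mod_cast h2) (p := (x, y)) ⟨hx, hy'⟩)
          (hc.comp (by fun_prop) fun x hx => ⟨hx, hy'⟩) hp.1
    _ = (f (p.1, p.2) - f (p.1, 0)) - (f (0, p.2) - f (0, 0)) := by
        have hi : ∀ a ∈ Icc (0 : ℝ) 1, IntegrableOn (fun y => pd2 f (a, y)) (Icc 0 p.2) :=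
          fun a ha => ((hslice2 a ha).mono (Icc_subset_Icc_right hp.2.2)).integrableOn_compact
            isCompact_Icc
        have h0 : (0 : ℝ) ∈ Icc (0 : ℝ) 1 := by simp
        rw [integral_sub (hi _ hp.1) (hi _ h0)]
        congr 1
        · exact integral_of_hasDerivWithinAt (u := fun y => f (p.1, y))
            (fun y hy => hasDerivWithinAt_pd2 (by omega) hf2 (p := (p.1, y)) ⟨hp.1, hy⟩)
            (hslice2 _ hp.1) hp.2
        · exact integral_of_hasDerivWithinAt (u := fun y => f (0, y))
            (fun y hy => hasDerivWithinAt_pd2 (by omega) hf2 (p := (0, y)) ⟨h0, hy⟩)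
            (hslice2 _ h0) hp.2

/-- Finite measures on the plane that agree on lower left quadrants are equal. -/
lemma measure_eq_of_quadrants {P Q : Measure (ℝ × ℝ)} [IsFiniteMeasure P] [IsFiniteMeasure Q]
    (h : ∀ a b : ℝ, P (Iic a ×ˢ Iic b) = Q (Iic a ×ˢ Iic b)) : P = Q := by
  have hspan : IsCountablySpanning (range (Iic : ℝ → Set ℝ)) := by
    refine ⟨fun n => Iic (n : ℝ), fun n => mem_range_self _, ?_⟩
    exact eq_univ_of_forall fun x => mem_iUnion.mpr (exists_nat_ge x)
  have hgen : (Prod.instMeasurableSpace : MeasurableSpace (ℝ × ℝ)) = MeasurableSpace.generateFrom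
      (image2 (· ×ˢ ·) (range (Iic : ℝ → Set ℝ)) (range (Iic : ℝ → Set ℝ))) := by
    refine Eq.trans ?_ (generateFrom_prod_eq hspan hspan)
    rw [← borel_eq_generateFrom_Iic, ← (BorelSpace.measurable_eq (α := ℝ))]
  refine Measure.ext_of_generateFrom_of_iUnion _ (fun n : ℕ => Iic (n : ℝ) ×ˢ Iic (n : ℝ)) hgen
    (isPiSystem_Iic.prod isPiSystem_Iic) ?_ (fun n => ⟨_, mem_range_self _, _, mem_range_self _, rfl⟩)
    (fun n => measure_ne_top _ _) ?_
  · refine eq_univ_of_forall fun x => mem_iUnion.mpr ?_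
    obtain ⟨n, hn⟩ := exists_nat_ge (max x.1 x.2)
    exact ⟨n, (le_max_left _ _).trans hn, (le_max_right _ _).trans hn⟩
  · rintro _ ⟨_, ⟨a, rfl⟩, _, ⟨b, rfl⟩, rfl⟩
    exact h a b

end Square

/-! ### Copulas with densities -/

namespace IsCopulaWithDensity

variable {H h : ℝ × ℝ → ℝ}

lemma integrableOn_rect (hc : IsCopulaWithDensity H h) {s : Set (ℝ × ℝ)} (hs : s ⊆ unitSquare) :
    IntegrableOn h s := hc.integrable.mono_set hs

lemma nonneg_H (hc : IsCopulaWithDensity H h) {p : ℝ × ℝ} (hp : p ∈ unitSquare) : 0 ≤ H p := by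
  rw [hc.eq_integral p hp]
  refine setIntegral_nonneg (measurableSet_Icc.prod measurableSet_Icc) fun v hv => hc.nonneg v ?_
  exact prod_mono (Icc_subset_Icc_right hp.1.2) (Icc_subset_Icc_right hp.2.2) hv

lemma H_sub_fst (hc : IsCopulaWithDensity H h) {a a' b : ℝ} (ha : 0 ≤ a) (haa : a ≤ a')
    (ha' : a' ≤ 1) (hb : b ∈ Icc (0 : ℝ) 1) :
    H (a', b) - H (a, b) = ∫ v in Ioc a a' ×ˢ Icc 0 b, h v := by
  rw [hc.eq_integral (a', b) ⟨⟨ha.trans haa, ha'⟩, hb⟩,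
    hc.eq_integral (a, b) ⟨⟨ha, haa.trans ha'⟩, hb⟩, ← Icc_union_Ioc_eq_Icc ha haa, union_prod,
    setIntegral_union (disjoint_prod.mpr (Or.inl ?_)) (measurableSet_Ioc.prod measurableSet_Icc)
      (hc.integrableOn_rect ?_) (hc.integrableOn_rect ?_)]
  · ring
  · exact (Set.disjoint_left.mpr fun x hx hx' => not_lt.mpr hx.2 hx'.1)
  · exact prod_mono (Icc_subset_Icc_right (haa.trans ha')) (Icc_subset_Icc_right hb.2)
  · exact prod_mono (Ioc_subset_Icc_self.trans (Icc_subset_Icc ha ha')) (Icc_subset_Icc_right hb.2)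

lemma H_sub_snd (hc : IsCopulaWithDensity H h) {a b b' : ℝ} (ha : a ∈ Icc (0 : ℝ) 1) (hb : 0 ≤ b)
    (hbb : b ≤ b') (hb' : b' ≤ 1) :
    H (a, b') - H (a, b) = ∫ v in Icc 0 a ×ˢ Ioc b b', h v := by
  rw [hc.eq_integral (a, b') ⟨ha, ⟨hb.trans hbb, hb'⟩⟩,
    hc.eq_integral (a, b) ⟨ha, ⟨hb, hbb.trans hb'⟩⟩, ← Icc_union_Ioc_eq_Icc hb hbb, prod_union,
    setIntegral_union (disjoint_prod.mpr (Or.inr ?_)) (measurableSet_Icc.prod measurableSet_Ioc)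
      (hc.integrableOn_rect ?_) (hc.integrableOn_rect ?_)]
  · ring
  · exact (Set.disjoint_left.mpr fun x hx hx' => not_lt.mpr hx.2 hx'.1)
  · exact prod_mono (Icc_subset_Icc_right ha.2) (Icc_subset_Icc_right (hbb.trans hb'))
  · exact prod_mono (Icc_subset_Icc_right ha.2) (Ioc_subset_Icc_self.trans (Icc_subset_Icc hb hb'))

/-- The increment is the mass of a strip of height b. Extending the strip to height 1 gives mass a'
- a, because the margins are uniform. This and its analogue in the second variable make every copula
1-Lipschitz in each argument. -/
lemma H_sub_fst_mem (hc : IsCopulaWithDensity H h) {a a' b : ℝ} (ha : 0 ≤ a) (haa : a ≤ a')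
    (ha' : a' ≤ 1) (hb : b ∈ Icc (0 : ℝ) 1) :
    H (a', b) - H (a, b) ∈ Icc 0 (a' - a) := by
  have hsub : Ioc a a' ×ˢ Icc 0 (1 : ℝ) ⊆ unitSquare :=
    prod_mono (Ioc_subset_Icc_self.trans (Icc_subset_Icc ha ha')) le_rfl
  have hsub' : Ioc a a' ×ˢ Icc 0 b ⊆ Ioc a a' ×ˢ Icc 0 (1 : ℝ) :=
    prod_mono le_rfl (Icc_subset_Icc_right hb.2)
  have h1 := hc.H_sub_fst ha haa ha' (b := 1) (by simp)
  rw [hc.margin_one a' ⟨ha.trans haa, ha'⟩, hc.margin_one a ⟨ha, haa.trans ha'⟩] at h1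
  rw [h1, hc.H_sub_fst ha haa ha' hb]
  refine ⟨setIntegral_nonneg (measurableSet_Ioc.prod measurableSet_Icc) fun v hv =>
    hc.nonneg v (hsub (hsub' hv)), ?_⟩
  refine setIntegral_mono_set (hc.integrableOn_rect hsub) ?_ (LE.le.eventuallyLE hsub')
  exact (ae_restrict_iff' (measurableSet_Ioc.prod measurableSet_Icc)).mpr
    (ae_of_all _ fun v hv => hc.nonneg v (hsub hv))

lemma H_sub_snd_mem (hc : IsCopulaWithDensity H h) {a b b' : ℝ} (ha : a ∈ Icc (0 : ℝ) 1)
    (hb : 0 ≤ b) (hbb : b ≤ b') (hb' : b' ≤ 1) :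
    H (a, b') - H (a, b) ∈ Icc 0 (b' - b) := by
  have hsub : Icc 0 (1 : ℝ) ×ˢ Ioc b b' ⊆ unitSquare :=
    prod_mono le_rfl (Ioc_subset_Icc_self.trans (Icc_subset_Icc hb hb'))
  have hsub' : Icc 0 a ×ˢ Ioc b b' ⊆ Icc 0 (1 : ℝ) ×ˢ Ioc b b' :=
    prod_mono (Icc_subset_Icc_right ha.2) le_rfl
  have h1 := hc.H_sub_snd (a := 1) (by simp) hb hbb hb'
  rw [hc.margin_two b' ⟨hb.trans hbb, hb'⟩, hc.margin_two b ⟨hb, hbb.trans hb'⟩] at h1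
  rw [h1, hc.H_sub_snd ha hb hbb hb']
  refine ⟨setIntegral_nonneg (measurableSet_Icc.prod measurableSet_Ioc) fun v hv =>
    hc.nonneg v (hsub (hsub' hv)), ?_⟩
  refine setIntegral_mono_set (hc.integrableOn_rect hsub) ?_ (LE.le.eventuallyLE hsub')
  exact (ae_restrict_iff' (measurableSet_Icc.prod measurableSet_Ioc)).mpr
    (ae_of_all _ fun v hv => hc.nonneg v (hsub hv))

lemma abs_H_sub_fst_le (hc : IsCopulaWithDensity H h) {a a' b : ℝ} (ha : a ∈ Icc (0 : ℝ) 1)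
    (ha' : a' ∈ Icc (0 : ℝ) 1) (hb : b ∈ Icc (0 : ℝ) 1) : |H (a, b) - H (a', b)| ≤ |a - a'| := by
  rcases le_total a a' with haa | haa
  · have := hc.H_sub_fst_mem ha.1 haa ha'.2 hb
    rw [abs_sub_comm, abs_sub_comm a, abs_of_nonneg this.1, abs_of_nonneg (sub_nonneg.mpr haa)]
    exact this.2
  · have := hc.H_sub_fst_mem ha'.1 haa ha.2 hb
    rw [abs_of_nonneg this.1, abs_of_nonneg (sub_nonneg.mpr haa)]
    exact this.2

lemma abs_H_sub_snd_le (hc : IsCopulaWithDensity H h) {a b b' : ℝ} (ha : a ∈ Icc (0 : ℝ) 1)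
    (hb : b ∈ Icc (0 : ℝ) 1) (hb' : b' ∈ Icc (0 : ℝ) 1) : |H (a, b) - H (a, b')| ≤ |b - b'| := by
  rcases le_total b b' with hbb | hbb
  · have := hc.H_sub_snd_mem ha hb.1 hbb hb'.2
    rw [abs_sub_comm, abs_sub_comm b, abs_of_nonneg this.1, abs_of_nonneg (sub_nonneg.mpr hbb)]
    exact this.2
  · have := hc.H_sub_snd_mem ha hb'.1 hbb hb.2
    rw [abs_of_nonneg this.1, abs_of_nonneg (sub_nonneg.mpr hbb)]
    exact this.2

lemma abs_H_sub_le (hc : IsCopulaWithDensity H h) {p p' : ℝ × ℝ} (hp : p ∈ unitSquare)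
    (hp' : p' ∈ unitSquare) : |H p - H p'| ≤ |p.1 - p'.1| + |p.2 - p'.2| := by
  calc |H p - H p'| = |(H (p.1, p.2) - H (p'.1, p.2)) + (H (p'.1, p.2) - H (p'.1, p'.2))| := by
        simp
    _ ≤ _ := (abs_add_le _ _).trans (add_le_add (hc.abs_H_sub_fst_le hp.1 hp'.1 hp.2)
        (hc.abs_H_sub_snd_le hp'.1 hp.2 hp'.2))

/-- Continuity serves measurability of the choice probabilities, since nothing is assumed about `H`
outside the square. -/
lemma continuousOn_H (hc : IsCopulaWithDensity H h) : ContinuousOn H unitSquare := by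
  have : LipschitzOnWith 2 H unitSquare := LipschitzOnWith.of_dist_le_mul fun p hp p' hp' => by
    rw [Real.dist_eq]
    refine (hc.abs_H_sub_le hp hp').trans ?_
    have h1 : |p.1 - p'.1| ≤ dist p p' := by rw [Prod.dist_eq, Real.dist_eq]; exact le_max_left _ _
    have h2 : |p.2 - p'.2| ≤ dist p p' := by
      rw [Prod.dist_eq, Real.dist_eq p.2]; exact le_max_right _ _
    push_cast
    linarith
  exact this.continuousOn

lemma fst_sub_H_mem (hc : IsCopulaWithDensity H h) {p : ℝ × ℝ} (hp : p ∈ unitSquare) :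
    p.1 - H p ∈ Icc (0 : ℝ) 1 := by
  have h1 := (hc.H_sub_snd_mem hp.1 hp.2.1 hp.2.2 le_rfl).1
  rw [hc.margin_one _ hp.1] at h1
  exact ⟨h1, by linarith [hc.nonneg_H hp, hp.1.2]⟩

end IsCopulaWithDensity

/-- Splitting of a strip into two rectangles. -/
lemma setIntegral_strip_split {p : ℝ × ℝ} (hp : p ∈ unitSquare) {φ : ℝ × ℝ → ℝ}
    (hφ : IntegrableOn φ unitSquare) :
    ∫ v in Icc 0 p.1 ×ˢ Icc 0 1, φ v
      = (∫ v in Icc 0 p.1 ×ˢ Icc 0 p.2, φ v) + ∫ v in Icc 0 p.1 ×ˢ Icc p.2 1, φ v := by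
  -- The two closed rectangles overlap in a horizontal segment, which is null.
  have hae : (Icc 0 p.1 ×ˢ Icc p.2 1 : Set (ℝ × ℝ)) =ᵐ[volume] Icc 0 p.1 ×ˢ Ioc p.2 1 :=
    Measure.set_prod_ae_eq (ae_eq_refl _) Ioc_ae_eq_Icc.symm
  rw [setIntegral_congr_set hae, ← Icc_union_Ioc_eq_Icc hp.2.1 hp.2.2, prod_union,
    setIntegral_union (disjoint_prod.mpr (Or.inr ?_)) (measurableSet_Icc.prod measurableSet_Ioc)
      (hφ.mono_set ?_) (hφ.mono_set ?_)]
  · exact (Set.disjoint_left.mpr fun x hx hx' => not_lt.mpr hx.2 hx'.1)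
  · exact prod_mono (Icc_subset_Icc_right hp.1.2) (Icc_subset_Icc_right hp.2.2)
  · exact prod_mono (Icc_subset_Icc_right hp.1.2)
      (Ioc_subset_Icc_self.trans (Icc_subset_Icc_left hp.2.1))

/-- The rectangle is the set of values of V that lead to action (1,0) when (P₁⁰, P₂¹) = p, and its
mass is the corresponding choice probability. -/
lemma IsCopulaWithDensity.integral_upper {H h : ℝ × ℝ → ℝ} (hc : IsCopulaWithDensity H h)
    {p : ℝ × ℝ} (hp : p ∈ unitSquare) : ∫ v in Icc 0 p.1 ×ˢ Icc p.2 1, h v = p.1 - H p := by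
  have h1 := setIntegral_strip_split hp hc.integrable
  have h2 := hc.eq_integral (p.1, 1) ⟨hp.1, by simp⟩
  rw [hc.margin_one _ hp.1] at h2
  simp only at h2
  rw [← h2, ← hc.eq_integral p hp] at h1
  linarith

end GameMTE

namespace GameMTE

/-! ### General facts on conditional means, independence and measurability -/

/-- Copulas, bases, g and the trimming function are regular only on compact sets and arbitrary
elsewhere. Their compositions are still measurable because the inner maps never leave these sets. -/
lemma measurable_comp_of_continuousOn {α β : Type*} [MeasurableSpace α] [TopologicalSpace β]
    [MeasurableSpace β] [OpensMeasurableSpace β] {f : β → ℝ} {s : Set β} (hf : ContinuousOn f s)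
    {φ : α → β} (hφ : Measurable φ) (hs : ∀ a, φ a ∈ s) : Measurable fun a => f (φ a) := by
  have h1 : Measurable (s.domRestrict f) := (continuousOn_iff_continuous_domRestrict.mp hf).measurable
  exact h1.comp (hφ.subtype_mk (h := hs))

lemma setIntegral_preimage_eq_condDistrib {α β : Type*} [MeasurableSpace α] [MeasurableSpace β]
    {μ : Measure α} [IsFiniteMeasure μ] {X : α → β} (hX : Measurable X) {Y : α → ℝ}
    (hY : Integrable Y μ) {B : Set β} (hB : MeasurableSet B) :
    ∫ a in X ⁻¹' B, Y a ∂μ = ∫ x in B, (∫ y, y ∂(condDistrib Y X μ x)) ∂(μ.map X) := by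
  rw [← setIntegral_condExp (m := MeasurableSpace.comap X inferInstance) hX.comap_le hY ⟨B, hB, rfl⟩,
    setIntegral_map hB _ hX.aemeasurable]
  · refine setIntegral_congr_ae (hX hB) ?_
    filter_upwards [condExp_ae_eq_integral_condDistrib' hX hY] with a ha _ using ha
  · exact AEStronglyMeasurable.integral_condDistrib_map (f := fun q : β × ℝ => q.2)
      hY.aemeasurable measurable_snd.aestronglyMeasurable

/-- Fubini's theorem for independent random variables. -/
lemma integral_of_indepFun {α β γ : Type*} [MeasurableSpace α] [MeasurableSpace β]
    [MeasurableSpace γ] {μ : Measure α} [IsProbabilityMeasure μ] {A : α → β} {W : α → γ}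
    (hA : Measurable A) (hW : Measurable W) (hind : IndepFun A W μ) {φ : β × γ → ℝ}
    (hφ : Measurable φ) (hint : Integrable (fun a => φ (A a, W a)) μ) :
    ∫ a, φ (A a, W a) ∂μ = ∫ a', (∫ a, φ (A a, W a') ∂μ) ∂μ := by
  have hlaw := (indepFun_iff_map_prod_eq_prod_map_map hA.aemeasurable hW.aemeasurable).mp hind
  have h1 : Integrable φ ((μ.map A).prod (μ.map W)) := by
    rw [← hlaw, integrable_map_measure hφ.aestronglyMeasurable (hA.prodMk hW).aemeasurable]
    exact hint
  have := Measure.isProbabilityMeasure_map (μ := μ) hA.aemeasurable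
  have := Measure.isProbabilityMeasure_map (μ := μ) hW.aemeasurable
  have hsm : StronglyMeasurable fun w => ∫ a, φ (a, w) ∂(μ.map A) :=
    hφ.stronglyMeasurable.integral_prod_left'
  calc ∫ a, φ (A a, W a) ∂μ = ∫ q, φ q ∂((μ.map A).prod (μ.map W)) := by
        rw [← hlaw, integral_map (hA.prodMk hW).aemeasurable hφ.aestronglyMeasurable]
    _ = ∫ w, ∫ a, φ (a, w) ∂(μ.map A) ∂(μ.map W) := integral_prod_symm _ h1
    _ = ∫ a', (∫ a, φ (a, W a') ∂(μ.map A)) ∂μ :=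
        integral_map hW.aemeasurable hsm.aestronglyMeasurable
    _ = _ := by
        refine integral_congr_ae (ae_of_all _ fun a' => ?_)
        exact integral_map hA.aemeasurable
          (hφ.comp (measurable_id.prodMk measurable_const)).aestronglyMeasurable

/-- Sublevel sets of a continuous distribution function. -/
lemma sublevel_trichotomy {F : ℝ → ℝ} (hF : Continuous F) (hmono : Monotone F)
    (h0 : Tendsto F atBot (𝓝 0)) (h1 : Tendsto F atTop (𝓝 1)) (v : ℝ) :
    ((∀ a, v < F a) ∧ v ≤ 0) ∨ ((∀ a, F a ≤ v) ∧ 1 ≤ v) ∨ ∃ a, F a = v ∧ ∀ x, F x ≤ v ↔ x ≤ a := by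
  by_cases hlow : ∀ a, v < F a
  · exact Or.inl ⟨hlow, ge_of_tendsto h0 (Eventually.of_forall fun a => (hlow a).le)⟩
  by_cases hup : ∀ a, F a ≤ v
  · exact Or.inr (Or.inl ⟨hup, le_of_tendsto h1 (Eventually.of_forall hup)⟩)
  push Not at hlow hup
  obtain ⟨l, hl⟩ := hlow
  obtain ⟨u, hu⟩ := hup
  have hbdd : BddAbove {x | F x ≤ v} :=
    ⟨u, fun x hx => le_of_not_ge fun hux => absurd (hmono hux) (not_le.mpr (lt_of_le_of_lt hx hu))⟩
  have hcl : IsClosed {x | F x ≤ v} := isClosed_le hF continuous_const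
  have hmem : F (sSup {x | F x ≤ v}) ≤ v := hcl.csSup_mem ⟨l, hl⟩ hbdd
  have hiff : ∀ x, F x ≤ v ↔ x ≤ sSup {x | F x ≤ v} := fun x =>
    ⟨fun hx => le_csSup hbdd hx, fun hx => (hmono hx).trans hmem⟩
  refine Or.inr (Or.inr ⟨sSup {x | F x ≤ v}, le_antisymm hmem ?_, hiff⟩)
  -- To the right of the supremum F exceeds v, so continuity forces F at the supremum to equal v and
  -- not merely to be at most v.
  refine ge_of_tendsto (hF.continuousAt.tendsto.mono_left
    (nhdsWithin_le_nhds (s := Ioi (sSup {x | F x ≤ v})))) ?_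
  filter_upwards [self_mem_nhdsWithin] with x hx
  exact (lt_of_not_ge fun hle => absurd ((hiff x).mp hle) (not_le.mpr hx)).le

namespace Model

variable {Ω₀ : Type*} [MeasurableSpace Ω₀] {dX dZ : ℕ} {M : Model Ω₀ dX dZ} {μ₀ : Measure Ω₀}

/-! ### Distribution of `V` and measurability -/

lemma F_mem (M : Model Ω₀ dX dZ) (μ₀ : Measure Ω₀) (j : Fin 2) (a : ℝ) :
    M.F μ₀ j a ∈ Icc (0 : ℝ) 1 := ⟨cdf_nonneg _ _, cdf_le_one _ _⟩

lemma P10_mem (M : Model Ω₀ dX dZ) (μ₀ : Measure Ω₀) (θ : Param dX dZ) (w : Fin 2 → WVec dX dZ) :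
    M.P10 μ₀ θ w ∈ unitSquare := ⟨F_mem _ _ _ _, F_mem _ _ _ _⟩

lemma F_mono (M : Model Ω₀ dX dZ) (μ₀ : Measure Ω₀) (j : Fin 2) : Monotone (M.F μ₀ j) :=
  monotone_cdf _

lemma measurable_F (M : Model Ω₀ dX dZ) (μ₀ : Measure Ω₀) (j : Fin 2) : Measurable (M.F μ₀ j) :=
  (M.F_mono μ₀ j).measurable

lemma isClosed_unitSquare : IsClosed unitSquare := isCompact_unitSquare.isClosed

lemma S10_subset (M : Model Ω₀ dX dZ) (μ₀ : Measure Ω₀) [IsProbabilityMeasure μ₀]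
    (hP : Measurable fun ω => M.P10 μ₀ M.θ (M.W ω)) : M.S10 μ₀ ⊆ unitSquare := by
  refine Measure.support_subset_of_isClosed isClosed_unitSquare ?_
  rw [mem_ae_iff, Measure.map_apply hP measurableSet_unitSquare.compl]
  have : (fun ω => M.P10 μ₀ M.θ (M.W ω)) ⁻¹' unitSquareᶜ = ∅ :=
    eq_empty_of_forall_notMem fun ω hω => hω (M.P10_mem μ₀ _ _)
  rw [this, measure_empty]

lemma rect_subset {p : ℝ × ℝ} (hp : p ∈ unitSquare) : Icc 0 p.1 ×ˢ Icc p.2 1 ⊆ unitSquare :=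
  prod_mono (Icc_subset_Icc_right hp.1.2) (Icc_subset_Icc_left hp.2.1)

section

variable [IsProbabilityMeasure μ₀] (hgame : M.ParametricGame μ₀)

include hgame

lemma ParametricGame.meas_ε' (j : Fin 2) : Measurable fun ω => M.ε ω j :=
  (measurable_pi_apply j).comp hgame.meas_ε

lemma ParametricGame.F_eq (j : Fin 2) (a : ℝ) : M.F μ₀ j a = μ₀.real {ω | M.ε ω j ≤ a} := by
  have := Measure.isProbabilityMeasure_map (μ := μ₀) (hgame.meas_ε' j).aemeasurable
  rw [F, cdf_eq_real, measureReal_def, Measure.map_apply (hgame.meas_ε' j) measurableSet_Iic]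
  rfl

lemma ParametricGame.meas_V : Measurable (M.V μ₀) :=
  ((M.measurable_F μ₀ 0).comp (hgame.meas_ε' 0)).prodMk
    ((M.measurable_F μ₀ 1).comp (hgame.meas_ε' 1))

lemma ParametricGame.copula_true : IsCopulaWithDensity (M.H M.θ.2.1) (M.h M.θ.2.1) :=
  hgame.copula _ hgame.ρ_mem

lemma ParametricGame.sublevel (j : Fin 2) (v : ℝ) :
    ((∀ a, v < M.F μ₀ j a) ∧ v ≤ 0) ∨ ((∀ a, M.F μ₀ j a ≤ v) ∧ 1 ≤ v) ∨
      ∃ a, M.F μ₀ j a = v ∧ ∀ x, M.F μ₀ j x ≤ v ↔ x ≤ a :=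
  sublevel_trichotomy (hgame.cdf_cont j) (M.F_mono μ₀ j) (tendsto_cdf_atBot _)
    (tendsto_cdf_atTop _) v

/-- `V` has density `h` on the unit square. -/
lemma ParametricGame.map_V : μ₀.map (M.V μ₀)
    = (volume.restrict unitSquare).withDensity fun v => ENNReal.ofReal (M.h M.θ.2.1 v) := by
  set H := M.H M.θ.2.1
  set h := M.h M.θ.2.1
  have hc : IsCopulaWithDensity H h := hgame.copula_true
  have hQ : ∀ s, MeasurableSet s →
      ((volume.restrict unitSquare).withDensity fun v => ENNReal.ofReal (h v)) s
        = ENNReal.ofReal (∫ v in s ∩ unitSquare, h v) := by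
    intro s hs
    rw [withDensity_apply _ hs, Measure.restrict_restrict hs,
      ofReal_integral_eq_lintegral_ofReal (hc.integrableOn_rect inter_subset_right)]
    exact (ae_restrict_iff' (hs.inter measurableSet_unitSquare)).mpr
      (ae_of_all _ fun v hv => hc.nonneg v hv.2)
  have hfin : IsFiniteMeasure
      ((volume.restrict unitSquare).withDensity fun v => ENNReal.ofReal (h v)) := by
    constructor
    rw [hQ _ MeasurableSet.univ]
    exact ENNReal.ofReal_lt_top
  have := Measure.isProbabilityMeasure_map (μ := μ₀) hgame.meas_V.aemeasurable
  refine measure_eq_of_quadrants fun v₁ v₂ => ?_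
  rw [hQ _ (measurableSet_Iic.prod measurableSet_Iic),
    Measure.map_apply hgame.meas_V (measurableSet_Iic.prod measurableSet_Iic),
    ← ofReal_measureReal]
  congr 1
  have hpre : M.V μ₀ ⁻¹' (Iic v₁ ×ˢ Iic v₂)
      = {ω | M.F μ₀ 0 (M.ε ω 0) ≤ v₁ ∧ M.F μ₀ 1 (M.ε ω 1) ≤ v₂} := rfl
  have hset : (Iic v₁ ×ˢ Iic v₂) ∩ unitSquare = (Iic v₁ ∩ Icc 0 1) ×ˢ (Iic v₂ ∩ Icc 0 1) := by
    rw [unitSquare, prod_inter_prod]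
  rw [hpre, hset]
  have hneg : ∀ v : ℝ, v ≤ 0 → volume (Iic v ∩ Icc (0 : ℝ) 1) = 0 := by
    intro v hv
    refine measure_mono_null (t := {0}) (fun x hx => ?_) (by simp)
    exact le_antisymm (hx.1.trans hv) hx.2.1
  have hone : ∀ v : ℝ, 1 ≤ v → Iic v ∩ Icc (0 : ℝ) 1 = Icc 0 1 := fun v hv =>
    inter_eq_right.mpr fun x hx => hx.2.trans hv
  have hmid : ∀ v : ℝ, v ≤ 1 → Iic v ∩ Icc (0 : ℝ) 1 = Icc 0 v := fun v hv => by
    ext x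
    exact ⟨fun hx => ⟨hx.2.1, hx.1⟩, fun hx => ⟨hx.2, hx.1, hx.2.trans hv⟩⟩
  have h1 : (1 : ℝ) ∈ Icc (0 : ℝ) 1 := by simp
  -- In each coordinate the event F(ε) ≤ v is empty, certain, or of the form ε ≤ a with F(a) = v.
  -- Empty events correspond to null parts of the square, the copula margins settle the cases with a
  -- certain event, and `joint_cdf` the case of two genuine thresholds.
  rcases hgame.sublevel 0 v₁ with ⟨ha, hv⟩ | ha
  · have e1 : {ω | M.F μ₀ 0 (M.ε ω 0) ≤ v₁ ∧ M.F μ₀ 1 (M.ε ω 1) ≤ v₂} = ∅ :=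
      eq_empty_of_forall_notMem fun ω hω => not_le.mpr (ha _) hω.1
    rw [e1, measureReal_empty, setIntegral_measure_zero]
    rw [Measure.volume_eq_prod, Measure.prod_prod, hneg _ hv, zero_mul]
  rcases hgame.sublevel 1 v₂ with ⟨hb, hv⟩ | hb
  · have e1 : {ω | M.F μ₀ 0 (M.ε ω 0) ≤ v₁ ∧ M.F μ₀ 1 (M.ε ω 1) ≤ v₂} = ∅ :=
      eq_empty_of_forall_notMem fun ω hω => not_le.mpr (hb _) hω.2
    rw [e1, measureReal_empty, setIntegral_measure_zero]
    rw [Measure.volume_eq_prod, Measure.prod_prod, hneg _ hv, mul_zero]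
  rcases ha with ⟨ha, hv₁⟩ | ⟨a, rfl, ha⟩ <;> rcases hb with ⟨hb, hv₂⟩ | ⟨b, rfl, hb⟩
  · simp only [ha, hb, hone _ hv₁, hone _ hv₂, and_self]
    rw [← hc.eq_integral (1, 1) ⟨h1, h1⟩, hc.margin_one 1 h1]
    simp
  · simp only [ha, hb, hone _ hv₁, hmid _ (M.F_mem μ₀ 1 b).2, true_and]
    rw [← hc.eq_integral (1, M.F μ₀ 1 b) ⟨h1, M.F_mem μ₀ 1 b⟩, hc.margin_two _ (M.F_mem μ₀ 1 b),
      hgame.F_eq]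
  · simp only [ha, hb, hone _ hv₂, hmid _ (M.F_mem μ₀ 0 a).2, and_true]
    rw [← hc.eq_integral (M.F μ₀ 0 a, 1) ⟨M.F_mem μ₀ 0 a, h1⟩, hc.margin_one _ (M.F_mem μ₀ 0 a),
      hgame.F_eq]
  · simp only [ha, hb, hmid _ (M.F_mem μ₀ 0 a).2, hmid _ (M.F_mem μ₀ 1 b).2]
    rw [← hc.eq_integral (M.F μ₀ 0 a, M.F μ₀ 1 b) ⟨M.F_mem μ₀ 0 a, M.F_mem μ₀ 1 b⟩,
      hgame.joint_cdf]

lemma ParametricGame.meas_h : AEMeasurable (fun v => ENNReal.ofReal (M.h M.θ.2.1 v))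
    (volume.restrict unitSquare) :=
  hgame.copula_true.integrable.aemeasurable.ennreal_ofReal

/-- Integrals with respect to the law of `V`. -/
lemma ParametricGame.setIntegral_map_V {s : Set (ℝ × ℝ)} (hs : MeasurableSet s)
    (hsub : s ⊆ unitSquare) (φ : ℝ × ℝ → ℝ) :
    ∫ v in s, φ v ∂(μ₀.map (M.V μ₀)) = ∫ v in s, φ v * M.h M.θ.2.1 v := by
  rw [hgame.map_V, setIntegral_withDensity_eq_setIntegral_toReal_smul₀ _
    (ae_of_all _ fun _ => ENNReal.ofReal_lt_top) _ hs, Measure.restrict_restrict hs,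
    inter_eq_left.mpr hsub]
  · refine setIntegral_congr_fun hs fun v hv => ?_
    simp only [smul_eq_mul]
    rw [ENNReal.toReal_ofReal (hgame.copula_true.nonneg v (hsub hv)), mul_comm]
  · exact hgame.meas_h.restrict

lemma ParametricGame.integrable_meanU_mul (hlin : M.LinearOutcome μ₀) :
    IntegrableOn (fun v => M.meanU μ₀ v * M.h M.θ.2.1 v) unitSquare := by
  have h1 : Integrable (M.meanU μ₀) (μ₀.map (M.V μ₀)) :=
    Integrable.integral_condDistrib_map (f := fun q : (ℝ × ℝ) × ℝ => q.2)
      (hlin.meas_U 0 true false).aemeasurable <| (integrable_map_measure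
        measurable_snd.aestronglyMeasurable (hgame.meas_V.prodMk
          (hlin.meas_U 0 true false)).aemeasurable).mpr hlin.integrable_U
  rw [hgame.map_V, integrable_withDensity_iff_integrable_smul₀' hgame.meas_h
    (ae_of_all _ fun _ => ENNReal.ofReal_lt_top)] at h1
  refine h1.congr ((ae_restrict_iff' measurableSet_unitSquare).mpr (ae_of_all _ fun v hv => ?_))
  simp only [smul_eq_mul]
  rw [ENNReal.toReal_ofReal (hgame.copula_true.nonneg v hv), mul_comm]

/-- This gives g its meaning: it is the unnormalized mean of U on the event of V that leads to
action (1,0). -/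
lemma ParametricGame.setIntegral_U_rect (hlin : M.LinearOutcome μ₀) {p : ℝ × ℝ}
    (hp : p ∈ unitSquare) :
    ∫ ω in M.V μ₀ ⁻¹' (Icc 0 p.1 ×ˢ Icc p.2 1), M.U 0 true false ω ∂μ₀ = M.g10 μ₀ p := by
  have hm : MeasurableSet (Icc 0 p.1 ×ˢ Icc p.2 1) := measurableSet_Icc.prod measurableSet_Icc
  rw [setIntegral_preimage_eq_condDistrib hgame.meas_V hlin.integrable_U hm,
    hgame.setIntegral_map_V hm (rect_subset hp)]
  rfl

lemma ParametricGame.measure_rect {p : ℝ × ℝ} (hp : p ∈ unitSquare) :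
    μ₀.real (M.V μ₀ ⁻¹' (Icc 0 p.1 ×ˢ Icc p.2 1)) = p.1 - M.H M.θ.2.1 p := by
  have hm : MeasurableSet (Icc 0 p.1 ×ˢ Icc p.2 1) := measurableSet_Icc.prod measurableSet_Icc
  rw [← map_measureReal_apply hgame.meas_V hm, ← setIntegral_one_eq_measureReal,
    hgame.setIntegral_map_V hm (rect_subset hp)]
  simp only [one_mul]
  exact hgame.copula_true.integral_upper hp

/-- The event of action `(1,0)` for best responses with thresholds `a` and `a'`. -/
def actionSet (M : Model Ω₀ dX dZ) (a a' : ℝ) : Set Ω₀ := {ω | M.ε ω 0 ≤ a ∧ a' < M.ε ω 1}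

lemma ParametricGame.measurableSet_actionSet (a a' : ℝ) : MeasurableSet (M.actionSet a a') :=
  (measurableSet_le (hgame.meas_ε' 0) measurable_const).inter
    (measurableSet_lt measurable_const (hgame.meas_ε' 1))

lemma ParametricGame.measure_actionSet (a a' : ℝ) :
    μ₀.real (M.actionSet a a') = M.F μ₀ 0 a - M.H M.θ.2.1 (M.F μ₀ 0 a, M.F μ₀ 1 a') := by
  rw [← hgame.joint_cdf, hgame.F_eq 0 a]
  have : {ω | M.ε ω 0 ≤ a} = M.actionSet a a' ∪ {ω | M.ε ω 0 ≤ a ∧ M.ε ω 1 ≤ a'} := by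
    ext ω
    simp only [actionSet, mem_union, mem_ofPred_eq]
    rcases le_or_gt (M.ε ω 1) a' with h | h
    · simp [h, not_lt.mpr h]
    · simp [h, not_le.mpr h]
  rw [this, measureReal_union]
  · ring
  · exact Set.disjoint_left.mpr fun ω h1 h2 => not_lt.mpr h2.2 h1.2
  · exact (measurableSet_le (hgame.meas_ε' 0) measurable_const).inter
      (measurableSet_le (hgame.meas_ε' 1) measurable_const)

/-- The marginal distribution functions may have flat pieces, so the threshold event for ε can be
strictly smaller than the rectangle event for V. It is contained in it and has the same probability,
hence they agree almost surely. -/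
lemma ParametricGame.setIntegral_actionSet (hlin : M.LinearOutcome μ₀) (a a' : ℝ) :
    ∫ ω in M.actionSet a a', M.U 0 true false ω ∂μ₀ = M.g10 μ₀ (M.F μ₀ 0 a, M.F μ₀ 1 a') := by
  have hp : (M.F μ₀ 0 a, M.F μ₀ 1 a') ∈ unitSquare := ⟨M.F_mem μ₀ 0 a, M.F_mem μ₀ 1 a'⟩
  rw [← hgame.setIntegral_U_rect hlin hp]
  refine setIntegral_congr_set (ae_eq_of_subset_of_measure_ge ?_ ?_
    (hgame.measurableSet_actionSet a a').nullMeasurableSet (measure_ne_top _ _))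
  · rintro ω ⟨h1, h2⟩
    exact ⟨⟨(M.F_mem μ₀ 0 _).1, M.F_mono μ₀ 0 h1⟩, ⟨M.F_mono μ₀ 1 h2.le, (M.F_mem μ₀ 1 _).2⟩⟩
  · have := (hgame.measure_rect hp).trans (hgame.measure_actionSet a a').symm
    rw [measureReal_def, measureReal_def, ENNReal.toReal_eq_toReal_iff'
      (measure_ne_top _ _) (measure_ne_top _ _)] at this
    exact this.le

/-- The action `(1,0)` is a.s. determined by the two thresholds. -/
lemma ParametricGame.action_ae : ∀ᵐ ω ∂μ₀, (M.D ω 0 = true ∧ M.D ω 1 = false) ↔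
    M.ε ω 0 ≤ M.W ω 0 ⬝ᵥ M.θ.1.1 ∧
      M.W ω 1 ⬝ᵥ M.θ.1.1 + M.η (M.W ω 1 ⬝ᵥ M.θ.1.2) < M.ε ω 1 := by
  filter_upwards [hgame.decision] with ω hω
  have h0 := hω 0
  have h1 := hω 1
  have o0 : opp 0 = 1 := rfl
  have o1 : opp 1 = 0 := rfl
  rw [o0] at h0
  rw [o1] at h1
  have hη0 := hgame.η_pos (M.W ω 0 ⬝ᵥ M.θ.1.2)
  have hη1 := hgame.η_pos (M.W ω 1 ⬝ᵥ M.θ.1.2)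
  constructor
  · rintro ⟨hd0, hd1⟩
    simp only [hd0, hd1, if_true, true_iff, Bool.false_eq_true, if_false, add_zero, false_iff,
      not_le] at h0 h1
    exact ⟨h0, h1⟩
  · rintro ⟨he0, he1⟩
    -- Below the low threshold player 1 takes the treatment whatever the partner does, as η > 0.
    -- Player 2 then faces the high threshold, so the selection among multiple equilibria plays no
    -- role.
    have hd0 : M.D ω 0 = true := by
      rw [h0]
      split_ifs <;> linarith
    refine ⟨hd0, ?_⟩
    rw [← Bool.not_eq_true, h1]
    simp only [hd0, if_true, not_le]
    exact he1

end

end Model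

end GameMTE

/-! ### Identification: centred regression errors and the formula for the response function -/

namespace GameMTE

/-- An integrable function on the unit square whose integrals over all rectangles with a vertex at
the origin vanish is almost everywhere zero. -/
lemma ae_eq_zero_of_rect_integrals {φ : ℝ × ℝ → ℝ} (hφ : IntegrableOn φ unitSquare)
    (h : ∀ p ∈ unitSquare, ∫ v in Icc 0 p.1 ×ˢ Icc 0 p.2, φ v = 0) :
    ∀ᵐ v ∂(volume.restrict unitSquare), φ v = 0 := by
  set ν := (volume : Measure (ℝ × ℝ)).restrict unitSquare with hν
  have hfin : ∀ ψ : ℝ × ℝ → ℝ, Integrable ψ ν →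
      IsFiniteMeasure (ν.withDensity fun v => ENNReal.ofReal (ψ v)) := fun ψ hψ =>
    isFiniteMeasure_withDensity_ofReal hψ.2
  have := hfin φ hφ
  have := hfin (fun v => -φ v) hφ.neg
  -- The positive and negative parts are densities of finite measures. A lower left quadrant meets
  -- the square in a rectangle with a vertex at the origin, or not at all, so the hypothesis makes
  -- the two measures agree on quadrants.
  have key : (ν.withDensity fun v => ENNReal.ofReal (φ v))
      = ν.withDensity fun v => ENNReal.ofReal (-φ v) := by
    refine measure_eq_of_quadrants fun a b => ?_
    have hm : MeasurableSet (Iic a ×ˢ Iic b) := measurableSet_Iic.prod measurableSet_Iic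
    rw [withDensity_apply _ hm, withDensity_apply _ hm]
    have h0 : ∫ v in Iic a ×ˢ Iic b, φ v ∂ν = 0 := by
      rw [hν, Measure.restrict_restrict hm]
      rcases lt_or_ge a 0 with ha | ha
      · have : (Iic a ×ˢ Iic b) ∩ unitSquare = ∅ :=
          eq_empty_of_forall_notMem fun v hv => not_le.mpr ha (hv.2.1.1.trans hv.1.1)
        rw [this]; simp
      rcases lt_or_ge b 0 with hb | hb
      · have : (Iic a ×ˢ Iic b) ∩ unitSquare = ∅ :=
          eq_empty_of_forall_notMem fun v hv => not_le.mpr hb (hv.2.2.1.trans hv.1.2)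
        rw [this]; simp
      have : (Iic a ×ˢ Iic b) ∩ unitSquare = Icc 0 (min a 1) ×ˢ Icc 0 (min b 1) := by
        ext v
        simp only [unitSquare, mem_inter_iff, mem_prod, mem_Iic, mem_Icc, le_min_iff]
        tauto
      rw [this]
      exact h (min a 1, min b 1) ⟨⟨le_min ha zero_le_one, min_le_right _ _⟩,
        ⟨le_min hb zero_le_one, min_le_right _ _⟩⟩
    have hi : Integrable φ (ν.restrict (Iic a ×ˢ Iic b)) := Integrable.restrict (show Integrable φ ν from hφ)
    have hn : ∫⁻ v in Iic a ×ˢ Iic b, ENNReal.ofReal (-φ v) ∂ν ≠ ∞ := hi.neg.lintegral_lt_top.ne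
    rw [integral_eq_lintegral_pos_part_sub_lintegral_neg_part hi, sub_eq_zero,
      ENNReal.toReal_eq_toReal_iff' hi.lintegral_lt_top.ne hn] at h0
    exact h0
  have h2 := (withDensity_eq_iff hφ.aemeasurable.ennreal_ofReal
    hφ.neg.aemeasurable.ennreal_ofReal hφ.lintegral_lt_top.ne).mp key
  filter_upwards [h2] with v hv
  simp only [Pi.neg_apply] at hv
  rcases le_total 0 (φ v) with h | h
  · rw [ENNReal.ofReal_of_nonpos (neg_nonpos.mpr h), ENNReal.ofReal_eq_zero] at hv
    exact le_antisymm hv h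
  · rw [ENNReal.ofReal_of_nonpos h, eq_comm, ENNReal.ofReal_eq_zero] at hv
    exact le_antisymm h (neg_nonpos.mp hv)

namespace Model

variable {Ω₀ : Type*} [MeasurableSpace Ω₀] {dX dZ : ℕ} {M : Model Ω₀ dX dZ} {μ₀ : Measure Ω₀}

/-- The regression error as a function of the observation. -/
def errObs (M : Model Ω₀ dX dZ) (μ₀ : Measure Ω₀) [IsFiniteMeasure μ₀] (o : Obs dX dZ) : ℝ :=
  I10 o.2 * o.1 0 - I10 o.2 * (covX o.2.2 0 ⬝ᵥ M.β 0 true false)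
    - I10 o.2 / M.L10 μ₀ M.θ o.2.2 * M.g10 μ₀ (M.P10 μ₀ M.θ o.2.2)

lemma measurable_dotProduct' {α ι : Type*} [MeasurableSpace α] [Fintype ι] {f g : α → ι → ℝ}
    (hf : Measurable f) (hg : Measurable g) : Measurable fun a => f a ⬝ᵥ g a := by
  refine Finset.measurable_sum _ fun i _ => ?_
  exact ((measurable_pi_apply i).comp hf).mul ((measurable_pi_apply i).comp hg)

lemma measurable_I10 : Measurable (I10 : Design dX dZ → ℝ) := by
  refine Measurable.ite ?_ measurable_const measurable_const
  have h0 : Measurable fun z : Design dX dZ => z.1 0 := (measurable_pi_apply 0).comp measurable_fst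
  have h1 : Measurable fun z : Design dX dZ => z.1 1 := (measurable_pi_apply 1).comp measurable_fst
  exact (h0 (measurableSet_singleton true)).inter (h1 (measurableSet_singleton false))

lemma I10_mem (z : Design dX dZ) : I10 z ∈ Icc (0 : ℝ) 1 := by
  unfold I10; split_ifs <;> simp

lemma I10_mul_self (z : Design dX dZ) : I10 z * I10 z = I10 z := by
  unfold I10; split_ifs <;> simp

lemma measurable_covX {α : Type*} [MeasurableSpace α] {f : α → Fin 2 → WVec dX dZ}
    (hf : Measurable f) (j : Fin 2) : Measurable fun a => covX (f a) j :=
  measurable_pi_lambda _ fun k => (measurable_pi_apply (Sum.inl k)).comp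
    ((measurable_pi_apply j).comp hf)

lemma measurable_P (hη : Measurable M.η) (μ₀ : Measure Ω₀) {α : Type*} [MeasurableSpace α]
    {t : α → Param dX dZ} (ht : Measurable t) {w : α → Fin 2 → WVec dX dZ} (hw : Measurable w)
    (j : Fin 2) (d : Bool) : Measurable fun a => M.P μ₀ (t a) (w a) j d := by
  have hwj : Measurable fun a => w a j := (measurable_pi_apply j).comp hw
  refine (M.measurable_F μ₀ j).comp ((measurable_dotProduct' hwj ht.fst.fst).add ?_)
  cases d
  · simp
  · simp only [if_true]
    exact hη.comp (measurable_dotProduct' hwj ht.fst.snd)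

lemma measurable_P10 (hη : Measurable M.η) (μ₀ : Measure Ω₀) {α : Type*} [MeasurableSpace α]
    {t : α → Param dX dZ} (ht : Measurable t) {w : α → Fin 2 → WVec dX dZ} (hw : Measurable w) :
    Measurable fun a => M.P10 μ₀ (t a) (w a) :=
  (measurable_P hη μ₀ ht hw 0 false).prodMk (measurable_P hη μ₀ ht hw 1 true)

section

variable [IsProbabilityMeasure μ₀] (hgame : M.ParametricGame μ₀)

include hgame

lemma ParametricGame.meas_X : Measurable M.X :=
  measurable_pi_lambda _ fun j => measurable_covX hgame.meas_W j

lemma ParametricGame.meas_design : Measurable M.design := hgame.meas_D.prodMk hgame.meas_W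

lemma ParametricGame.meas_P10_true : Measurable fun w => M.P10 μ₀ M.θ w :=
  measurable_P10 hgame.meas_η μ₀ measurable_const measurable_id

lemma ParametricGame.meas_L10_true : Measurable fun w => M.L10 μ₀ M.θ w :=
  (measurable_P hgame.meas_η μ₀ measurable_const measurable_id 0 false).sub
    (measurable_comp_of_continuousOn hgame.copula_true.continuousOn_H hgame.meas_P10_true
      fun w => M.P10_mem μ₀ _ w)

lemma ParametricGame.meas_errObs (hg : ContinuousOn (M.g10 μ₀) unitSquare) :
    Measurable (M.errObs μ₀) := by
  have hw : Measurable fun o : Obs dX dZ => o.2.2 := measurable_snd.snd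
  have hI : Measurable fun o : Obs dX dZ => I10 o.2 := measurable_I10.comp measurable_snd
  have hY : Measurable fun o : Obs dX dZ => o.1 0 := (measurable_pi_apply 0).comp measurable_fst
  refine ((hI.mul hY).sub (hI.mul
    (measurable_dotProduct' (measurable_covX hw 0) measurable_const))).sub ?_
  exact (hI.div (hgame.meas_L10_true.comp hw)).mul (measurable_comp_of_continuousOn hg
    (hgame.meas_P10_true.comp hw) fun o => M.P10_mem μ₀ _ _)

/-- The regression error has conditional mean zero given the design. -/
lemma ParametricGame.setIntegral_err (hlin : M.LinearOutcome μ₀)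
    (hg : ContinuousOn (M.g10 μ₀) unitSquare) (herr : Integrable (M.err μ₀) μ₀)
    {B : Set (Design dX dZ)} (hB : MeasurableSet B) :
    ∫ ω in M.design ⁻¹' B, M.err μ₀ ω ∂μ₀ = 0 := by
  set A : Ω₀ → (Fin 2 → ℝ) × ℝ × ℝ := fun ω => (M.ε ω, M.U 0 true false ω, M.U 1 false true ω)
  have hA : Measurable A :=
    hgame.meas_ε.prodMk ((hlin.meas_U 0 true false).prodMk (hlin.meas_U 1 false true))
  set d : Fin 2 → Bool := ![true, false]
  set c : (Fin 2 → WVec dX dZ) → ℝ := fun w => M.g10 μ₀ (M.P10 μ₀ M.θ w) / M.L10 μ₀ M.θ w with hc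
  set a : (Fin 2 → WVec dX dZ) → ℝ := fun w => w 0 ⬝ᵥ M.θ.1.1 with ha
  set a' : (Fin 2 → WVec dX dZ) → ℝ := fun w => w 1 ⬝ᵥ M.θ.1.1 + M.η (w 1 ⬝ᵥ M.θ.1.2) with ha'
  have hcm : Measurable c := (measurable_comp_of_continuousOn hg hgame.meas_P10_true
    fun w => M.P10_mem μ₀ _ _).div hgame.meas_L10_true
  have ham : Measurable a := measurable_dotProduct' (measurable_pi_apply 0) measurable_const
  have ham' : Measurable a' :=
    (measurable_dotProduct' (measurable_pi_apply 1) measurable_const).add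
      (hgame.meas_η.comp (measurable_dotProduct' (measurable_pi_apply 1) measurable_const))
  set E : Set (((Fin 2 → ℝ) × ℝ × ℝ) × (Fin 2 → WVec dX dZ)) :=
    {q | (d, q.2) ∈ B ∧ q.1.1 0 ≤ a q.2 ∧ a' q.2 < q.1.1 1} with hE
  have hEm : MeasurableSet E := by
    have m1 : MeasurableSet {q : ((Fin 2 → ℝ) × ℝ × ℝ) × (Fin 2 → WVec dX dZ) | (d, q.2) ∈ B} :=
      (measurable_const.prodMk measurable_snd) hB
    have he : ∀ j : Fin 2, Measurable fun q : ((Fin 2 → ℝ) × ℝ × ℝ) × (Fin 2 → WVec dX dZ) =>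
        q.1.1 j := fun j => (measurable_pi_apply j).comp measurable_fst.fst
    exact m1.inter ((measurableSet_le (he 0) (ham.comp measurable_snd)).inter
      (measurableSet_lt (ham'.comp measurable_snd) (he 1)))
  set φ : ((Fin 2 → ℝ) × ℝ × ℝ) × (Fin 2 → WVec dX dZ) → ℝ :=
    E.indicator fun q => q.1.2.1 - c q.2 with hφ
  have hφm : Measurable φ :=
    (measurable_fst.snd.fst.sub (hcm.comp measurable_snd)).indicator hEm
  -- Off action (1,0) the error is zero. On it the outcome is a known potential outcome and
  -- membership is decided by thresholds, so the error depends only on the pair (A, W) of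
  -- independent variables, and W can be frozen.
  have hae : (M.design ⁻¹' B).indicator (M.err μ₀) =ᵐ[μ₀] fun ω => φ (A ω, M.W ω) := by
    filter_upwards [hgame.action_ae] with ω hω
    by_cases hact : M.D ω 0 = true ∧ M.D ω 1 = false
    · have hD : M.D ω = d := by
        funext j; fin_cases j
        · exact hact.1
        · exact hact.2
      have hI : I10 (M.design ω) = 1 := by simp [I10, design, hact]
      have hY : M.Y ω 0 = covX (M.W ω) 0 ⬝ᵥ M.β 0 true false + M.U 0 true false ω := by
        have : opp 0 = 1 := rfl
        simp [Y, potY, this, hact]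
      have herr : M.err μ₀ ω = M.U 0 true false ω - c (M.W ω) := by
        rw [err, hI, hY]; simp only [hc]; ring
      have hiff : (A ω, M.W ω) ∈ E ↔ ω ∈ M.design ⁻¹' B := by
        simp only [hE, mem_ofPred_eq, mem_preimage, design, hD]
        exact ⟨fun h => h.1, fun h => ⟨h, hω.mp hact⟩⟩
      by_cases hB' : ω ∈ M.design ⁻¹' B
      · rw [indicator_of_mem hB', hφ, indicator_of_mem (hiff.mpr hB'), herr]
      · rw [indicator_of_notMem hB', hφ, indicator_of_notMem (fun h => hB' (hiff.mp h))]
    · have hI : I10 (M.design ω) = 0 := by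
        simp only [I10, design]; exact if_neg hact
      have hnot : (A ω, M.W ω) ∉ E := fun h => hact (hω.mpr h.2)
      rw [hφ, indicator_of_notMem hnot]
      have herr : M.err μ₀ ω = 0 := by rw [err, hI]; simp
      by_cases hB' : ω ∈ M.design ⁻¹' B
      · rw [indicator_of_mem hB', herr]
      · rw [indicator_of_notMem hB']
  have hBm : MeasurableSet (M.design ⁻¹' B) := hgame.meas_design hB
  have hint : Integrable (fun ω => φ (A ω, M.W ω)) μ₀ := (herr.indicator hBm).congr hae
  rw [← integral_indicator hBm, integral_congr_ae hae,
    integral_of_indepFun hA hgame.meas_W (hlin.indep true false) hφm hint]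
  refine integral_eq_zero_of_ae (ae_of_all _ fun ω' => ?_)
  set w := M.W ω'
  simp only [Pi.zero_apply]
  by_cases hw : (d, w) ∈ B
  · have h1 : (fun ω => φ (A ω, w))
        = (M.actionSet (a w) (a' w)).indicator fun ω => M.U 0 true false ω - c w := by
      funext ω
      have : (A ω, w) ∈ E ↔ ω ∈ M.actionSet (a w) (a' w) :=
        ⟨fun h => h.2, fun h => ⟨hw, h⟩⟩
      by_cases h : ω ∈ M.actionSet (a w) (a' w)
      · rw [indicator_of_mem h, hφ, indicator_of_mem (this.mpr h)]
      · rw [indicator_of_notMem h, hφ, indicator_of_notMem (fun h' => h (this.mp h'))]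
    have hp : (M.F μ₀ 0 (a w), M.F μ₀ 1 (a' w)) = M.P10 μ₀ M.θ w := by simp [P10, P, ha, ha']
    have hL : μ₀.real (M.actionSet (a w) (a' w)) = M.L10 μ₀ M.θ w := by
      rw [hgame.measure_actionSet, hp]; simp [L10, P, ha]
    have hU := hgame.setIntegral_actionSet hlin (a w) (a' w)
    rw [hp] at hU
    rw [h1, integral_indicator (hgame.measurableSet_actionSet _ _),
      integral_sub hlin.integrable_U.restrict (integrable_const _), hU, setIntegral_const, hL,
      smul_eq_mul]
    -- If the choice probability vanishes, the quotient g / L is zero by convention; this does no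
    -- harm because g, an integral over a null event, vanishes as well.
    by_cases hL0 : M.L10 μ₀ M.θ w = 0
    · have : M.g10 μ₀ (M.P10 μ₀ M.θ w) = 0 := by
        rw [← hU]
        refine setIntegral_measure_zero _ ?_
        rwa [hL0, measureReal_eq_zero_iff] at hL
      rw [this, hL0]; simp
    · rw [hc]; field_simp; ring
  · have : ∀ ω, φ (A ω, w) = 0 := fun ω => indicator_of_notMem (fun h => hw h.1) _
    exact integral_eq_zero_of_ae (ae_of_all _ this)

/-- Conditional mean of the potential outcome given `(X, V)`. -/
lemma ParametricGame.potY_condMean (hlin : M.LinearOutcome μ₀) :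
    ∀ᵐ z ∂(μ₀.map fun ω => (M.X ω, M.V μ₀ ω)),
      ∫ y, y ∂(condDistrib (M.potY 0 true false) (fun ω => (M.X ω, M.V μ₀ ω)) μ₀ z)
        = z.1 0 ⬝ᵥ M.β 0 true false + M.meanU μ₀ z.2 := by
  have hXV : Measurable fun ω => (M.X ω, M.V μ₀ ω) := hgame.meas_X.prodMk hgame.meas_V
  have hmU : Measurable (M.meanU μ₀) :=
    (StronglyMeasurable.integral_condDistrib (f := fun q : (ℝ × ℝ) × ℝ => q.2)
      measurable_snd.stronglyMeasurable).measurable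
  have hXβ : Integrable (fun ω => M.X ω 0 ⬝ᵥ M.β 0 true false) μ₀ :=
    integrable_finsetSum _ fun k _ => ((hlin.memLp_X k).integrable one_le_two).mul_const _
  have hY : Integrable (M.potY 0 true false) μ₀ := hXβ.add hlin.integrable_U
  have hmUV : Integrable (fun ω => M.meanU μ₀ (M.V μ₀ ω)) μ₀ :=
    Integrable.integral_condDistrib (f := fun q : (ℝ × ℝ) × ℝ => q.2) hgame.meas_V.aemeasurable
      (hlin.meas_U 0 true false).aemeasurable <| (integrable_map_measure
        measurable_snd.aestronglyMeasurable (hgame.meas_V.prodMk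
          (hlin.meas_U 0 true false)).aemeasurable).mpr hlin.integrable_U
  have hlhs : Integrable (fun z : (Fin 2 → Fin dX → ℝ) × (ℝ × ℝ) =>
      ∫ y, y ∂(condDistrib (M.potY 0 true false) (fun ω => (M.X ω, M.V μ₀ ω)) μ₀ z))
      (μ₀.map fun ω => (M.X ω, M.V μ₀ ω)) :=
    Integrable.integral_condDistrib_map
      (f := fun q : ((Fin 2 → Fin dX → ℝ) × (ℝ × ℝ)) × ℝ => q.2) hY.aemeasurable <|
      (integrable_map_measure measurable_snd.aestronglyMeasurable
        (hXV.aemeasurable.prodMk hY.aemeasurable)).mpr hY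
  have hrhsm : Measurable fun z : (Fin 2 → Fin dX → ℝ) × (ℝ × ℝ) =>
      z.1 0 ⬝ᵥ M.β 0 true false + M.meanU μ₀ z.2 :=
    (measurable_dotProduct' ((measurable_pi_apply 0).comp measurable_fst) measurable_const).add
      (hmU.comp measurable_snd)
  have hrhs : Integrable (fun z : (Fin 2 → Fin dX → ℝ) × (ℝ × ℝ) =>
      z.1 0 ⬝ᵥ M.β 0 true false + M.meanU μ₀ z.2) (μ₀.map fun ω => (M.X ω, M.V μ₀ ω)) :=
    (integrable_map_measure hrhsm.aestronglyMeasurable hXV.aemeasurable).mpr (hXβ.add hmUV)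
  refine hlhs.ae_eq_of_forall_setIntegral_eq _ _ hrhs fun s hs _ => ?_
  rw [← setIntegral_preimage_eq_condDistrib hXV hY hs,
    setIntegral_map hs hrhsm.aestronglyMeasurable hXV.aemeasurable]
  have hpre := hXV hs
  change _ = ∫ ω in (fun ω => (M.X ω, M.V μ₀ ω)) ⁻¹' s, ((fun ω => M.X ω 0 ⬝ᵥ M.β 0 true false) +
        fun ω => M.meanU μ₀ (M.V μ₀ ω)) ω ∂μ₀
  rw [← sub_eq_zero, ← integral_sub hY.restrict (hXβ.add hmUV).restrict,
    ← integral_indicator hpre]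
  set A : Ω₀ → (Fin 2 → ℝ) × ℝ × ℝ := fun ω => (M.ε ω, M.U 0 true false ω, M.U 1 false true ω)
  have hA : Measurable A :=
    hgame.meas_ε.prodMk ((hlin.meas_U 0 true false).prodMk (hlin.meas_U 1 false true))
  have hVe : Measurable fun q : ((Fin 2 → ℝ) × ℝ × ℝ) × (Fin 2 → WVec dX dZ) =>
      (M.F μ₀ 0 (q.1.1 0), M.F μ₀ 1 (q.1.1 1)) :=
    ((M.measurable_F μ₀ 0).comp ((measurable_pi_apply 0).comp measurable_fst.fst)).prodMk
      ((M.measurable_F μ₀ 1).comp ((measurable_pi_apply 1).comp measurable_fst.fst))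
  have hXe : Measurable fun q : ((Fin 2 → ℝ) × ℝ × ℝ) × (Fin 2 → WVec dX dZ) => covX q.2 :=
    measurable_pi_lambda _ fun j => measurable_covX measurable_snd j
  set E : Set (((Fin 2 → ℝ) × ℝ × ℝ) × (Fin 2 → WVec dX dZ)) :=
    (fun q => (covX q.2, (M.F μ₀ 0 (q.1.1 0), M.F μ₀ 1 (q.1.1 1)))) ⁻¹' s
  set φ : ((Fin 2 → ℝ) × ℝ × ℝ) × (Fin 2 → WVec dX dZ) → ℝ :=
    E.indicator fun q => q.1.2.1 - M.meanU μ₀ (M.F μ₀ 0 (q.1.1 0), M.F μ₀ 1 (q.1.1 1)) with hφ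
  have hφm : Measurable φ :=
    (measurable_fst.snd.fst.sub (hmU.comp hVe)).indicator ((hXe.prodMk hVe) hs)
  have heq : (((fun ω => (M.X ω, M.V μ₀ ω)) ⁻¹' s).indicator fun ω =>
      M.potY 0 true false ω - ((fun ω => M.X ω 0 ⬝ᵥ M.β 0 true false) +
        fun ω => M.meanU μ₀ (M.V μ₀ ω)) ω) = fun ω => φ (A ω, M.W ω) := by
    funext ω
    have hval : M.potY 0 true false ω - ((fun ω => M.X ω 0 ⬝ᵥ M.β 0 true false) +
        fun ω => M.meanU μ₀ (M.V μ₀ ω)) ω = M.U 0 true false ω - M.meanU μ₀ (M.V μ₀ ω) := by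
      simp [potY, X]
    by_cases h : ω ∈ (fun ω => (M.X ω, M.V μ₀ ω)) ⁻¹' s
    · have h' : (A ω, M.W ω) ∈ E := h
      rw [indicator_of_mem h, hval, hφ, indicator_of_mem h']
      rfl
    · have h' : (A ω, M.W ω) ∉ E := h
      rw [indicator_of_notMem h, hφ, indicator_of_notMem h']
  have hint : Integrable (fun ω => φ (A ω, M.W ω)) μ₀ := by
    rw [← heq]
    exact (hY.sub (hXβ.add hmUV)).indicator hpre
  have goal_eq : ∫ ω, φ (A ω, M.W ω) ∂μ₀ = 0 := by
    rw [integral_of_indepFun hA hgame.meas_W (hlin.indep true false) hφm hint]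
    refine integral_eq_zero_of_ae (ae_of_all _ fun ω' => ?_)
    -- With W frozen, the event becomes {V ∈ t} for a section t of s, on which U and E[U | V] have
    -- the same integral by definition of the latter.
    set t : Set (ℝ × ℝ) := {v | (M.X ω', v) ∈ s}
    have ht : MeasurableSet t := measurable_prodMk_left hs
    have h1 : (fun ω => φ (A ω, M.W ω')) = ((M.V μ₀ ⁻¹' t).indicator
        (fun ω => M.U 0 true false ω - M.meanU μ₀ (M.V μ₀ ω)) : Ω₀ → ℝ) := rfl
    simp only [Pi.zero_apply]
    rw [h1, integral_indicator (hgame.meas_V ht), integral_sub hlin.integrable_U.restrict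
      hmUV.restrict, setIntegral_preimage_eq_condDistrib hgame.meas_V hlin.integrable_U ht,
      setIntegral_map ht hmU.aestronglyMeasurable hgame.meas_V.aemeasurable |>.symm]
    exact sub_self _
  rw [← goal_eq, ← heq]

/-- Mixed derivative of `g` and the conditional mean of the error. -/
lemma ParametricGame.meanU_mul_h_ae (hlin : M.LinearOutcome μ₀)
    (hg : ContDiffOn ℝ 2 (M.g10 μ₀) unitSquare) :
    ∀ᵐ v ∂(volume.restrict unitSquare),
      M.meanU μ₀ v * M.h M.θ.2.1 v + pd (1, 1) (M.g10 μ₀) v = 0 := by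
  have hc : ContinuousOn (pd (1, 1) (M.g10 μ₀)) unitSquare := by
    have h2 : ContDiffOn ℝ ((1 : ℕ)) (pd2 (M.g10 μ₀)) unitSquare :=
      contDiffOn_pd2 (by exact_mod_cast hg)
    exact (contDiffOn_pd1 (k := 0) (by exact_mod_cast h2)).continuousOn
  have hi1 := hgame.integrable_meanU_mul hlin
  have hi2 : IntegrableOn (pd (1, 1) (M.g10 μ₀)) unitSquare :=
    hc.integrableOn_compact isCompact_unitSquare
  refine ae_eq_zero_of_rect_integrals (hi1.add hi2) fun p hp => ?_
  have hsub : Icc 0 p.1 ×ˢ Icc 0 p.2 ⊆ unitSquare :=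
    prod_mono (Icc_subset_Icc_right hp.1.2) (Icc_subset_Icc_right hp.2.2)
  have hadd : ∫ v in Icc 0 p.1 ×ˢ Icc 0 p.2,
      (M.meanU μ₀ v * M.h M.θ.2.1 v + pd (1, 1) (M.g10 μ₀) v)
      = (∫ v in Icc 0 p.1 ×ˢ Icc 0 p.2, M.meanU μ₀ v * M.h M.θ.2.1 v)
        + ∫ v in Icc 0 p.1 ×ˢ Icc 0 p.2, pd (1, 1) (M.g10 μ₀) v :=
    integral_add (hi1.mono_set hsub) (hi2.mono_set hsub)
  have h0 : ∀ y : ℝ, M.g10 μ₀ (0, y) = 0 := by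
    intro y
    refine setIntegral_measure_zero _ ?_
    rw [Measure.volume_eq_prod, Measure.prod_prod]
    simp
  -- The full strip has integral g(p₁, 0) and its upper part g(p), so the lower rectangle has g(p₁,
  -- 0) - g(p). As g(0, ·) = 0, this is minus the integral of the mixed derivative; the sign comes
  -- from p₂ being a lower limit of integration.
  have hsplit := setIntegral_strip_split hp hi1
  have e1 : ∫ v in Icc 0 p.1 ×ˢ Icc 0 1, M.meanU μ₀ v * M.h M.θ.2.1 v = M.g10 μ₀ (p.1, 0) := rfl
  have e2 : ∫ v in Icc 0 p.1 ×ˢ Icc p.2 1, M.meanU μ₀ v * M.h M.θ.2.1 v = M.g10 μ₀ p := rfl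
  rw [hadd, integral_pd11 hg hp, h0, h0]
  rw [e1, e2] at hsplit
  linarith

/-- The marginal treatment response function in terms of the mixed derivative of `g`. -/
lemma ParametricGame.mtr_eq (hlin : M.LinearOutcome μ₀)
    (hg : ContDiffOn ℝ 2 (M.g10 μ₀) unitSquare)
    (hh : ContinuousOn (M.h M.θ.2.1) unitSquare)
    {m : (Fin 2 → Fin dX → ℝ) × (ℝ × ℝ) → ℝ} (hm : M.IsMTR10 μ₀ m)
    {x : Fin 2 → Fin dX → ℝ} (hx : x ∈ (μ₀.map M.X).support) {p : ℝ × ℝ} (hp : p ∈ unitSquare)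
    (hhp : 0 < M.h M.θ.2.1 p)
    (hm_cont : ContinuousWithinAt m ((μ₀.map M.X).support ×ˢ unitSquare) (x, p)) :
    m (x, p) = x 0 ⬝ᵥ M.β 0 true false - pd (1, 1) (M.g10 μ₀) p / M.h M.θ.2.1 p := by
  set h := M.h M.θ.2.1 with hh_def
  set ψ : (Fin 2 → Fin dX → ℝ) × (ℝ × ℝ) → ℝ := fun z =>
    z.1 0 ⬝ᵥ M.β 0 true false - pd (1, 1) (M.g10 μ₀) z.2 / h z.2 with hψ
  have hc : ContinuousOn (pd (1, 1) (M.g10 μ₀)) unitSquare := by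
    have h2 : ContDiffOn ℝ ((1 : ℕ)) (pd2 (M.g10 μ₀)) unitSquare :=
      contDiffOn_pd2 (by exact_mod_cast hg)
    exact (contDiffOn_pd1 (k := 0) (by exact_mod_cast h2)).continuousOn
  have hXV : Measurable fun ω => (M.X ω, M.V μ₀ ω) := hgame.meas_X.prodMk hgame.meas_V
  have hac : μ₀.map (M.V μ₀) ≪ volume.restrict unitSquare := by
    rw [hgame.map_V]; exact withDensity_absolutelyContinuous _ _
  -- V almost surely avoids the zeros of its own density, so division by h is legitimate along V
  -- even though h is bounded below only on S^{(1,0)}.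
  have hpos : ∀ᵐ ω ∂μ₀, 0 < h (M.V μ₀ ω) := by
    have : ∀ᵐ v ∂(μ₀.map (M.V μ₀)), 0 < h v := by
      rw [hgame.map_V, ae_withDensity_iff' hgame.meas_h]
      exact ae_of_all _ fun v hv => by
        by_contra hcon
        exact hv (ENNReal.ofReal_eq_zero.mpr (not_lt.mp hcon))
    exact ae_of_ae_map hgame.meas_V.aemeasurable this
  have hae : ∀ᵐ ω ∂μ₀, m (M.X ω, M.V μ₀ ω) = ψ (M.X ω, M.V μ₀ ω) := by
    have h1 := ae_of_ae_map hXV.aemeasurable (hm.and (hgame.potY_condMean hlin))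
    have h2 := ae_of_ae_map hgame.meas_V.aemeasurable
      (hac.ae_le (hgame.meanU_mul_h_ae hlin hg))
    filter_upwards [h1, h2, hpos] with ω h1 h2 h3
    rw [h1.1, h1.2]
    simp only [hψ]
    have : M.meanU μ₀ (M.V μ₀ ω) = -(pd (1, 1) (M.g10 μ₀) (M.V μ₀ ω) / h (M.V μ₀ ω)) := by
      rw [eq_neg_iff_add_eq_zero, ← mul_right_cancel_iff_of_pos h3, add_mul,
        div_mul_cancel₀ _ h3.ne', zero_mul]
      exact h2
    rw [this]; ring
  set T := (μ₀.map M.X).support ×ˢ unitSquare with hT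
  have hψc : ContinuousWithinAt ψ T (x, p) := by
    have hsnd : ContinuousWithinAt (fun z : (Fin 2 → Fin dX → ℝ) × (ℝ × ℝ) => z.2) T (x, p) :=
      continuous_snd.continuousWithinAt
    have hmaps : MapsTo (fun z : (Fin 2 → Fin dX → ℝ) × (ℝ × ℝ) => z.2) T unitSquare :=
      fun z hz => hz.2
    have hlinc : Continuous fun z : (Fin 2 → Fin dX → ℝ) × (ℝ × ℝ) =>
        z.1 0 ⬝ᵥ M.β 0 true false := by
      simp only [dotProduct]; fun_prop
    exact hlinc.continuousWithinAt.sub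
      (((hc p hp).comp (f := fun z : (Fin 2 → Fin dX → ℝ) × (ℝ × ℝ) => z.2) (x := (x, p)) hsnd hmaps).div
        ((hh p hp).comp (f := fun z : (Fin 2 → Fin dX → ℝ) × (ℝ × ℝ) => z.2) (x := (x, p)) hsnd hmaps)
        hhp.ne')
  -- Two functions that are continuous at (x, p) relative to the product set and differ there would
  -- differ on a relative neighbourhood. That neighbourhood has positive probability: X and V are
  -- independent, x is in the support of X, and h > 0 near p. This contradicts almost sure equality.
  by_contra hne
  have hev : ∀ᶠ z in 𝓝[T] (x, p), m z ≠ ψ z :=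
    (hm_cont.sub hψc).eventually_ne (sub_ne_zero.mpr hne) |>.mono fun z hz => sub_ne_zero.mp hz
  have hhev : ∀ᶠ v in 𝓝[unitSquare] p, 0 < h v := (hh p hp).eventually_const_lt hhp
  rw [eventually_nhdsWithin_iff, nhds_prod_eq] at hev
  obtain ⟨u₁, hu₁, u₂, hu₂, hu⟩ := Filter.mem_prod_iff.mp hev
  rw [eventually_nhdsWithin_iff] at hhev
  obtain ⟨o₁, ho₁, ho₁o, hxo₁⟩ := mem_nhds_iff.mp hu₁
  obtain ⟨o₂, ho₂, ho₂o, hpo₂⟩ := mem_nhds_iff.mp (inter_mem hu₂ hhev)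
  have hX_ae : ∀ᵐ ω ∂μ₀, M.X ω ∈ (μ₀.map M.X).support :=
    ae_of_ae_map hgame.meas_X.aemeasurable Measure.support_mem_ae
  have hindXV : IndepFun M.X (M.V μ₀) μ₀ := by
    have h1 : Measurable fun w : Fin 2 → WVec dX dZ => covX w :=
      measurable_pi_lambda _ fun j => measurable_covX measurable_id j
    have h2 : Measurable fun q : (Fin 2 → ℝ) × ℝ × ℝ =>
        (M.F μ₀ 0 (q.1 0), M.F μ₀ 1 (q.1 1)) :=
      ((M.measurable_F μ₀ 0).comp ((measurable_pi_apply 0).comp measurable_fst)).prodMk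
        ((M.measurable_F μ₀ 1).comp ((measurable_pi_apply 1).comp measurable_fst))
    exact ((hlin.indep true false).comp h2 h1).symm
  have hpX : 0 < μ₀ (M.X ⁻¹' o₁) := by
    rw [← Measure.map_apply hgame.meas_X ho₁o.measurableSet]
    exact (Measure.mem_support_iff_forall x).mp hx _ (ho₁o.mem_nhds hxo₁)
  have hpV : 0 < μ₀ (M.V μ₀ ⁻¹' (o₂ ∩ unitSquare)) := by
    have hms : MeasurableSet (o₂ ∩ unitSquare) := ho₂o.measurableSet.inter measurableSet_unitSquare
    have hvol : 0 < volume (o₂ ∩ unitSquare) := by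
      -- The point p may lie on the edge of the square, but every neighbourhood of it meets the
      -- interior, hence has positive area within the square.
      have hcl : p ∈ closure (interior unitSquare) := by
        rw [unitSquare, interior_prod_eq, interior_Icc, closure_prod_eq,
          closure_Ioo zero_ne_one]
        exact hp
      have hne' : (o₂ ∩ interior unitSquare).Nonempty := mem_closure_iff.mp hcl o₂ ho₂o hpo₂
      exact ((ho₂o.inter isOpen_interior).measure_pos volume hne').trans_le
        (measure_mono (inter_subset_inter_right _ interior_subset))
    rw [← Measure.map_apply hgame.meas_V hms, hgame.map_V, withDensity_apply _ hms,
      Measure.restrict_restrict hms, inter_assoc, inter_self]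
    rw [pos_iff_ne_zero]
    intro h0
    rw [setLIntegral_eq_zero_iff' hms (hgame.meas_h.mono_measure
      (Measure.restrict_mono inter_subset_right le_rfl))] at h0
    obtain ⟨v, hv, hv'⟩ := ((frequently_ae_mem_iff.mpr hvol.ne').and_eventually h0).exists
    exact absurd (ENNReal.ofReal_eq_zero.mp (hv' hv)) (not_le.mpr ((ho₂ hv.1).2 hv.2))
  have hjoint : 0 < μ₀ (M.X ⁻¹' o₁ ∩ M.V μ₀ ⁻¹' (o₂ ∩ unitSquare)) := by
    rw [hindXV.measure_inter_preimage_eq_mul _ _ ho₁o.measurableSet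
      (ho₂o.measurableSet.inter measurableSet_unitSquare)]
    exact ENNReal.mul_pos hpX.ne' hpV.ne'
  have hfreq : ∃ᵐ ω ∂μ₀, ω ∈ M.X ⁻¹' o₁ ∩ M.V μ₀ ⁻¹' (o₂ ∩ unitSquare) :=
    frequently_ae_mem_iff.mpr hjoint.ne'
  obtain ⟨ω, hω, h1, h2⟩ := (hfreq.and_eventually (hae.and hX_ae)).exists
  have hmem : (M.X ω, M.V μ₀ ω) ∈ u₁ ×ˢ u₂ := ⟨ho₁ hω.1, (ho₂ hω.2.1).1⟩
  exact hu hmem ⟨h2, hω.2.2⟩ h1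

end

end Model

end GameMTE

namespace GameMTE

/-! ### Trimming functions -/

namespace IsTrimming

variable {ϖ : ℝ} {τ : ℝ → ℝ}

lemma exists_lipschitz (hτ : IsTrimming ϖ τ) :
    ∃ C, 0 ≤ C ∧ ∀ a ∈ Icc (0 : ℝ) 1, ∀ a' ∈ Icc (0 : ℝ) 1, |τ a - τ a'| ≤ C * |a - a'| := by
  obtain ⟨C, hC⟩ := hτ.bdd_deriv
  have h0 : (0 : ℝ) ∈ Icc (0 : ℝ) 1 := by simp
  refine ⟨C, (abs_nonneg _).trans (hC 0 h0), fun a ha a' ha' => ?_⟩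
  exact (convex_Icc (0 : ℝ) 1).norm_image_sub_le_of_norm_derivWithin_le
    (hτ.contDiff.differentiableOn one_ne_zero) (fun x hx => hC x hx) ha' ha

lemma zero_of_le (hτ : IsTrimming ϖ τ) {a : ℝ} (ha : a ∈ Icc (0 : ℝ) 1) (h : a ≤ ϖ) : τ a = 0 :=
  (hτ.zero_iff a ha).mpr h

lemma div_mem (hτ : IsTrimming ϖ τ) {a : ℝ} (ha : a ∈ Icc (0 : ℝ) 1) :
    τ a / a ∈ Icc 0 ϖ⁻¹ := by
  have hpos := hτ.pos
  have hm := hτ.maps ha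
  refine ⟨div_nonneg hm.1 ha.1, ?_⟩
  rcases le_or_gt a ϖ with h | h
  · rw [hτ.zero_of_le ha h]; simp [hpos.le]
  · rw [div_le_iff₀ (hpos.trans h), ← div_eq_inv_mul, le_div_iff₀ hpos]
    nlinarith [hm.2, hm.1]

/-- The weight `τ(a)/a` is Lipschitz. -/
lemma exists_lipschitz_div (hτ : IsTrimming ϖ τ) :
    ∃ C, 0 ≤ C ∧ ∀ a ∈ Icc (0 : ℝ) 1, ∀ a' ∈ Icc (0 : ℝ) 1,
      |τ a / a - τ a' / a'| ≤ C * |a - a'| := by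
  obtain ⟨C, hC0, hC⟩ := hτ.exists_lipschitz
  have hpos := hτ.pos
  have key : ∀ a ∈ Icc (0 : ℝ) 1, ∀ a' ∈ Icc (0 : ℝ) 1, a' ≤ a →
      |τ a / a - τ a' / a'| ≤ (ϖ⁻¹ * C + ϖ⁻¹ * ϖ⁻¹) * |a - a'| := by
    intro a ha a' ha' haa
    have hi : 0 < ϖ⁻¹ := inv_pos.mpr hpos
    rcases le_or_gt a ϖ with h | h
    · rw [hτ.zero_of_le ha h, hτ.zero_of_le ha' (haa.trans h)]
      simp only [zero_div, sub_zero, abs_zero]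
      positivity
    have ha0 : 0 < a := hpos.trans h
    have hinv : a⁻¹ ≤ ϖ⁻¹ := inv_anti₀ hpos h.le
    rcases le_or_gt a' ϖ with h' | h'
    · rw [hτ.zero_of_le ha' h']
      -- Here a' may be arbitrarily close to zero, but its weight is zero, so only a > ϖ and the
      -- Lipschitz bound for τ enter.
      have h1 := hC a ha a' ha'
      rw [hτ.zero_of_le ha' h', sub_zero] at h1
      rw [zero_div, sub_zero, abs_div, abs_of_pos ha0, div_eq_inv_mul]
      calc a⁻¹ * |τ a| ≤ ϖ⁻¹ * (C * |a - a'|) := by gcongr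
        _ ≤ _ := by
          rw [add_mul, mul_assoc]
          exact le_add_of_nonneg_right (by positivity)
    · have ha0' : 0 < a' := hpos.trans h'
      have hinv' : a'⁻¹ ≤ ϖ⁻¹ := inv_anti₀ hpos h'.le
      have e : τ a / a - τ a' / a' = a⁻¹ * (τ a - τ a') + (τ a' * (a⁻¹ * a'⁻¹)) * (a' - a) := by
        field_simp; ring
      rw [e, add_mul]
      refine (abs_add_le _ _).trans (add_le_add ?_ ?_)
      · rw [abs_mul, abs_of_pos (inv_pos.mpr ha0), mul_assoc]
        gcongr
        exact hC a ha a' ha'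
      · have hm := hτ.maps ha'
        rw [abs_mul, abs_sub_comm a', abs_of_nonneg (mul_nonneg hm.1 (by positivity))]
        refine mul_le_mul_of_nonneg_right ?_ (abs_nonneg _)
        calc τ a' * (a⁻¹ * a'⁻¹) ≤ 1 * (ϖ⁻¹ * ϖ⁻¹) := by
              gcongr
              exact hm.2
          _ = _ := one_mul _
  refine ⟨ϖ⁻¹ * C + ϖ⁻¹ * ϖ⁻¹, by positivity, fun a ha a' ha' => ?_⟩
  rcases le_total a' a with h | h
  · exact key a ha a' ha' h
  · rw [abs_sub_comm, abs_sub_comm a]; exact key a' ha' a ha h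

end IsTrimming

/-! ### Bounds for the basis functions -/

section Zeta

variable {K : ℕ} {b : Fin K → ℝ × ℝ → ℝ}

lemma continuousOn_pd {f : ℝ × ℝ → ℝ} (hf : ContDiffOn ℝ (1 : ℕ) f unitSquare) {a : ℕ × ℕ}
    (ha : a.1 + a.2 ≤ 1) : ContinuousOn (pd a f) unitSquare := by
  obtain ⟨a₁, a₂⟩ := a
  have h : (a₁ = 0 ∧ a₂ = 0) ∨ (a₁ = 1 ∧ a₂ = 0) ∨ (a₁ = 0 ∧ a₂ = 1) := by
    simp only at ha; omega
  rcases h with ⟨rfl, rfl⟩ | ⟨rfl, rfl⟩ | ⟨rfl, rfl⟩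
  · exact hf.continuousOn
  · exact (contDiffOn_pd1 (k := 0) (by exact_mod_cast hf)).continuousOn
  · exact (contDiffOn_pd2 (k := 0) (by exact_mod_cast hf)).continuousOn

/-- `zeta` is a real supremum and would take the default value 0 on an unbounded set. Boundedness,
from compactness of the square, is what makes it a genuine upper bound. -/
lemma zeta_bddAbove (hb : ∀ k, ContDiffOn ℝ (1 : ℕ) (b k) unitSquare) {d : ℕ} (hd : d ≤ 1) :
    BddAbove {r : ℝ | ∃ a : ℕ × ℕ, a.1 + a.2 ≤ d ∧ ∃ p ∈ unitSquare,
      r = √(∑ k, pd a (b k) p ^ 2)} := by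
  have hfin : {a : ℕ × ℕ | a.1 + a.2 ≤ d}.Finite := by
    refine ((finite_Iic d).prod (finite_Iic d)).subset fun a ha => ?_
    have : a.1 + a.2 ≤ d := ha
    exact ⟨mem_Iic.mpr (by omega), mem_Iic.mpr (by omega)⟩
  have hsub : {r : ℝ | ∃ a : ℕ × ℕ, a.1 + a.2 ≤ d ∧ ∃ p ∈ unitSquare,
      r = √(∑ k, pd a (b k) p ^ 2)}
      ⊆ ⋃ a ∈ {a : ℕ × ℕ | a.1 + a.2 ≤ d}, (fun p => √(∑ k, pd a (b k) p ^ 2)) '' unitSquare := by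
    rintro r ⟨a, ha, p, hp, rfl⟩
    exact mem_biUnion ha ⟨p, hp, rfl⟩
  refine BddAbove.mono hsub ((hfin.bddAbove_biUnion).mpr fun a ha => ?_)
  refine (isCompact_unitSquare.image_of_continuousOn ?_).bddAbove
  have ha' : a.1 + a.2 ≤ 1 := le_trans ha hd
  exact Real.continuous_sqrt.comp_continuousOn
    (continuousOn_finsetSum _ fun k _ => (continuousOn_pd (hb k) ha').pow 2)

lemma l2_pd_le_zeta (hb : ∀ k, ContDiffOn ℝ (1 : ℕ) (b k) unitSquare) {d : ℕ} (hd : d ≤ 1)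
    {a : ℕ × ℕ} (ha : a.1 + a.2 ≤ d) {p : ℝ × ℝ} (hp : p ∈ unitSquare) :
    l2 (fun k => pd a (b k) p) ≤ zeta b d := by
  rw [l2_eq_sqrt]
  exact le_csSup (zeta_bddAbove hb hd) ⟨a, ha, p, hp, rfl⟩

lemma l2_le_zeta (hb : ∀ k, ContDiffOn ℝ (1 : ℕ) (b k) unitSquare) {p : ℝ × ℝ}
    (hp : p ∈ unitSquare) : l2 (fun k => b k p) ≤ zeta b 0 :=
  l2_pd_le_zeta (a := (0, 0)) hb zero_le_one le_rfl hp

lemma zeta_nonneg (b : Fin K → ℝ × ℝ → ℝ) (d : ℕ) : 0 ≤ zeta b d := by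
  refine Real.sSup_nonneg ?_
  rintro r ⟨a, -, p, -, rfl⟩
  exact Real.sqrt_nonneg _

lemma zeta_zero_le_one (hb : ∀ k, ContDiffOn ℝ (1 : ℕ) (b k) unitSquare) :
    zeta b 0 ≤ zeta b 1 := by
  refine csSup_le_csSup (zeta_bddAbove hb le_rfl)
    ⟨_, (0, 0), le_rfl, (0, 0), by simp [unitSquare], rfl⟩ ?_
  rintro r ⟨a, ha, p, hp, rfl⟩
  exact ⟨a, by omega, p, hp, rfl⟩

/-- Testing a vector against itself turns a bound on scalar functionals into a bound on its norm. In
this way the scalar mean value inequality suffices for increments of the whole basis, without a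
factor depending on K. -/
lemma l2_sub_le_of_dot {v : Fin K → ℝ} {B : ℝ} (hB : 0 ≤ B) (h : |v ⬝ᵥ v| ≤ l2 v * B) :
    l2 v ≤ B := by
  rw [← l2_sq_eq_dot, abs_of_nonneg (sq_nonneg _), sq] at h
  rcases (l2_nonneg v).eq_or_lt with h0 | h0
  · rw [← h0]; exact hB
  · exact le_of_mul_le_mul_left h h0

/-- The basis is Lipschitz with constant `ζ₁`. -/
lemma l2_basis_sub_le (hb : ∀ k, ContDiffOn ℝ (1 : ℕ) (b k) unitSquare) {p p' : ℝ × ℝ}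
    (hp : p ∈ unitSquare) (hp' : p' ∈ unitSquare) :
    l2 ((fun k => b k p) - fun k => b k p') ≤ zeta b 1 * (|p.1 - p'.1| + |p.2 - p'.2|) := by
  have h_fst : l2 ((fun k => b k (p.1, p.2)) - fun k => b k (p'.1, p.2))
      ≤ zeta b 1 * |p.1 - p'.1| := by
    refine l2_sub_le_of_dot (mul_nonneg (zeta_nonneg b 1) (abs_nonneg _)) ?_
    set v := (fun k => b k (p.1, p.2)) - fun k => b k (p'.1, p.2) with hv
    have hder : ∀ t ∈ Icc (0 : ℝ) 1, HasDerivWithinAt (fun t => v ⬝ᵥ fun k => b k (t, p.2))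
        (v ⬝ᵥ fun k => pd (1, 0) (b k) (t, p.2)) (Icc 0 1) t := fun t ht => by
      simp only [dotProduct]
      refine HasDerivWithinAt.fun_sum fun k _ => ?_
      exact (hasDerivWithinAt_pd1 le_rfl (hb k) (p := (t, p.2)) ⟨ht, hp.2⟩).const_mul (v k)
    have := (convex_Icc (0 : ℝ) 1).norm_image_sub_le_of_norm_hasDerivWithin_le
      (C := l2 v * zeta b 1) hder (fun t ht => (abs_dot_le _ _).trans
        (mul_le_mul_of_nonneg_left (l2_pd_le_zeta (a := (1, 0)) hb le_rfl le_rfl ⟨ht, hp.2⟩)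
          (l2_nonneg v))) hp'.1 hp.1
    rw [← dotProduct_sub, Real.norm_eq_abs, Real.norm_eq_abs, mul_assoc] at this
    exact this
  have h_snd : l2 ((fun k => b k (p'.1, p.2)) - fun k => b k (p'.1, p'.2))
      ≤ zeta b 1 * |p.2 - p'.2| := by
    refine l2_sub_le_of_dot (mul_nonneg (zeta_nonneg b 1) (abs_nonneg _)) ?_
    set v := (fun k => b k (p'.1, p.2)) - fun k => b k (p'.1, p'.2) with hv
    have hder : ∀ t ∈ Icc (0 : ℝ) 1, HasDerivWithinAt (fun t => v ⬝ᵥ fun k => b k (p'.1, t))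
        (v ⬝ᵥ fun k => pd (0, 1) (b k) (p'.1, t)) (Icc 0 1) t := fun t ht => by
      simp only [dotProduct]
      refine HasDerivWithinAt.fun_sum fun k _ => ?_
      exact (hasDerivWithinAt_pd2 le_rfl (hb k) (p := (p'.1, t)) ⟨hp'.1, ht⟩).const_mul (v k)
    have := (convex_Icc (0 : ℝ) 1).norm_image_sub_le_of_norm_hasDerivWithin_le
      (C := l2 v * zeta b 1) hder (fun t ht => (abs_dot_le _ _).trans
        (mul_le_mul_of_nonneg_left (l2_pd_le_zeta (a := (0, 1)) hb le_rfl le_rfl ⟨hp'.1, ht⟩)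
          (l2_nonneg v))) hp'.2 hp.2
    rw [← dotProduct_sub, Real.norm_eq_abs, Real.norm_eq_abs, mul_assoc] at this
    exact this
  have e : (fun k => b k p) - (fun k => b k p')
      = ((fun k => b k (p.1, p.2)) - fun k => b k (p'.1, p.2))
        + ((fun k => b k (p'.1, p.2)) - fun k => b k (p'.1, p'.2)) := by simp
  rw [e, mul_add]
  exact (l2_add_le _ _).trans (add_le_add h_fst h_snd)

end Zeta

/-! ### The sample as a noisy sample -/

namespace Model

variable {Ω₀ Ω : Type*} [MeasurableSpace Ω₀] [MeasurableSpace Ω] {dX dZ : ℕ}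
  {M : Model Ω₀ dX dZ} {μ₀ : Measure Ω₀} [IsProbabilityMeasure μ₀] {μ : Measure Ω}
  {Z : ℕ → Ω → Obs dX dZ}

lemma meas_err (hgame : M.ParametricGame μ₀) (hlaw : ∀ i, IdentDistrib (Z i) M.obs μ μ₀)
    (hg : ContinuousOn (M.g10 μ₀) unitSquare) : AEMeasurable (M.err μ₀) μ₀ :=
  (hgame.meas_errObs hg).comp_aemeasurable (hlaw 0).aemeasurable_snd

/-- Independence over i and the common joint law come from the i.i.d. sample, and disintegration
over the design supplies the conditional laws. Their centring is the vanishing of the error's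
integral over every design event, and the moment bound is the assumption on E[e⁴ | W, D]. -/
lemma exists_noisySample [IsProbabilityMeasure μ] (hind : iIndepFun Z μ)
    (hlaw : ∀ i, IdentDistrib (Z i) M.obs μ μ₀) (hgame : M.ParametricGame μ₀)
    (hlin : M.LinearOutcome μ₀) (hg : ContinuousOn (M.g10 μ₀) unitSquare)
    (hmom : M.BoundedFourthMoment μ₀) :
    ∃ C, NoisySample μ (fun i ω => (Z i ω).2) (fun i ω => M.errObs μ₀ (Z i ω))
      (μ₀.map M.design) (condDistrib (M.err μ₀) M.design μ₀) C := by
  obtain ⟨hint4, C, hC⟩ := hmom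
  have hmerr := meas_err hgame hlaw hg
  have hΨ : Measurable fun o : Obs dX dZ => (o.2, M.errObs μ₀ o) :=
    measurable_snd.prodMk (hgame.meas_errObs hg)
  have hint : Integrable (M.err μ₀) μ₀ := by
    refine ((integrable_const 1).add hint4).mono' hmerr.aestronglyMeasurable
      (ae_of_all _ fun ω => ?_)
    simp only [Pi.add_apply, Real.norm_eq_abs]
    have h1 : |M.err μ₀ ω| ^ 2 ≤ 1 + M.err μ₀ ω ^ 4 := by
      rw [sq_abs]; nlinarith [sq_nonneg (M.err μ₀ ω ^ 2 - 1), sq_nonneg (M.err μ₀ ω ^ 2)]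
    nlinarith [sq_nonneg (|M.err μ₀ ω| - 1), sq_nonneg (M.err μ₀ ω ^ 2 - 1)]
  have hpair : Measurable M.design := hgame.meas_design
  refine ⟨C, ⟨fun i => hΨ.comp_aemeasurable (hlaw i).aemeasurable_fst, fun n => ?_, ?_⟩⟩
  · have hZn : iIndepFun (fun (i : Fin n) ω => ((Z i ω).2, M.errObs μ₀ (Z i ω))) μ :=
      (hind.precomp (g := fun i : Fin n => (i : ℕ)) Fin.val_injective).comp
        (fun _ o => (o.2, M.errObs μ₀ o)) fun _ => hΨ
    refine Eq.trans (hZn.map_fun_eq_pi_map fun i : Fin n =>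
      hΨ.comp_aemeasurable (hlaw i).aemeasurable_fst) ?_
    congr 1
    funext i
    rw [compProd_map_condDistrib hmerr]
    have h1 : μ.map (fun ω => ((Z i ω).2, M.errObs μ₀ (Z i ω)))
        = (μ.map (Z i)).map fun o => (o.2, M.errObs μ₀ o) :=
      (AEMeasurable.map_map_of_aemeasurable hΨ.aemeasurable (hlaw i).aemeasurable_fst).symm
    rw [h1, (hlaw i).map_eq,
      AEMeasurable.map_map_of_aemeasurable hΨ.aemeasurable (hlaw i).aemeasurable_snd]
    rfl
  · have hm4 : MeasurableSet {z | ∫ e, e ^ 4 ∂(condDistrib (M.err μ₀) M.design μ₀ z) ≤ C} := by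
      refine measurableSet_le ?_ measurable_const
      exact (StronglyMeasurable.integral_condDistrib (f := fun q : Design dX dZ × ℝ => q.2 ^ 4)
        (measurable_snd.pow_const 4).stronglyMeasurable).measurable
    have h4 : ∀ᵐ z ∂(μ₀.map M.design),
        ∫ e, e ^ 4 ∂(condDistrib (M.err μ₀) M.design μ₀ z) ≤ C := by
      rw [ae_map_iff hpair.aemeasurable hm4]
      filter_upwards [hC, condExp_ae_eq_integral_condDistrib hpair hmerr
        (f := fun e => e ^ 4) (measurable_id.pow_const 4).stronglyMeasurable hint4] with ω h1 h2
      rw [← h2]; exact h1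
    have hi4 : ∀ᵐ z ∂(μ₀.map M.design),
        Integrable (fun e => e ^ 4) (condDistrib (M.err μ₀) M.design μ₀ z) := by
      have : Integrable (fun q : Design dX dZ × ℝ => q.2 ^ 4)
          (μ₀.map fun ω => (M.design ω, M.err μ₀ ω)) :=
        (integrable_map_measure (measurable_snd.pow_const 4).aestronglyMeasurable
          (hpair.aemeasurable.prodMk hmerr)).mpr hint4
      exact this.condDistrib_ae_map hmerr
    have h0 : ∀ᵐ z ∂(μ₀.map M.design),
        ∫ e, e ∂(condDistrib (M.err μ₀) M.design μ₀ z) = 0 := by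
      have hi : Integrable (fun z => ∫ e, e ∂(condDistrib (M.err μ₀) M.design μ₀ z))
          (μ₀.map M.design) :=
        Integrable.integral_condDistrib_map (f := fun q : Design dX dZ × ℝ => q.2) hmerr <|
          (integrable_map_measure measurable_snd.aestronglyMeasurable
            (hpair.aemeasurable.prodMk hmerr)).mpr hint
      refine hi.ae_eq_zero_of_forall_setIntegral_eq_zero fun B hB _ => ?_
      rw [← setIntegral_preimage_eq_condDistrib hpair hint hB]
      exact hgame.setIntegral_err hlin hg hint hB
    filter_upwards [h4, hi4, h0] with z h1 h2 h3
    exact ⟨h2, h3, h1⟩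

end Model

end GameMTE

namespace GameMTE

open Model

/-! ### First-stage quantities near the true parameter -/

/-- `N` is a closed neighbourhood of the true `ρ` on which the copula family is Lipschitz; the true
density is at least `c` on `S^{(1,0)}`. -/
structure LocalCopula {Ω₀ : Type*} [MeasurableSpace Ω₀] {dX dZ : ℕ} (M : Model Ω₀ dX dZ)
    (μ₀ : Measure Ω₀) (N : Set ℝ) (L c : ℝ) : Prop where
  closed : IsClosed N
  subset : N ⊆ Icc M.ρmin M.ρmax
  true_mem : M.θ.2.1 ∈ N
  nhds : N ∈ 𝓝[Icc M.ρmin M.ρmax] M.θ.2.1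
  L_nonneg : 0 ≤ L
  H_lip : ∀ ρ ∈ N, ∀ ρ' ∈ N, ∀ p ∈ unitSquare, |M.H ρ p - M.H ρ' p| ≤ L * |ρ - ρ'|
  h_lip : ∀ ρ ∈ N, ∀ ρ' ∈ N, ∀ p ∈ unitSquare, |M.h ρ p - M.h ρ' p| ≤ L * |ρ - ρ'|
  h_cont : ContinuousOn (M.h M.θ.2.1) unitSquare
  c_pos : 0 < c
  h_ge : ∀ p ∈ M.S10 μ₀, c ≤ M.h M.θ.2.1 p

section

variable {Ω₀ : Type*} [MeasurableSpace Ω₀] {dX dZ : ℕ} {M : Model Ω₀ dX dZ} {μ₀ : Measure Ω₀}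

/-- The neighbourhood is shrunk to a closed ball within the parameter interval so that the event
that an estimate falls into it is measurable. The Lipschitz constant is replaced by its absolute
value because its sign is not part of the assumption. -/
lemma Model.SmoothCopula.exists_local (hcop : M.SmoothCopula μ₀)
    (hρ : M.θ.2.1 ∈ Icc M.ρmin M.ρmax) : ∃ N L c, LocalCopula M μ₀ N L c := by
  obtain ⟨N, hN, L, hH, hh, hc, hpos⟩ := hcop
  obtain ⟨u, hu, hsub⟩ := mem_nhdsWithin_iff_exists_mem_nhds_inter.mp hN
  obtain ⟨r, hr, hball⟩ := Metric.nhds_basis_closedBall.mem_iff.mp hu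
  have hin : Metric.closedBall M.θ.2.1 r ∩ Icc M.ρmin M.ρmax ⊆ N :=
    fun ρ hρ' => hsub ⟨hball hρ'.1, hρ'.2⟩
  have hmem : M.θ.2.1 ∈ Metric.closedBall M.θ.2.1 r ∩ Icc M.ρmin M.ρmax :=
    ⟨Metric.mem_closedBall_self hr.le, hρ⟩
  obtain ⟨c, hc0, hcS⟩ := hpos _ (hin hmem)
  have hLL : ∀ t : ℝ, 0 ≤ t → L * t ≤ |L| * t := fun t ht =>
    mul_le_mul_of_nonneg_right (le_abs_self L) ht
  refine ⟨Metric.closedBall M.θ.2.1 r ∩ Icc M.ρmin M.ρmax, |L|, c, ?_⟩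
  exact
    { closed := Metric.isClosed_closedBall.inter isClosed_Icc
      subset := inter_subset_right
      true_mem := hmem
      nhds := inter_mem (mem_nhdsWithin_of_mem_nhds (Metric.closedBall_mem_nhds _ hr))
        self_mem_nhdsWithin
      L_nonneg := abs_nonneg L
      H_lip := fun ρ h1 ρ' h2 p hp => (hH ρ (hin h1) ρ' (hin h2) p hp).trans (hLL _ (abs_nonneg _))
      h_lip := fun ρ h1 ρ' h2 p hp => (hh ρ (hin h1) ρ' (hin h2) p hp).trans (hLL _ (abs_nonneg _))
      h_cont := hc _ (hin hmem)
      c_pos := hc0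
      h_ge := hcS }

variable [IsProbabilityMeasure μ₀]

lemma L10_mem (hgame : M.ParametricGame μ₀) {θ : Param dX dZ} (hθ : θ.2.1 ∈ Icc M.ρmin M.ρmax)
    (w : Fin 2 → WVec dX dZ) : M.L10 μ₀ θ w ∈ Icc (0 : ℝ) 1 :=
  (hgame.copula _ hθ).fst_sub_H_mem (M.P10_mem μ₀ θ w)

namespace LocalCopula

variable {N : Set ℝ} {L c : ℝ}

/-- Joint continuity in ρ and p makes the choice probabilities measurable at an estimated parameter.
It combines the Lipschitz bound in ρ with the automatic Lipschitz bound of a copula in its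
arguments. -/
lemma continuousOn_H (hloc : LocalCopula M μ₀ N L c) (hgame : M.ParametricGame μ₀) :
    ContinuousOn (fun q : ℝ × (ℝ × ℝ) => M.H q.1 q.2) (N ×ˢ unitSquare) := by
  have hL := hloc.L_nonneg
  have : LipschitzOnWith (Real.toNNReal (L + 2)) (fun q : ℝ × (ℝ × ℝ) => M.H q.1 q.2)
      (N ×ˢ unitSquare) := by
    refine LipschitzOnWith.of_dist_le_mul fun q hq q' hq' => ?_
    rw [Real.dist_eq, Real.coe_toNNReal _ (by positivity)]
    have h1 := hloc.H_lip q.1 hq.1 q'.1 hq'.1 q.2 hq.2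
    have h2 := (hgame.copula _ (hloc.subset hq'.1)).abs_H_sub_le hq.2 hq'.2
    have d0 : |q.1 - q'.1| ≤ dist q q' := by
      rw [Prod.dist_eq, Real.dist_eq]; exact le_max_left _ _
    have d1 : dist q.2 q'.2 ≤ dist q q' := by rw [Prod.dist_eq (x := q)]; exact le_max_right _ _
    have d2 : |q.2.1 - q'.2.1| ≤ dist q.2 q'.2 := by
      rw [Prod.dist_eq, Real.dist_eq]; exact le_max_left _ _
    have d3 : |q.2.2 - q'.2.2| ≤ dist q.2 q'.2 := by
      rw [Prod.dist_eq, Real.dist_eq q.2.2]; exact le_max_right _ _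
    calc |M.H q.1 q.2 - M.H q'.1 q'.2|
        = |(M.H q.1 q.2 - M.H q'.1 q.2) + (M.H q'.1 q.2 - M.H q'.1 q'.2)| := by ring_nf
      _ ≤ L * |q.1 - q'.1| + (|q.2.1 - q'.2.1| + |q.2.2 - q'.2.2|) :=
          (abs_add_le _ _).trans (add_le_add h1 h2)
      _ ≤ L * dist q q' + (dist q q' + dist q q') := by
          gcongr <;> linarith
      _ = _ := by ring
  exact this.continuousOn

variable {α : Type*} [MeasurableSpace α] {t : α → Param dX dZ} {w : α → Fin 2 → WVec dX dZ}

lemma measurable_L10 (hloc : LocalCopula M μ₀ N L c) (hgame : M.ParametricGame μ₀)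
    (ht : Measurable t) (htN : ∀ a, (t a).2.1 ∈ N) (hw : Measurable w) :
    Measurable fun a => M.L10 μ₀ (t a) (w a) :=
  (measurable_P hgame.meas_η μ₀ ht hw 0 false).sub
    (measurable_comp_of_continuousOn (f := fun q : ℝ × (ℝ × ℝ) => M.H q.1 q.2)
      (hloc.continuousOn_H hgame) (ht.snd.fst.prodMk (measurable_P10 hgame.meas_η μ₀ ht hw))
      fun a => ⟨htN a, M.P10_mem μ₀ _ _⟩)

lemma measurable_tau (hloc : LocalCopula M μ₀ N L c) (hgame : M.ParametricGame μ₀)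
    {ϖ : ℝ} {τ : ℝ → ℝ} (hτ : IsTrimming ϖ τ)
    (ht : Measurable t) (htN : ∀ a, (t a).2.1 ∈ N) (hw : Measurable w) :
    Measurable fun a => τ (M.L10 μ₀ (t a) (w a)) :=
  measurable_comp_of_continuousOn hτ.contDiff.continuousOn (hloc.measurable_L10 hgame ht htN hw)
    fun a => L10_mem hgame (hloc.subset (htN a)) _

lemma measurable_regressor (hloc : LocalCopula M μ₀ N L c) (hgame : M.ParametricGame μ₀)
    {ϖ : ℝ} {τ : ℝ → ℝ} (hτ : IsTrimming ϖ τ) {K : ℕ} {b : Fin K → ℝ × ℝ → ℝ}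
    (hb : ∀ k, ContinuousOn (b k) unitSquare)
    (ht : Measurable t) (htN : ∀ a, (t a).2.1 ∈ N) {z : α → Design dX dZ} (hz : Measurable z)
    (l : Fin dX ⊕ Fin K) : Measurable fun a => regressor M μ₀ τ b (t a) (z a) l := by
  have hw : Measurable fun a => (z a).2 := measurable_snd.comp hz
  have hI : Measurable fun a => trimI M μ₀ τ (t a) (z a) :=
    (hloc.measurable_tau hgame hτ ht htN hw).mul (measurable_I10.comp hz)
  cases l with
  | inl k => exact hI.mul ((measurable_pi_apply k).comp (measurable_covX hw 0))
  | inr k =>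
    exact (hI.div (hloc.measurable_L10 hgame ht htN hw)).mul
      (measurable_comp_of_continuousOn (hb k) (measurable_P10 hgame.meas_η μ₀ ht hw)
        fun a => M.P10_mem μ₀ _ _)

/-- First-stage error in the choice probability. -/
lemma abs_L10_sub_le (hloc : LocalCopula M μ₀ N L c) (hgame : M.ParametricGame μ₀)
    {θ : Param dX dZ} (hθ : θ.2.1 ∈ N) {w : Fin 2 → WVec dX dZ} {δ : ℝ}
    (hP : ∀ j d, |M.P μ₀ θ w j d - M.P μ₀ M.θ w j d| ≤ δ) (hρ : |θ.2.1 - M.θ.2.1| ≤ δ) :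
    |M.L10 μ₀ θ w - M.L10 μ₀ M.θ w| ≤ (3 + L) * δ := by
  have h0 := hP 0 false
  have h1 := hP 1 true
  -- In the constant 3 + L, one unit comes from P₁⁰ itself, two from the arguments of the copula,
  -- and L from its parameter.
  have h2 := (hgame.copula _ (hloc.subset hθ)).abs_H_sub_le (M.P10_mem μ₀ θ w) (M.P10_mem μ₀ M.θ w)
  have h3 := hloc.H_lip _ hθ _ hloc.true_mem _ (M.P10_mem μ₀ M.θ w)
  have h4 : L * |θ.2.1 - M.θ.2.1| ≤ L * δ := mul_le_mul_of_nonneg_left hρ hloc.L_nonneg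
  have e1 : (M.P10 μ₀ θ w).1 = M.P μ₀ θ w 0 false := rfl
  have e2 : (M.P10 μ₀ θ w).2 = M.P μ₀ θ w 1 true := rfl
  have e3 : (M.P10 μ₀ M.θ w).1 = M.P μ₀ M.θ w 0 false := rfl
  have e4 : (M.P10 μ₀ M.θ w).2 = M.P μ₀ M.θ w 1 true := rfl
  rw [e1, e2, e3, e4] at h2
  have h2' := abs_le.mp (h2.trans (add_le_add h0 h1))
  have h3' := abs_le.mp (h3.trans h4)
  have h0' := abs_le.mp h0
  unfold L10
  rw [abs_le]
  constructor <;> linarith [h0'.1, h0'.2, h2'.1, h2'.2, h3'.1, h3'.2]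

end LocalCopula

/-! ### Regressors and the regression equation -/

section Regressor

variable {ϖ : ℝ} {τ : ℝ → ℝ} {K : ℕ} {b : Fin K → ℝ × ℝ → ℝ}

lemma trimI_mem (hgame : M.ParametricGame μ₀) (hτ : IsTrimming ϖ τ) {θ : Param dX dZ}
    (hθ : θ.2.1 ∈ Icc M.ρmin M.ρmax) (z : Design dX dZ) :
    trimI M μ₀ τ θ z ∈ Icc (0 : ℝ) 1 := by
  have h1 := hτ.maps (L10_mem hgame hθ z.2)
  have h2 := I10_mem z
  exact ⟨mul_nonneg h1.1 h2.1, mul_le_one₀ h1.2 h2.1 h2.2⟩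

lemma trimT_eq (θ : Param dX dZ) (z : Design dX dZ) :
    trimT M μ₀ τ θ z = τ (M.L10 μ₀ θ z.2) / M.L10 μ₀ θ z.2 * I10 z := by
  simp only [trimT, trimI]; ring

lemma trimT_mem (hgame : M.ParametricGame μ₀) (hτ : IsTrimming ϖ τ) {θ : Param dX dZ}
    (hθ : θ.2.1 ∈ Icc M.ρmin M.ρmax) (z : Design dX dZ) :
    trimT M μ₀ τ θ z ∈ Icc 0 ϖ⁻¹ := by
  have h1 := hτ.div_mem (L10_mem hgame hθ z.2)
  have h2 := I10_mem z
  rw [trimT_eq]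
  exact ⟨mul_nonneg h1.1 h2.1, by nlinarith [h1.1, h1.2, h2.1, h2.2]⟩

lemma l2_regressor_inr_le (hgame : M.ParametricGame μ₀) (hτ : IsTrimming ϖ τ)
    (hb : ∀ k, ContDiffOn ℝ (1 : ℕ) (b k) unitSquare) {θ : Param dX dZ}
    (hθ : θ.2.1 ∈ Icc M.ρmin M.ρmax) (z : Design dX dZ) :
    l2 (fun k => regressor M μ₀ τ b θ z (Sum.inr k)) ≤ ϖ⁻¹ * zeta b 0 := by
  have e : (fun k => regressor M μ₀ τ b θ z (Sum.inr k))
      = trimT M μ₀ τ θ z • fun k => b k (M.P10 μ₀ θ z.2) := rfl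
  have h := trimT_mem hgame hτ hθ z
  rw [e, l2_smul, abs_of_nonneg h.1]
  exact mul_le_mul h.2 (l2_le_zeta hb (M.P10_mem μ₀ θ z.2)) (l2_nonneg _) (h.1.trans h.2)

lemma l2_regressor_inl_le (hgame : M.ParametricGame μ₀) (hτ : IsTrimming ϖ τ) {θ : Param dX dZ}
    (hθ : θ.2.1 ∈ Icc M.ρmin M.ρmax) (z : Design dX dZ) :
    l2 (fun k => regressor M μ₀ τ b θ z (Sum.inl k)) ≤ l2 (covX z.2 0) := by
  have e : (fun k => regressor M μ₀ τ b θ z (Sum.inl k)) = trimI M μ₀ τ θ z • covX z.2 0 := rfl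
  have h := trimI_mem hgame hτ hθ z
  rw [e, l2_smul, abs_of_nonneg h.1]
  exact mul_le_of_le_one_left (l2_nonneg _) h.2

lemma sum_sq_eq_inl_add_inr {ι κ : Type*} [Fintype ι] [Fintype κ] (v : ι ⊕ κ → ℝ) :
    l2 v ^ 2 = l2 (fun i => v (Sum.inl i)) ^ 2 + l2 (fun k => v (Sum.inr k)) ^ 2 := by
  rw [l2_sq, l2_sq, l2_sq, Fintype.sum_sum_type]

lemma l2_regressor_sq_le (hgame : M.ParametricGame μ₀) (hτ : IsTrimming ϖ τ)
    (hb : ∀ k, ContDiffOn ℝ (1 : ℕ) (b k) unitSquare) {θ : Param dX dZ}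
    (hθ : θ.2.1 ∈ Icc M.ρmin M.ρmax) (z : Design dX dZ) :
    l2 (regressor M μ₀ τ b θ z) ^ 2 ≤ l2 (covX z.2 0) ^ 2 + (ϖ⁻¹ * zeta b 0) ^ 2 := by
  rw [sum_sq_eq_inl_add_inr]
  exact add_le_add (pow_le_pow_left₀ (l2_nonneg _) (l2_regressor_inl_le hgame hτ hθ z) 2)
    (pow_le_pow_left₀ (l2_nonneg _) (l2_regressor_inr_le hgame hτ hb hθ z) 2)

/-- First-stage error in the regressors. -/
lemma exists_regressor_lipschitz (hgame : M.ParametricGame μ₀) (hτ : IsTrimming ϖ τ) {N : Set ℝ}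
    {L c : ℝ} (hloc : LocalCopula M μ₀ N L c) :
    ∃ C, 0 ≤ C ∧ ∀ {K : ℕ} {b : Fin K → ℝ × ℝ → ℝ},
      (∀ k, ContDiffOn ℝ (1 : ℕ) (b k) unitSquare) → ∀ {θ : Param dX dZ}, θ.2.1 ∈ N →
      ∀ {z : Design dX dZ} {δ : ℝ}, 0 ≤ δ → (∀ j d, |M.P μ₀ θ z.2 j d - M.P μ₀ M.θ z.2 j d| ≤ δ) →
        |θ.2.1 - M.θ.2.1| ≤ δ →
        l2 (regressor M μ₀ τ b θ z - regressor M μ₀ τ b M.θ z) ^ 2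
          ≤ (C * δ) ^ 2 * (l2 (covX z.2 0) ^ 2 + zeta b 1 ^ 2) := by
  obtain ⟨C₁, hC₁, hl₁⟩ := hτ.exists_lipschitz
  obtain ⟨C₂, hC₂, hl₂⟩ := hτ.exists_lipschitz_div
  have hL := hloc.L_nonneg
  have hϖ : 0 < ϖ⁻¹ := inv_pos.mpr hτ.pos
  refine ⟨C₁ * (3 + L) + (C₂ * (3 + L) + ϖ⁻¹ * 2), by positivity, ?_⟩
  intro K b hb θ hθ z δ hδ hP hρ
  have hLd := hloc.abs_L10_sub_le hgame hθ hP hρ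
  have hm := L10_mem hgame (hloc.subset hθ) z.2
  have hm' := L10_mem hgame hgame.ρ_mem z.2
  have hI := I10_mem z
  have dI : |trimI M μ₀ τ θ z - trimI M μ₀ τ M.θ z| ≤ C₁ * (3 + L) * δ := by
    rw [trimI, trimI, ← sub_mul, abs_mul, abs_of_nonneg hI.1, mul_assoc]
    calc _ ≤ |τ (M.L10 μ₀ θ z.2) - τ (M.L10 μ₀ M.θ z.2)| * 1 := by gcongr; exact hI.2
      _ ≤ _ := by
        rw [mul_one]
        exact (hl₁ _ hm _ hm').trans (mul_le_mul_of_nonneg_left hLd hC₁)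
  have dT : |trimT M μ₀ τ θ z - trimT M μ₀ τ M.θ z| ≤ C₂ * (3 + L) * δ := by
    rw [trimT_eq, trimT_eq, ← sub_mul, abs_mul, abs_of_nonneg hI.1, mul_assoc]
    calc _ ≤ |τ (M.L10 μ₀ θ z.2) / M.L10 μ₀ θ z.2 - τ (M.L10 μ₀ M.θ z.2) / M.L10 μ₀ M.θ z.2| * 1 := by
          gcongr; exact hI.2
      _ ≤ _ := by
        rw [mul_one]
        exact (hl₂ _ hm _ hm').trans (mul_le_mul_of_nonneg_left hLd hC₂)
  have hz0 := zeta_nonneg b 0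
  have hz01 := zeta_zero_le_one hb
  have e1 : l2 (fun k => (regressor M μ₀ τ b θ z - regressor M μ₀ τ b M.θ z) (Sum.inl k))
      ≤ C₁ * (3 + L) * δ * l2 (covX z.2 0) := by
    have e : (fun k => (regressor M μ₀ τ b θ z - regressor M μ₀ τ b M.θ z) (Sum.inl k))
        = (trimI M μ₀ τ θ z - trimI M μ₀ τ M.θ z) • covX z.2 0 := by
      funext k
      simp only [regressor, Pi.sub_apply, Sum.elim_inl, Pi.smul_apply, smul_eq_mul]
      ring
    rw [e, l2_smul]
    exact mul_le_mul_of_nonneg_right dI (l2_nonneg _)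
  have e2 : l2 (fun k => (regressor M μ₀ τ b θ z - regressor M μ₀ τ b M.θ z) (Sum.inr k))
      ≤ (C₂ * (3 + L) + ϖ⁻¹ * 2) * δ * zeta b 1 := by
    set v := fun k => b k (M.P10 μ₀ θ z.2)
    set v' := fun k => b k (M.P10 μ₀ M.θ z.2)
    -- The change of the weight multiplies a basis vector of length at most ζ₀ ≤ ζ₁, and the change
    -- of the basis vector is at most ζ₁ · 2δ; so ζ₁ controls both.
    have e : (fun k => (regressor M μ₀ τ b θ z - regressor M μ₀ τ b M.θ z) (Sum.inr k))
        = (trimT M μ₀ τ θ z - trimT M μ₀ τ M.θ z) • v' + trimT M μ₀ τ θ z • (v - v') := by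
      funext k
      simp only [regressor, Pi.sub_apply, Sum.elim_inr, Pi.smul_apply, smul_eq_mul, Pi.add_apply,
        v, v']
      ring
    have hT := trimT_mem hgame hτ (hloc.subset hθ) z
    have hv' : l2 v' ≤ zeta b 1 := (l2_le_zeta hb (M.P10_mem μ₀ M.θ z.2)).trans hz01
    have hvv : l2 (v - v') ≤ zeta b 1 * (2 * δ) := by
      refine (l2_basis_sub_le hb (M.P10_mem μ₀ θ z.2) (M.P10_mem μ₀ M.θ z.2)).trans ?_
      refine mul_le_mul_of_nonneg_left ?_ (zeta_nonneg b 1)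
      have h0 : |(M.P10 μ₀ θ z.2).1 - (M.P10 μ₀ M.θ z.2).1| ≤ δ := hP 0 false
      have h1 : |(M.P10 μ₀ θ z.2).2 - (M.P10 μ₀ M.θ z.2).2| ≤ δ := hP 1 true
      linarith
    rw [e]
    calc _ ≤ _ := l2_add_le _ _
      _ ≤ C₂ * (3 + L) * δ * zeta b 1 + ϖ⁻¹ * (zeta b 1 * (2 * δ)) := by
          rw [l2_smul, l2_smul, abs_of_nonneg hT.1]
          gcongr
          · exact l2_nonneg _
          · exact l2_nonneg _
          · exact hT.2
      _ = _ := by ring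
  rw [sum_sq_eq_inl_add_inr, mul_add, ← mul_pow, ← mul_pow]
  refine add_le_add (pow_le_pow_left₀ (l2_nonneg _) (e1.trans ?_) 2)
    (pow_le_pow_left₀ (l2_nonneg _) (e2.trans ?_) 2)
  · refine mul_le_mul_of_nonneg_right (mul_le_mul_of_nonneg_right ?_ hδ) (l2_nonneg _)
    exact le_add_of_nonneg_right (by positivity)
  · refine mul_le_mul_of_nonneg_right (mul_le_mul_of_nonneg_right ?_ hδ) (zeta_nonneg b 1)
    exact le_add_of_nonneg_left (by positivity)

/-- Part of the regression error due to the estimated choice probabilities. -/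
def firstStageErr (M : Model Ω₀ dX dZ) (μ₀ : Measure Ω₀) [IsProbabilityMeasure μ₀] (τ : ℝ → ℝ)
    (θ : Param dX dZ) (z : Design dX dZ) : ℝ :=
  trimI M μ₀ τ θ z * (M.g10 μ₀ (M.P10 μ₀ M.θ z.2) / M.L10 μ₀ M.θ z.2
    - M.g10 μ₀ (M.P10 μ₀ θ z.2) / M.L10 μ₀ θ z.2)

/-- Approximation error of the sieve, weighted by `τ(L)/L`. -/
def sieveErr (M : Model Ω₀ dX dZ) (μ₀ : Measure Ω₀) [IsProbabilityMeasure μ₀] (τ : ℝ → ℝ)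
    (b : Fin K → ℝ × ℝ → ℝ) (α : Fin K → ℝ) (θ : Param dX dZ) (w : Fin 2 → WVec dX dZ) : ℝ :=
  τ (M.L10 μ₀ θ w) / M.L10 μ₀ θ w *
    (M.g10 μ₀ (M.P10 μ₀ θ w) - ∑ k, b k (M.P10 μ₀ θ w) * α k)

/-- The regression equation at an arbitrary first-stage parameter. -/
lemma response_eq (θ : Param dX dZ) (α : Fin K → ℝ) (o : Obs dX dZ) :
    trimI M μ₀ τ θ o.2 * o.1 0
      = regressor M μ₀ τ b θ o.2 ⬝ᵥ Sum.elim (M.β 0 true false) α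
        + firstStageErr M μ₀ τ θ o.2 + I10 o.2 * sieveErr M μ₀ τ b α θ o.2.2
        + τ (M.L10 μ₀ θ o.2.2) * M.errObs μ₀ o := by
  have hdot : regressor M μ₀ τ b θ o.2 ⬝ᵥ Sum.elim (M.β 0 true false) α
      = trimI M μ₀ τ θ o.2 * (covX o.2.2 0 ⬝ᵥ M.β 0 true false)
        + trimT M μ₀ τ θ o.2 * ∑ k, b k (M.P10 μ₀ θ o.2.2) * α k := by
    simp only [dotProduct, regressor, Fintype.sum_sum_type, Sum.elim_inl, Sum.elim_inr,
      Finset.mul_sum, mul_assoc]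
  rw [hdot, firstStageErr, sieveErr, errObs, trimT_eq]
  simp only [trimI]
  ring

lemma abs_sieveErr_le (hgame : M.ParametricGame μ₀) (hτ : IsTrimming ϖ τ) {α : Fin K → ℝ}
    {θ : Param dX dZ} (hθ : θ.2.1 ∈ Icc M.ρmin M.ρmax) {A : ℝ}
    (hA : ∀ p ∈ unitSquare, |M.g10 μ₀ p - ∑ k, b k p * α k| ≤ A) (w : Fin 2 → WVec dX dZ) :
    |sieveErr M μ₀ τ b α θ w| ≤ ϖ⁻¹ * A := by
  have h := hτ.div_mem (L10_mem hgame hθ w)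
  rw [sieveErr, abs_mul, abs_of_nonneg h.1]
  exact mul_le_mul h.2 (hA _ (M.P10_mem μ₀ θ w)) (abs_nonneg _) (h.1.trans h.2)

lemma exists_g10_lipschitz {g : ℝ × ℝ → ℝ} (hg : ContDiffOn ℝ (1 : ℕ) g unitSquare) :
    ∃ B, 0 ≤ B ∧ (∀ p ∈ unitSquare, |g p| ≤ B) ∧ ∀ p ∈ unitSquare, ∀ p' ∈ unitSquare,
      |g p - g p'| ≤ B * (|p.1 - p'.1| + |p.2 - p'.2|) := by
  -- A single smooth function is treated as a basis with one element.
  set b : Fin 1 → ℝ × ℝ → ℝ := fun _ => g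
  have hb : ∀ k, ContDiffOn ℝ (1 : ℕ) (b k) unitSquare := fun _ => hg
  refine ⟨zeta b 1, zeta_nonneg b 1, fun p hp => ?_, fun p hp p' hp' => ?_⟩
  · exact (abs_le_l2 (fun k => b k p) 0).trans ((l2_le_zeta hb hp).trans (zeta_zero_le_one hb))
  · exact (abs_le_l2 ((fun k => b k p) - fun k => b k p') 0).trans (l2_basis_sub_le hb hp hp')

/-- Trimming at the estimated parameter either removes the observation or ensures L̂ > ϖ. The
smallness of δ then keeps the true L above ϖ / 2, so the difference of the quotients g / L is of
order δ. -/
lemma exists_abs_firstStageErr_le (hgame : M.ParametricGame μ₀) (hτ : IsTrimming ϖ τ) {N : Set ℝ}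
    {L c : ℝ} (hloc : LocalCopula M μ₀ N L c) (hg : ContDiffOn ℝ (1 : ℕ) (M.g10 μ₀) unitSquare) :
    ∃ C, 0 ≤ C ∧ ∀ {θ : Param dX dZ}, θ.2.1 ∈ N → ∀ {z : Design dX dZ} {δ : ℝ}, 0 ≤ δ →
      (3 + L) * δ ≤ ϖ / 2 → (∀ j d, |M.P μ₀ θ z.2 j d - M.P μ₀ M.θ z.2 j d| ≤ δ) →
      |θ.2.1 - M.θ.2.1| ≤ δ → |firstStageErr M μ₀ τ θ z| ≤ C * δ := by
  obtain ⟨B, hB, hgB, hgL⟩ := exists_g10_lipschitz hg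
  have hL := hloc.L_nonneg
  have hϖ := hτ.pos
  refine ⟨2 / ϖ * (B * 2) + B * (2 / ϖ ^ 2) * (3 + L), by positivity, ?_⟩
  intro θ hθ z δ hδ hsmall hP hρ
  have hLd := hloc.abs_L10_sub_le hgame hθ hP hρ
  have hm := L10_mem hgame (hloc.subset hθ) z.2
  have hI := trimI_mem hgame hτ (hloc.subset hθ) z
  rcases le_or_gt (M.L10 μ₀ θ z.2) ϖ with h | h
  · have : trimI M μ₀ τ θ z = 0 := by rw [trimI, hτ.zero_of_le hm h, zero_mul]
    rw [firstStageErr, this, zero_mul, abs_zero]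
    positivity
  set ℓ := M.L10 μ₀ M.θ z.2 with hℓ
  set ℓ' := M.L10 μ₀ θ z.2 with hℓ'
  have hl2 : ϖ / 2 ≤ ℓ := by linarith [(abs_le.mp hLd).2]
  have hl0 : 0 < ℓ := lt_of_lt_of_le (by positivity) hl2
  have hl0' : 0 < ℓ' := hϖ.trans h
  set γ := M.g10 μ₀ (M.P10 μ₀ M.θ z.2)
  set γ' := M.g10 μ₀ (M.P10 μ₀ θ z.2)
  have hγ : |γ - γ'| ≤ B * (2 * δ) := by
    rw [abs_sub_comm]
    refine (hgL _ (M.P10_mem μ₀ θ z.2) _ (M.P10_mem μ₀ M.θ z.2)).trans ?_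
    refine mul_le_mul_of_nonneg_left ?_ hB
    have h0 : |(M.P10 μ₀ θ z.2).1 - (M.P10 μ₀ M.θ z.2).1| ≤ δ := hP 0 false
    have h1 : |(M.P10 μ₀ θ z.2).2 - (M.P10 μ₀ M.θ z.2).2| ≤ δ := hP 1 true
    linarith
  have hγ' : |γ'| ≤ B := hgB _ (M.P10_mem μ₀ θ z.2)
  have key : γ / ℓ - γ' / ℓ' = ℓ⁻¹ * (γ - γ') + γ' * (ℓ⁻¹ * ℓ'⁻¹) * (ℓ' - ℓ) := by
    field_simp; ring
  have i1 : ℓ⁻¹ ≤ 2 / ϖ := by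
    rw [← inv_div]; exact inv_anti₀ (by positivity) hl2
  have i2 : ℓ'⁻¹ ≤ ϖ⁻¹ := inv_anti₀ hϖ h.le
  have hl1 : 0 ≤ ℓ⁻¹ := (inv_pos.mpr hl0).le
  have hl1' : 0 ≤ ℓ'⁻¹ := (inv_pos.mpr hl0').le
  rw [firstStageErr, abs_mul, abs_of_nonneg hI.1]
  calc _ ≤ 1 * |γ / ℓ - γ' / ℓ'| := mul_le_mul_of_nonneg_right hI.2 (abs_nonneg _)
    _ ≤ ℓ⁻¹ * |γ - γ'| + |γ'| * (ℓ⁻¹ * ℓ'⁻¹) * |ℓ' - ℓ| := by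
        rw [one_mul, key]
        refine (abs_add_le _ _).trans (le_of_eq ?_)
        rw [abs_mul, abs_mul, abs_mul, abs_of_nonneg hl1, abs_of_nonneg (mul_nonneg hl1 hl1')]
    _ ≤ 2 / ϖ * (B * (2 * δ)) + B * (2 / ϖ * ϖ⁻¹) * ((3 + L) * δ) := by gcongr
    _ = _ := by field_simp

end Regressor

end

end GameMTE

namespace GameMTE

open Model Matrix

/-! ### Linear functionals of least squares coefficients -/

section NoiseWeights

variable {ι κ σ : Type*} [Fintype ι] [Fintype κ] [DecidableEq κ] [Fintype σ] [DecidableEq σ]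

/-- Weights of the observations in the second block of a linear functional `(0, q)` of the least
squares coefficients. -/
def noiseWt (B : Matrix ι (σ ⊕ κ) ℝ) (q : κ → ℝ) (i : ι) : ℝ :=
  ∑ k, B i (Sum.inr k) * ((Bᵀ * B)⁻¹ *ᵥ Sum.elim 0 q) (Sum.inr k)

variable {B : Matrix ι (σ ⊕ κ) ℝ} {c : ℝ}

lemma l2_sumElim_zero (q : κ → ℝ) : l2 (Sum.elim (0 : σ → ℝ) q) = l2 q := by
  have h := l2_sumElim (0 : σ → ℝ) q
  rw [l2_zero] at h
  nlinarith [l2_nonneg (Sum.elim (0 : σ → ℝ) q), l2_nonneg q,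
    sq_nonneg (l2 (Sum.elim (0 : σ → ℝ) q) - l2 q)]

lemma noiseWt_sub (q q' : κ → ℝ) (i : ι) :
    noiseWt B (q - q') i = noiseWt B q i - noiseWt B q' i := by
  have : (Sum.elim 0 (q - q') : σ ⊕ κ → ℝ) = Sum.elim (0 : σ → ℝ) q - Sum.elim (0 : σ → ℝ) q' := by
    funext l; cases l <;> simp
  simp only [noiseWt, this, mulVec_sub, Pi.sub_apply, mul_sub, Finset.sum_sub_distrib]

/-- Only the sieve block has rows bounded by a multiple of ζ₀, since the covariates have mere second
moments. This is why the uniformly bounded weights needed for an exponential inequality are taken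
from that block alone. -/
lemma abs_noiseWt_le (hc : 0 < c) (hB : ∀ v, c * l2 v ^ 2 ≤ l2 (B *ᵥ v) ^ 2) {r : ℝ} {i : ι}
    (hr : l2 (fun k => B i (Sum.inr k)) ≤ r) (q : κ → ℝ) :
    |noiseWt B q i| ≤ r * (c⁻¹ * l2 q) := by
  refine (abs_dot_le (fun k => B i (Sum.inr k))
    fun k => ((Bᵀ * B)⁻¹ *ᵥ Sum.elim 0 q) (Sum.inr k)).trans ?_
  have h := l2_gram_inv_le hc hB (Sum.elim 0 q)
  rw [l2_sumElim_zero] at h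
  exact mul_le_mul hr ((l2_inr_le _).trans h) (l2_nonneg _) ((l2_nonneg _).trans hr)

/-- The weights of both blocks together have squared length at most c⁻¹‖q‖². Subtracting the
covariate block costs a term governed by the second moments of the covariates. -/
lemma sum_noiseWt_sq_le (hc : 0 < c) (hB : ∀ v, c * l2 v ^ 2 ≤ l2 (B *ᵥ v) ^ 2) (q : κ → ℝ) :
    ∑ i, noiseWt B q i ^ 2 ≤ 2 * (c⁻¹ * l2 q ^ 2)
      + 2 * (c⁻¹ * l2 q) ^ 2 * ∑ i, l2 (fun k => B i (Sum.inl k)) ^ 2 := by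
  set w := (Bᵀ * B)⁻¹ *ᵥ Sum.elim 0 q with hw
  have h1 : l2 (B *ᵥ w) ^ 2 ≤ c⁻¹ * l2 q ^ 2 := by
    have := l2_mulVec_gram_inv_le hc hB (Sum.elim 0 q)
    rwa [l2_sumElim_zero] at this
  have h2 : l2 (fun k => w (Sum.inl k)) ≤ c⁻¹ * l2 q := by
    have := l2_gram_inv_le hc hB (Sum.elim 0 q)
    rw [l2_sumElim_zero] at this
    exact (l2_inl_le _).trans this
  have h3 : ∀ i, noiseWt B q i ^ 2 ≤ 2 * (B *ᵥ w) i ^ 2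
      + 2 * (c⁻¹ * l2 q) ^ 2 * l2 (fun k => B i (Sum.inl k)) ^ 2 := by
    intro i
    set y := (fun k => B i (Sum.inl k)) ⬝ᵥ fun k => w (Sum.inl k) with hy
    have e : noiseWt B q i = (B *ᵥ w) i - y := by
      have e' : (B *ᵥ w) i = ∑ k, B i (Sum.inl k) * w (Sum.inl k)
          + ∑ k, B i (Sum.inr k) * w (Sum.inr k) := Fintype.sum_sum_type _
      rw [e', add_comm]
      exact (add_sub_cancel_right _ _).symm
    have hy2 : y ^ 2 ≤ (l2 (fun k => B i (Sum.inl k)) * (c⁻¹ * l2 q)) ^ 2 := by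
      refine sq_le_sq' ?_ ?_ <;>
        nlinarith [abs_le.mp (abs_dot_le (fun k => B i (Sum.inl k)) fun k => w (Sum.inl k)),
          mul_le_mul_of_nonneg_left h2 (l2_nonneg (fun k => B i (Sum.inl k)))]
    rw [e]
    nlinarith [sq_nonneg ((B *ᵥ w) i + y)]
  calc _ ≤ ∑ i, (2 * (B *ᵥ w) i ^ 2
        + 2 * (c⁻¹ * l2 q) ^ 2 * l2 (fun k => B i (Sum.inl k)) ^ 2) :=
        Finset.sum_le_sum fun i _ => h3 i
    _ = 2 * l2 (B *ᵥ w) ^ 2 + 2 * (c⁻¹ * l2 q) ^ 2 * ∑ i, l2 (fun k => B i (Sum.inl k)) ^ 2 := by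
        rw [Finset.sum_add_distrib, ← Finset.mul_sum, ← Finset.mul_sum, ← l2_sq]
    _ ≤ _ := by gcongr

lemma sum_inr_lsq_eq (q : κ → ℝ) (y : ι → ℝ) :
    ∑ k, q k * lsq B y (Sum.inr k)
      = (∑ k, ((Bᵀ * B)⁻¹ *ᵥ Sum.elim 0 q) (Sum.inl k) * (Bᵀ *ᵥ y) (Sum.inl k))
        + ∑ i, noiseWt B q i * y i := by
  set w := (Bᵀ * B)⁻¹ *ᵥ Sum.elim 0 q with hw
  have hsymm : ((Bᵀ * B)⁻¹)ᵀ = (Bᵀ * B)⁻¹ := by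
    rw [Matrix.transpose_nonsing_inv, Matrix.transpose_mul, Matrix.transpose_transpose]
  have e1 : ∑ k, q k * lsq B y (Sum.inr k) = Sum.elim 0 q ⬝ᵥ lsq B y := by
    simp [dotProduct, Fintype.sum_sum_type]
  have e2 : Sum.elim 0 q ⬝ᵥ lsq B y = w ⬝ᵥ (Bᵀ *ᵥ y) := by
    rw [lsq, dotProduct_mulVec, ← mulVec_transpose, hsymm]
  have e3 : ∑ k, w (Sum.inr k) * (Bᵀ *ᵥ y) (Sum.inr k) = ∑ i, noiseWt B q i * y i := by
    have e4 : ∀ i, noiseWt B q i = ∑ k, B i (Sum.inr k) * w (Sum.inr k) := fun i => rfl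
    have e5 : ∀ k, (Bᵀ *ᵥ y) (Sum.inr k) = ∑ i, B i (Sum.inr k) * y i := fun k => rfl
    simp only [e4, e5, Finset.mul_sum, Finset.sum_mul]
    rw [Finset.sum_comm]
    exact Finset.sum_congr rfl fun i _ => Finset.sum_congr rfl fun k _ => by ring
  rw [e1, e2, dotProduct, Fintype.sum_sum_type, e3]

/-- The part through the covariate block is bounded by Cauchy–Schwarz with a score of fixed
dimension. Only the second term requires a maximal inequality over q. -/
lemma abs_sum_inr_lsq_le (hc : 0 < c) (hB : ∀ v, c * l2 v ^ 2 ≤ l2 (B *ᵥ v) ^ 2) (q : κ → ℝ)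
    (y : ι → ℝ) :
    |∑ k, q k * lsq B y (Sum.inr k)|
      ≤ c⁻¹ * l2 q * l2 (fun k => (Bᵀ *ᵥ y) (Sum.inl k)) + |∑ i, noiseWt B q i * y i| := by
  rw [sum_inr_lsq_eq]
  refine (abs_add_le _ _).trans (add_le_add ?_ le_rfl)
  refine (abs_dot_le (fun k => ((Bᵀ * B)⁻¹ *ᵥ Sum.elim 0 q) (Sum.inl k)) _).trans ?_
  have h := l2_gram_inv_le hc hB (Sum.elim 0 q)
  rw [l2_sumElim_zero] at h
  exact mul_le_mul_of_nonneg_right ((l2_inl_le _).trans h) (l2_nonneg _)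

lemma l2_lsq_le_gram (hc : 0 < c) (hB : ∀ v, c * l2 v ^ 2 ≤ l2 (B *ᵥ v) ^ 2) (y : ι → ℝ) :
    l2 (lsq B y) ≤ c⁻¹ * l2 (Bᵀ *ᵥ y) := l2_gram_inv_le hc hB _

lemma abs_sum_inr_le (q : κ → ℝ) (v : σ ⊕ κ → ℝ) : |∑ k, q k * v (Sum.inr k)| ≤ l2 q * l2 v :=
  (abs_dot_le q fun k => v (Sum.inr k)).trans
    (mul_le_mul_of_nonneg_left (l2_inr_le _) (l2_nonneg _))

end NoiseWeights

/-! ### Interpolation and the projection operator -/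

/-- The operator norm of P_{nK} tests continuous functions only, whereas the sieve error need not be
continuous in W because η is only measurable. P_{nK} sees just finitely many sample points, where
any function has a continuous interpolant with the same bound (Tietze). -/
lemma exists_continuous_interpolation {Y : Type*} [MetricSpace Y] {T : Set Y} (hT : T.Finite)
    (φ : Y → ℝ) {m : ℝ} (hm : 0 ≤ m) (hφ : ∀ y ∈ T, |φ y| ≤ m) :
    ∃ f : Y → ℝ, Continuous f ∧ (∀ y, |f y| ≤ m) ∧ ∀ y ∈ T, f y = φ y := by
  have : Finite T := hT
  obtain ⟨g, hg, hgφ⟩ := BoundedContinuousFunction.exists_extension_forall_mem_Icc_of_isClosedEmbedding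
    (BoundedContinuousFunction.mkOfCompact ⟨fun y : T => φ y, continuous_of_discreteTopology⟩)
    (a := -m) (b := m) (fun y => abs_le.mp (hφ y y.2)) (by linarith)
    hT.isClosed.isClosedEmbedding_subtypeVal
  exact ⟨g, g.continuous, fun y => abs_le.mpr (hg y), fun y hy => congrFun hgφ ⟨y, hy⟩⟩

section Series

variable {Ω₀ : Type*} [MeasurableSpace Ω₀] {dX dZ : ℕ} {M : Model Ω₀ dX dZ} {μ₀ : Measure Ω₀}
  {ϖ : ℝ} {τ : ℝ → ℝ} {K n : ℕ} {b : Fin K → ℝ × ℝ → ℝ}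

lemma projOp_congr {o : Fin n → Obs dX dZ} {f f' : (Fin 2 → WVec dX dZ) → ℝ}
    (h : ∀ i, f (o i).2.2 = f' (o i).2.2) (p : ℝ × ℝ) :
    projOp M μ₀ τ b o f p = projOp M μ₀ τ b o f' p := by
  simp only [projOp, h]

lemma projOp_smul {o : Fin n → Obs dX dZ} (a : ℝ) (f : (Fin 2 → WVec dX dZ) → ℝ) (p : ℝ × ℝ) :
    projOp M μ₀ τ b o (fun w => a * f w) p = a * projOp M μ₀ τ b o f p := by
  simp only [projOp, Finset.mul_sum, mul_smul, ← Finset.smul_sum]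
  rw [smul_comm]
  simp only [mulVec_smul, Pi.smul_apply, smul_eq_mul]
  refine Finset.sum_congr rfl fun k _ => by ring

lemma enorm_projOp_le {o : Fin n → Obs dX dZ} (hW : ∀ i, (o i).2.2 ∈ (μ₀.map M.W).support)
    {φ : (Fin 2 → WVec dX dZ) → ℝ} {F : ℝ} (hF : ∀ i, |φ (o i).2.2| ≤ F) {p : ℝ × ℝ}
    (hp : p ∈ M.S10 μ₀) :
    ‖projOp M μ₀ τ b o φ p‖ₑ ≤ projNorm M μ₀ τ b o * ENNReal.ofReal F := by
  by_cases h0 : ∀ i, φ (o i).2.2 = 0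
  · have : projOp M μ₀ τ b o φ p = 0 := by
      rw [projOp_congr (f' := fun w => 0 * φ w) (fun i => by simp [h0 i]), projOp_smul, zero_mul]
    simp [this]
  push Not at h0
  obtain ⟨i₁, hi₁⟩ := h0
  obtain ⟨i₀, -, hmax⟩ := Finset.exists_max_image Finset.univ (fun i => |φ (o i).2.2|)
    -- The largest sample value serves to normalize: the rescaled interpolant has supremum exactly
    -- 1, attained at a sample point of the support.
    ⟨i₁, Finset.mem_univ _⟩
  set m := |φ (o i₀).2.2| with hm
  have hm0 : 0 < m := lt_of_lt_of_le (abs_pos.mpr hi₁) (hmax i₁ (Finset.mem_univ _))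
  obtain ⟨f, hf, hfm, hfφ⟩ := exists_continuous_interpolation
    (finite_range fun i => (o i).2.2) φ hm0.le (by
      rintro _ ⟨i, rfl⟩; exact hmax i (Finset.mem_univ _))
  have hφf : ∀ i, f (o i).2.2 = φ (o i).2.2 := fun i => hfφ _ ⟨i, rfl⟩
  set f₁ : (Fin 2 → WVec dX dZ) → ℝ := fun w => m⁻¹ * f w with hf₁
  have hf₁c : ContinuousOn f₁ (μ₀.map M.W).support := (continuous_const.mul hf).continuousOn
  have hsup : (⨆ q ∈ (μ₀.map M.W).support, ‖f₁ q‖ₑ) = 1 := by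
    apply le_antisymm
    · refine iSup₂_le fun q _ => ?_
      rw [Real.enorm_eq_ofReal_abs, ← ENNReal.ofReal_one]
      apply ENNReal.ofReal_le_ofReal
      rw [hf₁, abs_mul, abs_of_pos (inv_pos.mpr hm0), inv_mul_le_iff₀ hm0, mul_one]
      exact hfm q
    · refine le_trans ?_ (le_iSup₂ (f := fun q (_ : q ∈ (μ₀.map M.W).support) => ‖f₁ q‖ₑ)
        (o i₀).2.2 (hW i₀))
      rw [Real.enorm_eq_ofReal_abs, hf₁, abs_mul, abs_of_pos (inv_pos.mpr hm0), hφf, ← hm,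
        inv_mul_cancel₀ hm0.ne', ENNReal.ofReal_one]
  have h1 : ‖projOp M μ₀ τ b o f₁ p‖ₑ ≤ projNorm M μ₀ τ b o := by
    refine le_trans ?_ (le_iSup₂ (f := fun (f : (Fin 2 → WVec dX dZ) → ℝ)
      (_ : f ∈ {f : (Fin 2 → WVec dX dZ) → ℝ | ContinuousOn f (μ₀.map M.W).support ∧
        (⨆ q ∈ (μ₀.map M.W).support, ‖f q‖ₑ) = 1}) =>
      ⨆ p ∈ M.S10 μ₀, ‖projOp M μ₀ τ b o f p‖ₑ) f₁ ⟨hf₁c, hsup⟩)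
    exact le_iSup₂ (f := fun p (_ : p ∈ M.S10 μ₀) => ‖projOp M μ₀ τ b o f₁ p‖ₑ) p hp
  have h2 : projOp M μ₀ τ b o φ p = m * projOp M μ₀ τ b o f₁ p := by
    rw [← projOp_smul]
    exact projOp_congr (fun i => by
      simp only [hf₁, hφf]; rw [mul_inv_cancel_left₀ hm0.ne']) p
  rw [h2, enorm_mul, mul_comm, Real.enorm_eq_ofReal_abs m, abs_of_pos hm0]
  exact mul_le_mul' h1 (ENNReal.ofReal_le_ofReal (hF i₀))

/-- `P_{nK}` is the second block of least squares at the true first-stage parameter. -/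
lemma projOp_eq_lsq (hn : 0 < n) (o : Fin n → Obs dX dZ) (f : (Fin 2 → WVec dX dZ) → ℝ)
    (p : ℝ × ℝ) :
    projOp M μ₀ τ b o f p
      = ∑ k, b k p * lsq (regMatrix M μ₀ τ b M.θ o)
          (fun i => I10 (o i).2 * f (o i).2.2) (Sum.inr k) := by
  set A := regMatrix M μ₀ τ b M.θ o with hA
  have hn0 : (n : ℝ) ≠ 0 := by positivity
  have e1 : ∑ i, f (o i).2.2 • regressor M μ₀ τ b M.θ (o i).2
      = Aᵀ *ᵥ fun i => I10 (o i).2 * f (o i).2.2 := by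
    funext l
    simp only [Finset.sum_apply, Pi.smul_apply, smul_eq_mul, mulVec, dotProduct,
      Matrix.transpose_apply, hA, regMatrix, Matrix.of_apply]
    refine Finset.sum_congr rfl fun i _ => ?_
    -- Every regressor already contains the indicator as a factor and I² = I, so an extra indicator
    -- in the response is invisible to the normal equations.
    have : regressor M μ₀ τ b M.θ (o i).2 l * I10 (o i).2 = regressor M μ₀ τ b M.θ (o i).2 l := by
      have hI := I10_mul_self (o i).2
      have hT : trimI M μ₀ τ M.θ (o i).2 * I10 (o i).2 = trimI M μ₀ τ M.θ (o i).2 := by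
        rw [trimI, mul_assoc, hI]
      cases l with
      | inl k => simp only [regressor, Sum.elim_inl]; rw [mul_right_comm, hT]
      | inr k =>
        simp only [regressor, Sum.elim_inr, trimT]
        rw [mul_right_comm, div_mul_eq_mul_div, hT]
    rw [← mul_assoc, this, mul_comm]
  have e2 : (PsiSample M μ₀ τ b o)⁻¹ = (n : ℝ) • (Aᵀ * A)⁻¹ := by
    rw [PsiSample, ← hA]
    by_cases hdet : IsUnit (Aᵀ * A).det
    · apply Matrix.inv_eq_left_inv
      rw [Matrix.smul_mul, Matrix.mul_smul, Matrix.nonsing_inv_mul _ hdet, smul_smul,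
        mul_inv_cancel₀ hn0, one_smul]
    -- In the singular case both inverses are zero by convention, so the scaling identity persists.
    · have hdet' : ¬ IsUnit ((n : ℝ)⁻¹ • (Aᵀ * A)).det := by
        rw [Matrix.det_smul, isUnit_iff_ne_zero, not_not]
        rw [isUnit_iff_ne_zero, not_not] at hdet
        rw [hdet, mul_zero]
      rw [Matrix.nonsing_inv_apply_not_isUnit _ hdet, Matrix.nonsing_inv_apply_not_isUnit _ hdet',
        smul_zero]
  rw [projOp, e1, e2]
  simp only [mulVec_smul, Matrix.smul_mulVec, smul_smul, inv_mul_cancel₀ hn0, one_smul,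
    lsq]

variable [IsProbabilityMeasure μ₀]

/-- The part of the regression error that has conditional mean zero given the designs. -/
def noiseVec (M : Model Ω₀ dX dZ) (μ₀ : Measure Ω₀) [IsProbabilityMeasure μ₀] (τ : ℝ → ℝ)
    (θ : Param dX dZ) (o : Fin n → Obs dX dZ) (i : Fin n) : ℝ :=
  τ (M.L10 μ₀ θ (o i).2.2) * M.errObs μ₀ (o i)

variable {ginv : ∀ K : ℕ, Matrix (Fin dX ⊕ Fin K) (Fin dX ⊕ Fin K) ℝ →
      Matrix (Fin dX ⊕ Fin K) (Fin dX ⊕ Fin K) ℝ} {c : ℝ}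

/-- A nonsingular Gram matrix has only one generalized inverse, so the coefficients are linear in
the response and the regression equation splits their error into three. -/
lemma lsCoef_sub_eq (hginv : IsSymmGenInverse ginv) {θ : Param dX dZ} {o : Fin n → Obs dX dZ}
    (hc : 0 < c)
    (hB : ∀ v, c * l2 v ^ 2 ≤ l2 (regMatrix M μ₀ τ b θ o *ᵥ v) ^ 2) (α : Fin K → ℝ) :
    lsCoef M μ₀ τ (ginv K) b θ o - Sum.elim (M.β 0 true false) α
      = lsq (regMatrix M μ₀ τ b θ o) (fun i => firstStageErr M μ₀ τ θ (o i).2)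
        + lsq (regMatrix M μ₀ τ b θ o)
            (fun i => I10 (o i).2 * sieveErr M μ₀ τ b α θ (o i).2.2)
        + lsq (regMatrix M μ₀ τ b θ o) (noiseVec M μ₀ τ θ o) := by
  set B := regMatrix M μ₀ τ b θ o with hBdef
  have hsymm : (Bᵀ * B).IsSymm := by
    rw [Matrix.IsSymm, Matrix.transpose_mul, Matrix.transpose_transpose]
  have e1 : lsCoef M μ₀ τ (ginv K) b θ o
      = lsq B (fun i => trimI M μ₀ τ θ (o i).2 * (o i).1 0) := by
    rw [lsCoef, ← hBdef, eq_inv_of_gen_inverse (isUnit_gram_det hc hB) (hginv K _ hsymm).2, lsq]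
  have e2 : (fun i => trimI M μ₀ τ θ (o i).2 * (o i).1 0)
      = B *ᵥ Sum.elim (M.β 0 true false) α + (fun i => firstStageErr M μ₀ τ θ (o i).2)
        + (fun i => I10 (o i).2 * sieveErr M μ₀ τ b α θ (o i).2.2) + noiseVec M μ₀ τ θ o := by
    funext i
    exact response_eq θ α (o i)
  rw [e1, e2, lsq_add, lsq_add, lsq_add, lsq_mulVec hc hB]
  abel

/-- Bounds on the least squares coefficients in terms of the three parts of the error. -/
lemma l2_lsCoef_sub_inl_le (hginv : IsSymmGenInverse ginv) {θ : Param dX dZ}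
    {o : Fin n → Obs dX dZ} (hn : 0 < n) (hc : 0 < c)
    (hB : ∀ v, c * n * l2 v ^ 2 ≤ l2 (regMatrix M μ₀ τ b θ o *ᵥ v) ^ 2) {α : Fin K → ℝ}
    {F₁ F₂ : ℝ} (hF₁ : 0 ≤ F₁) (hF₂ : 0 ≤ F₂)
    (h₁ : ∀ i, |firstStageErr M μ₀ τ θ (o i).2| ≤ F₁)
    (h₂ : ∀ i, |sieveErr M μ₀ τ b α θ (o i).2.2| ≤ F₂) :
    l2 (fun k => lsCoef M μ₀ τ (ginv K) b θ o (Sum.inl k) - M.β 0 true false k)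
      ≤ (√c)⁻¹ * (F₁ + F₂)
        + (c * n)⁻¹ * l2 ((regMatrix M μ₀ τ b θ o)ᵀ *ᵥ noiseVec M μ₀ τ θ o) := by
  have hn0 : (0 : ℝ) < n := by positivity
  have hcn : 0 < c * n := by positivity
  have key := lsCoef_sub_eq hginv hcn hB α
  have e : (fun k => lsCoef M μ₀ τ (ginv K) b θ o (Sum.inl k) - M.β 0 true false k)
      = fun k => (lsCoef M μ₀ τ (ginv K) b θ o - Sum.elim (M.β 0 true false) α) (Sum.inl k) := by
    funext k; simp
  have hs : ∀ (y : Fin n → ℝ) {F : ℝ}, 0 ≤ F → (∀ i, |y i| ≤ F) →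
      l2 (lsq (regMatrix M μ₀ τ b θ o) y) ≤ (√c)⁻¹ * F := by
    intro y F hF hy
    refine (l2_lsq_le hcn hB y).trans ?_
    rw [Real.sqrt_mul hc.le, mul_inv, mul_assoc]
    refine mul_le_mul_of_nonneg_left ?_ (by positivity)
    rw [inv_mul_le_iff₀ (Real.sqrt_pos.mpr hn0)]
    exact l2_le_of_abs_le y hF hy
  have h₂' : ∀ i, |I10 (o i).2 * sieveErr M μ₀ τ b α θ (o i).2.2| ≤ F₂ := fun i => by
    rw [abs_mul, abs_of_nonneg (I10_mem _).1]
    exact (mul_le_of_le_one_left (abs_nonneg _) (I10_mem _).2).trans (h₂ i)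
  rw [e]
  refine (l2_inl_le _).trans ?_
  rw [key]
  calc _ ≤ _ := l2_add_le _ _
    _ ≤ _ := add_le_add (l2_add_le _ _) le_rfl
    _ ≤ (√c)⁻¹ * F₁ + (√c)⁻¹ * F₂ + _ :=
        add_le_add (add_le_add (hs _ hF₁ h₁) (hs _ hF₂ h₂')) (l2_lsq_le_gram hcn hB _)
    _ = _ := by ring

/-- Each error gets its own treatment. The sieve error must not pick up a factor ζ, so it is
projected with the true design, where the norm of P_{nK} applies, and the change of design is paid
for by the perturbation term with d. The first-stage error can afford the crude factor ζ, and the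
noise is left for a maximal inequality. -/
lemma abs_sum_basis_lsCoef_sub_le (hginv : IsSymmGenInverse ginv) {θ : Param dX dZ}
    {o : Fin n → Obs dX dZ} (hn : 0 < n) (hc : 0 < c)
    (hA : ∀ v, c * n * l2 v ^ 2 ≤ l2 (regMatrix M μ₀ τ b M.θ o *ᵥ v) ^ 2)
    (hB : ∀ v, c * n * l2 v ^ 2 ≤ l2 (regMatrix M μ₀ τ b θ o *ᵥ v) ^ 2) {d : ℝ} (hd : 0 ≤ d)
    (hBA : ∑ i, ∑ k, (regMatrix M μ₀ τ b θ o - regMatrix M μ₀ τ b M.θ o) i k ^ 2 ≤ d ^ 2)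
    {α : Fin K → ℝ} {F₁ F₂ P : ℝ} (hF₁ : 0 ≤ F₁) (hF₂ : 0 ≤ F₂) (hP : 0 ≤ P)
    (h₁ : ∀ i, |firstStageErr M μ₀ τ θ (o i).2| ≤ F₁)
    (h₂ : ∀ i, |sieveErr M μ₀ τ b α θ (o i).2.2| ≤ F₂)
    (hW : ∀ i, (o i).2.2 ∈ (μ₀.map M.W).support)
    (hproj : projNorm M μ₀ τ b o ≤ ENNReal.ofReal P) {p : ℝ × ℝ} (hp : p ∈ M.S10 μ₀) {ζ : ℝ}
    (hζ : l2 (fun k => b k p) ≤ ζ) :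
    |∑ k, b k p * (lsCoef M μ₀ τ (ginv K) b θ o (Sum.inr k) - α k)|
      ≤ ζ * ((√c)⁻¹ * F₁) + P * F₂ + 3 * ζ * d / (c * √n) * F₂
        + ((c * n)⁻¹ * ζ * l2 (fun k =>
            ((regMatrix M μ₀ τ b θ o)ᵀ *ᵥ noiseVec M μ₀ τ θ o) (Sum.inl k))
          + |∑ i, noiseWt (regMatrix M μ₀ τ b θ o) (fun k => b k p) i * noiseVec M μ₀ τ θ o i|) := by
  have hn0 : (0 : ℝ) < n := by positivity
  have hcn : 0 < c * n := by positivity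
  have hζ0 : 0 ≤ ζ := (l2_nonneg _).trans hζ
  set A := regMatrix M μ₀ τ b M.θ o
  set B := regMatrix M μ₀ τ b θ o
  set y₁ : Fin n → ℝ := fun i => firstStageErr M μ₀ τ θ (o i).2
  set y₂ : Fin n → ℝ := fun i => I10 (o i).2 * sieveErr M μ₀ τ b α θ (o i).2.2
  set y₃ : Fin n → ℝ := noiseVec M μ₀ τ θ o
  have h₂' : ∀ i, |y₂ i| ≤ F₂ := fun i => by
    rw [abs_mul, abs_of_nonneg (I10_mem _).1]
    exact (mul_le_of_le_one_left (abs_nonneg _) (I10_mem _).2).trans (h₂ i)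
  have e : ∑ k, b k p * (lsCoef M μ₀ τ (ginv K) b θ o (Sum.inr k) - α k)
      = ∑ k, b k p * lsq B y₁ (Sum.inr k)
        + ∑ k, b k p * lsq A y₂ (Sum.inr k) + ∑ k, b k p * (lsq B y₂ - lsq A y₂) (Sum.inr k)
        + ∑ k, b k p * lsq B y₃ (Sum.inr k) := by
    rw [← Finset.sum_add_distrib, ← Finset.sum_add_distrib, ← Finset.sum_add_distrib]
    refine Finset.sum_congr rfl fun k _ => ?_
    have := congrFun (lsCoef_sub_eq hginv hcn hB α) (Sum.inr k)
    simp only [Pi.sub_apply, Pi.add_apply, Sum.elim_inr] at this ⊢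
    rw [this]
    ring
  have t₁ : |∑ k, b k p * lsq B y₁ (Sum.inr k)| ≤ ζ * ((√c)⁻¹ * F₁) := by
    refine (abs_sum_inr_le _ _).trans (mul_le_mul hζ ?_ (l2_nonneg _) hζ0)
    refine (l2_lsq_le hcn hB y₁).trans ?_
    rw [Real.sqrt_mul hc.le, mul_inv, mul_assoc]
    refine mul_le_mul_of_nonneg_left ?_ (by positivity)
    rw [inv_mul_le_iff₀ (Real.sqrt_pos.mpr hn0)]
    exact l2_le_of_abs_le y₁ hF₁ h₁
  have t₂ : |∑ k, b k p * lsq A y₂ (Sum.inr k)| ≤ P * F₂ := by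
    rw [← projOp_eq_lsq hn]
    have h := (enorm_projOp_le (τ := τ) (b := b) hW h₂ hp).trans
      (mul_le_mul' hproj le_rfl)
    rw [← ENNReal.ofReal_mul hP, Real.enorm_eq_ofReal_abs] at h
    exact (ENNReal.ofReal_le_ofReal_iff (by positivity)).mp h
  have t₃ : |∑ k, b k p * (lsq B y₂ - lsq A y₂) (Sum.inr k)| ≤ 3 * ζ * d / (c * √n) * F₂ := by
    refine (abs_sum_inr_le _ _).trans ((mul_le_mul hζ
      (l2_lsq_sub_lsq_le hcn hA hB hd hBA y₂) (l2_nonneg _) hζ0).trans ?_)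
    have h := l2_le_of_abs_le y₂ hF₂ h₂'
    have hsn : √(n : ℝ) * √(n : ℝ) = n := Real.mul_self_sqrt hn0.le
    have hs0 : 0 < √(n : ℝ) := Real.sqrt_pos.mpr hn0
    calc ζ * (3 * d / (c * n) * l2 y₂) ≤ ζ * (3 * d / (c * n) * (√n * F₂)) := by gcongr
      _ = 3 * ζ * d / (c * √n) * F₂ := by
          rw [show c * (n : ℝ) = c * (√n * √n) by rw [hsn]]; field_simp
  have t₄ := abs_sum_inr_lsq_le hcn hB (fun k => b k p) y₃
  rw [e]
  refine (abs_add_le _ _).trans (add_le_add ((abs_add_le _ _).trans (add_le_add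
    ((abs_add_le _ _).trans (add_le_add t₁ t₂)) t₃)) (t₄.trans ?_))
  gcongr
  exact l2_nonneg _

end Series

end GameMTE

namespace GameMTE

/-! ### Properties that hold up to constants with probability close to one -/

section Tight

variable {Ω α β : Type*} [MeasurableSpace Ω] {μ : Measure Ω}

/-- For every `δ > 0` there is a constant `a` such that `G a n` fails with probability at most `δ`
for all large `n`. -/
def Tight (μ : Measure Ω) (G : α → ℕ → Ω → Prop) : Prop :=
  ∀ δ : ℝ≥0∞, 0 < δ → ∃ a, ∀ᶠ n in atTop, μ {ω | ¬ G a n ω} ≤ δ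

lemma Tight.mono_ae {G : α → ℕ → Ω → Prop} {H : β → ℕ → Ω → Prop} (h : Tight μ G)
    (himp : ∀ a, ∃ b, ∀ᶠ n in atTop, ∀ᵐ ω ∂μ, G a n ω → H b n ω) : Tight μ H := by
  intro δ hδ
  obtain ⟨a, ha⟩ := h δ hδ
  obtain ⟨b, hb⟩ := himp a
  refine ⟨b, ?_⟩
  filter_upwards [ha, hb] with n h1 h2
  refine le_trans (measure_mono_ae ?_) h1
  filter_upwards [h2] with ω h3 h4 h5
  exact h4 (h3 h5)

lemma Tight.mono {G : α → ℕ → Ω → Prop} {H : β → ℕ → Ω → Prop} (h : Tight μ G)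
    (himp : ∀ a, ∃ b, ∀ᶠ n in atTop, ∀ ω, G a n ω → H b n ω) : Tight μ H :=
  h.mono_ae fun a => (himp a).imp fun _ hb => hb.mono fun _ hn => ae_of_all _ hn

/-- Half of δ is spent on each property, and the second constant may depend on the one already
chosen for the first. -/
lemma Tight.bind {G : α → ℕ → Ω → Prop} {H : β → ℕ → Ω → Prop} (h : Tight μ G)
    (himp : ∀ a, Tight μ fun b n ω => G a n ω → H b n ω) : Tight μ H := by
  intro δ hδ
  have hδ2 : 0 < δ / 2 := ENNReal.half_pos hδ.ne'
  obtain ⟨a, ha⟩ := h _ hδ2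
  obtain ⟨b, hb⟩ := himp a _ hδ2
  refine ⟨b, ?_⟩
  filter_upwards [ha, hb] with n h1 h2
  calc μ {ω | ¬ H b n ω} ≤ μ ({ω | ¬ G a n ω} ∪ {ω | ¬ (G a n ω → H b n ω)}) :=
        measure_mono fun ω hω => by
          by_cases hG : G a n ω
          · exact Or.inr fun hi => hω (hi hG)
          · exact Or.inl hG
    _ ≤ δ / 2 + δ / 2 := (measure_union_le _ _).trans (add_le_add h1 h2)
    _ = δ := ENNReal.add_halves δ

lemma Tight.and {G : α → ℕ → Ω → Prop} {H : β → ℕ → Ω → Prop} (hG : Tight μ G)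
    (hH : Tight μ H) : Tight μ fun (a : α × β) n ω => G a.1 n ω ∧ H a.2 n ω :=
  hG.bind fun a => hH.mono fun b => ⟨(a, b), Eventually.of_forall fun _ _ hb ha => ⟨ha, hb⟩⟩

lemma tight_of_tendsto {G : ℕ → Ω → Prop} (h : Tendsto (fun n => μ {ω | ¬ G n ω}) atTop (𝓝 0)) :
    Tight μ fun (_ : Unit) => G := fun _ hδ =>
  ⟨(), (h.eventually (Iio_mem_nhds hδ)).mono fun _ hn => le_of_lt hn⟩

lemma isOP_iff_tight {X : ℕ → Ω → ℝ≥0∞} {r : ℕ → ℝ} (hr : ∀ᶠ n in atTop, 0 ≤ r n) :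
    IsOP μ X r ↔ Tight μ fun (C : ℝ) n ω => X n ω ≤ ENNReal.ofReal (C * r n) := by
  constructor
  · intro h δ hδ
    obtain ⟨C, -, hC⟩ := h δ hδ
    refine ⟨C, hC.mono fun n hn => ?_⟩
    simpa only [not_le] using hn
  · intro h δ hδ
    obtain ⟨C, hC⟩ := h δ hδ
    refine ⟨max C 1, by positivity, ?_⟩
    filter_upwards [hC, hr] with n hn hrn
    refine (measure_mono fun ω hω => ?_).trans hn
    simp only [mem_ofPred_eq, not_le] at hω ⊢
    exact lt_of_le_of_lt (ENNReal.ofReal_le_ofReal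
      (mul_le_mul_of_nonneg_right (le_max_left _ _) hrn)) hω

/-- Markov's inequality. -/
lemma tight_of_lintegral_le {X : ℕ → Ω → ℝ} {r : ℕ → ℝ} (hX : ∀ n, AEMeasurable (X n) μ)
    (hr : ∀ᶠ n in atTop, 0 < r n) {C : ℝ} (hC : 0 ≤ C)
    (h : ∀ᶠ n in atTop, ∫⁻ ω, ENNReal.ofReal (X n ω) ∂μ ≤ ENNReal.ofReal (C * r n)) :
    Tight μ fun (a : ℝ) n ω => X n ω ≤ a * r n := by
  intro δ hδ
  set δ' := min δ 1 with hδ'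
  have h0 : 0 < δ' := lt_min hδ one_pos
  have ht : δ' ≠ ∞ := ((min_le_right _ _).trans_lt ENNReal.one_lt_top).ne
  have hr0 : 0 < δ'.toReal := ENNReal.toReal_pos h0.ne' ht
  -- C + 1 keeps the constant positive when C = 0, and δ' replaces δ because the latter may be
  -- infinite.
  refine ⟨(C + 1) / δ'.toReal, ?_⟩
  filter_upwards [hr, h] with n hrn hn
  have hpos : 0 < (C + 1) / δ'.toReal * r n := by positivity
  calc μ {ω | ¬ X n ω ≤ (C + 1) / δ'.toReal * r n}
      ≤ μ {ω | ENNReal.ofReal ((C + 1) / δ'.toReal * r n) ≤ ENNReal.ofReal (X n ω)} :=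
        measure_mono fun ω hω => ENNReal.ofReal_le_ofReal (not_le.mp hω).le
    _ ≤ (∫⁻ ω, ENNReal.ofReal (X n ω) ∂μ) / ENNReal.ofReal ((C + 1) / δ'.toReal * r n) :=
        meas_ge_le_lintegral_div (hX n).ennreal_ofReal (ENNReal.ofReal_pos.mpr hpos).ne'
          ENNReal.ofReal_ne_top
    _ ≤ ENNReal.ofReal (C * r n) / ENNReal.ofReal ((C + 1) / δ'.toReal * r n) :=
        ENNReal.div_le_div_right hn _
    _ = ENNReal.ofReal (C * r n / ((C + 1) / δ'.toReal * r n)) :=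
        (ENNReal.ofReal_div_of_pos hpos).symm
    _ ≤ ENNReal.ofReal δ'.toReal := by
        apply ENNReal.ofReal_le_ofReal
        rw [div_le_iff₀ hpos]
        calc C * r n ≤ (C + 1) * r n := by gcongr; linarith
          _ = _ := by field_simp
    _ ≤ δ := (ENNReal.ofReal_toReal ht).le.trans (min_le_left _ _)

/-- Markov's inequality for a quantity with vanishing mean. -/
lemma tendsto_measure_of_lintegral {X : ℕ → Ω → ℝ} {r : ℕ → ℝ} (hX : ∀ n, AEMeasurable (X n) μ)
    (h : ∀ᶠ n in atTop, ∫⁻ ω, ENNReal.ofReal (X n ω) ∂μ ≤ ENNReal.ofReal (r n))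
    (hr : Tendsto r atTop (𝓝 0)) {ε : ℝ} (hε : 0 < ε) :
    Tendsto (fun n => μ {ω | ¬ X n ω ≤ ε}) atTop (𝓝 0) := by
  have hlim : Tendsto (fun n => ENNReal.ofReal (r n / ε)) atTop (𝓝 0) := by
    have := ENNReal.tendsto_ofReal (hr.div_const ε)
    simpa using this
  refine tendsto_of_tendsto_of_tendsto_of_le_of_le' tendsto_const_nhds hlim
    (Eventually.of_forall fun _ => zero_le) ?_
  filter_upwards [h] with n hn
  calc μ {ω | ¬ X n ω ≤ ε} ≤ μ {ω | ENNReal.ofReal ε ≤ ENNReal.ofReal (X n ω)} :=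
        measure_mono fun ω hω => ENNReal.ofReal_le_ofReal (not_le.mp hω).le
    _ ≤ (∫⁻ ω, ENNReal.ofReal (X n ω) ∂μ) / ENNReal.ofReal ε :=
        meas_ge_le_lintegral_div (hX n).ennreal_ofReal (ENNReal.ofReal_pos.mpr hε).ne'
          ENNReal.ofReal_ne_top
    _ ≤ ENNReal.ofReal (r n) / ENNReal.ofReal ε := ENNReal.div_le_div_right hn _
    _ = ENNReal.ofReal (r n / ε) := (ENNReal.ofReal_div_of_pos hε).symm

end Tight

/-! ### Averages of independent copies -/

section Average

variable {Ω Ω₀ 𝒪 : Type*} [MeasurableSpace Ω] [MeasurableSpace Ω₀] [MeasurableSpace 𝒪]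
  {μ : Measure Ω} {μ₀ : Measure Ω₀} {Z : ℕ → Ω → 𝒪} {Z₀ : Ω₀ → 𝒪}

lemma lintegral_sum_identDistrib (hlaw : ∀ i, IdentDistrib (Z i) Z₀ μ μ₀) {f : 𝒪 → ℝ}
    (hf : Measurable f) (hf0 : ∀ o, 0 ≤ f o) (n : ℕ) :
    ∫⁻ ω, ENNReal.ofReal (∑ i : Fin n, f (Z i ω)) ∂μ
      = n * ∫⁻ ω, ENNReal.ofReal (f (Z₀ ω)) ∂μ₀ := by
  simp_rw [ENNReal.ofReal_sum_of_nonneg fun (i : Fin n) _ => hf0 _]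
  rw [lintegral_finsetSum' (f := fun (i : Fin n) ω => ENNReal.ofReal (f (Z i ω))) _ fun i _ =>
    (hf.comp_aemeasurable (hlaw i).aemeasurable_fst).ennreal_ofReal]
  have : ∀ i : ℕ, ∫⁻ ω, ENNReal.ofReal (f (Z i ω)) ∂μ = ∫⁻ ω, ENNReal.ofReal (f (Z₀ ω)) ∂μ₀ :=
    fun i => ((hlaw i).comp (ENNReal.measurable_ofReal.comp hf)).lintegral_eq
  simp [this]

lemma tight_sum_le (hlaw : ∀ i, IdentDistrib (Z i) Z₀ μ μ₀) {f : 𝒪 → ℝ}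
    (hf : Measurable f) (hf0 : ∀ o, 0 ≤ f o) (hint : Integrable (fun ω => f (Z₀ ω)) μ₀) :
    Tight μ fun (C : ℝ) n ω => ∑ i : Fin n, f (Z i ω) ≤ C * n := by
  refine tight_of_lintegral_le (C := ∫ ω, f (Z₀ ω) ∂μ₀)
    (fun n => Finset.aemeasurable_fun_sum _ fun i _ =>
      hf.comp_aemeasurable (hlaw i).aemeasurable_fst)
    ((eventually_gt_atTop 0).mono fun n hn => by positivity)
    (integral_nonneg fun ω => hf0 _) (Eventually.of_forall fun n => ?_)
  rw [lintegral_sum_identDistrib hlaw hf hf0,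
    ← ofReal_integral_eq_lintegral_ofReal hint (ae_of_all _ fun ω => hf0 _),
    ENNReal.ofReal_mul (integral_nonneg fun ω => hf0 _), ENNReal.ofReal_natCast, mul_comm]

variable [IsProbabilityMeasure μ] [IsProbabilityMeasure μ₀]

/-- The mean squared error of a sample mean. -/
lemma lintegral_mean_sub_sq_le (hind : iIndepFun Z μ) (hlaw : ∀ i, IdentDistrib (Z i) Z₀ μ μ₀)
    {f : 𝒪 → ℝ} (hf : Measurable f) (hf2 : MemLp (fun ω => f (Z₀ ω)) 2 μ₀) {n : ℕ} (hn : 0 < n) :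
    ∫⁻ ω, ENNReal.ofReal (((n : ℝ)⁻¹ * ∑ i : Fin n, f (Z i ω) - ∫ ω, f (Z₀ ω) ∂μ₀) ^ 2) ∂μ
      ≤ ENNReal.ofReal ((n : ℝ)⁻¹ * ∫ ω, f (Z₀ ω) ^ 2 ∂μ₀) := by
  have hn0 : (n : ℝ) ≠ 0 := by positivity
  set X : Fin n → Ω → ℝ := fun i ω => f (Z i ω) with hX
  have hid : ∀ i : Fin n, IdentDistrib (X i) (fun ω => f (Z₀ ω)) μ μ₀ := fun i => (hlaw i).comp hf
  have hL : ∀ i, MemLp (X i) 2 μ := fun i => (hid i).symm.memLp_snd hf2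
  have hvar : variance (∑ i, X i) μ = n * variance (fun ω => f (Z₀ ω)) μ₀ := by
    rw [IndepFun.variance_sum (fun i _ => hL i)
      (fun i _ j _ hij => (hind.indepFun (fun h => hij (Fin.ext h))).comp hf hf)]
    simp [fun i => (hid i).variance_eq]
  have hmean : ∫ ω, (∑ i, X i) ω ∂μ = n * ∫ ω, f (Z₀ ω) ∂μ₀ := by
    simp_rw [Finset.sum_apply]
    rw [integral_finsetSum _ fun i _ => (hL i).integrable one_le_two]
    simp [fun i => (hid i).integral_eq]
  have hLs : MemLp (∑ i, X i) 2 μ := memLp_finsetSum' _ fun i _ => hL i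
  have hsq : ∀ ω, ((n : ℝ)⁻¹ * ∑ i : Fin n, f (Z i ω) - ∫ ω, f (Z₀ ω) ∂μ₀) ^ 2
      = ((n : ℝ)⁻¹) ^ 2 * ((∑ i, X i) ω - ∫ ω, (∑ i, X i) ω ∂μ) ^ 2 := by
    intro ω
    rw [hmean, ← mul_pow, mul_sub, ← mul_assoc, inv_mul_cancel₀ hn0, one_mul, Finset.sum_apply]
  simp_rw [hsq]
  have hint : Integrable (fun ω => ((n : ℝ)⁻¹) ^ 2 *
      ((∑ i, X i) ω - ∫ ω, (∑ i, X i) ω ∂μ) ^ 2) μ :=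
    ((hLs.sub (memLp_const _)).integrable_sq).const_mul _
  rw [← ofReal_integral_eq_lintegral_ofReal hint (ae_of_all _ fun ω => by positivity)]
  apply ENNReal.ofReal_le_ofReal
  rw [integral_const_mul, ← variance_eq_integral hLs.aemeasurable, hvar]
  have hv : variance (fun ω => f (Z₀ ω)) μ₀ ≤ ∫ ω, f (Z₀ ω) ^ 2 ∂μ₀ := by
    have := variance_le_expectation_sq hf2.1
    simpa using this
  calc ((n : ℝ)⁻¹) ^ 2 * (n * variance (fun ω => f (Z₀ ω)) μ₀)
      = (n : ℝ)⁻¹ * variance (fun ω => f (Z₀ ω)) μ₀ := by field_simp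
    _ ≤ _ := by gcongr

/-- Weak law of large numbers. -/
lemma tendsto_measure_mean_sub_sq (hind : iIndepFun Z μ)
    (hlaw : ∀ i, IdentDistrib (Z i) Z₀ μ μ₀)
    {f : 𝒪 → ℝ} (hf : Measurable f) (hint : Integrable (fun ω => f (Z₀ ω)) μ₀) {ε : ℝ}
    (hε : 0 < ε) :
    Tendsto (fun n : ℕ => μ {ω |
      ¬ ((n : ℝ)⁻¹ * ∑ i : Fin n, f (Z i ω) - ∫ ω, f (Z₀ ω) ∂μ₀) ^ 2 ≤ ε}) atTop (𝓝 0) := by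
  have hid : ∀ i, IdentDistrib (fun ω => f (Z i ω)) (fun ω => f (Z₀ ω)) μ μ₀ :=
    fun i => (hlaw i).comp hf
  have hlln := strong_law_ae_real (fun i ω => f (Z i ω)) ((hid 0).integrable_iff.mpr hint)
    (fun i j hij => (hind.indepFun hij).comp hf hf) fun i => (hid i).trans (hid 0).symm
  have hme := tendstoInMeasure_of_tendsto_ae (f := fun (n : ℕ) ω =>
      (n : ℝ)⁻¹ * ∑ i : Fin n, f (Z i ω)) (g := fun _ => ∫ ω, f (Z₀ ω) ∂μ₀)
    (fun n => ((Finset.aemeasurable_fun_sum (f := fun (i : Fin n) ω => f (Z i ω)) Finset.univ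
      fun i _ => hf.comp_aemeasurable (hlaw i).aemeasurable_fst).const_mul
        _).aestronglyMeasurable) (by
      filter_upwards [hlln] with ω hω
      rw [(hid 0).integral_eq] at hω
      refine hω.congr fun n => ?_
      rw [div_eq_inv_mul, Finset.sum_range])
  rw [tendstoInMeasure_iff_norm] at hme
  have h := hme (√ε) (Real.sqrt_pos.mpr hε)
  refine tendsto_of_tendsto_of_tendsto_of_le_of_le tendsto_const_nhds h
    (fun _ => zero_le) fun n => measure_mono fun ω hω => ?_
  simp only [mem_ofPred_eq, not_le] at hω ⊢
  rw [Real.norm_eq_abs, ← Real.sqrt_sq_eq_abs]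
  exact Real.sqrt_le_sqrt hω.le

end Average

end GameMTE

namespace GameMTE

open Model Matrix

lemma tendsto_measure_forall {Ω ι : Type*} [MeasurableSpace Ω] {μ : Measure Ω} [Fintype ι]
    {G : ι → ℕ → Ω → Prop} (h : ∀ i, Tendsto (fun n => μ {ω | ¬ G i n ω}) atTop (𝓝 0)) :
    Tendsto (fun n => μ {ω | ¬ ∀ i, G i n ω}) atTop (𝓝 0) := by
  have hsum : Tendsto (fun n => ∑ i, μ {ω | ¬ G i n ω}) atTop (𝓝 0) := by
    have := tendsto_finsetSum Finset.univ fun i _ => h i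
    simpa using this
  refine tendsto_of_tendsto_of_tendsto_of_le_of_le tendsto_const_nhds hsum
    (fun _ => zero_le) fun n => ?_
  have : {ω | ¬ ∀ i, G i n ω} = ⋃ i, {ω | ¬ G i n ω} := by ext ω; simp
  simp only [this]
  exact measure_iUnion_fintype_le μ _

/-- One dominating function for the sum of squares bounds the total mean squared error, so the
number of entries, which grows with K, does not appear. -/
lemma lintegral_sum_mean_sub_sq_le {Ω Ω₀ 𝒪 ι : Type*} [MeasurableSpace Ω] [MeasurableSpace Ω₀]
    [MeasurableSpace 𝒪] {μ : Measure Ω} {μ₀ : Measure Ω₀} {Z : ℕ → Ω → 𝒪} {Z₀ : Ω₀ → 𝒪}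
    [IsProbabilityMeasure μ] [IsProbabilityMeasure μ₀] [Fintype ι]
    (hind : iIndepFun Z μ) (hlaw : ∀ i, IdentDistrib (Z i) Z₀ μ μ₀)
    {f : ι → 𝒪 → ℝ} (hf : ∀ i, Measurable (f i)) {g : 𝒪 → ℝ}
    (hg : Integrable (fun ω => g (Z₀ ω)) μ₀) (hfg : ∀ o, ∑ i, f i o ^ 2 ≤ g o)
    {n : ℕ} (hn : 0 < n) :
    ∫⁻ ω, ENNReal.ofReal (∑ k, ((n : ℝ)⁻¹ * ∑ i : Fin n, f k (Z i ω)
        - ∫ ω, f k (Z₀ ω) ∂μ₀) ^ 2) ∂μ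
      ≤ ENNReal.ofReal ((n : ℝ)⁻¹ * ∫ ω, g (Z₀ ω) ∂μ₀) := by
  have hle : ∀ k o, f k o ^ 2 ≤ g o := fun k o =>
    (Finset.single_le_sum (f := fun k => f k o ^ 2) (fun k _ => sq_nonneg _)
      (Finset.mem_univ k)).trans (hfg o)
  have hm : ∀ k, AEMeasurable (fun ω => f k (Z₀ ω)) μ₀ := fun k =>
    (hf k).comp_aemeasurable (hlaw 0).aemeasurable_snd
  have hi : ∀ k, Integrable (fun ω => f k (Z₀ ω) ^ 2) μ₀ := fun k =>
    hg.mono' ((hm k).pow_const 2).aestronglyMeasurable (ae_of_all _ fun ω => by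
      rw [Real.norm_eq_abs, abs_of_nonneg (sq_nonneg _)]; exact hle k _)
  have hL : ∀ k, MemLp (fun ω => f k (Z₀ ω)) 2 μ₀ := fun k =>
    (memLp_two_iff_integrable_sq (hm k).aestronglyMeasurable).mpr (hi k)
  simp_rw [ENNReal.ofReal_sum_of_nonneg fun k _ => sq_nonneg _]
  rw [lintegral_finsetSum' _ fun k _ => by
    refine AEMeasurable.ennreal_ofReal (AEMeasurable.pow_const (AEMeasurable.sub_const
      (AEMeasurable.const_mul ?_ _) _) 2)
    exact Finset.aemeasurable_fun_sum (f := fun (i : Fin n) ω => f k (Z i ω)) Finset.univ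
      fun i _ => (hf k).comp_aemeasurable (hlaw i).aemeasurable_fst]
  calc _ ≤ ∑ k, ENNReal.ofReal ((n : ℝ)⁻¹ * ∫ ω, f k (Z₀ ω) ^ 2 ∂μ₀) :=
        Finset.sum_le_sum fun k _ => lintegral_mean_sub_sq_le hind hlaw (hf k) (hL k) hn
    _ = ENNReal.ofReal (∑ k, (n : ℝ)⁻¹ * ∫ ω, f k (Z₀ ω) ^ 2 ∂μ₀) :=
        (ENNReal.ofReal_sum_of_nonneg fun k _ =>
          mul_nonneg (by positivity) (integral_nonneg fun _ => sq_nonneg _)).symm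
    _ ≤ _ := by
        apply ENNReal.ofReal_le_ofReal
        rw [← Finset.mul_sum, ← integral_finsetSum _ fun k _ => hi k]
        refine mul_le_mul_of_nonneg_left ?_ (by positivity)
        exact integral_mono (integrable_finsetSum _ fun k _ => hi k) hg fun ω => hfg _

/-! ### Bounds on quadratic forms -/

lemma le_quadForm_of_spectrum {κ : Type*} [Fintype κ] [DecidableEq κ] {Ψ : Matrix κ κ ℝ}
    (hΨ : Ψ.IsSymm) {c C : ℝ} (h : spectrum ℝ Ψ ⊆ Icc c C) (v : κ → ℝ) :
    c * l2 v ^ 2 ≤ v ⬝ᵥ (Ψ *ᵥ v) := by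
  have hpsd : (Ψ - c • (1 : Matrix κ κ ℝ)).PosSemidef := by
    rw [Matrix.posSemidef_iff_isHermitian_and_spectrum_nonneg]
    constructor
    · rw [Matrix.IsHermitian, Matrix.conjTranspose_eq_transpose_of_trivial, Matrix.transpose_sub,
        Matrix.transpose_smul, Matrix.transpose_one, hΨ.eq]
    · have e : Ψ - c • (1 : Matrix κ κ ℝ) = Ψ - algebraMap ℝ (Matrix κ κ ℝ) c := by
        rw [Algebra.algebraMap_eq_smul_one]
      rw [e, ← spectrum.sub_singleton_eq]
      rintro _ ⟨x, hx, y, rfl, rfl⟩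
      exact sub_nonneg.mpr (h hx).1
  have h1 := hpsd.dotProduct_mulVec_nonneg v
  rw [Matrix.sub_mulVec, dotProduct_sub, Matrix.smul_mulVec, Matrix.one_mulVec, dotProduct_smul,
    star_trivial, smul_eq_mul, ← l2_sq_eq_dot] at h1
  linarith

lemma gram_lower_of_close {ι κ : Type*} [Fintype ι] [Fintype κ] {A : Matrix ι κ ℝ}
    {Ψ : Matrix κ κ ℝ} {c m : ℝ} (hc : 0 ≤ c) (hm : 0 < m)
    (hΨ : ∀ v, c * l2 v ^ 2 ≤ v ⬝ᵥ (Ψ *ᵥ v))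
    (hA : ∑ k, ∑ l, (m⁻¹ * (Aᵀ * A) k l - Ψ k l) ^ 2 ≤ (c / 2) ^ 2) (v : κ → ℝ) :
    c / 2 * m * l2 v ^ 2 ≤ l2 (A *ᵥ v) ^ 2 := by
  have hD : l2 ((m⁻¹ • (Aᵀ * A) - Ψ) *ᵥ v) ≤ c / 2 * l2 v :=
    l2_mulVec_le _ (by positivity) (by simpa using hA) v
  have h1 : |v ⬝ᵥ ((m⁻¹ • (Aᵀ * A) - Ψ) *ᵥ v)| ≤ c / 2 * l2 v ^ 2 :=
    (abs_dot_le _ _).trans (by nlinarith [l2_nonneg v])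
  rw [Matrix.sub_mulVec, dotProduct_sub, Matrix.smul_mulVec, dotProduct_smul, smul_eq_mul,
    ← l2_mulVec_sq] at h1
  have h2 : c / 2 * l2 v ^ 2 ≤ m⁻¹ * l2 (A *ᵥ v) ^ 2 := by
    linarith [hΨ v, (abs_le.mp h1).1]
  rw [mul_comm (c / 2) m, mul_assoc]
  calc m * (c / 2 * l2 v ^ 2) ≤ m * (m⁻¹ * l2 (A *ᵥ v) ^ 2) := by gcongr
    _ = _ := by field_simp

/-! ### The setting of the series estimator -/

/-- The standing assumptions on the sample, the population and the sieve. -/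
structure SeriesSetting {Ω₀ Ω : Type*} [MeasurableSpace Ω₀] [MeasurableSpace Ω] {dX dZ : ℕ}
    (M : Model Ω₀ dX dZ) (μ₀ : Measure Ω₀) [IsProbabilityMeasure μ₀] (μ : Measure Ω)
    (Z : ℕ → Ω → Obs dX dZ) (N : Set ℝ) (L h₀ ϖ : ℝ) (τ : ℝ → ℝ) (K : ℕ → ℕ)
    (b : ∀ K : ℕ, Fin K → ℝ × ℝ → ℝ) : Prop where
  indep : iIndepFun Z μ
  law : ∀ i, IdentDistrib (Z i) M.obs μ μ₀
  game : M.ParametricGame μ₀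
  lin : M.LinearOutcome μ₀
  copula : LocalCopula M μ₀ N L h₀
  trimming : IsTrimming ϖ τ
  K_pos : ∀ n, 0 < K n
  smooth_g : ContDiffOn ℝ (2 : ℕ) (M.g10 μ₀) unitSquare
  smooth_b : ∀ n k, ContDiffOn ℝ (2 : ℕ) (b (K n) k) unitSquare
  eigen : EigenBounds M μ₀ τ b K
  moment : M.BoundedFourthMoment μ₀
  growth : BasisGrowth b K

namespace SeriesSetting

variable {Ω₀ Ω : Type*} [MeasurableSpace Ω₀] [MeasurableSpace Ω] {dX dZ : ℕ}
  {M : Model Ω₀ dX dZ} {μ₀ : Measure Ω₀} [IsProbabilityMeasure μ₀] {μ : Measure Ω}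
  [IsProbabilityMeasure μ] {Z : ℕ → Ω → Obs dX dZ} {N : Set ℝ} {L h₀ ϖ : ℝ} {τ : ℝ → ℝ}
  {K : ℕ → ℕ} {b : ∀ K : ℕ, Fin K → ℝ × ℝ → ℝ}

lemma contDiff_b (S : SeriesSetting M μ₀ μ Z N L h₀ ϖ τ K b) (n : ℕ) (k : Fin (K n)) :
    ContDiffOn ℝ (1 : ℕ) (b (K n) k) unitSquare :=
  (S.smooth_b n k).of_le (by norm_num)

lemma contDiff_g (S : SeriesSetting M μ₀ μ Z N L h₀ ϖ τ K b) :
    ContDiffOn ℝ (1 : ℕ) (M.g10 μ₀) unitSquare :=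
  S.smooth_g.of_le (by norm_num)

lemma measurable_regressor_true (S : SeriesSetting M μ₀ μ Z N L h₀ ϖ τ K b) (n : ℕ)
    (l : Fin dX ⊕ Fin (K n)) :
    Measurable fun z : Design dX dZ => regressor M μ₀ τ (b (K n)) M.θ z l :=
  S.copula.measurable_regressor S.game S.trimming (fun k => (S.contDiff_b n k).continuousOn)
    measurable_const (fun _ => S.copula.true_mem) measurable_id l

lemma measurable_l2_covX : Measurable fun z : Design dX dZ => l2 (covX z.2 0) ^ 2 := by
  simp only [l2_sq]
  exact Finset.measurable_sum _ fun k _ =>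
    ((measurable_pi_apply k).comp (measurable_covX measurable_snd 0)).pow_const 2

lemma integrable_l2_covX (S : SeriesSetting M μ₀ μ Z N L h₀ ϖ τ K b) :
    Integrable (fun ω => l2 (covX (M.design ω).2 0) ^ 2) μ₀ := by
  simp only [l2_sq]
  exact integrable_finsetSum _ fun k _ => (S.lin.memLp_X k).integrable_sq

lemma tight_sum_covX (S : SeriesSetting M μ₀ μ Z N L h₀ ϖ τ K b) :
    Tight μ fun (C : ℝ) n ω => ∑ i : Fin n, l2 (covX (Z i ω).2.2 0) ^ 2 ≤ C * n :=
  tight_sum_le (f := fun o : Obs dX dZ => l2 (covX o.2.2 0) ^ 2) S.law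
    (measurable_l2_covX.comp measurable_snd) (fun _ => sq_nonneg _) S.integrable_l2_covX

lemma tight_sum_errObs (S : SeriesSetting M μ₀ μ Z N L h₀ ϖ τ K b) :
    Tight μ fun (C : ℝ) n ω => ∑ i : Fin n, M.errObs μ₀ (Z i ω) ^ 4 ≤ C * n :=
  tight_sum_le (f := fun o : Obs dX dZ => M.errObs μ₀ o ^ 4) S.law
    ((S.game.meas_errObs S.smooth_g.continuousOn).pow_const 4) (fun _ => by positivity)
    S.moment.1

lemma ae_mem_support (S : SeriesSetting M μ₀ μ Z N L h₀ ϖ τ K b) :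
    ∀ᵐ ω ∂μ, ∀ i, (Z i ω).2.2 ∈ (μ₀.map M.W).support := by
  rw [ae_all_iff]
  intro i
  have h := (S.law i).comp (u := fun o : Obs dX dZ => o.2.2) measurable_snd.snd
  have hms : MeasurableSet (μ₀.map M.W).support := Measure.isClosed_support.measurableSet
  have h0 : ∀ᵐ w ∂(μ₀.map M.W), w ∈ (μ₀.map M.W).support := Measure.support_mem_ae
  have h1 : ∀ᵐ ω ∂μ₀, M.W ω ∈ (μ₀.map M.W).support :=
    (ae_map_iff S.game.meas_W.aemeasurable hms).mp h0
  exact (h.symm.ae_snd hms h1 : _)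

/-! #### Growth of the basis -/

lemma tendsto_zeta_sq_div_sqrt (S : SeriesSetting M μ₀ μ Z N L h₀ ϖ τ K b) :
    Tendsto (fun n : ℕ => zeta (b (K n)) 0 ^ 2 * (√(n : ℝ))⁻¹) atTop (𝓝 0) := by
  refine squeeze_zero' (Eventually.of_forall fun n => by positivity) ?_ S.growth.zeta_sq
  filter_upwards [eventually_ge_atTop 3] with n hn
  have hlog : 1 ≤ Real.log n := by
    rw [Real.le_log_iff_exp_le (by positivity)]
    exact Real.exp_one_lt_d9.le.trans (by
      have : (3 : ℝ) ≤ n := by exact_mod_cast hn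
      linarith)
  have : (√(n : ℝ))⁻¹ ≤ √(Real.log n / n) := by
    rw [← Real.sqrt_inv]
    apply Real.sqrt_le_sqrt
    rw [← one_div]
    gcongr
  gcongr

lemma tendsto_zeta_sq_div (S : SeriesSetting M μ₀ μ Z N L h₀ ϖ τ K b) :
    Tendsto (fun n : ℕ => (n : ℝ)⁻¹ * zeta (b (K n)) 0 ^ 2) atTop (𝓝 0) := by
  have h2 : Tendsto (fun n : ℕ => (√(n : ℝ))⁻¹) atTop (𝓝 0) :=
    (Real.tendsto_sqrt_atTop.comp tendsto_natCast_atTop_atTop).inv_tendsto_atTop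
  have := S.tendsto_zeta_sq_div_sqrt.mul h2
  rw [zero_mul] at this
  refine this.congr fun n => ?_
  rw [mul_assoc, ← mul_inv, Real.mul_self_sqrt n.cast_nonneg, mul_comm]

lemma tendsto_zeta_four_div (S : SeriesSetting M μ₀ μ Z N L h₀ ϖ τ K b) :
    Tendsto (fun n : ℕ => (n : ℝ)⁻¹ * zeta (b (K n)) 0 ^ 4) atTop (𝓝 0) := by
  have := S.tendsto_zeta_sq_div_sqrt.pow 2
  rw [zero_pow two_ne_zero] at this
  refine this.congr fun n => ?_
  rw [mul_pow, inv_pow, Real.sq_sqrt n.cast_nonneg]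
  ring

/-! #### The Gram matrix -/

lemma exists_quadForm_lower (S : SeriesSetting M μ₀ μ Z N L h₀ ϖ τ K b) :
    ∃ c, 0 < c ∧ ∀ n v, c * l2 v ^ 2 ≤ v ⬝ᵥ (PsiPop M μ₀ τ (b (K n)) *ᵥ v) := by
  obtain ⟨c, C, hc, h⟩ := S.eigen
  refine ⟨c, hc, fun n v => le_quadForm_of_spectrum ?_ (h n) v⟩
  ext k l
  simp only [PsiPop, Matrix.transpose_apply, Matrix.of_apply, mul_comm]

/-- Each diagonal entry of the sieve block of Ψ_K is at least c, while the trace of that block is at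
most (ζ₀/ϖ)². Thus K = O(ζ₀²), which also keeps ζ₀ away from zero. -/
lemma exists_zeta_lower (S : SeriesSetting M μ₀ μ Z N L h₀ ϖ τ K b) :
    ∃ c, 0 < c ∧ ∀ n, c * K n ≤ zeta (b (K n)) 0 ^ 2 := by
  obtain ⟨c, hc, h⟩ := S.exists_quadForm_lower
  have hϖ := S.trimming.pos
  refine ⟨c * ϖ ^ 2, by positivity, fun n => ?_⟩
  have hd : ∀ k : Fin (K n), c ≤ ∫ ω, regressor M μ₀ τ (b (K n)) M.θ (M.design ω) (Sum.inr k) ^ 2 ∂μ₀ := by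
    intro k
    have h1 := h n (Pi.single (Sum.inr k) 1)
    rw [l2_sq_eq_dot] at h1
    simp only [Matrix.mulVec_single_one, single_one_dotProduct, Pi.single_eq_same, mul_one,
      Matrix.col_apply, PsiPop, Matrix.of_apply] at h1
    simpa only [sq] using h1
  have hb : ∀ ω, ∑ k, regressor M μ₀ τ (b (K n)) M.θ (M.design ω) (Sum.inr k) ^ 2
      ≤ (ϖ⁻¹ * zeta (b (K n)) 0) ^ 2 := fun ω => by
    rw [← l2_sq]
    exact pow_le_pow_left₀ (l2_nonneg _)
      (l2_regressor_inr_le S.game S.trimming (S.contDiff_b n) S.game.ρ_mem _) 2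
  have hm : ∀ l, Measurable fun ω => regressor M μ₀ τ (b (K n)) M.θ (M.design ω) l := fun l =>
    (S.measurable_regressor_true n l).comp S.game.meas_design
  have hi : ∀ k : Fin (K n), Integrable (fun ω =>
      regressor M μ₀ τ (b (K n)) M.θ (M.design ω) (Sum.inr k) ^ 2) μ₀ := fun k =>
    Integrable.mono' (integrable_const ((ϖ⁻¹ * zeta (b (K n)) 0) ^ 2))
      ((hm _).pow_const 2).aestronglyMeasurable (ae_of_all _ fun ω => by
        rw [Real.norm_eq_abs, abs_of_nonneg (sq_nonneg _)]
        exact (Finset.single_le_sum (f := fun k =>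
          regressor M μ₀ τ (b (K n)) M.θ (M.design ω) (Sum.inr k) ^ 2) (fun k _ => sq_nonneg _)
          (Finset.mem_univ k)).trans (hb ω))
  have hsum : c * K n ≤ (ϖ⁻¹ * zeta (b (K n)) 0) ^ 2 := by
    calc c * K n = ∑ _k : Fin (K n), c := by simp [mul_comm]
      _ ≤ ∑ k : Fin (K n), _ := Finset.sum_le_sum fun k _ => hd k
      _ = ∫ ω, ∑ k, regressor M μ₀ τ (b (K n)) M.θ (M.design ω) (Sum.inr k) ^ 2 ∂μ₀ :=
          (integral_finsetSum _ fun k _ => hi k).symm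
      _ ≤ ∫ _ω, (ϖ⁻¹ * zeta (b (K n)) 0) ^ 2 ∂μ₀ :=
          integral_mono (integrable_finsetSum _ fun k _ => hi k) (integrable_const _) hb
      _ = _ := by simp
  rw [mul_pow, inv_pow, ← div_eq_inv_mul, le_div_iff₀ (by positivity)] at hsum
  linarith

/-- With probability approaching one, the sample Gram matrix is uniformly nonsingular. -/
lemma tight_gram (S : SeriesSetting M μ₀ μ Z N L h₀ ϖ τ K b) :
    ∃ c, 0 < c ∧ Tight μ fun (_ : Unit) n ω => ∀ v, c * n * l2 v ^ 2
      ≤ l2 (regMatrix M μ₀ τ (b (K n)) M.θ (sample Z n ω) *ᵥ v) ^ 2 := by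
  obtain ⟨c, hc, hΨ⟩ := S.exists_quadForm_lower
  refine ⟨c / 2, by positivity, ?_⟩
  have hϖ := S.trimming.pos
  -- covariate block
  set fX : Fin dX × Fin dX → Obs dX dZ → ℝ := fun q o =>
    (trimI M μ₀ τ M.θ o.2 * covX o.2.2 0 q.1) * (trimI M μ₀ τ M.θ o.2 * covX o.2.2 0 q.2) with hfX
  have hfXm : ∀ q, Measurable (fX q) := fun q =>
    ((S.measurable_regressor_true 0 (Sum.inl q.1)).comp measurable_snd).mul
      ((S.measurable_regressor_true 0 (Sum.inl q.2)).comp measurable_snd)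
  have hfXi : ∀ q, Integrable (fun ω => fX q (M.obs ω)) μ₀ := fun q => by
    refine S.integrable_l2_covX.mono' ((hfXm q).comp_aemeasurable
      (S.law 0).aemeasurable_snd).aestronglyMeasurable (ae_of_all _ fun ω => ?_)
    have hI := trimI_mem S.game S.trimming S.game.ρ_mem (M.design ω)
    have h1 : ∀ k, |trimI M μ₀ τ M.θ (M.design ω) * covX (M.design ω).2 0 k|
        ≤ l2 (covX (M.design ω).2 0) := fun k => by
      rw [abs_mul, abs_of_nonneg hI.1]
      exact (mul_le_of_le_one_left (abs_nonneg _) hI.2).trans (abs_le_l2 _ k)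
    rw [Real.norm_eq_abs, abs_mul, sq]
    exact mul_le_mul (h1 _) (h1 _) (abs_nonneg _) (l2_nonneg _)
  -- Half of the error budget (c / 2)² is shared among the entries of the covariate block. These are
  -- merely integrable, hence a law of large numbers without rate, which suffices as their number is
  -- fixed. The added 1 avoids division by zero.
  set ε : ℝ := (c / 2) ^ 2 / 2 / (Fintype.card (Fin dX × Fin dX) + 1) with hε
  have hε0 : 0 < ε := by positivity
  have tX := tendsto_measure_forall fun q => tendsto_measure_mean_sub_sq S.indep S.law (hfXm q)
    (hfXi q) hε0
  -- remaining blocks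
  set fb : ∀ n, Fin (K n) × (Fin dX ⊕ Fin (K n)) → Obs dX dZ → ℝ := fun n q o =>
    regressor M μ₀ τ (b (K n)) M.θ o.2 (Sum.inr q.1) * regressor M μ₀ τ (b (K n)) M.θ o.2 q.2
    with hfb
  have hfbm : ∀ n q, Measurable (fb n q) := fun n q =>
    ((S.measurable_regressor_true n _).comp measurable_snd).mul
      ((S.measurable_regressor_true n _).comp measurable_snd)
  set m₂ := ∫ ω, l2 (covX (M.design ω).2 0) ^ 2 ∂μ₀ with hm₂
  -- Every entry outside the covariate block contains a sieve factor, so the row norm bounds give a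
  -- mean squared Frobenius error of order (ζ₀² + ζ₀⁴) / n.
  have hfbg : ∀ n o, ∑ q, fb n q o ^ 2 ≤ (ϖ⁻¹ * zeta (b (K n)) 0) ^ 2 *
      (l2 (covX o.2.2 0) ^ 2 + (ϖ⁻¹ * zeta (b (K n)) 0) ^ 2) := by
    intro n o
    have e : ∑ q, fb n q o ^ 2 = l2 (fun k => regressor M μ₀ τ (b (K n)) M.θ o.2 (Sum.inr k)) ^ 2
        * l2 (regressor M μ₀ τ (b (K n)) M.θ o.2) ^ 2 := by
      rw [l2_sq, l2_sq, Finset.sum_mul_sum, Fintype.sum_prod_type]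
      simp only [hfb, mul_pow]
    rw [e]
    exact mul_le_mul (pow_le_pow_left₀ (l2_nonneg _)
      (l2_regressor_inr_le S.game S.trimming (S.contDiff_b n) S.game.ρ_mem _) 2)
      (l2_regressor_sq_le S.game S.trimming (S.contDiff_b n) S.game.ρ_mem _) (sq_nonneg _)
      (sq_nonneg _)
  have hfbint : ∀ n, Integrable (fun ω => (ϖ⁻¹ * zeta (b (K n)) 0) ^ 2 *
      (l2 (covX (M.obs ω).2.2 0) ^ 2 + (ϖ⁻¹ * zeta (b (K n)) 0) ^ 2)) μ₀ := fun n =>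
    (S.integrable_l2_covX.add (integrable_const _)).const_mul _
  have tb := tendsto_measure_of_lintegral (μ := μ) (ε := (c / 2) ^ 2 / 4)
    (X := fun n ω => ∑ q, ((n : ℝ)⁻¹ * ∑ i : Fin n, fb n q (Z i ω)
      - ∫ ω, fb n q (M.obs ω) ∂μ₀) ^ 2)
    (r := fun n => (n : ℝ)⁻¹ * ((ϖ⁻¹ * zeta (b (K n)) 0) ^ 2 *
      (m₂ + (ϖ⁻¹ * zeta (b (K n)) 0) ^ 2)))
    (fun n => Finset.aemeasurable_fun_sum _ fun q _ => by
      refine AEMeasurable.pow_const (AEMeasurable.sub_const (AEMeasurable.const_mul ?_ _) _) 2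
      exact Finset.aemeasurable_fun_sum (f := fun (i : Fin n) ω => fb n q (Z i ω)) Finset.univ
        fun i _ => (hfbm n q).comp_aemeasurable (S.law i).aemeasurable_fst)
    (by
      filter_upwards [eventually_gt_atTop 0] with n hn
      refine (lintegral_sum_mean_sub_sq_le S.indep S.law (hfbm n) (hfbint n) (hfbg n) hn).trans
        (le_of_eq ?_)
      congr 2
      rw [integral_const_mul]
      refine congrArg _ ((integral_add S.integrable_l2_covX (integrable_const _)).trans ?_)
      simp [hm₂])
    (by
      have h1 := (S.tendsto_zeta_sq_div.const_mul (ϖ⁻¹ ^ 2 * m₂)).add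
        (S.tendsto_zeta_four_div.const_mul (ϖ⁻¹ ^ 4))
      simp only [mul_zero, add_zero] at h1
      refine h1.congr fun n => by ring)
    (by positivity)
  refine ((tight_of_tendsto tX).and (tight_of_tendsto tb)).mono fun _ => ⟨(), ?_⟩
  filter_upwards [eventually_gt_atTop 0] with n hn ω hω v
  obtain ⟨hX, hb⟩ := hω
  have hn0 : (0 : ℝ) < n := by positivity
  refine gram_lower_of_close (Ψ := PsiPop M μ₀ τ (b (K n))) hc.le hn0 (hΨ n) ?_ v
  set A := regMatrix M μ₀ τ (b (K n)) M.θ (sample Z n ω) with hA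
  set D : Fin dX ⊕ Fin (K n) → Fin dX ⊕ Fin (K n) → ℝ := fun k l =>
    (n : ℝ)⁻¹ * (Aᵀ * A) k l - PsiPop M μ₀ τ (b (K n)) k l with hD
  have hsymm : ∀ k l, D k l = D l k := fun k l => by
    simp only [hD, PsiPop, Matrix.of_apply, Matrix.mul_apply, Matrix.transpose_apply, mul_comm]
  have e1 : ∀ k l, D (Sum.inl k) (Sum.inl l)
      = (n : ℝ)⁻¹ * ∑ i : Fin n, fX (k, l) (Z i ω) - ∫ ω, fX (k, l) (M.obs ω) ∂μ₀ :=
    fun k l => rfl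
  have e2 : ∀ k l, D (Sum.inr k) l
      = (n : ℝ)⁻¹ * ∑ i : Fin n, fb n (k, l) (Z i ω) - ∫ ω, fb n (k, l) (M.obs ω) ∂μ₀ :=
    fun k l => rfl
  have s1 : ∑ k, ∑ l, D (Sum.inl k) (Sum.inl l) ^ 2 ≤ (c / 2) ^ 2 / 2 := by
    calc ∑ k, ∑ l, D (Sum.inl k) (Sum.inl l) ^ 2
        = ∑ q : Fin dX × Fin dX, D (Sum.inl q.1) (Sum.inl q.2) ^ 2 :=
          (Fintype.sum_prod_type' fun k l => D (Sum.inl k) (Sum.inl l) ^ 2).symm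
      _ ≤ ∑ _q : Fin dX × Fin dX, ε := Finset.sum_le_sum fun q _ => by rw [e1]; exact hX q
      _ = Fintype.card (Fin dX × Fin dX) * ε := by simp
      _ ≤ (c / 2) ^ 2 / 2 := by
          rw [hε, mul_div_assoc', div_le_iff₀ (by positivity), mul_comm]
          gcongr
          linarith
  have s2 : ∑ k, ∑ l, D (Sum.inr k) l ^ 2 ≤ (c / 2) ^ 2 / 4 := by
    rw [← Fintype.sum_prod_type' fun k l => D (Sum.inr k) l ^ 2]
    simp only [e2]
    exact hb
  have s3 : ∑ k, ∑ l, D (Sum.inl k) (Sum.inr l) ^ 2 ≤ ∑ k, ∑ l, D (Sum.inr k) l ^ 2 := by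
    rw [Finset.sum_comm]
    refine Finset.sum_le_sum fun k _ => ?_
    rw [Fintype.sum_sum_type (fun l => D (Sum.inr k) l ^ 2)]
    simp only [hsymm (Sum.inl _) (Sum.inr k)]
    exact le_add_of_nonneg_right (Finset.sum_nonneg fun _ _ => sq_nonneg _)
  change ∑ k, ∑ l, D k l ^ 2 ≤ (c / 2) ^ 2
  -- By symmetry the mixed block counts twice, hence the remaining half of the budget was split into
  -- quarters.
  have e3 : ∑ k, ∑ l, D k l ^ 2 = ∑ k, ∑ l, D (Sum.inl k) (Sum.inl l) ^ 2
      + ∑ k, ∑ l, D (Sum.inl k) (Sum.inr l) ^ 2 + ∑ k, ∑ l, D (Sum.inr k) l ^ 2 := by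
    rw [Fintype.sum_sum_type, ← Finset.sum_add_distrib]
    congr 1
    exact Finset.sum_congr rfl fun k _ => Fintype.sum_sum_type _
  rw [e3]
  linarith

end SeriesSetting

end GameMTE

namespace GameMTE

open Model Matrix

/-! ### Measurability of least squares weights -/

section MeasurableWeights

variable {α ι κ σ : Type*} [MeasurableSpace α] [Fintype ι] [Fintype κ] [DecidableEq κ] [Fintype σ]
  [DecidableEq σ]

lemma measurable_det {A : α → Matrix κ κ ℝ} (hA : ∀ k l, Measurable fun a => A a k l) :
    Measurable fun a => (A a).det := by
  simp only [Matrix.det_apply]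
  exact Finset.measurable_sum _ fun π _ =>
    (Finset.measurable_prod _ fun k _ => hA _ _).const_smul _

/-- By Cramer's rule the inverse is a rational expression in the entries, and it remains measurable
across singular matrices since division by zero is defined. -/
lemma measurable_matrix_inv {A : α → Matrix κ κ ℝ} (hA : ∀ k l, Measurable fun a => A a k l)
    (k l : κ) : Measurable fun a => (A a)⁻¹ k l := by
  simp only [Matrix.inv_def, Matrix.smul_apply, Ring.inverse_eq_inv', smul_eq_mul,
    Matrix.adjugate_apply]
  refine (measurable_det hA).inv.mul (measurable_det fun i j => ?_)
  simp only [Matrix.updateRow_apply]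
  split_ifs
  · exact measurable_const
  · exact hA i j

lemma measurable_noiseWt {B : α → Matrix ι (σ ⊕ κ) ℝ} (hB : ∀ i l, Measurable fun a => B a i l)
    (q : κ → ℝ) (i : ι) : Measurable fun a => noiseWt (B a) q i := by
  refine Finset.measurable_sum _ fun k _ => (hB i _).mul (Finset.measurable_sum _ fun l _ =>
    Measurable.mul_const (measurable_matrix_inv (fun k l => ?_) _ l) _)
  simp only [Matrix.mul_apply, Matrix.transpose_apply]
  exact Finset.measurable_sum _ fun j _ => (hB j k).mul (hB j l)

end MeasurableWeights

/-! ### Second moments of weighted noise -/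

lemma NoisySample.lintegral_sum_sum_sq_le {Ω 𝒵 ι : Type*} [MeasurableSpace Ω] [MeasurableSpace 𝒵]
    [Fintype ι] {μ : Measure Ω} {z : ℕ → Ω → 𝒵} {e : ℕ → Ω → ℝ} {ν : Measure 𝒵}
    [IsProbabilityMeasure ν] {κ : Kernel 𝒵 ℝ} [IsMarkovKernel κ] {C : ℝ} {n : ℕ}
    (hS : NoisySample μ z e ν κ C) {a : ι → (Fin n → 𝒵) → Fin n → ℝ}
    (ha : ∀ l i, Measurable fun x => a l x i) :
    ∫⁻ ω, ENNReal.ofReal (∑ l, (∑ i, a l (fun i => z i ω) i * e i ω) ^ 2) ∂μ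
      ≤ ENNReal.ofReal (1 + C) *
        ∫⁻ ω, ENNReal.ofReal (∑ l, ∑ i, a l (fun i => z i ω) i ^ 2) ∂μ := by
  have hz : ∀ n, AEMeasurable (fun ω (i : Fin n) => z i ω) μ := fun n =>
    aemeasurable_pi_lambda _ fun i => (hS.aemeas i).fst
  have he : ∀ i, AEMeasurable (e i) μ := fun i => (hS.aemeas i).snd
  simp_rw [ENNReal.ofReal_sum_of_nonneg fun (l : ι) _ => sq_nonneg _,
    ENNReal.ofReal_sum_of_nonneg fun (l : ι) _ => Finset.sum_nonneg fun i _ => sq_nonneg _]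
  rw [lintegral_finsetSum' _ fun l _ => by
      refine AEMeasurable.ennreal_ofReal (AEMeasurable.pow_const ?_ 2)
      exact Finset.aemeasurable_fun_sum _ fun i _ =>
        ((ha l i).comp_aemeasurable (hz n)).mul (he i),
    lintegral_finsetSum' _ fun l _ => by
      refine AEMeasurable.ennreal_ofReal ?_
      exact Finset.aemeasurable_fun_sum _ fun i _ =>
        ((ha l i).comp_aemeasurable (hz n)).pow_const 2, Finset.mul_sum]
  exact Finset.sum_le_sum fun l _ => hS.lintegral_sum_sq_le (ha l)

/-! ### The first stage -/

/-- A root-`n` consistent, measurable first stage with copula parameter in `N`. -/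
structure FirstStage {Ω₀ Ω : Type*} [MeasurableSpace Ω₀] [MeasurableSpace Ω] {dX dZ : ℕ}
    (M : Model Ω₀ dX dZ) (μ₀ : Measure Ω₀) (μ : Measure Ω) (Z : ℕ → Ω → Obs dX dZ) (N : Set ℝ)
    (t : ∀ n : ℕ, (Fin n → Design dX dZ) → Param dX dZ) : Prop where
  meas : ∀ n, Measurable (t n)
  mem : ∀ n z, (t n z).2.1 ∈ N
  rootn : RootNConsistent M μ₀ μ Z t

/-- The first-stage errors are at most `δ`. -/
def FirstStageClose {Ω₀ : Type*} [MeasurableSpace Ω₀] {dX dZ : ℕ} (M : Model Ω₀ dX dZ)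
    (μ₀ : Measure Ω₀) {n : ℕ} (θ : Param dX dZ) (z : Fin n → Design dX dZ) (δ : ℝ) : Prop :=
  (∀ i j d, |M.P μ₀ θ (z i).2 j d - M.P μ₀ M.θ (z i).2 j d| ≤ δ) ∧ |θ.2.1 - M.θ.2.1| ≤ δ

section

variable {Ω₀ Ω : Type*} [MeasurableSpace Ω₀] [MeasurableSpace Ω] {dX dZ : ℕ}
  {M : Model Ω₀ dX dZ} {μ₀ : Measure Ω₀} [IsProbabilityMeasure μ₀] {μ : Measure Ω}
  [IsProbabilityMeasure μ] {Z : ℕ → Ω → Obs dX dZ} {N : Set ℝ} {L h₀ ϖ : ℝ} {τ : ℝ → ℝ}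
  {K : ℕ → ℕ} {b : ∀ K : ℕ, Fin K → ℝ × ℝ → ℝ}
  {t : ∀ n : ℕ, (Fin n → Design dX dZ) → Param dX dZ}

lemma RootNConsistent.tight_close (h : RootNConsistent M μ₀ μ Z t) :
    Tight μ fun (C : ℝ) n ω => 0 ≤ C ∧ FirstStageClose M μ₀ (t n (sampleDesign Z n ω))
      (sampleDesign Z n ω) (C * (√(n : ℝ))⁻¹) := by
  have hr : ∀ᶠ n : ℕ in atTop, 0 ≤ 1 / √(n : ℝ) := Eventually.of_forall fun n => by positivity
  have hθ := (isOP_iff_tight hr).mp h.1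
  have hP := fun j d => (isOP_iff_tight hr).mp (h.2 j d)
  refine (hθ.and (((hP 0 false).and (hP 0 true)).and ((hP 1 false).and (hP 1 true)))).mono ?_
  rintro ⟨c, ⟨c₁, c₂⟩, c₃, c₄⟩
  set C := max |c| (max (max |c₁| |c₂|) (max |c₃| |c₄|)) with hC
  have hC0 : 0 ≤ C := (abs_nonneg c).trans (le_max_left _ _)
  refine ⟨C, Eventually.of_forall fun n ω => ?_⟩
  rintro ⟨h0, ⟨h1, h2⟩, h3, h4⟩
  have hs : 0 ≤ (√(n : ℝ))⁻¹ := by positivity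
  have key : ∀ {x a : ℝ}, |a| ≤ C → ‖x‖ₑ ≤ ENNReal.ofReal (a * (1 / √(n : ℝ))) →
      |x| ≤ C * (√(n : ℝ))⁻¹ := by
    intro x a ha hx
    rw [Real.enorm_eq_ofReal_abs, one_div] at hx
    exact (ENNReal.ofReal_le_ofReal_iff (by positivity)).mp (hx.trans (ENNReal.ofReal_le_ofReal
      (mul_le_mul_of_nonneg_right ((le_abs_self a).trans ha) hs)))
  have hle : ∀ {a : ℝ} (j : Fin 2) (d : Bool), |a| ≤ C →
      (⨆ i : Fin n, ‖M.P μ₀ (t n (sampleDesign Z n ω)) (Z i ω).2.2 j d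
        - M.P μ₀ M.θ (Z i ω).2.2 j d‖ₑ) ≤ ENNReal.ofReal (a * (1 / √(n : ℝ))) →
      ∀ i : Fin n, |M.P μ₀ (t n (sampleDesign Z n ω)) (Z i ω).2.2 j d
        - M.P μ₀ M.θ (Z i ω).2.2 j d| ≤ C * (√(n : ℝ))⁻¹ :=
    fun j d ha hs i => key ha ((le_iSup (fun i : Fin n => ‖M.P μ₀ (t n (sampleDesign Z n ω))
      (Z i ω).2.2 j d - M.P μ₀ M.θ (Z i ω).2.2 j d‖ₑ) i).trans hs)
  refine ⟨hC0, fun i j d => ?_, ?_⟩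
  · fin_cases j <;> cases d
    · exact hle 0 false (by simp [hC]) h1 i
    · exact hle 0 true (by simp [hC]) h2 i
    · exact hle 1 false (by simp [hC]) h3 i
    · exact hle 1 true (by simp [hC]) h4 i
  · refine key (a := c) (by simp [hC]) (le_trans ?_ h0)
    rw [← ofReal_norm, ← ofReal_norm]
    apply ENNReal.ofReal_le_ofReal
    exact (norm_fst_le (t n (sampleDesign Z n ω) - M.θ).2).trans (norm_snd_le _)

namespace SeriesSetting

lemma tendsto_inv_sqrt : Tendsto (fun n : ℕ => (√(n : ℝ))⁻¹) atTop (𝓝 0) :=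
  (Real.tendsto_sqrt_atTop.comp tendsto_natCast_atTop_atTop).inv_tendsto_atTop

/-- With probability approaching one, the Gram matrices at the true and at the estimated
first-stage parameter are uniformly nonsingular and the regressor matrices are close. -/
lemma tight_design (S : SeriesSetting M μ₀ μ Z N L h₀ ϖ τ K b) (ht : FirstStage M μ₀ μ Z N t) :
    ∃ c, 0 < c ∧ Tight μ fun (D : ℝ) n ω => 0 ≤ D ∧
      (∀ v, c * n * l2 v ^ 2 ≤ l2 (regMatrix M μ₀ τ (b (K n)) M.θ (sample Z n ω) *ᵥ v) ^ 2) ∧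
      (∀ v, c * n * l2 v ^ 2 ≤ l2 (regMatrix M μ₀ τ (b (K n)) (t n (sampleDesign Z n ω))
        (sample Z n ω) *ᵥ v) ^ 2) ∧
      ∑ i, ∑ l, (regMatrix M μ₀ τ (b (K n)) (t n (sampleDesign Z n ω)) (sample Z n ω)
        - regMatrix M μ₀ τ (b (K n)) M.θ (sample Z n ω)) i l ^ 2
          ≤ (D * (1 + zeta (b (K n)) 1)) ^ 2 ∧
      ∑ i : Fin n, l2 (covX (Z i ω).2.2 0) ^ 2 ≤ D * n ∧
      FirstStageClose M μ₀ (t n (sampleDesign Z n ω)) (sampleDesign Z n ω)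
        (D * (√(n : ℝ))⁻¹) := by
  obtain ⟨c, hc, hgram⟩ := S.tight_gram
  obtain ⟨CR, hCR, hreg⟩ := exists_regressor_lipschitz S.game S.trimming S.copula
  refine ⟨c / 4, by positivity, (hgram.and (ht.rootn.tight_close.and S.tight_sum_covX)).mono ?_⟩
  rintro ⟨-, C, C'⟩
  set D := max (max C (|C'| + 1)) (CR * |C| * (|C'| + 1)) with hD
  have hD0 : 0 ≤ D := by
    refine le_trans ?_ ((le_max_right _ _).trans (le_max_left _ _))
    positivity
  -- The estimated regressor matrix differs from the true one by O(1 + ζ₁) in Frobenius norm. As ζ₁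
  -- = o(√n), this is eventually below half the smallest singular value √(cn), which explains c / 4.
  have hsmall : ∀ᶠ n : ℕ in atTop, D * (1 + zeta (b (K n)) 1) * (√(n : ℝ))⁻¹ ≤ √c / 2 := by
    have h1 : Tendsto (fun n : ℕ => D * (1 + zeta (b (K n)) 1) * (√(n : ℝ))⁻¹) atTop (𝓝 0) := by
      have := ((tendsto_inv_sqrt.add S.growth.zeta_one).const_mul D)
      rw [add_zero, mul_zero] at this
      exact this.congr fun n => by rw [div_eq_mul_inv]; ring
    exact h1.eventually_le_const (by positivity)
  refine ⟨D, ?_⟩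
  filter_upwards [hsmall, eventually_gt_atTop 0] with n hsm hn ω
  rintro ⟨hA, ⟨hC0, hclose⟩, hX⟩
  have hn0 : (0 : ℝ) < n := by positivity
  have hs0 : 0 < √(n : ℝ) := Real.sqrt_pos.mpr hn0
  have hss : √(n : ℝ) ^ 2 = n := Real.sq_sqrt hn0.le
  have hδ : 0 ≤ C * (√(n : ℝ))⁻¹ := by positivity
  have hz := zeta_nonneg (b (K n)) 1
  have hdiff : ∑ i, ∑ l, (regMatrix M μ₀ τ (b (K n)) (t n (sampleDesign Z n ω)) (sample Z n ω)
        - regMatrix M μ₀ τ (b (K n)) M.θ (sample Z n ω)) i l ^ 2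
          ≤ (D * (1 + zeta (b (K n)) 1)) ^ 2 := by
    calc _ ≤ ∑ i : Fin n, (CR * (C * (√(n : ℝ))⁻¹)) ^ 2 *
          (l2 (covX (Z i ω).2.2 0) ^ 2 + zeta (b (K n)) 1 ^ 2) := by
          refine Finset.sum_le_sum fun i _ => ?_
          have := hreg (S.contDiff_b n) (ht.mem n (sampleDesign Z n ω)) hδ (hclose.1 i) hclose.2
          rw [l2_sq] at this
          exact this
      _ = (CR * C) ^ 2 * (n : ℝ)⁻¹ * (∑ i : Fin n, l2 (covX (Z i ω).2.2 0) ^ 2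
            + n * zeta (b (K n)) 1 ^ 2) := by
          rw [← Finset.mul_sum, Finset.sum_add_distrib]
          simp only [Finset.sum_const, Finset.card_univ, Fintype.card_fin, nsmul_eq_mul]
          rw [← mul_assoc CR, mul_pow _ (√(n : ℝ))⁻¹, inv_pow, hss]
      _ ≤ (CR * C) ^ 2 * (n : ℝ)⁻¹ * (C' * n + n * zeta (b (K n)) 1 ^ 2) := by gcongr
      _ = (CR * C) ^ 2 * (C' + zeta (b (K n)) 1 ^ 2) := by field_simp
      _ ≤ (CR * C) ^ 2 * ((|C'| + 1) * (1 + zeta (b (K n)) 1)) ^ 2 := by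
          refine mul_le_mul_of_nonneg_left ?_ (sq_nonneg _)
          nlinarith [le_abs_self C', abs_nonneg C', mul_nonneg (abs_nonneg C') hz,
            mul_nonneg (abs_nonneg C') (sq_nonneg (zeta (b (K n)) 1)),
            mul_nonneg (sq_nonneg |C'|) (sq_nonneg (1 + zeta (b (K n)) 1)),
            sq_nonneg (|C'| - 1)]
      _ = (CR * |C| * (|C'| + 1) * (1 + zeta (b (K n)) 1)) ^ 2 := by
          rw [abs_of_nonneg hC0]; ring
      _ ≤ _ := by
          refine pow_le_pow_left₀ (by positivity) ?_ 2
          exact mul_le_mul_of_nonneg_right (le_max_right _ _) (by positivity)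
  have hgA : ∀ v, c * n * l2 v ^ 2
      ≤ l2 (regMatrix M μ₀ τ (b (K n)) M.θ (sample Z n ω) *ᵥ v) ^ 2 := hA
  refine ⟨hD0, fun v => (mul_le_mul_of_nonneg_right ?_ (sq_nonneg _)).trans (hgA v), fun v => ?_,
    hdiff, hX.trans ?_, fun i j d => (hclose.1 i j d).trans ?_, hclose.2.trans ?_⟩
  · exact mul_le_mul_of_nonneg_right (by linarith) hn0.le
  · have := gram_lower_of_perturb (by positivity) hgA (hdiff.trans (by
      refine pow_le_pow_left₀ (by positivity) ?_ 2
      rw [Real.sqrt_mul hc.le]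
      rw [← div_eq_mul_inv, div_le_iff₀ hs0] at hsm
      linarith)) v
    linarith
  · refine mul_le_mul_of_nonneg_right ?_ hn0.le
    exact ((le_abs_self C').trans (by linarith)).trans ((le_max_right _ _).trans (le_max_left _ _))
  · exact mul_le_mul_of_nonneg_right ((le_max_left _ _).trans (le_max_left _ _)) (by positivity)
  · exact mul_le_mul_of_nonneg_right ((le_max_left _ _).trans (le_max_left _ _)) (by positivity)

lemma measurable_regressor_est (S : SeriesSetting M μ₀ μ Z N L h₀ ϖ τ K b)
    (ht : FirstStage M μ₀ μ Z N t) (n : ℕ) (i : Fin n) (l : Fin dX ⊕ Fin (K n)) :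
    Measurable fun z : Fin n → Design dX dZ => regressor M μ₀ τ (b (K n)) (t n z) (z i) l :=
  S.copula.measurable_regressor S.game S.trimming (fun k => (S.contDiff_b n k).continuousOn)
    (ht.meas n) (ht.mem n) (measurable_pi_apply i) l

lemma measurable_tau_est (S : SeriesSetting M μ₀ μ Z N L h₀ ϖ τ K b)
    (ht : FirstStage M μ₀ μ Z N t) (n : ℕ) (i : Fin n) :
    Measurable fun z : Fin n → Design dX dZ => τ (M.L10 μ₀ (t n z) (z i).2) :=
  S.copula.measurable_tau S.game S.trimming (ht.meas n) (ht.mem n)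
    (measurable_snd.comp (measurable_pi_apply i))

lemma tau_mem (S : SeriesSetting M μ₀ μ Z N L h₀ ϖ τ K b) {θ : Param dX dZ} (hθ : θ.2.1 ∈ N)
    (w : Fin 2 → WVec dX dZ) : τ (M.L10 μ₀ θ w) ∈ Icc (0 : ℝ) 1 :=
  S.trimming.maps (L10_mem S.game (S.copula.subset hθ) w)

/-- Second moments of the score `R̂ᵀ(noise)`, for the coordinates selected by `f`. -/
lemma tight_score_of_le (S : SeriesSetting M μ₀ μ Z N L h₀ ϖ τ K b)
    (ht : FirstStage M μ₀ μ Z N t) {ι : ℕ → Type*} [∀ n, Fintype (ι n)]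
    (f : ∀ n, ι n → Fin dX ⊕ Fin (K n)) {A : ℝ} (hA : 0 ≤ A) {r : ℕ → ℝ} (hr : ∀ n, 1 ≤ r n)
    (hf : ∀ n θ z, θ.2.1 ∈ N → ∑ k, regressor M μ₀ τ (b (K n)) θ z (f n k) ^ 2
      ≤ l2 (covX z.2 0) ^ 2 + A * r n) :
    Tight μ fun (C : ℝ) n ω => ∑ k, ((regMatrix M μ₀ τ (b (K n)) (t n (sampleDesign Z n ω))
      (sample Z n ω))ᵀ *ᵥ noiseVec M μ₀ τ (t n (sampleDesign Z n ω)) (sample Z n ω)) (f n k) ^ 2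
        ≤ C * (n * r n) := by
  obtain ⟨C, hS⟩ := exists_noisySample S.indep S.law S.game S.lin S.smooth_g.continuousOn S.moment
  have : IsProbabilityMeasure (μ₀.map M.design) :=
    Measure.isProbabilityMeasure_map S.game.meas_design.aemeasurable
  have hC := hS.nonneg
  set m₂ := ∫ ω, l2 (covX (M.design ω).2 0) ^ 2 ∂μ₀ with hm₂
  have hm₂0 : 0 ≤ m₂ := integral_nonneg fun _ => sq_nonneg _
  -- The estimated parameter is a function of the designs, hence so are these coefficients.
  -- Conditionally on the designs the noise is still centred, and no separate argument for the
  -- estimation of θ is needed.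
  set a : ∀ n, ι n → (Fin n → Design dX dZ) → Fin n → ℝ := fun n k z i =>
    regressor M μ₀ τ (b (K n)) (t n z) (z i) (f n k) * τ (M.L10 μ₀ (t n z) (z i).2) with ha
  have ham : ∀ n k i, Measurable fun z => a n k z i := fun n k i =>
    (S.measurable_regressor_est ht n i _).mul (S.measurable_tau_est ht n i)
  have e : ∀ n ω k, ((regMatrix M μ₀ τ (b (K n)) (t n (sampleDesign Z n ω))
      (sample Z n ω))ᵀ *ᵥ noiseVec M μ₀ τ (t n (sampleDesign Z n ω)) (sample Z n ω)) (f n k)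
      = ∑ i : Fin n, a n k (fun i => (Z i ω).2) i * M.errObs μ₀ (Z i ω) := fun n ω k => by
    simp only [mulVec, dotProduct, Matrix.transpose_apply, regMatrix, Matrix.of_apply, noiseVec, ha]
    exact Finset.sum_congr rfl fun i _ => (mul_assoc _ _ _).symm
  simp only [e]
  have hz : ∀ n, AEMeasurable (fun ω (i : Fin n) => (Z i ω).2) μ := fun n =>
    aemeasurable_pi_lambda _ fun i => (hS.aemeas i).fst
  refine tight_of_lintegral_le (C := (1 + C) * (m₂ + A)) (r := fun n => n * r n) (fun n => ?_)
    ((eventually_gt_atTop 0).mono fun n hn => ?_) (by positivity)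
    (Eventually.of_forall fun n => ?_)
  · refine Finset.aemeasurable_fun_sum _ fun k _ => AEMeasurable.pow_const ?_ 2
    exact Finset.aemeasurable_fun_sum _ fun i _ =>
      ((ham n k i).comp_aemeasurable (hz n)).mul (hS.aemeas i).snd
  · have := hr n
    positivity
  · refine (hS.lintegral_sum_sum_sq_le (ham n)).trans ?_
    rw [mul_assoc, ENNReal.ofReal_mul (by positivity)]
    refine mul_le_mul' le_rfl ?_
    have hr0 : 0 ≤ r n := zero_le_one.trans (hr n)
    calc _ ≤ ∫⁻ ω, ENNReal.ofReal (∑ i : Fin n, (l2 (covX (Z i ω).2.2 0) ^ 2 + A * r n)) ∂μ := by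
          refine lintegral_mono fun ω => ENNReal.ofReal_le_ofReal ?_
          rw [Finset.sum_comm]
          refine Finset.sum_le_sum fun i _ => le_trans (Finset.sum_le_sum fun k _ => ?_)
            (hf n (t n (sampleDesign Z n ω)) (Z i ω).2 (ht.mem n _))
          have hτ := S.tau_mem (ht.mem n (sampleDesign Z n ω)) (Z i ω).2.2
          have e1 : a n k (fun i => (Z i ω).2) i ^ 2
              = regressor M μ₀ τ (b (K n)) (t n (sampleDesign Z n ω)) (Z i ω).2 (f n k) ^ 2
                * τ (M.L10 μ₀ (t n (sampleDesign Z n ω)) (Z i ω).2.2) ^ 2 := mul_pow _ _ 2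
          rw [e1]
          exact mul_le_of_le_one_right (sq_nonneg _) (pow_le_one₀ hτ.1 hτ.2)
      _ = n * ∫⁻ ω, ENNReal.ofReal (l2 (covX (M.obs ω).2.2 0) ^ 2 + A * r n) ∂μ₀ :=
          lintegral_sum_identDistrib (f := fun o : Obs dX dZ => l2 (covX o.2.2 0) ^ 2 + A * r n)
            S.law ((measurable_l2_covX.comp measurable_snd).add_const _)
            (fun o => by positivity) n
      _ = n * ENNReal.ofReal (m₂ + A * r n) := by
          have e2 : ∫ ω, (l2 (covX (M.obs ω).2.2 0) ^ 2 + A * r n) ∂μ₀ = m₂ + A * r n := by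
            refine (integral_add S.integrable_l2_covX (integrable_const _)).trans ?_
            simp [hm₂]
          have e3 := ofReal_integral_eq_lintegral_ofReal (μ := μ₀)
            (f := fun ω => l2 (covX (M.obs ω).2.2 0) ^ 2 + A * r n)
            (S.integrable_l2_covX.add (integrable_const _)) (ae_of_all _ fun ω => by positivity)
          rw [← e3, e2]
      _ = ENNReal.ofReal (n * (m₂ + A * r n)) := by
          rw [ENNReal.ofReal_mul n.cast_nonneg, ENNReal.ofReal_natCast]
      _ ≤ _ := by
          apply ENNReal.ofReal_le_ofReal
          have h1 : m₂ ≤ m₂ * r n := le_mul_of_one_le_right hm₂0 (hr n)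
          calc (n : ℝ) * (m₂ + A * r n) ≤ n * (m₂ * r n + A * r n) := by gcongr
            _ = _ := by ring

lemma tight_score (S : SeriesSetting M μ₀ μ Z N L h₀ ϖ τ K b) (ht : FirstStage M μ₀ μ Z N t) :
    Tight μ fun (C : ℝ) n ω => l2 ((regMatrix M μ₀ τ (b (K n)) (t n (sampleDesign Z n ω))
      (sample Z n ω))ᵀ *ᵥ noiseVec M μ₀ τ (t n (sampleDesign Z n ω)) (sample Z n ω)) ^ 2
        ≤ C * (n * (1 + zeta (b (K n)) 0 ^ 2)) := by
  simp only [l2_sq]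
  refine S.tight_score_of_le ht (fun n k => k) (A := ϖ⁻¹ ^ 2) (by positivity)
    (fun n => by linarith [sq_nonneg (zeta (b (K n)) 0)]) fun n θ z hθ => ?_
  rw [← l2_sq]
  refine (l2_regressor_sq_le S.game S.trimming (S.contDiff_b n) (S.copula.subset hθ) z).trans ?_
  rw [mul_pow]
  gcongr
  linarith

/-- The covariate block has fixed dimension, so its score is O(√n) without a factor ζ₀. Multiplied
by ζ₀ / n it stays within the rate, unlike the full score. -/
lemma tight_score_inl (S : SeriesSetting M μ₀ μ Z N L h₀ ϖ τ K b)
    (ht : FirstStage M μ₀ μ Z N t) :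
    Tight μ fun (C : ℝ) n ω => l2 (fun k => ((regMatrix M μ₀ τ (b (K n))
      (t n (sampleDesign Z n ω)) (sample Z n ω))ᵀ *ᵥ
        noiseVec M μ₀ τ (t n (sampleDesign Z n ω)) (sample Z n ω)) (Sum.inl k)) ^ 2 ≤ C * n := by
  have h := S.tight_score_of_le ht (ι := fun _ => Fin dX) (fun n k => Sum.inl k) (A := 0) le_rfl
    (r := fun _ => 1) (fun n => le_rfl) fun n θ z hθ => by
      rw [zero_mul, add_zero, ← l2_sq]
      exact pow_le_pow_left₀ (l2_nonneg _)
        (l2_regressor_inl_le S.game S.trimming (S.copula.subset hθ) z) 2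
  simpa only [l2_sq, mul_one] using h

end SeriesSetting

end

end GameMTE

/-! ### Maximal inequality for the noise part of the coefficients -/

namespace GameMTE

open Model Matrix

/-- A union bound for sums of truncated noise with finitely many weight vectors. -/
lemma NoisySample.measure_exists_sum_trunc_le {Ω 𝒵 ι : Type*} [MeasurableSpace Ω]
    [MeasurableSpace 𝒵] [Fintype ι] {μ : Measure Ω} {z : ℕ → Ω → 𝒵} {e : ℕ → Ω → ℝ}
    {ν : Measure 𝒵} [IsProbabilityMeasure ν] {κ : Kernel 𝒵 ℝ} [IsMarkovKernel κ] {C : ℝ} {n : ℕ}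
    (hS : NoisySample μ z e ν κ C) {a : ι → (Fin n → 𝒵) → Fin n → ℝ}
    (ha : ∀ j i, Measurable fun x => a j x i) {A B M l t : ℝ} (hA : 0 ≤ A) (hM : 0 < M)
    (hl : 0 < l) (hlA : l * A * M ≤ 1) :
    μ {ω | ∃ j, (∀ i, |a j (fun i => z i ω) i| ≤ A) ∧ ∑ i, a j (fun i => z i ω) i ^ 2 ≤ B ∧
        t < |∑ i, a j (fun i => z i ω) i * trunc M (e i ω)|}
      ≤ ENNReal.ofReal (Fintype.card ι *
        (2 * Real.exp (-(l * t) + (l ^ 2 * B * (1 + C) + l * (n * A) * (C / M ^ 3))))) := by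
  set x := Real.exp (-(l * t) + (l ^ 2 * B * (1 + C) + l * (n * A) * (C / M ^ 3)))
  have hx : 0 ≤ x := (Real.exp_pos _).le
  set G : ι → Set Ω := fun j => {ω | (∀ i, |a j (fun i => z i ω) i| ≤ A) ∧
    ∑ i, a j (fun i => z i ω) i ^ 2 ≤ B ∧ t < ∑ i, a j (fun i => z i ω) i * trunc M (e i ω)}
  set G' : ι → Set Ω := fun j => {ω | (∀ i, |(-a j (fun i => z i ω)) i| ≤ A) ∧
    ∑ i, (-a j (fun i => z i ω)) i ^ 2 ≤ B ∧
    t < ∑ i, (-a j (fun i => z i ω)) i * trunc M (e i ω)}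
  have h1 : ∀ j, μ (G j) ≤ ENNReal.ofReal x := fun j =>
    hS.measure_sum_trunc_le (ha j) hA hM hl hlA
  have h2 : ∀ j, μ (G' j) ≤ ENNReal.ofReal x := fun j =>
    hS.measure_sum_trunc_le (a := fun x => -a j x) (fun i => (ha j i).neg) hA hM hl hlA
  calc _ ≤ μ (⋃ j, (G j ∪ G' j)) := by
        refine measure_mono fun ω hω => ?_
        obtain ⟨j, h1, h2, h3⟩ := hω
        refine mem_iUnion.mpr ⟨j, ?_⟩
        rcases lt_abs.mp h3 with h | h
        · exact Or.inl ⟨h1, h2, h⟩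
        · refine Or.inr ⟨fun i => by simpa using h1 i, by simpa using h2, ?_⟩
          simpa [Finset.sum_neg_distrib] using h
    _ ≤ ∑ j, μ (G j ∪ G' j) := measure_iUnion_fintype_le μ _
    _ ≤ ∑ _j : ι, (ENNReal.ofReal x + ENNReal.ofReal x) :=
        Finset.sum_le_sum fun j _ => (measure_union_le _ _).trans (add_le_add (h1 j) (h2 j))
    _ = _ := by
        rw [← ENNReal.ofReal_add hx hx, ← two_mul, Finset.sum_const, Finset.card_univ,
          nsmul_eq_mul, ENNReal.ofReal_mul (Nat.cast_nonneg _), ENNReal.ofReal_natCast]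

lemma exists_grid_near {x : ℝ} (hx : x ∈ Icc (0 : ℝ) 1) {m : ℕ} (hm : 0 < m) :
    ∃ j : Fin (m + 1), ((j : ℕ) : ℝ) / m ∈ Icc (0 : ℝ) 1 ∧ |x - ((j : ℕ) : ℝ) / m| ≤ (m : ℝ)⁻¹ := by
  have hm0 : (0 : ℝ) < m := by positivity
  have hxm : 0 ≤ x * m := mul_nonneg hx.1 hm0.le
  have h1 : ⌊x * m⌋₊ ≤ m := by
    have := Nat.floor_le_floor (mul_le_mul_of_nonneg_right hx.2 hm0.le)
    rwa [one_mul, Nat.floor_natCast] at this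
  have h2 := Nat.floor_le hxm
  have h3 := Nat.lt_floor_add_one (x * m)
  refine ⟨⟨⌊x * m⌋₊, Nat.lt_succ_of_le h1⟩, ⟨by positivity, ?_⟩, ?_⟩
  · rw [div_le_one hm0]; exact_mod_cast h1
  · have e : x - ((⌊x * m⌋₊ : ℕ) : ℝ) / m = (x * m - (⌊x * m⌋₊ : ℝ)) * (m : ℝ)⁻¹ := by
      field_simp
    simp only [e, abs_mul, abs_of_pos (inv_pos.mpr hm0)]
    refine mul_le_of_le_one_left (inv_pos.mpr hm0).le ?_
    rw [abs_le]; constructor <;> linarith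

lemma add_one_mul_self_le {y : ℝ} (hy : 1 ≤ y) : (y + 1) * (y + 1) ≤ 4 * y ^ 2 := by nlinarith

lemma abs_le_one_add_pow_four (x : ℝ) : |x| ≤ 1 + x ^ 4 := by
  have h : |x| ^ 4 = x ^ 4 := by rw [← abs_pow, abs_of_nonneg (by positivity)]
  rw [← h]
  nlinarith [sq_nonneg (|x| ^ 2 - 1), sq_nonneg (|x| - 1), abs_nonneg x, sq_nonneg (|x| ^ 2)]

namespace SeriesSetting

variable {Ω₀ Ω : Type*} [MeasurableSpace Ω₀] [MeasurableSpace Ω] {dX dZ : ℕ}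
  {M : Model Ω₀ dX dZ} {μ₀ : Measure Ω₀} [IsProbabilityMeasure μ₀] {μ : Measure Ω}
  [IsProbabilityMeasure μ] {Z : ℕ → Ω → Obs dX dZ} {N : Set ℝ} {L h₀ ϖ : ℝ} {τ : ℝ → ℝ}
  {K : ℕ → ℕ} {b : ∀ K : ℕ, Fin K → ℝ × ℝ → ℝ}
  {t : ∀ n : ℕ, (Fin n → Design dX dZ) → Param dX dZ}

lemma zeta_pos (S : SeriesSetting M μ₀ μ Z N L h₀ ϖ τ K b) (n : ℕ) : 0 < zeta (b (K n)) 0 := by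
  obtain ⟨c, hc, h⟩ := S.exists_zeta_lower
  have hK : (0 : ℝ) < K n := by exact_mod_cast S.K_pos n
  have h1 : 0 < zeta (b (K n)) 0 ^ 2 := (mul_pos hc hK).trans_le (h n)
  exact (zeta_nonneg _ _).lt_of_ne fun h0 => by rw [← h0] at h1; norm_num at h1

/-- This turns the Lipschitz constant K^ω of the basis into a power of n, so that a grid of
polynomial size is fine enough. -/
lemma eventually_K_le (S : SeriesSetting M μ₀ μ Z N L h₀ ϖ τ K b) :
    ∀ᶠ n in atTop, (K n : ℝ) ≤ n := by
  obtain ⟨c, hc, h⟩ := S.exists_zeta_lower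
  filter_upwards [S.tendsto_zeta_sq_div.eventually_le_const hc, eventually_gt_atTop 0] with n h1 hn
  have hn0 : (0 : ℝ) < n := by positivity
  rw [inv_mul_le_iff₀ hn0] at h1
  have := (h n).trans h1
  rw [mul_comm (n : ℝ)] at this
  exact le_of_mul_le_mul_left this hc

set_option maxHeartbeats 1000000 in
/-- Uniform rate of the linear functional `b(p)'` of the noise part of the coefficients. -/
lemma tight_noise_sup (S : SeriesSetting M μ₀ μ Z N L h₀ ϖ τ K b) (ht : FirstStage M μ₀ μ Z N t)
    (hlip : BasisLipschitz b K) {c : ℝ} (hc : 0 < c) (D E : ℝ) :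
    Tight μ fun (T : ℝ) n ω =>
      (∀ v, c * n * l2 v ^ 2 ≤ l2 (regMatrix M μ₀ τ (b (K n)) (t n (sampleDesign Z n ω))
        (sample Z n ω) *ᵥ v) ^ 2) →
      ∑ i : Fin n, l2 (covX (Z i ω).2.2 0) ^ 2 ≤ D * n →
      ∑ i : Fin n, M.errObs μ₀ (Z i ω) ^ 4 ≤ E * n →
      ∀ p ∈ unitSquare, |∑ i, noiseWt (regMatrix M μ₀ τ (b (K n)) (t n (sampleDesign Z n ω))
        (sample Z n ω)) (fun k => b (K n) k p) i
          * noiseVec M μ₀ τ (t n (sampleDesign Z n ω)) (sample Z n ω) i|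
        ≤ T * (zeta (b (K n)) 0 * √(Real.log n / n)) := by
  obtain ⟨C, hS⟩ := exists_noisySample S.indep S.law S.game S.lin S.smooth_g.continuousOn S.moment
  have : IsProbabilityMeasure (μ₀.map M.design) :=
    Measure.isProbabilityMeasure_map S.game.meas_design.aemeasurable
  have hC := hS.nonneg
  obtain ⟨cb, ω₀, hcb, hω₀, hbl⟩ := hlip
  have hϖ := S.trimming.pos
  set κ := ϖ * c with hκ
  have hκ0 : 0 < κ := by positivity
  -- With mesh n^{-ν} the discretization error of the basis is of order K^ω n^{-ν} ≤ n⁻¹, using K ≤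
  -- n.
  set ν : ℕ := ⌈ω₀⌉₊ + 1 with hν
  set B₀ : ℝ := 2 / c + 2 * |D| / c ^ 2 with hB₀
  have hB₀0 : 0 ≤ B₀ := by positivity
  -- Chosen so that the exponent becomes at most -(2ν + 1) log n: the part 2ν pays for the grid of
  -- at most 4n^{2ν} points and the extra 1 leaves probability O(1/n), while the other summands
  -- absorb the variance and the truncation bias.
  set T : ℝ := ((2 * ν + 1 : ℕ) + (κ ^ 2 * B₀ * (1 + C) + C)) / κ with hT
  set ζ : ℕ → ℝ := fun n => zeta (b (K n)) 0 with hζ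
  have hζ0 : ∀ n, 0 < ζ n := S.zeta_pos
  set r : ℕ → ℝ := fun n => √(Real.log n / n) with hr
  -- The bound A on single weights, the truncation level 1/(ζr) and the Chernoff parameter l are
  -- matched so that their product is exactly 1, the largest value allowed, while l times the target
  -- deviation is κT log n.
  set A : ℕ → ℝ := fun n => κ⁻¹ * ζ n ^ 2 / n with hA
  set Mt : ℕ → ℝ := fun n => (ζ n * r n)⁻¹ with hMt
  set l : ℕ → ℝ := fun n => κ * Real.log n / (ζ n * r n) with hl
  set g : ∀ n, Fin (n ^ ν + 1) × Fin (n ^ ν + 1) → ℝ × ℝ := fun n j =>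
    (((j.1 : ℕ) : ℝ) / ((n ^ ν : ℕ) : ℝ), ((j.2 : ℕ) : ℝ) / ((n ^ ν : ℕ) : ℝ)) with hg
  set Bm : ∀ n, (Fin n → Design dX dZ) → Matrix (Fin n) (Fin dX ⊕ Fin (K n)) ℝ := fun n z =>
    Matrix.of fun i => regressor M μ₀ τ (b (K n)) (t n z) (z i) with hBm
  set a : ∀ n, Fin (n ^ ν + 1) × Fin (n ^ ν + 1) → (Fin n → Design dX dZ) → Fin n → ℝ :=
    fun n j z i => noiseWt (Bm n z) (fun k => b (K n) k (g n j)) i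
      * τ (M.L10 μ₀ (t n z) (z i).2) with ha
  have ham : ∀ n j i, Measurable fun z => a n j z i := fun n j i =>
    (measurable_noiseWt (fun i l => S.measurable_regressor_est ht n i l) _ i).mul
      (S.measurable_tau_est ht n i)
  set bad : ℕ → Set Ω := fun n => {ω | ∃ j, (∀ i, |a n j (fun i => (Z i ω).2) i| ≤ A n) ∧
    ∑ i, a n j (fun i => (Z i ω).2) i ^ 2 ≤ B₀ * ζ n ^ 2 / n ∧
    T * (ζ n * r n) < |∑ i : Fin n, a n j (fun i => (Z i ω).2) i *
      trunc (Mt n) (M.errObs μ₀ (Z i ω))|} with hbad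
  have hlarge : ∀ᶠ n : ℕ in atTop, 3 ≤ n ∧ ζ n ^ 2 * r n ≤ 1 ∧ (K n : ℝ) ≤ n :=
    (eventually_ge_atTop 3).and
      ((S.growth.zeta_sq.eventually_le_const one_pos).and S.eventually_K_le)
  have hbasic : ∀ n : ℕ, 3 ≤ n → (0 : ℝ) < n ∧ 1 ≤ Real.log n ∧ 0 < r n ∧
      Real.log n = n * r n ^ 2 := by
    intro n hn
    have hn0 : (0 : ℝ) < n := by positivity
    have hlog : 1 ≤ Real.log n := by
      rw [Real.le_log_iff_exp_le hn0]
      have : (3 : ℝ) ≤ n := by exact_mod_cast hn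
      exact Real.exp_one_lt_d9.le.trans (by linarith)
    refine ⟨hn0, hlog, Real.sqrt_pos.mpr (by positivity), ?_⟩
    rw [hr, Real.sq_sqrt (by positivity)]
    field_simp
  have hbadlim : Tendsto (fun n => μ (bad n)) atTop (𝓝 0) := by
    have hlim : Tendsto (fun n : ℕ => ENNReal.ofReal (8 * (n : ℝ)⁻¹)) atTop (𝓝 0) := by
      have := ENNReal.tendsto_ofReal
        (((tendsto_inv_atTop_zero (𝕜 := ℝ)).comp tendsto_natCast_atTop_atTop).const_mul 8)
      simpa using this
    refine tendsto_of_tendsto_of_tendsto_of_le_of_le' tendsto_const_nhds hlim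
      (Eventually.of_forall fun _ => zero_le) ?_
    filter_upwards [hlarge] with n hn
    obtain ⟨hn3, hsmall, -⟩ := hn
    obtain ⟨hn0, hlog, hr0, hrn⟩ := hbasic n hn3
    have hz0 := hζ0 n
    have hMt0 : 0 < Mt n := by positivity
    have hl0 : 0 < l n := by positivity
    refine (hS.measure_exists_sum_trunc_le (ham n) (A := A n) (B := B₀ * ζ n ^ 2 / n) (M := Mt n)
      (l := l n) (t := T * (ζ n * r n)) (by positivity) hMt0 hl0 (le_of_eq ?_)).trans ?_
    · simp only [hl, hA, hMt]
      rw [hrn]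
      field_simp
    · apply ENNReal.ofReal_le_ofReal
      have e1 : l n * (T * (ζ n * r n)) = κ * T * Real.log n := by
        simp only [hl]; field_simp
      have e2 : l n ^ 2 * (B₀ * ζ n ^ 2 / n) * (1 + C) = κ ^ 2 * B₀ * (1 + C) * Real.log n := by
        simp only [hl]; rw [hrn]; field_simp
      have e3 : l n * (n * A n) * (C / Mt n ^ 3) = C * Real.log n * (ζ n ^ 2 * r n) ^ 2 := by
        simp only [hl, hA, hMt]; field_simp
      -- The truncation bias is absorbed because ζ₀²√(log n / n) is eventually at most 1.
      have e4 : C * Real.log n * (ζ n ^ 2 * r n) ^ 2 ≤ C * Real.log n :=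
        mul_le_of_le_one_right (by positivity) (pow_le_one₀ (by positivity) hsmall)
      have e5 : κ * T = (2 * ν + 1 : ℕ) + (κ ^ 2 * B₀ * (1 + C) + C) := by
        rw [hT]; field_simp
      have e6 : -(l n * (T * (ζ n * r n))) + (l n ^ 2 * (B₀ * ζ n ^ 2 / n) * (1 + C)
          + l n * (n * A n) * (C / Mt n ^ 3)) ≤ -((2 * ν + 1 : ℕ) * Real.log n) := by
        rw [e1, e2, e3, e5]
        linarith [e4]
      have e7 : Real.exp (-((2 * ν + 1 : ℕ) * Real.log n)) = ((n : ℝ) ^ (2 * ν + 1))⁻¹ := by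
        rw [Real.exp_neg, Real.exp_nat_mul, Real.exp_log hn0]
      have hpow : 1 ≤ (n : ℝ) ^ ν := one_le_pow₀ (by
        have : (3 : ℝ) ≤ n := by exact_mod_cast hn3
        linarith)
      have e8 : (Fintype.card (Fin (n ^ ν + 1) × Fin (n ^ ν + 1)) : ℝ) ≤ 4 * (n : ℝ) ^ (2 * ν) := by
        simp only [Fintype.card_prod, Fintype.card_fin]
        push_cast
        rw [mul_comm 2 ν, pow_mul]
        exact add_one_mul_self_le hpow
      calc _ ≤ 4 * (n : ℝ) ^ (2 * ν) * (2 * ((n : ℝ) ^ (2 * ν + 1))⁻¹) := by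
            rw [← e7]
            gcongr
        _ = 8 * (n : ℝ)⁻¹ := by
            rw [pow_succ]; field_simp; norm_num
  have htight : Tight μ fun (_ : Unit) n ω => ω ∉ bad n := tight_of_tendsto <| by
    simpa only [not_not, ofPred_mem_eq] using hbadlim
  refine htight.mono fun _ => ⟨2 * cb * (1 + |E|) * κ⁻¹ + T + κ⁻¹ * |E|, ?_⟩
  filter_upwards [hlarge] with n hn ω hω hgram hX he p hp
  obtain ⟨hn3, hsmall, hKn⟩ := hn
  obtain ⟨hn0, hlog, hr0, hrn⟩ := hbasic n hn3
  have hz0 := hζ0 n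
  have hcn : 0 < c * n := by positivity
  have hMt0 : 0 < Mt n := by positivity
  have hm : 0 < n ^ ν := pow_pos (by omega) ν
  have hm0 : (0 : ℝ) < ((n ^ ν : ℕ) : ℝ) := by exact_mod_cast hm
  obtain ⟨j₁, hj₁, hd₁⟩ := exists_grid_near hp.1 hm
  obtain ⟨j₂, hj₂, hd₂⟩ := exists_grid_near hp.2 hm
  have hgp : g n (j₁, j₂) ∈ unitSquare := ⟨hj₁, hj₂⟩
  set z : Fin n → Design dX dZ := fun i => (Z i ω).2 with hz
  change ∀ v, c * n * l2 v ^ 2 ≤ l2 (Bm n z *ᵥ v) ^ 2 at hgram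
  change |∑ i : Fin n, noiseWt (Bm n z) (fun k => b (K n) k p) i
    * (τ (M.L10 μ₀ (t n z) (z i).2) * M.errObs μ₀ (Z i ω))| ≤ _
  set q := fun k => b (K n) k p
  set q' := fun k => b (K n) k (g n (j₁, j₂))
  set ε : Fin n → ℝ := fun i => M.errObs μ₀ (Z i ω) with hε
  have hτ : ∀ i, τ (M.L10 μ₀ (t n z) (z i).2) ∈ Icc (0 : ℝ) 1 := fun i =>
    S.tau_mem (ht.mem n z) _
  have hrow : ∀ i, l2 (fun k => Bm n z i (Sum.inr k)) ≤ ϖ⁻¹ * ζ n := fun i =>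
    l2_regressor_inr_le S.game S.trimming (S.contDiff_b n) (S.copula.subset (ht.mem n z)) _
  have hq' : l2 q' ≤ ζ n := l2_le_zeta (S.contDiff_b n) hgp
  -- discretization
  have hqq : l2 (q - q') ≤ 2 * cb * r n := by
    have h1 : l2 (q - q') ≤ cb * (K n : ℝ) ^ ω₀ *
        √((p.1 - (g n (j₁, j₂)).1) ^ 2 + (p.2 - (g n (j₁, j₂)).2) ^ 2) := by
      rw [l2_eq_sqrt]; exact hbl n p hp _ hgp
    have h2 : √((p.1 - (g n (j₁, j₂)).1) ^ 2 + (p.2 - (g n (j₁, j₂)).2) ^ 2)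
        ≤ 2 * ((n ^ ν : ℕ) : ℝ)⁻¹ := by
      rw [Real.sqrt_le_left (by positivity)]
      have h3 := sq_le_sq' (abs_le.mp hd₁).1 (abs_le.mp hd₁).2
      have h4 := sq_le_sq' (abs_le.mp hd₂).1 (abs_le.mp hd₂).2
      calc _ ≤ (((n ^ ν : ℕ) : ℝ)⁻¹) ^ 2 + (((n ^ ν : ℕ) : ℝ)⁻¹) ^ 2 := add_le_add h3 h4
        _ ≤ _ := by rw [mul_pow]; linarith [sq_nonneg (((n ^ ν : ℕ) : ℝ)⁻¹)]
    have h5 : (K n : ℝ) ^ ω₀ ≤ (n : ℝ) ^ ⌈ω₀⌉₊ := by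
      have hn1 : (1 : ℝ) ≤ n := by
        have : (3 : ℝ) ≤ n := by exact_mod_cast hn3
        linarith
      calc (K n : ℝ) ^ ω₀ ≤ (n : ℝ) ^ ω₀ := Real.rpow_le_rpow (Nat.cast_nonneg _) hKn hω₀
        _ ≤ (n : ℝ) ^ ((⌈ω₀⌉₊ : ℕ) : ℝ) := Real.rpow_le_rpow_of_exponent_le hn1 (Nat.le_ceil _)
        _ = _ := Real.rpow_natCast _ _
    have h6 : (n : ℝ)⁻¹ ≤ r n := by
      refine Real.le_sqrt_of_sq_le ?_
      have h7 : (n : ℝ)⁻¹ ≤ 1 := inv_le_one_of_one_le₀ (by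
        have : (3 : ℝ) ≤ n := by exact_mod_cast hn3
        linarith)
      rw [sq, div_eq_mul_inv]
      exact mul_le_mul_of_nonneg_right (h7.trans hlog) (by positivity)
    calc l2 (q - q') ≤ cb * (n : ℝ) ^ ⌈ω₀⌉₊ * (2 * ((n ^ ν : ℕ) : ℝ)⁻¹) :=
          h1.trans (by gcongr)
      _ = 2 * cb * (n : ℝ)⁻¹ := by
          rw [hν]; push_cast; rw [pow_succ]; field_simp
      _ ≤ _ := by gcongr
  have hesum : ∑ i, ε i ^ 4 ≤ |E| * n :=
    he.trans (mul_le_mul_of_nonneg_right (le_abs_self E) hn0.le)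
  -- Moving to the grid point needs no cancellation: q - q' is already O(r), each weight is then
  -- O(ζr/n), and the absolute errors sum to O(n) by their fourth moments.
  have t₁ : |∑ i, noiseWt (Bm n z) (q - q') i * (τ (M.L10 μ₀ (t n z) (z i).2) * ε i)|
      ≤ 2 * cb * (1 + |E|) * κ⁻¹ * (ζ n * r n) := by
    calc _ ≤ ∑ i, |noiseWt (Bm n z) (q - q') i * (τ (M.L10 μ₀ (t n z) (z i).2) * ε i)| :=
          Finset.abs_sum_le_sum_abs _ _
      _ ≤ ∑ i, ϖ⁻¹ * ζ n * ((c * n)⁻¹ * (2 * cb * r n)) * (1 + ε i ^ 4) := by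
          refine Finset.sum_le_sum fun i _ => ?_
          rw [abs_mul, abs_mul, abs_of_nonneg (hτ i).1]
          refine mul_le_mul ((abs_noiseWt_le hcn hgram (hrow i) _).trans ?_) ?_
            (mul_nonneg (hτ i).1 (abs_nonneg _)) (by positivity)
          · gcongr
          · exact (mul_le_of_le_one_left (abs_nonneg _) (hτ i).2).trans
              (abs_le_one_add_pow_four _)
      _ = ϖ⁻¹ * ζ n * ((c * n)⁻¹ * (2 * cb * r n)) * (n + ∑ i, ε i ^ 4) := by
          rw [← Finset.mul_sum, Finset.sum_add_distrib]; simp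
      _ ≤ ϖ⁻¹ * ζ n * ((c * n)⁻¹ * (2 * cb * r n)) * (n + |E| * n) := by gcongr
      _ = _ := by rw [hκ]; field_simp
  have hab : ∀ i, |a n (j₁, j₂) z i| ≤ A n := fun i => by
    simp only [ha, abs_mul, abs_of_nonneg (hτ i).1]
    refine (mul_le_of_le_one_right (abs_nonneg _) (hτ i).2).trans
      ((abs_noiseWt_le hcn hgram (hrow i) q').trans ?_)
    calc _ ≤ ϖ⁻¹ * ζ n * ((c * n)⁻¹ * ζ n) := by gcongr
      _ = A n := by simp only [hA, hκ]; field_simp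
  have t₂ : |∑ i, a n (j₁, j₂) z i * trunc (Mt n) (ε i)| ≤ T * (ζ n * r n) := by
    by_contra hcon
    refine hω ⟨(j₁, j₂), hab, ?_, not_le.mp hcon⟩
    calc ∑ i, a n (j₁, j₂) z i ^ 2 ≤ ∑ i, noiseWt (Bm n z) q' i ^ 2 := by
          refine Finset.sum_le_sum fun i _ => ?_
          simp only [ha, mul_pow]
          exact mul_le_of_le_one_right (sq_nonneg _) (pow_le_one₀ (hτ i).1 (hτ i).2)
      _ ≤ 2 * ((c * n)⁻¹ * l2 q' ^ 2) + 2 * ((c * n)⁻¹ * l2 q') ^ 2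
          * ∑ i, l2 (fun k => Bm n z i (Sum.inl k)) ^ 2 := sum_noiseWt_sq_le hcn hgram q'
      _ ≤ 2 * ((c * n)⁻¹ * ζ n ^ 2) + 2 * ((c * n)⁻¹ * ζ n) ^ 2 * (|D| * n) := by
          have hq0 := l2_nonneg q'
          have hXs : ∑ i, l2 (fun k => Bm n z i (Sum.inl k)) ^ 2 ≤ |D| * n := by
            refine (Finset.sum_le_sum fun i _ => ?_).trans (hX.trans
              (mul_le_mul_of_nonneg_right (le_abs_self D) hn0.le))
            exact pow_le_pow_left₀ (l2_nonneg _) (l2_regressor_inl_le (b := b (K n)) S.game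
              S.trimming (S.copula.subset (ht.mem n z)) _) 2
          gcongr
      _ = B₀ * ζ n ^ 2 / n := by rw [hB₀]; field_simp
  -- The discarded tail is bounded pathwise, uniformly over the grid, by A M⁻³ ∑ e⁴ = O(ζr (ζ²r)²),
  -- so it does not enter the union bound.
  have t₃ : |∑ i, a n (j₁, j₂) z i * (ε i - trunc (Mt n) (ε i))|
      ≤ κ⁻¹ * |E| * (ζ n * r n) := by
    calc _ ≤ ∑ i, |a n (j₁, j₂) z i * (ε i - trunc (Mt n) (ε i))| :=
          Finset.abs_sum_le_sum_abs _ _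
      _ ≤ ∑ i, A n * (ε i ^ 4 / Mt n ^ 3) := by
          refine Finset.sum_le_sum fun i _ => ?_
          rw [abs_mul]
          exact mul_le_mul (hab i) (abs_sub_trunc_le hMt0 _) (abs_nonneg _)
            ((abs_nonneg _).trans (hab i))
      _ = A n / Mt n ^ 3 * ∑ i, ε i ^ 4 := by
          rw [Finset.mul_sum]; exact Finset.sum_congr rfl fun i _ => by ring
      _ ≤ A n / Mt n ^ 3 * (|E| * n) := by gcongr
      _ = κ⁻¹ * |E| * (ζ n * r n) * (ζ n ^ 2 * r n) ^ 2 := by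
          simp only [hA, hMt]; field_simp
      _ ≤ _ := mul_le_of_le_one_right (by positivity) (pow_le_one₀ (by positivity) hsmall)
  have e : ∑ i, noiseWt (Bm n z) q i * (τ (M.L10 μ₀ (t n z) (z i).2) * ε i)
      = ∑ i, noiseWt (Bm n z) (q - q') i * (τ (M.L10 μ₀ (t n z) (z i).2) * ε i)
        + ∑ i, a n (j₁, j₂) z i * trunc (Mt n) (ε i)
        + ∑ i, a n (j₁, j₂) z i * (ε i - trunc (Mt n) (ε i)) := by
    rw [← Finset.sum_add_distrib, ← Finset.sum_add_distrib]
    refine Finset.sum_congr rfl fun i _ => ?_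
    simp only [ha, noiseWt_sub]
    ring
  rw [e]
  refine ((abs_add_le _ _).trans (add_le_add ((abs_add_le _ _).trans (add_le_add t₁ t₂)) t₃)).trans
    (le_of_eq ?_)
  ring

end SeriesSetting

end GameMTE

/-! ### Uniform rate of the series estimator -/

namespace GameMTE

open Model Matrix

section

variable {Ω₀ Ω : Type*} [MeasurableSpace Ω₀] [MeasurableSpace Ω] {dX dZ : ℕ}
  {M : Model Ω₀ dX dZ} {μ₀ : Measure Ω₀} [IsProbabilityMeasure μ₀] {μ : Measure Ω}
  [IsProbabilityMeasure μ] {Z : ℕ → Ω → Obs dX dZ} {N : Set ℝ} {L h₀ ϖ : ℝ} {τ : ℝ → ℝ}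
  {K : ℕ → ℕ} {b : ∀ K : ℕ, Fin K → ℝ × ℝ → ℝ}
  {t : ∀ n : ℕ, (Fin n → Design dX dZ) → Param dX dZ}

/-- The inverse inequality for the cross derivative. -/
lemma InverseInequality.exists_abs_cross_le (hinv : InverseInequality M μ₀ b K) :
    ∃ C, 0 ≤ C ∧ ∀ᶠ n in atTop, ∀ (v : Fin (K n) → ℝ) {B : ℝ}, 0 ≤ B →
      (∀ p ∈ M.S10 μ₀, |∑ k, b (K n) k p * v k| ≤ B) →
      ∀ p ∈ M.S10 μ₀, |∑ k, pd (1, 1) (b (K n) k) p * v k| ≤ C * K n * B := by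
  obtain ⟨C, hC⟩ := hinv (1, 1) le_rfl
  refine ⟨|C|, abs_nonneg C, hC.mono fun n hn v B hB hv p hp => ?_⟩
  have h1 : (⨆ p ∈ M.S10 μ₀, ‖∑ k, b (K n) k p * v k‖ₑ) ≤ ENNReal.ofReal B :=
    iSup₂_le fun p hp => by
      rw [Real.enorm_eq_ofReal_abs]; exact ENNReal.ofReal_le_ofReal (hv p hp)
  have h2 := (le_iSup₂ (f := fun p (_ : p ∈ M.S10 μ₀) =>
    ‖∑ k, pd (1, 1) (b (K n) k) p * v k‖ₑ) p hp).trans (hn v)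
  have h3 : (K n : ℝ) ^ ((((1 : ℕ) + (1 : ℕ) : ℕ) : ℝ) / 2) = K n := by norm_num
  simp only [h3] at h2
  have hK : (0 : ℝ) ≤ K n := Nat.cast_nonneg _
  have h4 := h2.trans (mul_le_mul' (ENNReal.ofReal_le_ofReal
    (mul_le_mul_of_nonneg_right (le_abs_self C) hK)) h1)
  rw [← ENNReal.ofReal_mul (by positivity), Real.enorm_eq_ofReal_abs] at h4
  exact (ENNReal.ofReal_le_ofReal_iff (by positivity)).mp h4

/-- Decomposition of the estimation error. -/
lemma abs_mtrEst_sub_le {K n : ℕ} {ginv : Matrix (Fin dX ⊕ Fin K) (Fin dX ⊕ Fin K) ℝ →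
      Matrix (Fin dX ⊕ Fin K) (Fin dX ⊕ Fin K) ℝ} {b : Fin K → ℝ × ℝ → ℝ} {θ : Param dX dZ}
    {o : Fin n → Obs dX dZ} {x : Fin 2 → Fin dX → ℝ} {p : ℝ × ℝ} {α : Fin K → ℝ}
    {Bβ Bα Bδ G Δ y : ℝ} (hh₀ : 0 < h₀) (hh : h₀ ≤ M.h M.θ.2.1 p)
    (hΔ : |M.h θ.2.1 p - M.h M.θ.2.1 p| ≤ Δ) (hΔ₀ : Δ ≤ h₀ / 2)
    (hβ : l2 (fun k => lsCoef M μ₀ τ ginv b θ o (Sum.inl k) - M.β 0 true false k) ≤ Bβ)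
    (hα : |∑ k, pd (1, 1) (b k) p * (lsCoef M μ₀ τ ginv b θ o (Sum.inr k) - α k)| ≤ Bα)
    (hδ : |pd (1, 1) (M.g10 μ₀) p - ∑ k, pd (1, 1) (b k) p * α k| ≤ Bδ)
    (hG : |pd (1, 1) (M.g10 μ₀) p| ≤ G)
    (hy : y = x 0 ⬝ᵥ M.β 0 true false - pd (1, 1) (M.g10 μ₀) p / M.h M.θ.2.1 p) :
    |mtrEst M μ₀ τ ginv b θ o x p - y|
      ≤ l2 (x 0) * Bβ + 2 / h₀ * (Bα + Bδ) + G * (2 / h₀ ^ 2 * Δ) := by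
  set h := M.h M.θ.2.1 p
  set h' := M.h θ.2.1 p
  set g := pd (1, 1) (M.g10 μ₀) p
  set coef := lsCoef M μ₀ τ ginv b θ o
  have hh' : h₀ / 2 ≤ h' := by linarith [(abs_le.mp hΔ).1]
  have hpos : 0 < h := hh₀.trans_le hh
  have hpos' : 0 < h' := (half_pos hh₀).trans_le hh'
  set s₁ := ∑ k, x 0 k * (coef (Sum.inl k) - M.β 0 true false k) with hs₁
  set s₂ := ∑ k, pd (1, 1) (b k) p * (coef (Sum.inr k) - α k) with hs₂
  set s₃ := g - ∑ k, pd (1, 1) (b k) p * α k with hs₃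
  -- The three summands are the error in β, the error in the mixed derivative, and the error from
  -- the estimated copula density; Δ ≤ h₀ / 2 keeps that density at least h₀ / 2.
  have e : mtrEst M μ₀ τ ginv b θ o x p - y
      = s₁ + h'⁻¹ * (s₃ - s₂) + g * (h⁻¹ * h'⁻¹ * (h' - h)) := by
    have e1 : ∑ k, x 0 k * coef (Sum.inl k) = s₁ + x 0 ⬝ᵥ M.β 0 true false := by
      rw [hs₁, dotProduct, ← Finset.sum_add_distrib]
      exact Finset.sum_congr rfl fun k _ => by ring
    have e2 : ∑ k, pd (1, 1) (b k) p * coef (Sum.inr k) = s₂ + (g - s₃) := by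
      rw [hs₂, hs₃, sub_sub_cancel, ← Finset.sum_add_distrib]
      exact Finset.sum_congr rfl fun k _ => by ring
    have e3 : mtrEst M μ₀ τ ginv b θ o x p = ∑ k, x 0 k * coef (Sum.inl k)
        - (∑ k, pd (1, 1) (b k) p * coef (Sum.inr k)) / h' := rfl
    rw [e3, e1, e2, hy]
    field_simp
    ring
  have i1 : h'⁻¹ ≤ 2 / h₀ := by
    rw [← inv_div]; exact inv_anti₀ (by positivity) hh'
  have i2 : h⁻¹ ≤ h₀⁻¹ := inv_anti₀ hh₀ hh
  have hi : 0 < h⁻¹ := inv_pos.mpr hpos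
  have hi' : 0 < h'⁻¹ := inv_pos.mpr hpos'
  have b1 : |s₁| ≤ l2 (x 0) * Bβ :=
    (abs_dot_le (x 0) _).trans (mul_le_mul_of_nonneg_left hβ (l2_nonneg _))
  have b2 : |h'⁻¹ * (s₃ - s₂)| ≤ 2 / h₀ * (Bα + Bδ) := by
    rw [abs_mul, abs_of_pos hi']
    have : |s₃ - s₂| ≤ Bα + Bδ := by
      have := abs_sub s₃ s₂
      linarith
    exact mul_le_mul i1 this (abs_nonneg _) (by positivity)
  have b3 : |g * (h⁻¹ * h'⁻¹ * (h' - h))| ≤ G * (2 / h₀ ^ 2 * Δ) := by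
    rw [abs_mul, abs_mul, abs_of_pos (mul_pos hi hi')]
    have hG0 : 0 ≤ G := (abs_nonneg _).trans hG
    have : h⁻¹ * h'⁻¹ ≤ 2 / h₀ ^ 2 := by
      calc h⁻¹ * h'⁻¹ ≤ h₀⁻¹ * (2 / h₀) := mul_le_mul i2 i1 hi'.le (by positivity)
        _ = _ := by field_simp
    exact mul_le_mul hG (mul_le_mul this hΔ (abs_nonneg _) (by positivity))
      (by positivity) hG0
  rw [e]
  exact (abs_add_le _ _).trans (add_le_add ((abs_add_le _ _).trans (add_le_add b1 b2)) b3)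

namespace SeriesSetting

lemma exists_abs_cross_g_le (S : SeriesSetting M μ₀ μ Z N L h₀ ϖ τ K b) :
    ∃ G, 0 ≤ G ∧ ∀ p ∈ unitSquare, |pd (1, 1) (M.g10 μ₀) p| ≤ G := by
  have hc : ContinuousOn (pd (1, 1) (M.g10 μ₀)) unitSquare := by
    have h2 : ContDiffOn ℝ ((1 : ℕ)) (pd2 (M.g10 μ₀)) unitSquare :=
      contDiffOn_pd2 (by exact_mod_cast S.smooth_g)
    exact (contDiffOn_pd1 (k := 0) (by exact_mod_cast h2)).continuousOn
  obtain ⟨G, hG⟩ := isCompact_unitSquare.exists_bound_of_continuousOn hc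
  exact ⟨|G|, abs_nonneg G, fun p hp => (hG p hp).trans (le_abs_self G)⟩

/-- This is the factor paid when the sieve error is projected with the true instead of the estimated
design; its boundedness keeps that error at K^{-s/2}. -/
lemma exists_zeta_mul_le (S : SeriesSetting M μ₀ μ Z N L h₀ ϖ τ K b) :
    ∃ C, 0 ≤ C ∧ ∀ᶠ n : ℕ in atTop,
      zeta (b (K n)) 0 * (1 + zeta (b (K n)) 1) * (√(n : ℝ))⁻¹ ≤ C := by
  obtain ⟨C, hC⟩ := S.growth.zeta_mul.bound
  refine ⟨1 + |C|, by positivity, ?_⟩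
  filter_upwards [hC, S.growth.zeta_one.eventually_le_const one_pos] with n h1 h2
  rw [norm_one, mul_one, Real.norm_eq_abs] at h1
  have h3 := (le_abs_self _).trans (h1.trans (le_abs_self C))
  rw [div_eq_mul_inv] at h2 h3
  have h4 := mul_le_mul_of_nonneg_right (zeta_zero_le_one (S.contDiff_b n))
    (by positivity : 0 ≤ (√(n : ℝ))⁻¹)
  linarith

set_option maxHeartbeats 1000000 in
/-- Uniform rate of the series estimator based on a root-`n` consistent first stage. -/
theorem tight_rate (S : SeriesSetting M μ₀ μ Z N L h₀ ϖ τ K b) (ht : FirstStage M μ₀ μ Z N t)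
    {ginv : ∀ K : ℕ, Matrix (Fin dX ⊕ Fin K) (Fin dX ⊕ Fin K) ℝ →
      Matrix (Fin dX ⊕ Fin K) (Fin dX ⊕ Fin K) ℝ} (hginv : IsSymmGenInverse ginv) {s : ℕ}
    (hsieve : SieveApprox M μ₀ b K s)
    (hproj : IsOP μ (fun n ω => projNorm M μ₀ τ (b (K n)) (sample Z n ω)) fun _ => 1)
    (hinv : InverseInequality M μ₀ b K) (hlip : BasisLipschitz b K)
    {y : ℝ × ℝ → ℝ} {x : Fin 2 → Fin dX → ℝ}
    (hy : ∀ p ∈ M.S10 μ₀, y p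
      = x 0 ⬝ᵥ M.β 0 true false - pd (1, 1) (M.g10 μ₀) p / M.h M.θ.2.1 p) :
    Tight μ fun (C : ℝ) n ω => ∀ p ∈ M.S10 μ₀,
      |mtrEst M μ₀ τ (ginv (K n)) (b (K n)) (t n (sampleDesign Z n ω)) (sample Z n ω) x p - y p|
        ≤ C * (zeta (b (K n)) 0 * K n * √(Real.log n / n) + (K n : ℝ) ^ ((2 - (s : ℝ)) / 2)) := by
  obtain ⟨c, hc, hdes⟩ := S.tight_design ht
  obtain ⟨-, -, α, hα⟩ := hsieve
  obtain ⟨C₀, hC₀⟩ := hα (0, 0) (by norm_num)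
  obtain ⟨C₁, hC₁⟩ := hα (1, 1) le_rfl
  obtain ⟨Ci, hCi, hcross⟩ := hinv.exists_abs_cross_le
  obtain ⟨CF, hCF, hfirst⟩ := exists_abs_firstStageErr_le S.game S.trimming S.copula S.contDiff_g
  obtain ⟨G, hG0, hG⟩ := S.exists_abs_cross_g_le
  obtain ⟨Cz, hCz, hzmul⟩ := S.exists_zeta_mul_le
  obtain ⟨c₁, hc₁, hzlow⟩ := S.exists_zeta_lower
  have hϖ := S.trimming.pos
  have hh₀ := S.copula.c_pos
  have hL := S.copula.L_nonneg
  have hproj' := (isOP_iff_tight (Eventually.of_forall fun _ => zero_le_one)).mp hproj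
  -- The maximal inequality presupposes bounds on the Gram matrix, the covariates and the errors, so
  -- its constant is chosen after theirs.
  refine (hdes.and (S.tight_sum_errObs.and ((S.tight_score ht).and ((S.tight_score_inl ht).and
    hproj')))).bind ?_
  rintro ⟨D, E, C₃, C₄, P⟩
  refine (S.tight_noise_sup ht hlip hc D E).mono_ae fun T => ?_
  set z₀ := √c₁ with hz₀
  have hz₀0 : 0 < z₀ := Real.sqrt_pos.mpr hc₁
  set A₁ := CF * |D| with hA₁
  set A₂ := ϖ⁻¹ * |C₀| with hA₂
  set W₁ := (√c)⁻¹ * A₁ + c⁻¹ * √|C₄| + |T| with hW₁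
  set W₂ := (|P| + 3 * |D| * Cz / c) * A₂ with hW₂
  set V₁ := (√c)⁻¹ * (A₁ * z₀⁻¹) + c⁻¹ * √|C₃| * (z₀⁻¹ + 1) with hV₁
  set V₂ := (√c)⁻¹ * A₂ with hV₂
  set Q₁ := l2 (x 0) * V₁ + 2 / h₀ * (Ci * W₁) + G * (2 / h₀ ^ 2 * (L * |D| * z₀⁻¹)) with hQ₁
  set Q₂ := l2 (x 0) * V₂ + 2 / h₀ * (Ci * W₂ + |C₁|) with hQ₂
  have hlx := l2_nonneg (x 0)
  have hsmall : ∀ A : ℝ, ∀ {ε : ℝ}, 0 < ε → ∀ᶠ n : ℕ in atTop, A * (√(n : ℝ))⁻¹ ≤ ε := by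
    intro A ε hε
    have := tendsto_inv_sqrt.const_mul A
    rw [mul_zero] at this
    exact this.eventually_le_const hε
  refine ⟨Q₁ + Q₂, ?_⟩
  filter_upwards [hC₀, hC₁, hcross, hzmul, eventually_ge_atTop 3,
    hsmall ((3 + L) * |D|) (half_pos hϖ), hsmall (L * |D|) (half_pos hh₀)]
    with n hC₀n hC₁n hcrossn hzn hn3 hsm₁ hsm₂
  filter_upwards [S.ae_mem_support] with ω hW hnoise
  rintro ⟨⟨hD0, hA, hB, hBA, hX, hclose⟩, hE, h₃, h₄, hP⟩ p hp
  replace hnoise := hnoise hB hX hE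
  rw [abs_of_nonneg hD0] at hsm₁ hsm₂
  have hn : 0 < n := by omega
  have hn0 : (0 : ℝ) < n := by positivity
  set q := (√(n : ℝ))⁻¹ with hq
  have hq0 : 0 < q := by positivity
  set r := √(Real.log n / n) with hr
  have hqr : q ≤ r := by
    rw [hq, hr, ← Real.sqrt_inv, ← one_div]
    apply Real.sqrt_le_sqrt
    have hlog : 1 ≤ Real.log n := by
      rw [Real.le_log_iff_exp_le hn0]
      have : (3 : ℝ) ≤ n := by exact_mod_cast hn3
      exact Real.exp_one_lt_d9.le.trans (by linarith)
    gcongr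
  have hr0 : 0 < r := hq0.trans_le hqr
  set ζ := zeta (b (K n)) 0 with hζ
  have hζ0 : 0 < ζ := S.zeta_pos n
  have hK1 : (1 : ℝ) ≤ K n := by exact_mod_cast S.K_pos n
  have hzζ : z₀ ≤ ζ := by
    rw [hz₀, Real.sqrt_le_left hζ0.le]
    exact (le_mul_of_one_le_right hc₁.le hK1).trans (hzlow n)
  set u := ζ * r with hu
  have hu0 : 0 < u := by positivity
  -- Since ζ₀ is bounded away from zero, errors of order n^{-1/2} are negligible within ζ₀√(log n /
  -- n).
  have hqu : q ≤ z₀⁻¹ * u := by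
    rw [le_inv_mul_iff₀ hz₀0]
    exact mul_le_mul hzζ hqr hq0.le hζ0.le
  have hζq : ζ * q ≤ u := mul_le_mul_of_nonneg_left hqr hζ0.le
  set κ₀ := (K n : ℝ) ^ (-(s : ℝ) / 2) with hκ₀
  have hκ₀0 : 0 ≤ κ₀ := by positivity
  set k := (K n : ℝ) ^ ((2 - (s : ℝ)) / 2) with hk
  have hk0 : 0 ≤ k := by positivity
  have hKκ : K n * κ₀ = k := by
    rw [hκ₀, hk, show (2 - (s : ℝ)) / 2 = 1 + -(s : ℝ) / 2 by ring,
      Real.rpow_add (by linarith), Real.rpow_one]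
  have hκk : κ₀ ≤ k := by rw [← hKκ]; exact le_mul_of_one_le_left hκ₀0 hK1
  have hAf₁ : 0 ≤ A₁ := by positivity
  have hAf₂ : 0 ≤ A₂ := by positivity
  set θ := t n (sampleDesign Z n ω) with hθ
  have hθN : θ.2.1 ∈ N := ht.mem n _
  set o := sample Z n ω with ho
  have hgap : ∀ p ∈ unitSquare, |M.g10 μ₀ p - ∑ k, b (K n) k p * α (K n) k| ≤ |C₀| * κ₀ := by
    intro p hp
    have h := hC₀n p hp
    have e : (((((0 : ℕ), (0 : ℕ)) : ℕ × ℕ).1 + (((0 : ℕ), (0 : ℕ)) : ℕ × ℕ).2 : ℕ) : ℝ) - s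
      = -(s : ℝ) := by simp
    rw [e] at h
    exact h.trans (mul_le_mul_of_nonneg_right (le_abs_self C₀) hκ₀0)
  have hgap₁ : ∀ p ∈ unitSquare,
      |pd (1, 1) (M.g10 μ₀) p - ∑ k, pd (1, 1) (b (K n) k) p * α (K n) k| ≤ |C₁| * k := by
    intro p hp
    have h := hC₁n p hp
    have e : (((((1 : ℕ), (1 : ℕ)) : ℕ × ℕ).1 + (((1 : ℕ), (1 : ℕ)) : ℕ × ℕ).2 : ℕ) : ℝ) - s
      = 2 - (s : ℝ) := by norm_num
    rw [e] at h
    exact h.trans (mul_le_mul_of_nonneg_right (le_abs_self C₁) hk0)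
  have hF₁ : ∀ i : Fin n, |firstStageErr M μ₀ τ θ (o i).2| ≤ A₁ * q := fun i => by
    have := hfirst hθN (z := (o i).2) (mul_nonneg hD0 hq0.le)
      (by rw [← mul_assoc]; exact hsm₁) (hclose.1 i) hclose.2
    rw [hA₁, abs_of_nonneg hD0, mul_assoc]
    exact this
  have hF₂ : ∀ i : Fin n, |sieveErr M μ₀ τ (b (K n)) (α (K n)) θ (o i).2.2| ≤ A₂ * κ₀ :=
    fun i => by
      rw [hA₂, mul_assoc]
      exact abs_sieveErr_le S.game S.trimming (S.copula.subset hθN) hgap _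
  have hS := S10_subset M μ₀ (S.game.meas_P10_true.comp S.game.meas_W)
  have hinvn : (n : ℝ)⁻¹ = q * q := by
    rw [hq, ← mul_inv, Real.mul_self_sqrt hn0.le]
  have hqn : q * √(n : ℝ) = 1 := inv_mul_cancel₀ (Real.sqrt_pos.mpr hn0).ne'
  -- coefficients of the covariates
  have hscore : (c * n)⁻¹ * l2 ((regMatrix M μ₀ τ (b (K n)) θ o)ᵀ *ᵥ noiseVec M μ₀ τ θ o)
      ≤ c⁻¹ * √|C₃| * (z₀⁻¹ + 1) * u := by
    have h1 : l2 ((regMatrix M μ₀ τ (b (K n)) θ o)ᵀ *ᵥ noiseVec M μ₀ τ θ o)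
        ≤ √|C₃| * (√(n : ℝ) * (1 + ζ)) := by
      refine le_of_sq_le_sq (h₃.trans ?_) (by positivity)
      rw [mul_pow, mul_pow, Real.sq_sqrt (abs_nonneg _), Real.sq_sqrt hn0.le]
      refine mul_le_mul (le_abs_self _) ?_ (by positivity) (abs_nonneg _)
      refine mul_le_mul_of_nonneg_left ?_ hn0.le
      rw [add_sq]
      linarith
    calc _ ≤ (c * n)⁻¹ * (√|C₃| * (√(n : ℝ) * (1 + ζ))) := by gcongr
      _ = c⁻¹ * √|C₃| * (q * √(n : ℝ)) * (q + ζ * q) := by rw [mul_inv, hinvn]; ring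
      _ ≤ c⁻¹ * √|C₃| * 1 * (z₀⁻¹ * u + u) := by
          rw [hqn]
          exact mul_le_mul_of_nonneg_left (add_le_add hqu hζq) (by positivity)
      _ = _ := by ring
  have hβ := l2_lsCoef_sub_inl_le hginv hn hc hB (α := α (K n)) (by positivity : 0 ≤ A₁ * q)
    (by positivity : 0 ≤ A₂ * κ₀) hF₁ hF₂
  have hβ' : l2 (fun k => lsCoef M μ₀ τ (ginv (K n)) (b (K n)) θ o (Sum.inl k)
      - M.β 0 true false k) ≤ V₁ * u + V₂ * κ₀ := by
    refine hβ.trans ?_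
    have : (√c)⁻¹ * (A₁ * q + A₂ * κ₀) ≤ (√c)⁻¹ * (A₁ * (z₀⁻¹ * u) + A₂ * κ₀) := by gcongr
    calc _ ≤ (√c)⁻¹ * (A₁ * (z₀⁻¹ * u) + A₂ * κ₀) + c⁻¹ * √|C₃| * (z₀⁻¹ + 1) * u :=
          add_le_add this hscore
      _ = _ := by rw [hV₁, hV₂]; ring
  -- sieve coefficients
  have hαn : ∀ p ∈ M.S10 μ₀, |∑ k, b (K n) k p *
      (lsCoef M μ₀ τ (ginv (K n)) (b (K n)) θ o (Sum.inr k) - α (K n) k)|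
        ≤ W₁ * u + W₂ * κ₀ := by
    intro p hp
    have hz1 := zeta_nonneg (b (K n)) 1
    have hPP : projNorm M μ₀ τ (b (K n)) o ≤ ENNReal.ofReal |P| := by
      refine hP.trans (ENNReal.ofReal_le_ofReal ?_)
      rw [mul_one]; exact le_abs_self P
    refine (abs_sum_basis_lsCoef_sub_le hginv hn hc hA hB (by positivity) hBA
      (by positivity : 0 ≤ A₁ * q) (by positivity : 0 ≤ A₂ * κ₀) (abs_nonneg P) hF₁ hF₂
      (fun i => hW i) hPP hp (l2_le_zeta (S.contDiff_b n) (hS hp))).trans ?_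
    have b₁ : ζ * ((√c)⁻¹ * (A₁ * q)) ≤ (√c)⁻¹ * A₁ * u := by
      calc _ = (√c)⁻¹ * A₁ * (ζ * q) := by ring
        _ ≤ _ := by gcongr
    have b₂ : 3 * ζ * (D * (1 + zeta (b (K n)) 1)) / (c * √(n : ℝ)) * (A₂ * κ₀)
        ≤ 3 * |D| * Cz / c * (A₂ * κ₀) := by
      rw [abs_of_nonneg hD0]
      refine mul_le_mul_of_nonneg_right ?_ (by positivity)
      calc _ = 3 * D / c * (ζ * (1 + zeta (b (K n)) 1) * q) := by rw [hq]; field_simp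
        _ ≤ 3 * D / c * Cz := by gcongr
        _ = _ := by ring
    have b₃ : (c * n)⁻¹ * ζ * l2 (fun k => ((regMatrix M μ₀ τ (b (K n)) θ o)ᵀ *ᵥ
        noiseVec M μ₀ τ θ o) (Sum.inl k)) ≤ c⁻¹ * √|C₄| * u := by
      have h1 : l2 (fun k => ((regMatrix M μ₀ τ (b (K n)) θ o)ᵀ *ᵥ
          noiseVec M μ₀ τ θ o) (Sum.inl k)) ≤ √|C₄| * √(n : ℝ) := by
        refine le_of_sq_le_sq (h₄.trans ?_) (by positivity)
        rw [mul_pow, Real.sq_sqrt (abs_nonneg _), Real.sq_sqrt hn0.le]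
        exact mul_le_mul_of_nonneg_right (le_abs_self _) hn0.le
      calc _ ≤ (c * n)⁻¹ * ζ * (√|C₄| * √(n : ℝ)) := by gcongr
        _ = c⁻¹ * √|C₄| * (q * √(n : ℝ)) * (ζ * q) := by rw [mul_inv, hinvn]; ring
        _ ≤ c⁻¹ * √|C₄| * 1 * u := by
            rw [hqn]
            exact mul_le_mul_of_nonneg_left hζq (by positivity)
        _ = _ := by ring
    have b₄ := (hnoise p (hS hp)).trans (mul_le_mul_of_nonneg_right (le_abs_self T) hu0.le)
    calc _ ≤ (√c)⁻¹ * A₁ * u + |P| * (A₂ * κ₀) + 3 * |D| * Cz / c * (A₂ * κ₀)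
          + (c⁻¹ * √|C₄| * u + |T| * u) :=
          add_le_add (add_le_add (add_le_add b₁ le_rfl) b₂) (add_le_add b₃ b₄)
      _ = _ := by rw [hW₁, hW₂]; ring
  have hW₁0 : 0 ≤ W₁ := by positivity
  have hW₂0 : 0 ≤ W₂ := by positivity
  have hV₁0 : 0 ≤ V₁ := by positivity
  have hV₂0 : 0 ≤ V₂ := by positivity
  -- Only the level of the fitted sieve has been bounded so far. The inverse inequality passes to
  -- the mixed derivative at the cost of a factor K, which turns ζ₀√(log n / n) into the first term
  -- of the rate and K^{-s/2} into the second.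
  have hcr := hcrossn _ (by positivity : 0 ≤ W₁ * u + W₂ * κ₀) hαn p hp
  have hΔ : |M.h θ.2.1 p - M.h M.θ.2.1 p| ≤ L * (D * q) :=
    (S.copula.h_lip _ hθN _ S.copula.true_mem p (hS hp)).trans
      (mul_le_mul_of_nonneg_left hclose.2 hL)
  refine (abs_mtrEst_sub_le hh₀ (S.copula.h_ge p hp) hΔ (by rw [← mul_assoc]; exact hsm₂) hβ' hcr
    (hgap₁ p (hS hp)) (hG p (hS hp)) (hy p hp)).trans ?_
  set U := ζ * K n * r with hU
  have huU : u ≤ U := by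
    calc u = ζ * 1 * r := by ring
      _ ≤ _ := by rw [hU]; gcongr
  have hU0 : 0 ≤ U := hu0.le.trans huU
  have hQ₁0 : 0 ≤ Q₁ := by positivity
  have hQ₂0 : 0 ≤ Q₂ := by positivity
  have hKu : (K n : ℝ) * u = U := by rw [hu, hU]; ring
  have f₁ : V₁ * u + V₂ * κ₀ ≤ V₁ * U + V₂ * k := by gcongr
  have f₂ : Ci * K n * (W₁ * u + W₂ * κ₀) = Ci * W₁ * U + Ci * W₂ * k := by
    rw [← hKu, ← hKκ]; ring
  have f₃ : L * (D * q) ≤ L * |D| * z₀⁻¹ * U := by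
    rw [abs_of_nonneg hD0]
    calc L * (D * q) ≤ L * (D * (z₀⁻¹ * U)) := by
          gcongr
          exact hqu.trans (by gcongr)
      _ = _ := by ring
  calc _ ≤ l2 (x 0) * (V₁ * U + V₂ * k) + 2 / h₀ * (Ci * W₁ * U + Ci * W₂ * k + |C₁| * k)
        + G * (2 / h₀ ^ 2 * (L * |D| * z₀⁻¹ * U)) := by
        rw [f₂]
        gcongr
    _ = Q₁ * U + Q₂ * k := by rw [hQ₁, hQ₂]; ring
    _ ≤ (Q₁ + Q₂) * (U + k) := by
        have := mul_nonneg hQ₁0 hk0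
        have := mul_nonneg hQ₂0 hU0
        rw [add_mul, mul_add, mul_add]
        linarith

end SeriesSetting

end

end GameMTE

namespace GameMTE

open Model

/-! ### Stochastic order of suprema -/

lemma isOP_iSup_of_tight {Ω α : Type*} [MeasurableSpace Ω] {μ : Measure Ω} {f : ℕ → Ω → α → ℝ}
    {A : Set α} {r : ℕ → ℝ} (hr : ∀ᶠ n in atTop, 0 ≤ r n)
    (h : Tight μ fun (C : ℝ) n ω => ∀ p ∈ A, |f n ω p| ≤ C * r n) :
    IsOP μ (fun n ω => ⨆ p ∈ A, ‖f n ω p‖ₑ) r :=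
  (isOP_iff_tight hr).mpr <| h.mono fun C => ⟨C, Eventually.of_forall fun n ω hω =>
    iSup₂_le fun p hp => by
      rw [Real.enorm_eq_ofReal_abs]
      exact ENNReal.ofReal_le_ofReal (hω p hp)⟩

lemma IsOP.trans_isBigO {Ω : Type*} [MeasurableSpace Ω] {μ : Measure Ω} {X : ℕ → Ω → ℝ≥0∞}
    {r r' : ℕ → ℝ} (h : IsOP μ X r) (hr : ∀ᶠ n in atTop, 0 ≤ r n) (hr' : ∀ᶠ n in atTop, 0 ≤ r' n)
    (hrr : r =O[atTop] r') : IsOP μ X r' := by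
  obtain ⟨c, hc⟩ := hrr.bound
  refine (isOP_iff_tight hr').mpr (((isOP_iff_tight hr).mp h).mono fun C => ⟨|C| * c, ?_⟩)
  filter_upwards [hr, hr', hc] with n h1 h2 h3 ω hω
  rw [Real.norm_of_nonneg h1, Real.norm_of_nonneg h2] at h3
  refine hω.trans (ENNReal.ofReal_le_ofReal ?_)
  calc C * r n ≤ |C| * r n := mul_le_mul_of_nonneg_right (le_abs_self C) h1
    _ ≤ |C| * (c * r' n) := mul_le_mul_of_nonneg_left h3 (abs_nonneg C)
    _ = _ := by ring

/-! ### First stages with copula parameter close to the truth -/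

section

variable {Ω₀ Ω : Type*} [MeasurableSpace Ω₀] [MeasurableSpace Ω] {dX dZ : ℕ}
  {M : Model Ω₀ dX dZ} {μ₀ : Measure Ω₀} [IsProbabilityMeasure μ₀] {μ : Measure Ω}
  [IsProbabilityMeasure μ] {Z : ℕ → Ω → Obs dX dZ} {N : Set ℝ} {L h₀ : ℝ}

/-- The constant first stage makes the infeasible estimator an instance of the feasible one, so a
single rate theorem covers both. -/
lemma LocalCopula.firstStage_true (hloc : LocalCopula M μ₀ N L h₀) :
    FirstStage M μ₀ μ Z N fun _ _ => M.θ where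
  meas _ := measurable_const
  mem _ _ := hloc.true_mem
  rootn := by
    constructor
    · exact fun δ _ => ⟨1, one_pos, Eventually.of_forall fun n => by simp⟩
    · exact fun j d δ _ => ⟨1, one_pos, Eventually.of_forall fun n => by simp⟩

lemma IsOP.mono_left {X X' : ℕ → Ω → ℝ≥0∞} {r : ℕ → ℝ} (h : IsOP μ X r)
    (hX : ∀ n ω, X' n ω ≤ X n ω) : IsOP μ X' r := fun δ hδ =>
  (h δ hδ).imp fun _ hC => ⟨hC.1, hC.2.mono fun n hn =>
    (measure_mono fun ω (hω : _ < _) => hω.trans_le (hX n ω)).trans hn⟩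

/-- A root-`n` consistent first stage agrees, with probability approaching one, with a root-`n`
consistent first stage whose copula parameter is always in `N`. -/
lemma RootNConsistent.exists_firstStage
    {est : ∀ n : ℕ, (Fin n → Design dX dZ) → Param dX dZ} (h : RootNConsistent M μ₀ μ Z est)
    (hloc : LocalCopula M μ₀ N L h₀) (hmeas : ∀ n, Measurable (est n))
    (hmem : ∀ n z, (est n z).2.1 ∈ Icc M.ρmin M.ρmax) :
    ∃ t : ∀ n : ℕ, (Fin n → Design dX dZ) → Param dX dZ, FirstStage M μ₀ μ Z N t ∧
      Tight μ fun (_ : ℝ) n ω => t n (sampleDesign Z n ω) = est n (sampleDesign Z n ω) := by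
  classical
  refine ⟨fun n z => if (est n z).2.1 ∈ N then est n z else M.θ, ⟨fun n => ?_, fun n z => ?_, ?_⟩,
    ?_⟩
  · exact Measurable.ite (hloc.closed.measurableSet.preimage (hmeas n).snd.fst) (hmeas n)
      measurable_const
  · split_ifs with hN
    exacts [hN, hloc.true_mem]
  -- The modified first stage has either the errors of the original or none.
  · refine ⟨h.1.mono_left fun n ω => ?_, fun j d => (h.2 j d).mono_left fun n ω =>
      iSup_mono fun i => ?_⟩ <;> dsimp only <;> split_ifs <;> simp
  · obtain ⟨u, hu, hsub⟩ := mem_nhdsWithin_iff_exists_mem_nhds_inter.mp hloc.nhds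
    obtain ⟨ε, hε, hball⟩ := Metric.mem_nhds_iff.mp hu
    refine h.tight_close.mono fun C => ⟨C, ?_⟩
    have hlim : Tendsto (fun n : ℕ => C * (√(n : ℝ))⁻¹) atTop (𝓝 0) := by
      simpa using SeriesSetting.tendsto_inv_sqrt.const_mul C
    filter_upwards [hlim.eventually_lt_const hε] with n hn ω hω
    refine if_pos (hsub ⟨hball ?_, hmem _ _⟩)
    rw [Metric.mem_ball, Real.dist_eq]
    exact hω.2.2.trans_lt hn

end

/-! ### Stone's rate -/

lemma eventually_log_div_pos : ∀ᶠ n : ℕ in atTop, 0 < Real.log n / n := by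
  filter_upwards [eventually_ge_atTop 2] with n hn
  have h1 : (1 : ℝ) < n := by exact_mod_cast hn
  exact div_pos (Real.log_pos h1) (by linarith)

/-- With a = log n / n and K of order a^{-1/(1+s)}, the stochastic term K^{3/2} a^{1/2} and the bias
K^{(2-s)/2} both become a^{(s-2)/(2s+2)}: this K balances them. The lower bound on K is needed for
the bias, whose exponent is not positive. -/
lemma isBigO_stoneRate {s : ℕ} (hs : 2 ≤ s) {z k : ℕ → ℝ} (hk : ∀ n, 0 < k n)
    (hz : z =O[atTop] fun n => √(k n))
    (hkΘ : k =Θ[atTop] fun n : ℕ => (Real.log n / n) ^ (-1 / (1 + (s : ℝ)))) :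
    (fun n => z n * k n * √(Real.log n / n) + k n ^ ((2 - (s : ℝ)) / 2))
      =O[atTop] stoneRate s 2 2 := by
  have hs' : (2 : ℝ) ≤ s := by exact_mod_cast hs
  have hpow : ∀ n, 0 ≤ k n := fun n => (hk n).le
  refine IsBigO.add ?_ ?_
  · have h1 : (fun n => √(k n)) =O[atTop]
        fun n : ℕ => ((Real.log n / n) ^ (-1 / (1 + (s : ℝ)))) ^ (1 / 2 : ℝ) := by
      simp only [Real.sqrt_eq_rpow]
      refine hkΘ.1.rpow (by norm_num) ?_
      filter_upwards [eventually_log_div_pos] with n hn using Real.rpow_nonneg hn.le _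
    refine (((hz.trans h1).mul hkΘ.1).mul (isBigO_refl _ _)).congr' EventuallyEq.rfl ?_
    filter_upwards [eventually_log_div_pos] with n hn
    rw [Real.sqrt_eq_rpow, ← Real.rpow_mul hn.le, ← Real.rpow_add hn, ← Real.rpow_add hn,
      stoneRate]
    congr 1
    push_cast
    field_simp
    ring
  · have h1 : (fun n => (k n)⁻¹) =O[atTop]
        fun n : ℕ => ((Real.log n / n) ^ (-1 / (1 + (s : ℝ))))⁻¹ := by
      refine hkΘ.2.inv_rev ?_
      filter_upwards [eventually_log_div_pos] with n hn h0
      exact absurd h0 (Real.rpow_pos_of_pos hn _).ne'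
    have h2 : ∀ᶠ n : ℕ in atTop, 0 ≤ ((Real.log n / n) ^ (-1 / (1 + (s : ℝ))))⁻¹ := by
      filter_upwards [eventually_log_div_pos] with n hn
      exact inv_nonneg.mpr (Real.rpow_nonneg hn.le _)
    refine (h1.rpow (r := ((s : ℝ) - 2) / 2) (by linarith) h2).congr' ?_ ?_
    · refine Eventually.of_forall fun n => ?_
      dsimp only
      rw [Real.inv_rpow (hpow n), ← Real.rpow_neg (hpow n)]
      congr 1
      ring
    · filter_upwards [eventually_log_div_pos] with n hn
      rw [← Real.rpow_neg hn.le, ← Real.rpow_mul hn.le, stoneRate]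
      congr 1
      push_cast
      field_simp
      ring

end GameMTE

end

/-! ### Assembly of the theorem -/

theorem theorem3
    {Ω₀ Ω : Type*} [MeasurableSpace Ω₀] [MeasurableSpace Ω]
    (μ₀ : Measure Ω₀) [IsProbabilityMeasure μ₀] (μ : Measure Ω) [IsProbabilityMeasure μ]
    {dX dZ : ℕ} (M : GameMTE.Model Ω₀ dX dZ)
    -- the sample: i.i.d. copies of the observables of the population model
    (Z : ℕ → Ω → GameMTE.Obs dX dZ)
    (hZ_indep : iIndepFun Z μ) (hZ_law : ∀ i, IdentDistrib (Z i) M.obs μ μ₀)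
    (hgame : M.ParametricGame μ₀) (hlin : M.LinearOutcome μ₀)
    -- first stage
    (Θ : Set (GameMTE.Param dX dZ))
    (est : ∀ n : ℕ, (Fin n → GameMTE.Design dX dZ) → GameMTE.Param dX dZ)
    (hmle : GameMTE.IsMLE M μ₀ μ Z Θ est)
    (hrootn : GameMTE.RootNConsistent M μ₀ μ Z est)
    (hcop : M.SmoothCopula μ₀)
    -- second stage: trimming, generalized inverses, number of terms, basis
    (ϖ : ℝ) (τ : ℝ → ℝ) (hτ : GameMTE.IsTrimming ϖ τ)
    (ginv : ∀ K : ℕ, Matrix (Fin dX ⊕ Fin K) (Fin dX ⊕ Fin K) ℝ →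
      Matrix (Fin dX ⊕ Fin K) (Fin dX ⊕ Fin K) ℝ)
    (hginv : GameMTE.IsSymmGenInverse ginv)
    (K : ℕ → ℕ) (hK : ∀ n, 0 < K n)
    (b : ∀ K : ℕ, Fin K → ℝ × ℝ → ℝ)
    (s : ℕ) (hs : 2 ≤ s)
    (heigen : GameMTE.EigenBounds M μ₀ τ b K)
    (hmom : M.BoundedFourthMoment μ₀)
    (hsieve : GameMTE.SieveApprox M μ₀ b K s)
    (hgrowth : GameMTE.BasisGrowth b K)
    (hproj : GameMTE.IsOP μ
      (fun n ω => GameMTE.projNorm M μ₀ τ (b (K n)) (GameMTE.sample Z n ω)) fun _ => 1)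
    (hinv : GameMTE.InverseInequality M μ₀ b K)
    (hlip : GameMTE.BasisLipschitz b K)
    -- the target: the MTR function, continuous at the points where it is evaluated
    (m : (Fin 2 → Fin dX → ℝ) × (ℝ × ℝ) → ℝ) (hm : M.IsMTR10 μ₀ m)
    (x : Fin 2 → Fin dX → ℝ) (hx : x ∈ (μ₀.map M.X).support)
    (hm_cont : ∀ p ∈ M.S10 μ₀,
      ContinuousWithinAt m ((μ₀.map M.X).support ×ˢ GameMTE.unitSquare) (x, p)) :
    -- infeasible estimator
    GameMTE.IsOP μ
      (fun n ω => ⨆ p ∈ M.S10 μ₀,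
        ‖GameMTE.mtrEst M μ₀ τ (ginv (K n)) (b (K n)) M.θ (GameMTE.sample Z n ω) x p - m (x, p)‖ₑ)
      (fun n => GameMTE.zeta (b (K n)) 0 * K n * √(Real.log n / n)
        + (K n : ℝ) ^ ((2 - (s : ℝ)) / 2)) ∧
    -- feasible estimator
    GameMTE.IsOP μ
      (fun n ω => ⨆ p ∈ M.S10 μ₀,
        ‖GameMTE.mtrEst M μ₀ τ (ginv (K n)) (b (K n)) (est n (GameMTE.sampleDesign Z n ω))
          (GameMTE.sample Z n ω) x p - m (x, p)‖ₑ)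
      (fun n => GameMTE.zeta (b (K n)) 0 * K n * √(Real.log n / n)
        + (K n : ℝ) ^ ((2 - (s : ℝ)) / 2)) ∧
    -- Stone's rate for `ζ₀(K) ≍ √K` and `K ≍ (log n / n)^{-1/(1+s)}`
    ((fun n => GameMTE.zeta (b (K n)) 0) =Θ[atTop] (fun n => √(K n : ℝ)) →
      (fun n => (K n : ℝ)) =Θ[atTop] (fun n : ℕ => (Real.log n / n) ^ (-1 / (1 + (s : ℝ)))) →
      GameMTE.IsOP μ
        (fun n ω => ⨆ p ∈ M.S10 μ₀,
          ‖GameMTE.mtrEst M μ₀ τ (ginv (K n)) (b (K n)) M.θ (GameMTE.sample Z n ω) x p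
            - m (x, p)‖ₑ)
        (GameMTE.stoneRate s 2 2) ∧
      GameMTE.IsOP μ
        (fun n ω => ⨆ p ∈ M.S10 μ₀,
          ‖GameMTE.mtrEst M μ₀ τ (ginv (K n)) (b (K n)) (est n (GameMTE.sampleDesign Z n ω))
            (GameMTE.sample Z n ω) x p - m (x, p)‖ₑ)
        (GameMTE.stoneRate s 2 2)) := by
  obtain ⟨N, L, h₀, hloc⟩ := hcop.exists_local hgame.ρ_mem
  have hsmooth : ∀ {f : ℝ × ℝ → ℝ}, ContDiffOn ℝ (s : ℕ∞) f GameMTE.unitSquare →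
      ContDiffOn ℝ (2 : ℕ) f GameMTE.unitSquare := fun hf =>
    hf.of_le (WithTop.coe_le_coe.mpr (Nat.cast_le.mpr hs))
  have S : GameMTE.SeriesSetting M μ₀ μ Z N L h₀ ϖ τ K b :=
    { indep := hZ_indep
      law := hZ_law
      game := hgame
      lin := hlin
      copula := hloc
      trimming := hτ
      K_pos := hK
      smooth_g := hsmooth hsieve.1
      smooth_b := fun n k => hsmooth (hsieve.2.1 n k)
      eigen := heigen
      moment := hmom
      growth := hgrowth }
  have hy : ∀ p ∈ M.S10 μ₀, m (x, p) = x 0 ⬝ᵥ M.β 0 true false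
      - GameMTE.pd (1, 1) (M.g10 μ₀) p / M.h M.θ.2.1 p := fun p hp =>
    hgame.mtr_eq hlin (by exact_mod_cast S.smooth_g) hloc.h_cont hm hx
      (GameMTE.Model.S10_subset M μ₀ (hgame.meas_P10_true.comp hgame.meas_W) hp)
      (hloc.c_pos.trans_le (hloc.h_ge p hp)) (hm_cont p hp)
  have hr : ∀ᶠ n in atTop, 0 ≤ GameMTE.zeta (b (K n)) 0 * K n * √(Real.log n / n)
      + (K n : ℝ) ^ ((2 - (s : ℝ)) / 2) := Eventually.of_forall fun n => by
    have := GameMTE.zeta_nonneg (b (K n)) 0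
    positivity
  have hstone : ∀ᶠ n in atTop, 0 ≤ GameMTE.stoneRate s 2 2 n := by
    filter_upwards [GameMTE.eventually_log_div_pos] with n hn using Real.rpow_nonneg hn.le _
  have infeasible := GameMTE.isOP_iSup_of_tight hr
    (S.tight_rate hloc.firstStage_true hginv hsieve hproj hinv hlip hy)
  obtain ⟨t, ht, heq⟩ := hrootn.exists_firstStage hloc hmle.meas
    fun n z => (hmle.space _ (hmle.mem n z)).1
  -- The rate is proved for the modified first stage and carried over on the event, of probability
  -- approaching one, on which it coincides with the maximum likelihood estimate.
  have feasible := GameMTE.isOP_iSup_of_tight hr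
    (((S.tight_rate ht hginv hsieve hproj hinv hlip hy).and heq).mono fun C =>
      ⟨C.1, Eventually.of_forall fun n ω hω p hp => by
        have := hω.1 p hp
        rwa [hω.2] at this⟩)
  refine ⟨infeasible, feasible, fun hζ hKΘ => ?_⟩
  have hO := GameMTE.isBigO_stoneRate hs (fun n => Nat.cast_pos.mpr (hK n)) hζ.1 hKΘ
  exact ⟨infeasible.trans_isBigO hr hstone hO, feasible.trans_isBigO hr hstone hO⟩
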